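/- Let $X$ be a smooth compact manifold with corners with $\partial X=\partial_0X\cup\partial_1X$ for two embedded boundary hypersurfaces (possibly empty or disconnected) that meet transversally, let $x_0,x_1$ be boundary defining functions of $\partial_0X,\partial_1X$, and let $\phi:\partial_0X\to Y$ be a smooth fiber bundle over a compact manifold with boundary, with typical fiber a closed manifold $Z$, such that $\phi^{-1}(\partial Y)=\partial_0X\cap\partial_1X$ and $x_1|_{\partial_0X}$ is constant on the fibers of $\phi$. Let $\mathcal V_{\Phi,b}(X)$ be the space of smooth vector fields $V$ on $X$ with $Vx_0\in x_0^2C^\infty(X)$, $V|_{\partial_0X}$ tangent to the fibers of $\phi$ and $V|_{\partial_1X}$ tangent to $\partial_1X$, and let ${}^{\Phi,b}TX\to X$ be the vector bundle with fibers $\mathcal V_{\Phi,b}(X)/\mathcal I_x\mathcal V_{\Phi,b}(X)$ ($\mathcal I_x$ the ideal of smooth functions vanishing at $x$) and with $\Gamma({}^{\Phi,b}TX)=\mathcal V_{\Phi,b}(X)$; it is a Lie algebroid, with anchor and bracket induced by $\mathcal V_{\Phi,b}(X)\subset\mathcal V(X)$. Then the real blow-up $X^2_b=[X^2;(\partial_0X)^2,(\partial_1X)^2]$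 exists. Let $\Phi_b\subset X^2_b$ be the lift of $\Phi=\partial_0X\times_Y\partial_0X$ to $\{x_0'/x_0=1\}$ in the front face over $(\partial_0X)^2$, that is, the closure of the set of points over $\Phi\setminus(\partial_1X)^2$ where the continuous extension of $x_0'/x_0$ equals $1$ (here $x_0,x_0'$ are the lifts of $x_0$ from the left and right factor). The real blow-up $X^2_{\Phi,b}=[X^2_b;\Phi_b]$ exists as well. Let $\beta:X^2_{\Phi,b}\to X^2$ be the blow-down map, let $L_i,R_i$ ($i=0,1$) be the lifts of $\partial_iX\times X$ and $X\times\partial_iX$ to $X^2_{\Phi,b}$, that is, the closures of the preimages under $\beta$ of these sets minus $(\partial_iX)^2$, and let $F_0$ be the lift of the front face of $X^2_b$ over $(\partial_0X)^2$, that is, the closure of the preimage of this face minus $\Phi_b$. Put $$\mathcal G:=X^2_{\Phi,b}\setminus(L_0\cup F_0\cup R_0\cup L_1\cup R_1).$$ Then $\beta^{-1}(\mathrm{int}\,X\times\mathrm{int}\,X)\subset\mathcal G$, and $\beta$ maps it diffeomorphically onto $\mathrm{int}\,X\times\mathrm{int}\,X$. The structure of pair groupoid over $\mathrm{int}\,X$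 (range $(p,p')\mapsto p$, domain $(p,p')\mapsto p'$) on this open subset extends to a structure of Lie groupoid $\mathcal G\rightrightarrows X$ on the manifold with corners $\mathcal G$: the structure maps are smooth, and domain and range are locally projections $B\times\mathbb R^N\to B$. The set of units of $\mathcal G$ is the lifted diagonal $\Delta_{\Phi,b}=\overline{\beta^{-1}(\{(p,p):p\in\mathrm{int}\,X\})}$, and the Lie algebroid $A(\mathcal G)$ (the vectors at the units tangent to the fibers of the range map, with anchor the differential of the domain map and the bracket of left invariant vector fields) is isomorphic to ${}^{\Phi,b}TX$ as a Lie algebroid over $X$. -/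

import Mathlib

universe u v w

open Set Topology
open scoped Manifold ContDiff

/-! ### Real blow-up of a submanifold of a manifold with corners -/

section BlowUp

variable {E H : Type*} [NormedAddCommGroup E] [NormedSpace ℝ E] [TopologicalSpace H]
  (I : ModelWithCorners ℝ E H) {M : Type*} [TopologicalSpace M] [ChartedSpace H M]
  {E' H' : Type*} [NormedAddCommGroup E'] [NormedSpace ℝ E'] [TopologicalSpace H']
  (I' : ModelWithCorners ℝ E' H') {M' : Type*} [TopologicalSpace M'] [ChartedSpace H' M']
  {F : Type*} [NormedAddCommGroup F] [NormedSpace ℝ F]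

/-- `ψ` restricts to a diffeomorphism from the (open) set `U` of the manifold with corners `M` onto
the subset `V` of a vector space: it is a bijection, smooth, and its inverse is smooth on `V`.
(The inverse `χ` is asked for at each point of `U` only to allow `U = M = ∅`.) -/
structure IsDiffeoOnto (U : Set M) (ψ : M → F) (V : Set F) : Prop where
  contMDiffOn : ContMDiffOn I 𝓘(ℝ, F) ∞ ψ U
  bijOn : BijOn ψ U V
  inverse : ∀ q ∈ U, ∃ χ : F → M, LeftInvOn χ ψ U ∧ ContMDiffWithinAt 𝓘(ℝ, F) I ∞ χ V (ψ q)

/-- The model corner: the coordinates with index in `J` are nonnegative. -/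
def cornerSet {m : ℕ} (J : Finset (Fin m)) : Set (EuclideanSpace ℝ (Fin m)) :=
  {x | ∀ j ∈ J, 0 ≤ x j}

/-- `ψ` is a coordinate system of the manifold with corners `M` on the open set `U`, with the
coordinates in `J` nonnegative, in which `S` is the zero set of the coordinates in `K`.
A closed set `S` that admits such coordinates at each of its points is a `p`-submanifold. -/
structure IsAdaptedChart (S U : Set M) {m : ℕ} (J K : Finset (Fin m))
    (ψ : M → EuclideanSpace ℝ (Fin m)) (V : Set (EuclideanSpace ℝ (Fin m))) : Prop where
  isOpen : IsOpen U
  isOpen_image : ∃ O, IsOpen O ∧ V = O ∩ cornerSet J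
  isDiffeoOnto : IsDiffeoOnto I U ψ V
  mem_iff : ∀ q ∈ U, q ∈ S ↔ ∀ i ∈ K, ψ q i = 0

/-- Polar coordinates in the variables with index in `K`: `(r, w) ↦ x` with `x_i = r w_i` for
`i ∈ K` and `x_i = w_i` otherwise. -/
noncomputable def polarMap {m : ℕ} (K : Finset (Fin m))
    (a : ℝ × EuclideanSpace ℝ (Fin m)) : EuclideanSpace ℝ (Fin m) :=
  WithLp.toLp 2 fun i => if i ∈ K then a.1 * a.2 i else a.2 i

/-- The blow-up of the subset `V` of the model corner along `{x_i = 0, i ∈ K}`, as a set of polar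
coordinates `(r, w)`: `r ≥ 0` and `(w_i)_{i ∈ K}` lies on the part of the unit sphere
contained in the corner. -/
def polarSet {m : ℕ} (J K : Finset (Fin m)) (V : Set (EuclideanSpace ℝ (Fin m))) :
    Set (ℝ × EuclideanSpace ℝ (Fin m)) :=
  {a | 0 ≤ a.1 ∧ a.2 ∈ cornerSet J ∧ ∑ i ∈ K, a.2 i ^ 2 = 1 ∧ polarMap K a ∈ V}

/-- `β : M' → M` is the (real, oriented) blow-up `[M; S]` of the manifold with corners `M` along
`S`, with its blow-down map: `S` is a closed `p`-submanifold, `β` is a diffeomorphism outside of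
`S`, and over adapted coordinates near a point of `S` it is the introduction of polar coordinates.
These conditions determine `(M', β)` up to a unique diffeomorphism over `M`. -/
structure IsBlowUp (β : M' → M) (S : Set M) : Prop where
  isClosed : IsClosed S
  contMDiff : ContMDiff I' I ∞ β
  diffeo_compl : ∃ γ : M → M', ContMDiffOn I I' ∞ γ Sᶜ ∧ MapsTo γ Sᶜ (β ⁻¹' Sᶜ) ∧
    RightInvOn γ β Sᶜ ∧ LeftInvOn γ β (β ⁻¹' Sᶜ)
  polar : ∀ p ∈ S, ∃ (m : ℕ) (J K : Finset (Fin m)) (U : Set M)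
    (ψ : M → EuclideanSpace ℝ (Fin m)) (V : Set (EuclideanSpace ℝ (Fin m))),
    p ∈ U ∧ IsAdaptedChart I S U J K ψ V ∧
    ∃ ψ' : M' → ℝ × EuclideanSpace ℝ (Fin m),
      IsDiffeoOnto I' (β ⁻¹' U) ψ' (polarSet J K V) ∧
      ∀ q ∈ β ⁻¹' U, polarMap K (ψ' q) = ψ (β q)

/-- The lift of `T ⊆ M` under the blow-up `β` with centre `S` (for `T` not contained in `S`): the
closure of the preimage of `T \ S`. -/
def blowUpLift (β : M' → M) (S T : Set M) : Set M' := closure (β ⁻¹' (T \ S))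

end BlowUp

/-! ### Lie groupoids and their Lie algebroids -/

section LieGroupoid

variable {E H : Type*} [NormedAddCommGroup E] [NormedSpace ℝ E] [TopologicalSpace H]
  (I : ModelWithCorners ℝ E H) {E' H' : Type*} [NormedAddCommGroup E'] [NormedSpace ℝ E']
  [TopologicalSpace H'] (J : ModelWithCorners ℝ E' H')

/-- `f` is at `g` a submersion of manifolds with corners: locally it is a projection
`B × ℝᴺ → B` (so the fibres are manifolds without boundary). -/
def IsCornerSubmersionAt {G B : Type*} [TopologicalSpace G] [ChartedSpace H G]
    [TopologicalSpace B] [ChartedSpace H' B] (f : G → B) (g : G) : Prop :=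
  ∃ (N : ℕ) (h : G → EuclideanSpace ℝ (Fin N)),
    IsLocalDiffeomorphAt I (J.prod (𝓡 N)) ∞ (fun q => (f q, h q)) g

/-- A Lie groupoid `G ⇉ B` of manifolds with corners. The product `mul g h` is meaningful when
`dom g = rng h`; its values at other pairs play no role. -/
structure LieGroupoid (G B : Type*) [TopologicalSpace G] [ChartedSpace H G]
    [TopologicalSpace B] [ChartedSpace H' B] where
  /-- domain -/
  dom : G → B
  /-- range -/
  rng : G → B
  /-- multiplication -/
  mul : G → G → G
  /-- units -/
  one : B → G
  /-- inversion -/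
  inv : G → G
  dom_mul : ∀ g h, dom g = rng h → dom (mul g h) = dom h
  rng_mul : ∀ g h, dom g = rng h → rng (mul g h) = rng g
  mul_assoc : ∀ g h k, dom g = rng h → dom h = rng k → mul (mul g h) k = mul g (mul h k)
  dom_one : ∀ x, dom (one x) = x
  rng_one : ∀ x, rng (one x) = x
  one_mul : ∀ g, mul (one (rng g)) g = g
  mul_one : ∀ g, mul g (one (dom g)) = g
  dom_inv : ∀ g, dom (inv g) = rng g
  rng_inv : ∀ g, rng (inv g) = dom g
  inv_mul : ∀ g, mul (inv g) g = one (dom g)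
  mul_inv : ∀ g, mul g (inv g) = one (rng g)
  contMDiff_dom : ContMDiff I J ∞ dom
  contMDiff_rng : ContMDiff I J ∞ rng
  contMDiff_one : ContMDiff J I ∞ one
  contMDiff_inv : ContMDiff I I ∞ inv
  contMDiffOn_mul : ContMDiffOn (I.prod I) I ∞ (fun a : G × G => mul a.1 a.2)
    {a | dom a.1 = rng a.2}
  submersion_dom : ∀ g, IsCornerSubmersionAt I J dom g
  submersion_rng : ∀ g, IsCornerSubmersionAt I J rng g

namespace LieGroupoid

variable {I J} {G B : Type*} [TopologicalSpace G] [ChartedSpace H G]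
  [TopologicalSpace B] [ChartedSpace H' B] (𝒢 : LieGroupoid I J G B)

/-- The fibre at `x` of the vector bundle underlying the Lie algebroid `A(G)`: the tangent space
at the unit of `x` of the fibre of the range map through it. -/
noncomputable def algebroidFiber (x : B) : Submodule ℝ (TangentSpace I (𝒢.one x)) :=
  LinearMap.ker (mfderiv I J 𝒢.rng (𝒢.one x)).toLinearMap

/-- Smooth sections of `A(G)`. -/
def IsSmoothSection [IsManifold I ∞ G] (σ : ∀ x, 𝒢.algebroidFiber x) : Prop :=
  ContMDiff J I.tangent ∞ fun x => (⟨𝒢.one x, (σ x : TangentSpace I (𝒢.one x))⟩ :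
    TangentBundle I G)

/-- The anchor `A(G) → TB`, the differential of the domain map. -/
noncomputable def anchor (x : B) (v : 𝒢.algebroidFiber x) : TangentSpace J x :=
  mfderiv I J 𝒢.dom (𝒢.one x) (v : TangentSpace I (𝒢.one x))

/-- The left invariant vector field on `G` that extends a section of `A(G)`: at `g`, the image of
`σ (dom g)` under the differential of the left translation `h ↦ g h`, which is defined on the
fibre `rng ⁻¹ (dom g)`. -/
noncomputable def leftInvariant (σ : ∀ x, 𝒢.algebroidFiber x) (g : G) : TangentSpace I g :=
  mfderivWithin I I (fun h => 𝒢.mul g h) {h | 𝒢.rng h = 𝒢.dom g} (𝒢.one (𝒢.dom g))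
    (σ (𝒢.dom g) : TangentSpace I (𝒢.one (𝒢.dom g)))

/-- The bracket of two sections of `A(G)`: the restriction to the units of the Lie bracket of the
left invariant vector fields extending them. -/
noncomputable def bracket (σ τ : ∀ x, 𝒢.algebroidFiber x) (x : B) :
    TangentSpace I (𝒢.one x) :=
  VectorField.mlieBracket I (𝒢.leftInvariant σ) (𝒢.leftInvariant τ) (𝒢.one x)

end LieGroupoid

end LieGroupoid

/-! ### Manifolds with fibered boundary -/

/-- Manifolds with corners of dimension `n` are modelled on the quadrant `[0, ∞)ⁿ`. -/
noncomputable abbrev quadrantModel (n : ℕ) :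
    ModelWithCorners ℝ (EuclideanSpace ℝ (Fin n)) (EuclideanQuadrant n) :=
  modelWithCornersEuclideanQuadrant n

/-- The differential of a real function on a manifold with corners of dimension `n`. -/
noncomputable def differential (n : ℕ) {X : Type*} [TopologicalSpace X]
    [ChartedSpace (EuclideanQuadrant n) X] (f : X → ℝ) (p : X) :
    TangentSpace (quadrantModel n) p →L[ℝ] ℝ :=
  mfderiv (quadrantModel n) 𝓘(ℝ, ℝ) f p

/-- The structure of a manifold with fibered boundary on `X`: boundary defining functions `x₀`, `x₁`
of the two boundary hypersurfaces `∂₀X = {x₀ = 0}` and `∂₁X = {x₁ = 0}`, and a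
fibre bundle `φ : ∂₀X → Y` with typical fibre `Z` (the map `φ` is total on `X`, but only its
restriction to `∂₀X` matters). Since `Z` has no boundary and the corners of `X` have
codimension at most two, `Y` has a boundary but no corners where `φ` has nonempty fibres. -/
structure FiberedBoundary {n k l : ℕ} (X Y Z : Type*)
    [TopologicalSpace X] [ChartedSpace (EuclideanQuadrant n) X]
    [TopologicalSpace Y] [ChartedSpace (EuclideanQuadrant k) Y]
    [TopologicalSpace Z] [ChartedSpace (EuclideanSpace ℝ (Fin l)) Z] where
  x₀ : X → ℝ
  x₁ : X → ℝ
  φ : X → Y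
  contMDiff_x₀ : ContMDiff (quadrantModel n) 𝓘(ℝ, ℝ) ∞ x₀
  contMDiff_x₁ : ContMDiff (quadrantModel n) 𝓘(ℝ, ℝ) ∞ x₁
  x₀_nonneg : ∀ p, 0 ≤ x₀ p
  x₁_nonneg : ∀ p, 0 ≤ x₁ p
  boundary_eq : (quadrantModel n).boundary X = {p | x₀ p = 0} ∪ {p | x₁ p = 0}
  d_x₀_ne : ∀ p, x₀ p = 0 → differential n x₀ p ≠ 0
  d_x₁_ne : ∀ p, x₁ p = 0 → differential n x₁ p ≠ 0
  /-- the two hypersurfaces meet transversally -/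
  independent : ∀ p, x₀ p = 0 → x₁ p = 0 →
    LinearIndependent ℝ ![differential n x₀ p, differential n x₁ p]
  contMDiffOn_φ : ContMDiffOn (quadrantModel n) (quadrantModel k) ∞ φ {p | x₀ p = 0}
  /-- local trivializations `τ : U × Z → φ⁻¹(U)` with inverse `(φ, ρ)` -/
  locally_trivial : ∀ y : Y, ∃ (U : Set Y) (τ : Y × Z → X), IsOpen U ∧ y ∈ U ∧
    ContMDiffOn ((quadrantModel k).prod (𝓡 l)) (quadrantModel n) ∞ τ (U ×ˢ univ) ∧
    (∀ u ∈ U, ∀ z, x₀ (τ (u, z)) = 0 ∧ φ (τ (u, z)) = u) ∧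
    ∀ p, x₀ p = 0 → φ p ∈ U → ∃ ρ : X → Z,
      ContMDiffWithinAt (quadrantModel n) (𝓡 l) ∞ ρ {q | x₀ q = 0} p ∧
      (∀ q, x₀ q = 0 → φ q ∈ U → τ (φ q, ρ q) = q) ∧
      ∀ u ∈ U, ∀ z, ρ (τ (u, z)) = z
  /-- `φ` maps the boundary of `∂₀X`, and nothing else, to the boundary of `Y` -/
  φ_boundary : ∀ p, x₀ p = 0 → (x₁ p = 0 ↔ φ p ∈ (quadrantModel k).boundary Y)
  /-- `x₁` is constant on the fibres of `φ` -/
  x₁_const : ∀ p q, x₀ p = 0 → x₀ q = 0 → φ p = φ q → x₁ p = x₁ q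

namespace FiberedBoundary

variable {n k l : ℕ} {X : Type*} {Y Z : Type*}
  [TopologicalSpace X] [ChartedSpace (EuclideanQuadrant n) X]
  [TopologicalSpace Y] [ChartedSpace (EuclideanQuadrant k) Y]
  [TopologicalSpace Z] [ChartedSpace (EuclideanSpace ℝ (Fin l)) Z]
  (S : FiberedBoundary (n := n) (k := k) (l := l) X Y Z)

/-- The boundary hypersurface `∂₀X`. -/
def bd₀ : Set X := {p | S.x₀ p = 0}

/-- The boundary hypersurface `∂₁X`. -/
def bd₁ : Set X := {p | S.x₁ p = 0}

/-- The fibre product of `∂₀X` with itself over `Y`. -/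
def fiberProduct : Set (X × X) := {w | w.1 ∈ S.bd₀ ∧ w.2 ∈ S.bd₀ ∧ S.φ w.1 = S.φ w.2}

variable [IsManifold (quadrantModel n) ∞ X]

/-- A smooth vector field is a fibered cusp b-vector field if `V x₀ ∈ x₀² C^∞(X)`, `V` is on `∂₀X`
tangent to the fibres of `φ`, and `V` is on `∂₁X` tangent to `∂₁X`. The derivative of `φ` within
`∂₀X` enters only through its values on vectors tangent to `∂₀X` (those with `V x₀ = 0`), where it
is the differential of `φ : ∂₀X → Y`. -/
def IsFiberedCuspB (V : ∀ p : X, TangentSpace (quadrantModel n) p) : Prop :=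
  (∃ f : X → ℝ, ContMDiff (quadrantModel n) 𝓘(ℝ, ℝ) ∞ f ∧
    ∀ p, differential n S.x₀ p (V p) = S.x₀ p ^ 2 * f p) ∧
  (∀ p ∈ S.bd₀, mfderivWithin (quadrantModel n) (quadrantModel k) S.φ S.bd₀ p (V p) = 0) ∧
  ∀ p ∈ S.bd₁, differential n S.x₁ p (V p) = 0

/-- The space of fibered cusp b-vector fields, inside the space of smooth vector fields. -/
def fields : Submodule ℝ
    (Cₛ^∞⟮quadrantModel n; EuclideanSpace ℝ (Fin n),
      (TangentSpace (quadrantModel n) : X → Type)⟯) where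
  carrier := {V | S.IsFiberedCuspB V}
  add_mem' := by
    rintro V W ⟨⟨f, hf, hf'⟩, h₂, h₃⟩ ⟨⟨g, hg, hg'⟩, h₂', h₃'⟩
    refine ⟨⟨f + g, hf.add hg, fun p => ?_⟩, fun p hp => ?_, fun p hp => ?_⟩
    · exact (map_add (differential n S.x₀ p) (V p) (W p)).trans
        ((congrArg₂ (· + ·) (hf' p) (hg' p)).trans (mul_add _ _ _).symm)
    · exact (map_add (mfderivWithin (quadrantModel n) (quadrantModel k) S.φ S.bd₀ p)
        (V p) (W p)).trans ((congrArg₂ (· + ·) (h₂ p hp) (h₂' p hp)).trans (add_zero _))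
    · exact (map_add (differential n S.x₁ p) (V p) (W p)).trans
        ((congrArg₂ (· + ·) (h₃ p hp) (h₃' p hp)).trans (add_zero _))
  zero_mem' := by
    refine ⟨⟨0, contMDiff_const, fun p => ?_⟩, fun p _ => ?_, fun p _ => ?_⟩
    · exact (map_zero (differential n S.x₀ p)).trans (mul_zero _).symm
    · exact map_zero (mfderivWithin (quadrantModel n) (quadrantModel k) S.φ S.bd₀ p)
    · exact map_zero (differential n S.x₁ p)
  smul_mem' := by
    rintro c V ⟨⟨f, hf, hf'⟩, h₂, h₃⟩
    refine ⟨⟨fun p => c * f p, contMDiff_const.mul hf, fun p => ?_⟩, fun p hp => ?_,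
      fun p hp => ?_⟩
    · exact (map_smul (differential n S.x₀ p) c (V p)).trans
        ((congrArg (c * ·) (hf' p)).trans (mul_left_comm _ _ _))
    · exact (map_smul (mfderivWithin (quadrantModel n) (quadrantModel k) S.φ S.bd₀ p) c
        (V p)).trans ((congrArg (c • ·) (h₂ p hp)).trans (smul_zero _))
    · exact (map_smul (differential n S.x₁ p) c (V p)).trans
        ((congrArg (c * ·) (h₃ p hp)).trans (mul_zero _))

/-- The subspace `𝓘_x · 𝒱` of the space `𝒱` of fibered cusp b-vector fields, where `𝓘_x` is the ideal
of the smooth functions vanishing at `x`. -/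
noncomputable def vanishingFields (x : X) : Submodule ℝ S.fields :=
  Submodule.span ℝ {W | ∃ (f : X → ℝ) (V : S.fields),
    ContMDiff (quadrantModel n) 𝓘(ℝ, ℝ) ∞ f ∧ f x = 0 ∧ ∀ q, W.1 q = f q • V.1 q}

/-- The fibre at `x` of the vector bundle `^{Φ,b}TX` whose space of smooth sections is the space
`𝒱` of fibered cusp b-vector fields: `𝒱 / 𝓘_x 𝒱`. A section `s` of this bundle is smooth if it comes
from an element of `𝒱`. -/
abbrev bundleFiber (x : X) : Type _ := S.fields ⧸ S.vanishingFields x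

/-- The value at `x` of the section of `^{Φ,b}TX` given by an element of `𝒱`. -/
noncomputable def value (x : X) (V : S.fields) : S.bundleFiber x := (S.vanishingFields x).mkQ V

end FiberedBoundary

/-! ### The double space `X²_{Φ,b}` -/

/-- The lift `Φ_b` to `X²_b` (with blow-down map `β`) of the fibre product `Φ = ∂₀X ×_Y ∂₀X`, as a
subset of `{x₀' / x₀ = 1}` in the front face over `(∂₀X)²`: the closure of the set of those points
over `Φ \ (∂₁X)²` at which the continuous extension of `x₀' / x₀` has the value `1`. -/
def FiberedBoundary.liftedFiberProduct {n k l : ℕ} {X Y Z : Type*}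
    [TopologicalSpace X] [ChartedSpace (EuclideanQuadrant n) X]
    [TopologicalSpace Y] [ChartedSpace (EuclideanQuadrant k) Y]
    [TopologicalSpace Z] [ChartedSpace (EuclideanSpace ℝ (Fin l)) Z]
    (S : FiberedBoundary (n := n) (k := k) (l := l) X Y Z)
    {M : Type*} [TopologicalSpace M] (β : M → X × X) : Set M :=
  closure {q | β q ∈ S.fiberProduct \ S.bd₁ ×ˢ S.bd₁ ∧
    Filter.Tendsto (fun a => S.x₀ (β a).2 / S.x₀ (β a).1) (𝓝[{a | S.x₀ (β a).1 ≠ 0}] q) (𝓝 1)}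

/-- The iterated blow-up `X²_{Φ,b} = [X²; (∂₀X)², (∂₁X)²; Φ_b]` with its blow-down maps
`X²_{Φ,b} → X²_b → [X²; (∂₀X)²] → X²`; it is determined up to a unique diffeomorphism
over `X²`. -/
structure PhiBDouble {n k l : ℕ} {X : Type u} {Y : Type v} {Z : Type w}
    [TopologicalSpace X] [ChartedSpace (EuclideanQuadrant n) X]
    [TopologicalSpace Y] [ChartedSpace (EuclideanQuadrant k) Y]
    [TopologicalSpace Z] [ChartedSpace (EuclideanSpace ℝ (Fin l)) Z]
    (S : FiberedBoundary (n := n) (k := k) (l := l) X Y Z) where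
  /-- `[X²; (∂₀X)²]` -/
  X0 : Type u
  /-- `X²_b = [X²; (∂₀X)², (∂₁X)²]` -/
  Xb : Type u
  /-- `X²_{Φ,b} = [X²_b; Φ_b]` -/
  XΦb : Type u
  [top0 : TopologicalSpace X0]
  [topb : TopologicalSpace Xb]
  [topΦb : TopologicalSpace XΦb]
  [charted0 : ChartedSpace (EuclideanQuadrant (n + n)) X0]
  [chartedb : ChartedSpace (EuclideanQuadrant (n + n)) Xb]
  [chartedΦb : ChartedSpace (EuclideanQuadrant (n + n)) XΦb]
  [manifold0 : IsManifold (quadrantModel (n + n)) ∞ X0]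
  [manifoldb : IsManifold (quadrantModel (n + n)) ∞ Xb]
  [manifoldΦb : IsManifold (quadrantModel (n + n)) ∞ XΦb]
  β₀ : X0 → X × X
  β₁ : Xb → X0
  βΦ : XΦb → Xb
  isBlowUp₀ : IsBlowUp ((quadrantModel n).prod (quadrantModel n)) (quadrantModel (n + n)) β₀
    (S.bd₀ ×ˢ S.bd₀)
  isBlowUp₁ : IsBlowUp (quadrantModel (n + n)) (quadrantModel (n + n)) β₁
    (blowUpLift β₀ (S.bd₀ ×ˢ S.bd₀) (S.bd₁ ×ˢ S.bd₁))
  isBlowUpΦ : IsBlowUp (quadrantModel (n + n)) (quadrantModel (n + n)) βΦ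
    (S.liftedFiberProduct (β₀ ∘ β₁))

namespace PhiBDouble

attribute [instance] top0 topb topΦb charted0 chartedb chartedΦb manifold0 manifoldb manifoldΦb

variable {n k l : ℕ} {X : Type u} {Y : Type v} {Z : Type w}
  [TopologicalSpace X] [ChartedSpace (EuclideanQuadrant n) X]
  [TopologicalSpace Y] [ChartedSpace (EuclideanQuadrant k) Y]
  [TopologicalSpace Z] [ChartedSpace (EuclideanSpace ℝ (Fin l)) Z]
  {S : FiberedBoundary (n := n) (k := k) (l := l) X Y Z} (D : PhiBDouble S)

/-- The blow-down map `X²_{Φ,b} → X²`. -/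
def β : D.XΦb → X × X := fun q => D.β₀ (D.β₁ (D.βΦ q))

/-- The interior of `X²` (as the product of the interiors). -/
def interiorSq (_ : PhiBDouble S) : Set (X × X) :=
  (quadrantModel n).interior X ×ˢ (quadrantModel n).interior X

/-- `L₀`, the lift of `∂₀X × X`. -/
def L₀ : Set D.XΦb := closure (D.β ⁻¹' (S.bd₀ ×ˢ univ \ S.bd₀ ×ˢ S.bd₀))

/-- `R₀`, the lift of `X × ∂₀X`. -/
def R₀ : Set D.XΦb := closure (D.β ⁻¹' (univ ×ˢ S.bd₀ \ S.bd₀ ×ˢ S.bd₀))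

/-- `L₁`, the lift of `∂₁X × X`. -/
def L₁ : Set D.XΦb := closure (D.β ⁻¹' (S.bd₁ ×ˢ univ \ S.bd₁ ×ˢ S.bd₁))

/-- `R₁`, the lift of `X × ∂₁X`. -/
def R₁ : Set D.XΦb := closure (D.β ⁻¹' (univ ×ˢ S.bd₁ \ S.bd₁ ×ˢ S.bd₁))

/-- `F₀`, the lift of the front face of `X²_b` over `(∂₀X)²` (the new hypersurface over `Φ_b` is not
part of it). -/
def F₀ : Set D.XΦb :=
  blowUpLift D.βΦ (S.liftedFiberProduct (D.β₀ ∘ D.β₁)) {q | D.β₀ (D.β₁ q) ∈ S.bd₀ ×ˢ S.bd₀}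

/-- The open subset `X²_{Φ,b} \ (L₀ ∪ F₀ ∪ R₀ ∪ L₁ ∪ R₁)` of `X²_{Φ,b}`, a manifold with corners. -/
def space : TopologicalSpace.Opens D.XΦb :=
  ⟨(D.L₀ ∪ D.F₀ ∪ D.R₀ ∪ D.L₁ ∪ D.R₁)ᶜ,
    ((((isClosed_closure.union isClosed_closure).union isClosed_closure).union
      isClosed_closure).union isClosed_closure).isOpen_compl⟩

/-- The lifted diagonal `Δ_{Φ,b}`. -/
def diagonal : Set D.XΦb :=
  closure (D.β ⁻¹' {w | w.1 = w.2 ∧ w.1 ∈ (quadrantModel n).interior X})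

/-- The structure maps of `𝒢` extend those of the pair groupoid `int X × int X ⇉ int X`, which is
embedded in `𝒢` by the inverse `j` of the diffeomorphism `β : β⁻¹(int X²) → int X²`. -/
def ExtendsPairGroupoid (𝒢 : LieGroupoid (quadrantModel (n + n)) (quadrantModel n) D.space X) :
    Prop :=
  D.β ⁻¹' D.interiorSq ⊆ D.space ∧
  ∃ j : X × X → D.space,
    ContMDiffOn ((quadrantModel n).prod (quadrantModel n)) (quadrantModel (n + n)) ∞ j
      D.interiorSq ∧
    (∀ w ∈ D.interiorSq, D.β (j w) = w) ∧
    (∀ g : D.space, D.β g ∈ D.interiorSq → j (D.β g) = g) ∧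
    ∀ a ∈ (quadrantModel n).interior X, 𝒢.one a = j (a, a) ∧
      ∀ b ∈ (quadrantModel n).interior X,
        𝒢.rng (j (a, b)) = a ∧ 𝒢.dom (j (a, b)) = b ∧ 𝒢.inv (j (a, b)) = j (b, a) ∧
        ∀ c ∈ (quadrantModel n).interior X, 𝒢.mul (j (a, b)) (j (b, c)) = j (a, c)

variable [IsManifold (quadrantModel n) ∞ X]

/-- The fibrewise linear isomorphisms `Θ x` form an isomorphism of Lie algebroids over `X` from
`A(𝒢)` to `^{Φ,b}TX`, whose anchor and bracket are induced by the inclusion of the space of fibered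
cusp b-vector fields in the space of vector fields. -/
structure IsAlgebroidIso
    (𝒢 : LieGroupoid (quadrantModel (n + n)) (quadrantModel n) D.space X)
    (Θ : ∀ x : X, 𝒢.algebroidFiber x ≃ₗ[ℝ] S.bundleFiber x) : Prop where
  /-- `Θ` is smooth with smooth inverse. -/
  smooth : ∀ σ : ∀ x, 𝒢.algebroidFiber x, 𝒢.IsSmoothSection σ ↔
    ∃ V : S.fields, ∀ x, Θ x (σ x) = S.value x V
  /-- `Θ` intertwines the anchor maps. -/
  anchor : ∀ (V : S.fields) (x : X), 𝒢.anchor x ((Θ x).symm (S.value x V)) = V.1 x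
  /-- `Θ` intertwines the brackets. -/
  bracket : ∀ V W : S.fields, ∃ U : S.fields,
    (∀ x, U.1 x = VectorField.mlieBracket (quadrantModel n) V.1 W.1 x) ∧
    ∀ x, 𝒢.bracket (fun x => (Θ x).symm (S.value x V)) (fun x => (Θ x).symm (S.value x W)) x =
      ((Θ x).symm (S.value x U) : TangentSpace (quadrantModel (n + n)) (𝒢.one x))

end PhiBDouble

open Filter
open EuclideanSpace (single)
open WithLp (toLp)

local notation "𝓠" => quadrantModel
local notation "𝓔" m:max => EuclideanSpace ℝ (Fin m)
local notation "𝓛" N:max => Option (Option (Fin N))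
local notation "𝓣" n:max => ModelWithCorners.prod (quadrantModel n) (𝓡 n)
local notation "𝓖" N:max => EuclideanSpace ℝ (Option (Option (Fin N)))
local notation "ℱ" N:max => EuclideanSpace ℝ (Option (Option (Option (Fin N))))

/-- The coordinate functionals. -/
noncomputable abbrev coordL {ι : Type*} (i : ι) : EuclideanSpace ℝ ι →L[ℝ] ℝ := EuclideanSpace.proj i

/-! ### Integrals of smooth functions depending on a parameter in a convex set -/

section Parametric

variable {E : Type u} [NormedAddCommGroup E] [NormedSpace ℝ E]

lemma ContinuousOn.eventually_forall_Icc_norm_sub_lt {E F : Type*} [NormedAddCommGroup E]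
    [NormedAddCommGroup F] {s : Set E} {g : ℝ × E → F} (hg : ContinuousOn g (Icc 0 1 ×ˢ s)) {x₀ : E} (hx : x₀ ∈ s)
    {ε : ℝ} (hε : 0 < ε) :
    ∀ᶠ x in 𝓝[s] x₀, ∀ t ∈ Icc (0 : ℝ) 1, ‖g (t, x) - g (t, x₀)‖ < ε := by
  have key : ∀ᶠ x in 𝓝 x₀, ∀ t ∈ Icc (0 : ℝ) 1, x ∈ s → t ∈ Icc (0 : ℝ) 1 →
      ‖g (t, x) - g (t, x₀)‖ < ε := by
    apply isCompact_Icc.eventually_forall_of_forall_eventually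
    intro t ht
    have h1 : Tendsto g (𝓝[Icc 0 1 ×ˢ s] (t, x₀)) (𝓝 (g (t, x₀))) := hg (t, x₀) ⟨ht, hx⟩
    have h2 := (Metric.tendsto_nhds.1 h1) (ε / 2) (half_pos hε)
    rw [eventually_nhdsWithin_iff, nhds_prod_eq, eventually_prod_iff] at h2
    obtain ⟨pa, ha, pb, hb, hab⟩ := h2
    rw [nhds_prod_eq, eventually_prod_iff]
    refine ⟨pb, hb, pa, ha, fun {x} hxb {t'} hta hxs ht' => ?_⟩
    have e1 := hab hta hxb ⟨ht', hxs⟩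
    have e2 := hab hta hb.self_of_nhds ⟨ht', hx⟩
    rw [← dist_eq_norm]
    calc dist (g (t', x)) (g (t', x₀)) ≤ dist (g (t', x)) (g (t, x₀)) +
        dist (g (t', x₀)) (g (t, x₀)) := dist_triangle_right _ _ _
      _ < ε := by linarith
  rw [eventually_nhdsWithin_iff]
  filter_upwards [key] with x hx' hxs t ht using hx' t ht hxs ht

lemma ContinuousOn.intervalIntegrable_section {E F : Type*} [NormedAddCommGroup E]
    [NormedAddCommGroup F] {s : Set E} {g : ℝ × E → F} (hg : ContinuousOn g (Icc 0 1 ×ˢ s)) {x : E} (hx : x ∈ s) :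
    IntervalIntegrable (fun t => g (t, x)) MeasureTheory.volume 0 1 := by
  apply ContinuousOn.intervalIntegrable
  rw [uIcc_of_le zero_le_one]
  exact hg.comp (by fun_prop) fun t ht => ⟨ht, hx⟩

lemma ContinuousOn.integral_Icc {F : Type*} [NormedAddCommGroup F] [NormedSpace ℝ F]
    {s : Set E} {g : ℝ × E → F}
    (hg : ContinuousOn g (Icc 0 1 ×ˢ s)) :
    ContinuousOn (fun x => ∫ t in (0 : ℝ)..1, g (t, x)) s := by
  intro x₀ hx
  refine Metric.tendsto_nhds.2 fun ε hε => ?_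
  filter_upwards [hg.eventually_forall_Icc_norm_sub_lt hx (half_pos hε), self_mem_nhdsWithin]
    with x h hxs
  rw [dist_eq_norm, ← intervalIntegral.integral_sub (hg.intervalIntegrable_section hxs)
    (hg.intervalIntegrable_section hx)]
  refine (intervalIntegral.norm_integral_le_of_norm_le_const (C := ε / 2) fun t ht => ?_).trans_lt ?_
  · rw [uIoc_of_le zero_le_one] at ht
    exact (h t ⟨ht.1.le, ht.2⟩).le
  · simp; linarith

lemma hasFDerivWithinAt_integral_Icc {F : Type*} [NormedAddCommGroup F] [NormedSpace ℝ F]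
    [CompleteSpace F] {s : Set E} (hs : Convex ℝ s) {g : ℝ × E → F} {D : ℝ × E → E →L[ℝ] F}
    (hg : ContinuousOn g (Icc 0 1 ×ˢ s)) (hD : ContinuousOn D (Icc 0 1 ×ˢ s))
    (h : ∀ t ∈ Icc (0 : ℝ) 1, ∀ x ∈ s, HasFDerivWithinAt (fun x => g (t, x)) (D (t, x)) s x)
    {x₀ : E} (hx : x₀ ∈ s) :
    HasFDerivWithinAt (fun x => ∫ t in (0 : ℝ)..1, g (t, x)) (∫ t in (0 : ℝ)..1, D (t, x₀)) s x₀ := by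
  rw [hasFDerivWithinAt_iff_isLittleO, Asymptotics.isLittleO_iff]
  intro ε hε
  have h1 := hD.eventually_forall_Icc_norm_sub_lt hx hε
  obtain ⟨δ, hδ, hball⟩ := Metric.mem_nhdsWithin_iff.1 h1
  filter_upwards [self_mem_nhdsWithin, mem_nhdsWithin_of_mem_nhds (Metric.ball_mem_nhds x₀ hδ)]
    with x hxs hxb
  have e : (∫ t in (0 : ℝ)..1, g (t, x)) - (∫ t in (0 : ℝ)..1, g (t, x₀)) -
      (∫ t in (0 : ℝ)..1, D (t, x₀)) (x - x₀) =
      ∫ t in (0 : ℝ)..1, (g (t, x) - g (t, x₀) - D (t, x₀) (x - x₀)) := by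
    have hDi := hD.intervalIntegrable_section hx
    rw [ContinuousLinearMap.intervalIntegral_apply hDi, intervalIntegral.integral_sub,
      intervalIntegral.integral_sub (hg.intervalIntegrable_section hxs)
        (hg.intervalIntegrable_section hx)]
    · exact (hg.intervalIntegrable_section hxs).sub (hg.intervalIntegrable_section hx)
    · apply ContinuousOn.intervalIntegrable
      rw [uIcc_of_le zero_le_one]
      exact (hD.comp (by fun_prop) fun t ht => ⟨ht, hx⟩).clm_apply continuousOn_const
  rw [e]
  refine (intervalIntegral.norm_integral_le_of_norm_le_const (C := ε * ‖x - x₀‖) fun t ht => ?_).trans_eq (by simp)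
  rw [uIoc_of_le zero_le_one] at ht
  have ht' : t ∈ Icc (0 : ℝ) 1 := ⟨ht.1.le, ht.2⟩
  refine Convex.norm_image_sub_le_of_norm_hasFDerivWithin_le' (f := fun x => g (t, x))
    (s := Metric.ball x₀ δ ∩ s) (f' := fun x => D (t, x)) (fun y hy => (h t ht' y hy.2).mono inter_subset_right)
    (fun y hy => (hball hy t ht').le) ((convex_ball _ _).inter hs) ⟨Metric.mem_ball_self hδ, hx⟩
    ⟨hxb, hxs⟩

lemma contDiffOn_nat_integral_Icc {s : Set E} (hs : Convex ℝ s) (hu : UniqueDiffOn ℝ s) (n : ℕ) :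
    ∀ {F : Type u} [NormedAddCommGroup F] [NormedSpace ℝ F] [CompleteSpace F] {g : ℝ × E → F},
    ContDiffOn ℝ n g (Icc 0 1 ×ˢ s) → ContDiffOn ℝ n (fun x => ∫ t in (0 : ℝ)..1, g (t, x)) s := by
  have hu' : UniqueDiffOn ℝ (Icc (0 : ℝ) 1 ×ˢ s) := (uniqueDiffOn_Icc zero_lt_one).prod hu
  induction n with
  | zero =>
    intro F _ _ _ g hg
    exact contDiffOn_zero.2 (contDiffOn_zero.1 hg).integral_Icc
  | succ n ih =>
    intro F _ _ _ g hg
    set D : ℝ × E → E →L[ℝ] F := fun a =>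
      (fderivWithin ℝ g (Icc 0 1 ×ˢ s) a).comp (ContinuousLinearMap.inr ℝ ℝ E) with hDdef
    have hD : ContDiffOn ℝ n D (Icc 0 1 ×ˢ s) := by
      have := hg.fderivWithin hu' (m := n) (by norm_cast)
      exact this.clm_comp contDiffOn_const
    have hh : ∀ t ∈ Icc (0 : ℝ) 1, ∀ x ∈ s,
        HasFDerivWithinAt (fun x => g (t, x)) (D (t, x)) s x := by
      intro t ht x hx
      have h1 := ((hg.differentiableOn (by norm_cast)) (t, x) ⟨ht, hx⟩).hasFDerivWithinAt
      exact h1.comp x (hasFDerivAt_prodMk_right t x).hasFDerivWithinAt fun y hy => ⟨ht, hy⟩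
    have hder := fun x hx => hasFDerivWithinAt_integral_Icc hs hg.continuousOn hD.continuousOn hh
      (x₀ := x) hx
    have : ContDiffOn ℝ (n + 1 : ℕ∞ω) (fun x => ∫ t in (0 : ℝ)..1, g (t, x)) s := by
      rw [contDiffOn_succ_iff_fderivWithin hu]
      refine ⟨fun x hx => (hder x hx).differentiableWithinAt, by simp, ?_⟩
      exact (ih hD).congr fun x hx => (hder x hx).fderivWithin (hu x hx)
    exact_mod_cast this

lemma contDiffOn_integral_Icc {s : Set E} (hs : Convex ℝ s) (hu : UniqueDiffOn ℝ s)
    {F : Type u} [NormedAddCommGroup F] [NormedSpace ℝ F] [CompleteSpace F] {g : ℝ × E → F}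
    (hg : ContDiffOn ℝ ∞ g (Icc 0 1 ×ˢ s)) :
    ContDiffOn ℝ ∞ (fun x => ∫ t in (0 : ℝ)..1, g (t, x)) s :=
  contDiffOn_infty.2 fun n => contDiffOn_nat_integral_Icc hs hu n
    (hg.of_le (by exact_mod_cast le_top))

end Parametric

/-! ### Model corners -/

section Corner

variable {m : ℕ} {J : Finset (Fin m)}

lemma convex_cornerSet : Convex ℝ (cornerSet J) := by
  intro x hx y hy a b ha hb _ j hj
  have := hx j hj; have := hy j hj
  simp only [PiLp.add_apply, PiLp.smul_apply, smul_eq_mul]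
  positivity

lemma isClosed_cornerSet : IsClosed (cornerSet J) := by
  simp only [cornerSet, Set.ofPred_forall]
  exact isClosed_biInter fun j _ => isClosed_le continuous_const (by fun_prop)

/-- The vector with all coordinates equal to `1`. -/
noncomputable def onesVec (m : ℕ) : 𝓔 m := toLp 2 fun _ => 1

lemma interior_cornerSet : interior (cornerSet J) = {x | ∀ j ∈ J, 0 < x j} := by
  apply subset_antisymm
  · intro x hx j hj
    have hc : Tendsto (fun t : ℝ => x + t • onesVec m) (𝓝 0) (𝓝 x) := by
      have : Continuous (fun t : ℝ => x + t • onesVec m) := by fun_prop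
      simpa using this.tendsto 0
    have := hc.eventually (mem_interior_iff_mem_nhds.1 hx)
    obtain ⟨δ, hδ, hb⟩ := Metric.eventually_nhds_iff.1 this
    have h2 := hb (y := -(δ / 2)) (by rw [Real.dist_eq]; simp; rw [abs_of_pos] <;> linarith) j hj
    simp [onesVec] at h2
    linarith
  · apply interior_maximal
    · intro x hx j hj
      exact (hx j hj).le
    · simp only [Set.ofPred_forall]
      exact isOpen_biInter_finset fun j _ => isOpen_lt continuous_const (by fun_prop)

lemma add_smul_onesVec_mem_interior {x : 𝓔 m} (hx : x ∈ cornerSet J) {t : ℝ}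
    (ht : 0 < t) : x + t • onesVec m ∈ interior (cornerSet J) := by
  rw [interior_cornerSet]
  intro j hj
  have := hx j hj
  simp [onesVec]; linarith

lemma uniqueDiffOn_cornerSet : UniqueDiffOn ℝ (cornerSet J) :=
  uniqueDiffOn_convex convex_cornerSet ⟨_, add_smul_onesVec_mem_interior (x := 0) (fun _ _ => le_rfl)
    one_pos⟩

lemma uniqueDiffOn_inter_cornerSet {O : Set (𝓔 m)} (hO : IsOpen O) :
    UniqueDiffOn ℝ (O ∩ cornerSet J) := by
  rw [inter_comm]; exact uniqueDiffOn_cornerSet.inter hO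

lemma cornerSet_subset_closure_interior : cornerSet J ⊆ closure (interior (cornerSet J)) := by
  intro x hx
  have hc : Tendsto (fun t : ℝ => x + t • onesVec m) (𝓝[>] 0) (𝓝 x) := by
    have : Continuous (fun t : ℝ => x + t • onesVec m) := by fun_prop
    simpa using (this.tendsto 0).mono_left nhdsWithin_le_nhds
  exact mem_closure_of_tendsto hc (by
    filter_upwards [self_mem_nhdsWithin] with t ht using add_smul_onesVec_mem_interior hx ht)

lemma contDiff_polarMap (K : Finset (Fin m)) : ContDiff ℝ ∞ (polarMap K) := by
  rw [contDiff_euclidean]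
  intro i
  by_cases hi : i ∈ K
  · simp only [polarMap, hi, if_true]; fun_prop
  · simp only [polarMap, hi, if_false]; fun_prop

/-- **Hadamard's lemma** on a corner. -/
lemma exists_eq_sum_smul_of_eq_zero {F : Type} [NormedAddCommGroup F] [NormedSpace ℝ F]
    [CompleteSpace F] {O : Set (𝓔 m)} (hO : IsOpen O) (K : Finset (Fin m))
    {g : 𝓔 m → F} (hg : ContDiffOn ℝ ∞ g (O ∩ cornerSet J))
    (hg0 : ∀ x ∈ O ∩ cornerSet J, (∀ i ∈ K, x i = 0) → g x = 0)
    {p : 𝓔 m} (hp : p ∈ O ∩ cornerSet J) (hpK : ∀ i ∈ K, p i = 0) :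
    ∃ O', IsOpen O' ∧ p ∈ O' ∧ O' ⊆ O ∧ ∃ a : Fin m → 𝓔 m → F,
      (∀ i, ContDiffOn ℝ ∞ (a i) (O' ∩ cornerSet J)) ∧
      ∀ x ∈ O' ∩ cornerSet J, g x = ∑ i ∈ K, x i • a i x := by
  obtain ⟨ε, hε, hball⟩ := Metric.isOpen_iff.1 hO p hp.1
  set O' := Metric.ball p ε
  set V := O' ∩ cornerSet J with hV
  have hVs : V ⊆ O ∩ cornerSet J := inter_subset_inter_left _ hball
  have hVconv : Convex ℝ V := (convex_ball p ε).inter convex_cornerSet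
  have hVu : UniqueDiffOn ℝ V := uniqueDiffOn_inter_cornerSet Metric.isOpen_ball
  have hscale : ∀ t ∈ Icc (0 : ℝ) 1, ∀ x ∈ V, polarMap K (t, x) ∈ V := by
    intro t ht x hx
    refine ⟨?_, fun j hj => ?_⟩
    · have hx1 := hx.1
      rw [Metric.mem_ball, EuclideanSpace.dist_eq] at hx1 ⊢
      refine lt_of_le_of_lt (Real.sqrt_le_sqrt (Finset.sum_le_sum fun i _ => ?_)) hx1
      by_cases hi : i ∈ K
      · simp only [polarMap, hi, if_true, hpK i hi, Real.dist_eq, sub_zero, sq_abs, mul_pow]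
        exact mul_le_of_le_one_left (sq_nonneg _) (pow_le_one₀ ht.1 ht.2)
      · simp [polarMap, hi]
    · have := hx.2 j hj
      by_cases hi : j ∈ K
      · simp only [polarMap, hi, if_true]; exact mul_nonneg ht.1 this
      · simpa [polarMap, hi] using this
  set G : ℝ × 𝓔 m → 𝓔 m →L[ℝ] F := fun a => fderivWithin ℝ g V (polarMap K a) with hG
  have hGs : ContDiffOn ℝ ∞ G (Icc 0 1 ×ˢ V) := by
    have h1 : ContDiffOn ℝ ∞ (fderivWithin ℝ g V) V :=
      (hg.mono hVs).fderivWithin hVu (m := ∞) (by simp)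
    exact h1.comp (contDiff_polarMap K).contDiffOn fun a ha => hscale _ ha.1 _ ha.2
  refine ⟨O', Metric.isOpen_ball, Metric.mem_ball_self hε, hball,
    fun i x => (∫ t in (0 : ℝ)..1, G (t, x)) (single i 1), fun i => ?_, ?_⟩
  · exact (contDiffOn_integral_Icc hVconv hVu hGs).clm_apply contDiffOn_const
  · intro x hx
    set v : 𝓔 m := ∑ i ∈ K, x i • single i 1 with hv
    have hvi : ∀ i, v i = if i ∈ K then x i else 0 := by
      intro i
      simp [hv, Finset.sum_apply, Pi.single_apply]
    have hpath : ∀ t, polarMap K (t, x) = (x - v) + t • v := by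
      intro t; ext i
      by_cases hi : i ∈ K <;> simp [polarMap, hi, hvi]
    have hder : ∀ t ∈ Icc (0 : ℝ) 1, HasDerivWithinAt (fun t => g (polarMap K (t, x))) (G (t, x) v)
        (Icc 0 1) t := by
      intro t ht
      have h1 : HasFDerivWithinAt g (G (t, x)) V (polarMap K (t, x)) :=
        ((hg.mono hVs).differentiableOn (by simp) _ (hscale t ht x hx)).hasFDerivWithinAt
      have h2 : HasDerivWithinAt (fun t => polarMap K (t, x)) v (Icc 0 1) t := by
        simp only [hpath]
        simpa using ((hasDerivAt_id t).smul_const v).const_add (x - v) |>.hasDerivWithinAt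
      exact h1.comp_hasDerivWithinAt t h2 fun t' ht' => hscale t' ht' x hx
    have hpair : ContinuousOn (fun t : ℝ => (t, x)) (Icc 0 1) := by fun_prop
    have hGc : ContinuousOn (fun t => G (t, x)) (Icc 0 1) :=
      hGs.continuousOn.comp hpair fun t ht => mk_mem_prod ht hx
    have hcont : ContinuousOn (fun t => G (t, x) v) (Icc 0 1) := hGc.clm_apply continuousOn_const
    have hcont' : ContinuousOn (fun t => g (polarMap K (t, x))) (Icc 0 1) :=
      fun t ht => (hder t ht).continuousWithinAt
    have hder' : ∀ t ∈ Ioo (0 : ℝ) 1, HasDerivAt (fun t => g (polarMap K (t, x))) (G (t, x) v) t :=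
      fun t ht => (hder t (Ioo_subset_Icc_self ht)).hasDerivAt (Icc_mem_nhds ht.1 ht.2)
    have hii : IntervalIntegrable (fun t => G (t, x) v) MeasureTheory.volume 0 1 := by
      apply ContinuousOn.intervalIntegrable; rwa [uIcc_of_le zero_le_one]
    have hint := intervalIntegral.integral_eq_sub_of_hasDerivAt_of_le zero_le_one hcont' hder' hii
    have e1 : polarMap K (1, x) = x := by rw [hpath]; simp
    have e0 : g (polarMap K (0, x)) = 0 := by
      refine hg0 _ (hVs (hscale 0 (by simp) x hx)) fun i hi => by simp [polarMap, hi]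
    simp only [e1, e0, sub_zero] at hint
    rw [← hint, ← ContinuousLinearMap.intervalIntegral_apply
      (hGs.continuousOn.intervalIntegrable_section hx), hv, map_sum]
    simp

end Corner

/-! ### The inverse function theorem on corners -/

lemma ContDiffOn.of_rightInverse {E F : Type*} [NormedAddCommGroup E] [NormedSpace ℝ E]
    [CompleteSpace E] [NormedAddCommGroup F] [NormedSpace ℝ F] {s : Set E} {t : Set F} {f : E → F}
    {g : F → E} (hf : ContDiffOn ℝ ∞ f s) (hs : UniqueDiffOn ℝ s) (ht : UniqueDiffOn ℝ t)
    (hg : ContinuousOn g t) (hgs : MapsTo g t s) (hfg : ∀ y ∈ t, f (g y) = y)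
    (hinv : ∀ y ∈ t, ∃ e : E ≃L[ℝ] F, fderivWithin ℝ f s (g y) = (e : E →L[ℝ] F)) :
    ContDiffOn ℝ ∞ g t := by
  have hder : ∀ y ∈ t, HasFDerivWithinAt g
      (ContinuousLinearMap.inverse (fderivWithin ℝ f s (g y))) t y := by
    intro y hy
    obtain ⟨e, he⟩ := hinv y hy
    have h1 : HasFDerivWithinAt f (e : E →L[ℝ] F) s (g y) :=
      he ▸ (hf.differentiableOn (by simp) _ (hgs hy)).hasFDerivWithinAt
    rw [he, ContinuousLinearMap.inverse_equiv]
    refine HasFDerivWithinAt.of_local_left_inverse ?_ h1 hy ?_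
    · exact tendsto_nhdsWithin_of_tendsto_nhds_of_eventually_within _ (hg y hy)
        (by filter_upwards [self_mem_nhdsWithin] with z hz using hgs hz)
    · filter_upwards [self_mem_nhdsWithin] with z hz using hfg z hz
  refine contDiffOn_infty.2 fun n => ?_
  induction n with
  | zero => exact contDiffOn_zero.2 hg
  | succ n ih =>
    have : ContDiffOn ℝ (n + 1 : ℕ∞ω) g t := by
      rw [contDiffOn_succ_iff_fderivWithin ht]
      refine ⟨fun y hy => (hder y hy).differentiableWithinAt, by simp, ?_⟩
      have h2 : ContDiffOn ℝ n (fun y => ContinuousLinearMap.inverse (fderivWithin ℝ f s (g y))) t := by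
        intro y hy
        obtain ⟨e, he⟩ := hinv y hy
        have h3 : ContDiffOn ℝ n (fderivWithin ℝ f s) s :=
          (hf.fderivWithin hs (m := ∞) (by simp)).of_le (by exact_mod_cast le_top)
        have h4 : ContDiffWithinAt ℝ n (fun y => fderivWithin ℝ f s (g y)) t y :=
          (h3.comp ih hgs) y hy
        have h5 : ContDiffAt ℝ n (ContinuousLinearMap.inverse (R := ℝ) (M := E) (M₂ := F))
            (fderivWithin ℝ f s (g y)) := by
          rw [he]; exact contDiffAt_map_inverse e
        exact h5.comp_contDiffWithinAt y h4
      exact h2.congr fun y hy => (hder y hy).fderivWithin (ht y hy)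
    exact_mod_cast this

lemma exists_cornerSet_inverse {m : ℕ} {J J' : Finset (Fin m)}
    {O : Set (𝓔 m)} (hO : IsOpen O)
    {f : 𝓔 m → 𝓔 m}
    (hf : ContDiffOn ℝ ∞ f (O ∩ cornerSet J)) {p : 𝓔 m}
    (hp : p ∈ O ∩ cornerSet J) (hmaps : MapsTo f (O ∩ cornerSet J) (cornerSet J'))
    (hint : ∀ x ∈ O ∩ cornerSet J, x ∈ interior (cornerSet J) ↔ f x ∈ interior (cornerSet J'))
    (hinj : Function.Injective (fderivWithin ℝ f (O ∩ cornerSet J) p)) :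
    ∃ (O₁ O₂ : Set (𝓔 m)) (g : 𝓔 m → 𝓔 m), IsOpen O₁ ∧ p ∈ O₁ ∧ O₁ ⊆ O ∧ IsOpen O₂ ∧
      MapsTo f (O₁ ∩ cornerSet J) (O₂ ∩ cornerSet J') ∧
      MapsTo g (O₂ ∩ cornerSet J') (O₁ ∩ cornerSet J) ∧
      LeftInvOn g f (O₁ ∩ cornerSet J) ∧ RightInvOn g f (O₂ ∩ cornerSet J') ∧
      ContDiffOn ℝ ∞ g (O₂ ∩ cornerSet J') := by
  set V := O ∩ cornerSet J with hV
  have hVu : UniqueDiffOn ℝ V := uniqueDiffOn_inter_cornerSet hO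
  set e : 𝓔 m ≃L[ℝ] 𝓔 m :=
    (LinearEquiv.ofInjectiveEndo (fderivWithin ℝ f V p : _ →ₗ[ℝ] _) hinj).toContinuousLinearEquiv
  have he : (e : 𝓔 m →L[ℝ] 𝓔 m) = fderivWithin ℝ f V p := by
    ext x; rfl
  have hder : ContinuousOn (fderivWithin ℝ f V) V := hf.continuousOn_fderivWithin hVu (by simp)
  obtain ⟨c, hc0, hc⟩ : ∃ c : NNReal, 0 < c ∧ (Subsingleton (𝓔 m) ∨
      lipschitzExtensionConstant (𝓔 m) * c < ‖(e.symm : 𝓔 m →L[ℝ] 𝓔 m)‖₊⁻¹) := by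
    rcases subsingleton_or_nontrivial (𝓔 m) with h | h
    · exact ⟨1, one_pos, Or.inl h⟩
    · have h1 : 0 < ‖(e.symm : 𝓔 m →L[ℝ] 𝓔 m)‖₊⁻¹ := inv_pos.2 e.nnnorm_symm_pos
      obtain ⟨c, h2, h3⟩ := exists_between (div_pos h1 (lipschitzExtensionConstant_pos (𝓔 m)))
      refine ⟨c, h2, Or.inr ?_⟩
      rw [lt_div_iff₀ (lipschitzExtensionConstant_pos _), mul_comm] at h3
      exact h3
  have ev1 : ∀ᶠ x in 𝓝[V] p, ‖fderivWithin ℝ f V x - e‖ < c := by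
    have := hder p hp
    rw [ContinuousWithinAt, Metric.tendsto_nhds] at this
    simpa [he, dist_eq_norm] using this c hc0
  have ev2 : ∀ᶠ x in 𝓝[V] p, fderivWithin ℝ f V x ∈ range ((↑) : (𝓔 m ≃L[ℝ] 𝓔 m) → _) :=
    (hder p hp).eventually (by rw [← he]; exact e.nhds)
  obtain ⟨δ, hδ, hball⟩ := Metric.mem_nhdsWithin_iff.1 (ev1.and ev2)
  obtain ⟨δ', hδ', hball'⟩ := Metric.isOpen_iff.1 hO p hp.1
  set D := Metric.ball p (min δ δ') with hD
  have hDO : D ⊆ O := (Metric.ball_subset_ball (min_le_right _ _)).trans hball'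
  have hpD : p ∈ D := Metric.mem_ball_self (lt_min hδ hδ')
  have hDV : D ∩ cornerSet J ⊆ V := inter_subset_inter_left _ hDO
  have hDprop : ∀ x ∈ D ∩ cornerSet J, ‖fderivWithin ℝ f V x - e‖ < c ∧ fderivWithin ℝ f V x ∈
      range ((↑) : (𝓔 m ≃L[ℝ] 𝓔 m) → _) := fun x hx =>
    hball ⟨Metric.ball_subset_ball (min_le_left _ _) hx.1, hDV hx⟩
  have happ : ApproximatesLinearOn f (e : 𝓔 m →L[ℝ] 𝓔 m) (D ∩ cornerSet J) c := by
    intro x hx y hy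
    exact Convex.norm_image_sub_le_of_norm_hasFDerivWithin_le' (f := f) (s := D ∩ cornerSet J)
      (f' := fderivWithin ℝ f V) (fun z hz =>
        (hf.differentiableOn (by simp) z (hDV hz)).hasFDerivWithinAt.mono hDV)
      (fun z hz => (hDprop z hz).1.le) ((convex_ball _ _).inter convex_cornerSet) hy hx
  obtain ⟨u, hu⟩ := happ.exists_homeomorph_extension hc
  have hup : u p = f p := (hu ⟨hpD, hp.2⟩).symm
  obtain ⟨η, hη, hηD⟩ : ∃ η > 0, Metric.ball (f p) η ⊆ u.symm ⁻¹' D :=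
    Metric.isOpen_iff.1 (Metric.isOpen_ball.preimage u.symm.continuous) (f p) (by
      change u.symm (f p) ∈ D; rw [← hup, u.symm_apply_apply]; exact hpD)
  set B := Metric.ball (f p) η with hB
  have key1 : B ∩ interior (cornerSet J') ⊆ u.symm ⁻¹' interior (cornerSet J) := by
    have hpre : IsPreconnected (B ∩ interior (cornerSet J')) :=
      ((convex_ball _ _).inter convex_cornerSet.interior).isPreconnected
    refine hpre.subset_of_closure_inter_subset (isOpen_interior.preimage u.symm.continuous) ?_ ?_
    · have hc : Tendsto (fun t : ℝ => p + t • onesVec m) (𝓝[>] 0) (𝓝[D ∩ cornerSet J] p) := by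
        have : Continuous (fun t : ℝ => p + t • onesVec m) := by fun_prop
        have h0 : Tendsto (fun t : ℝ => p + t • onesVec m) (𝓝[>] 0) (𝓝 p) := by
          simpa using (this.tendsto 0).mono_left nhdsWithin_le_nhds
        refine tendsto_nhdsWithin_of_tendsto_nhds_of_eventually_within _ h0 ?_
        filter_upwards [self_mem_nhdsWithin, h0 (Metric.isOpen_ball.mem_nhds hpD)] with t ht ht'
        exact ⟨ht', interior_subset (add_smul_onesVec_mem_interior hp.2 ht)⟩
      have hfc : ContinuousWithinAt f (D ∩ cornerSet J) p := (hf.continuousOn p hp).mono hDV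
      have h1 := (hfc.tendsto.comp hc) (Metric.ball_mem_nhds _ hη)
      have h2 := hc self_mem_nhdsWithin
      have h3 : Ioi (0 : ℝ) ∈ 𝓝[>] 0 := self_mem_nhdsWithin
      obtain ⟨t, ht1, ht2, ht3⟩ := Filter.nonempty_of_mem
        (inter_mem (mem_map.1 h1) (inter_mem (mem_map.1 h2) h3))
      have h4 := add_smul_onesVec_mem_interior hp.2 (J := J) ht3
      refine ⟨f (p + t • onesVec m), ⟨ht1, (hint _ (hDV ht2)).1 h4⟩, ?_⟩
      change u.symm (f (p + t • onesVec m)) ∈ interior (cornerSet J)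
      rw [hu ht2, u.symm_apply_apply]; exact h4
    · rintro y ⟨hy1, hy2, hy3⟩
      have h1 : u.symm y ∈ cornerSet J := by
        rw [← u.symm.preimage_closure] at hy1
        exact closure_minimal interior_subset isClosed_cornerSet hy1
      have h2 : u.symm y ∈ D ∩ cornerSet J := ⟨hηD hy2, h1⟩
      refine (hint _ (hDV h2)).2 ?_
      rw [hu h2, u.apply_symm_apply]; exact hy3
  have key2 : B ∩ cornerSet J' ⊆ u.symm ⁻¹' cornerSet J := by
    rintro y ⟨hy1, hy2⟩
    have h1 : y ∈ closure (B ∩ interior (cornerSet J')) :=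
      Metric.isOpen_ball.inter_closure ⟨hy1, cornerSet_subset_closure_interior hy2⟩
    have h2 := closure_mono key1 h1
    rw [← u.symm.preimage_closure] at h2
    exact closure_minimal interior_subset isClosed_cornerSet h2
  have hmap1 : MapsTo f (D ∩ u ⁻¹' B ∩ cornerSet J) (B ∩ cornerSet J') := by
    rintro x ⟨⟨hx1, hx2⟩, hx3⟩
    exact ⟨by rw [hu ⟨hx1, hx3⟩]; exact hx2, hmaps (hDV ⟨hx1, hx3⟩)⟩
  have hmap2 : MapsTo u.symm (B ∩ cornerSet J') (D ∩ u ⁻¹' B ∩ cornerSet J) := fun y hy =>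
    ⟨⟨hηD hy.1, by simpa using hy.1⟩, key2 hy⟩
  have hright : ∀ y ∈ B ∩ cornerSet J', f (u.symm y) = y := fun y hy => by
    have := hmap2 hy
    rw [hu ⟨this.1.1, this.2⟩, u.apply_symm_apply]
  refine ⟨D ∩ u ⁻¹' B, B, u.symm, Metric.isOpen_ball.inter (Metric.isOpen_ball.preimage u.continuous),
    ⟨hpD, by change u p ∈ B; rw [hup]; exact Metric.mem_ball_self hη⟩,
    inter_subset_left.trans hDO, Metric.isOpen_ball, hmap1, hmap2, ?_, hright, ?_⟩
  · rintro x ⟨⟨hx1, hx2⟩, hx3⟩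
    rw [hu ⟨hx1, hx3⟩, u.symm_apply_apply]
  · refine hf.of_rightInverse hVu (uniqueDiffOn_inter_cornerSet Metric.isOpen_ball)
      u.symm.continuous.continuousOn (fun y hy => ?_) hright fun y hy => ?_
    · exact hDV ⟨(hmap2 hy).1.1, (hmap2 hy).2⟩
    · obtain ⟨e', he'⟩ := (hDprop _ ⟨(hmap2 hy).1.1, (hmap2 hy).2⟩).2
      exact ⟨e', he'.symm⟩

noncomputable section Manifolds

variable {E H : Type*} [NormedAddCommGroup E] [NormedSpace ℝ E] [TopologicalSpace H]
  {I : ModelWithCorners ℝ E H} {P : Type*} [TopologicalSpace P] [ChartedSpace H P]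
  {M : Type*} [TopologicalSpace M] [ChartedSpace H M]
  {E' H' : Type*} [NormedAddCommGroup E'] [NormedSpace ℝ E'] [TopologicalSpace H']
  {I' : ModelWithCorners ℝ E' H'} {P' : Type*} [TopologicalSpace P'] [ChartedSpace H' P']
  {M' : Type*} [TopologicalSpace M'] [ChartedSpace H' M']

/-! ### Coordinate systems and initial embeddings -/

section Charts

variable {E'' H'' : Type*} [NormedAddCommGroup E''] [NormedSpace ℝ E''] [TopologicalSpace H'']
  {I'' : ModelWithCorners ℝ E'' H''} {P'' : Type*} [TopologicalSpace P''] [ChartedSpace H'' P'']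

/-- A coordinate system of the subset `W` of a manifold, with values in a model corner. -/
structure EmbChart (I : ModelWithCorners ℝ E H) (W : Set P) (m : ℕ) where
  U : Set P
  O : Set (𝓔 m)
  J : Finset (Fin m)
  ψ : P → 𝓔 m
  χ : 𝓔 m → P
  isOpen_U : IsOpen U
  isOpen_O : IsOpen O
  smooth_ψ : ContMDiffOn I 𝓘(ℝ, 𝓔 m) ∞ ψ (W ∩ U)
  smooth_χ : ContMDiffOn 𝓘(ℝ, 𝓔 m) I ∞ χ (O ∩ cornerSet J)
  mapsTo_ψ : MapsTo ψ (W ∩ U) (O ∩ cornerSet J)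
  mapsTo_χ : MapsTo χ (O ∩ cornerSet J) (W ∩ U)
  left_inv : LeftInvOn χ ψ (W ∩ U)
  right_inv : LeftInvOn ψ χ (O ∩ cornerSet J)

/-- A coordinate system of a manifold with corners. -/
abbrev CornerChart (I : ModelWithCorners ℝ E H) (P : Type*) [TopologicalSpace P] [ChartedSpace H P]
    (m : ℕ) := EmbChart I (univ : Set P) m

namespace EmbChart

variable {W : Set P} {m : ℕ} (c : EmbChart I W m)

lemma exists_restrict {N : Set P} (hN : IsOpen N) : ∃ c' : EmbChart I W m,
    c'.U = c.U ∩ N ∧ c'.J = c.J ∧ c'.ψ = c.ψ ∧ c'.χ = c.χ ∧ c'.O ⊆ c.O := by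
  obtain ⟨u, hu, huV⟩ := continuousOn_iff'.1 c.smooth_χ.continuousOn N hN
  have hmem : ∀ x ∈ c.O ∩ cornerSet c.J, x ∈ u ↔ c.χ x ∈ N := fun x hx =>
    ⟨fun h => (huV.symm.subset ⟨h, hx⟩).1, fun h => (huV.subset ⟨h, hx⟩).1⟩
  refine ⟨⟨c.U ∩ N, c.O ∩ u, c.J, c.ψ, c.χ, c.isOpen_U.inter hN, c.isOpen_O.inter hu,
    c.smooth_ψ.mono fun x hx => ⟨hx.1, hx.2.1⟩, c.smooth_χ.mono fun x hx => ⟨hx.1.1, hx.2⟩,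
    fun x hx => ?_, fun x hx => ?_, fun x hx => c.left_inv ⟨hx.1, hx.2.1⟩,
    fun x hx => c.right_inv ⟨hx.1.1, hx.2⟩⟩, rfl, rfl, rfl, rfl, inter_subset_left⟩
  · have h1 := c.mapsTo_ψ ⟨hx.1, hx.2.1⟩
    exact ⟨⟨h1.1, (hmem _ h1).2 (by rw [c.left_inv ⟨hx.1, hx.2.1⟩]; exact hx.2.2)⟩, h1.2⟩
  · have h1 := c.mapsTo_χ ⟨hx.1.1, hx.2⟩
    exact ⟨h1.1, h1.2, (hmem x ⟨hx.1.1, hx.2⟩).1 hx.1.2⟩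

end EmbChart

namespace EmbChart

variable {m : ℕ} (c : EmbChart I (univ : Set P) m)

lemma smooth_ψ' : ContMDiffOn I 𝓘(ℝ, 𝓔 m) ∞ c.ψ c.U := c.smooth_ψ.mono fun _ h => ⟨mem_univ _, h⟩

lemma smooth_coord (i : Fin m) : ContMDiffOn I 𝓘(ℝ, ℝ) ∞ (fun q => c.ψ q i) c.U :=
  (coordL i).contMDiff.comp_contMDiffOn c.smooth_ψ'

lemma mapsTo_ψ' {q : P} (hq : q ∈ c.U) : c.ψ q ∈ c.O ∩ cornerSet c.J := c.mapsTo_ψ ⟨mem_univ _, hq⟩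

lemma mapsTo_χ' {x : 𝓔 m} (hx : x ∈ c.O ∩ cornerSet c.J) : c.χ x ∈ c.U := (c.mapsTo_χ hx).2

lemma left_inv' {q : P} (hq : q ∈ c.U) : c.χ (c.ψ q) = q := c.left_inv ⟨mem_univ _, hq⟩

lemma isDiffeoOnto : IsDiffeoOnto I c.U c.ψ (c.O ∩ cornerSet c.J) where
  contMDiffOn := c.smooth_ψ'
  bijOn := ⟨fun _ h => c.mapsTo_ψ' h, fun x hx y hy h => by
    rw [← c.left_inv' hx, ← c.left_inv' hy]; exact congrArg c.χ h,
    fun x hx => ⟨c.χ x, c.mapsTo_χ' hx, c.right_inv hx⟩⟩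
  inverse _ hq := ⟨c.χ, fun _ h => c.left_inv' h, c.smooth_χ _ (c.mapsTo_ψ' hq)⟩

lemma isAdaptedChart {S : Set P} {K : Finset (Fin m)}
    (hS : ∀ q ∈ c.U, q ∈ S ↔ ∀ i ∈ K, c.ψ q i = 0) :
    IsAdaptedChart I S c.U c.J K c.ψ (c.O ∩ cornerSet c.J) :=
  ⟨c.isOpen_U, ⟨c.O, c.isOpen_O, rfl⟩, c.isDiffeoOnto, hS⟩

end EmbChart

lemma IsDiffeoOnto.exists_inverse {F : Type*} [NormedAddCommGroup F] [NormedSpace ℝ F]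
    {U : Set P} {ψ : P → F} {V : Set F} (h : IsDiffeoOnto I U ψ V) (hU : U.Nonempty) :
    ∃ χ : F → P, LeftInvOn χ ψ U ∧ LeftInvOn ψ χ V ∧ MapsTo χ V U ∧ ContMDiffOn 𝓘(ℝ, F) I ∞ χ V := by
  classical
  obtain ⟨q₀, hq₀⟩ := hU
  obtain ⟨χ, hχ, -⟩ := h.inverse q₀ hq₀
  refine ⟨χ, hχ, fun x hx => ?_, fun x hx => ?_, fun x hx => ?_⟩
  · obtain ⟨q, hq, rfl⟩ := h.bijOn.surjOn hx
    rw [hχ hq]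
  · obtain ⟨q, hq, rfl⟩ := h.bijOn.surjOn hx
    rwa [hχ hq]
  · obtain ⟨q, hq, rfl⟩ := h.bijOn.surjOn hx
    obtain ⟨χ', hχ', hs⟩ := h.inverse q hq
    refine hs.congr (fun y hy => ?_) (by rw [hχ hq, hχ' hq])
    obtain ⟨q', hq', rfl⟩ := h.bijOn.surjOn hy
    rw [hχ hq', hχ' hq']

lemma IsAdaptedChart.exists_cornerChart {S U : Set P} {m : ℕ} {J K : Finset (Fin m)}
    {ψ : P → 𝓔 m} {V : Set (𝓔 m)}
    (h : IsAdaptedChart I S U J K ψ V) (hU : U.Nonempty) :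
    ∃ c : CornerChart I P m, c.U = U ∧ c.J = J ∧ c.ψ = ψ ∧ V = c.O ∩ cornerSet c.J := by
  obtain ⟨O, hO, rfl⟩ := h.isOpen_image
  obtain ⟨χ, h1, h2, h3, h4⟩ := h.isDiffeoOnto.exists_inverse hU
  exact ⟨⟨U, O, J, ψ, χ, h.isOpen, hO, h.isDiffeoOnto.contMDiffOn.mono fun _ h => h.2, h4,
    fun x hx => h.isDiffeoOnto.bijOn.mapsTo hx.2, fun x hx => ⟨mem_univ _, h3 hx⟩,
    fun x hx => h1 hx.2, h2⟩, rfl, rfl, rfl, rfl⟩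

/-- **Hadamard's lemma** in adapted coordinates. -/
lemma EmbChart.exists_eq_sum_smul {m : ℕ} (c : EmbChart I (univ : Set P) m) {S : Set P}
    {K : Finset (Fin m)} (hS : ∀ q ∈ c.U, q ∈ S ↔ ∀ i ∈ K, c.ψ q i = 0) {p : P} (hpS : p ∈ S)
    {N : Set P} (hN : IsOpen N) (hpN : p ∈ N) (hpU : p ∈ c.U) {F : Type} [NormedAddCommGroup F]
    [NormedSpace ℝ F] [CompleteSpace F] {g : P → F} (hg : ContMDiffOn I 𝓘(ℝ, F) ∞ g N)
    (hg0 : ∀ q ∈ N, q ∈ S → g q = 0) :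
    ∃ U', IsOpen U' ∧ p ∈ U' ∧ U' ⊆ c.U ∧ U' ⊆ N ∧ ∃ a : Fin m → P → F,
      (∀ i, ContMDiffOn I 𝓘(ℝ, F) ∞ (a i) U') ∧ ∀ q ∈ U', g q = ∑ i ∈ K, c.ψ q i • a i q := by
  obtain ⟨c', hU', hJ, hψ, hχ, hO⟩ := c.exists_restrict hN
  have hp : p ∈ c'.U := by rw [hU']; exact ⟨hpU, hpN⟩
  have hsub : c'.U ⊆ c.U := by rw [hU']; exact inter_subset_left
  have hsubN : c'.U ⊆ N := by rw [hU']; exact inter_subset_right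
  have hgs : ContDiffOn ℝ ∞ (g ∘ c'.χ) (c'.O ∩ cornerSet c'.J) := by
    rw [← contMDiffOn_iff_contDiffOn]
    exact hg.comp c'.smooth_χ fun x hx => hsubN (c'.mapsTo_χ' hx)
  obtain ⟨O', hO', hpO', hO'O, a, ha, hsum⟩ := exists_eq_sum_smul_of_eq_zero c'.isOpen_O K hgs
    (fun x hx h0 => hg0 _ (hsubN (c'.mapsTo_χ' hx)) ((hS _ (hsub (c'.mapsTo_χ' hx))).2 fun i hi => by
      rw [← hψ, c'.right_inv hx]; exact h0 i hi)) (c'.mapsTo_ψ' hp)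
    (fun i hi => by rw [hψ]; exact (hS p hpU).1 hpS i hi)
  refine ⟨c'.U ∩ c'.ψ ⁻¹' O', c'.smooth_ψ'.continuousOn.isOpen_inter_preimage c'.isOpen_U hO',
    ⟨hp, hpO'⟩, inter_subset_left.trans hsub, inter_subset_left.trans hsubN, fun i => a i ∘ c'.ψ,
    fun i => ?_, fun q hq => ?_⟩
  · refine (contMDiffOn_iff_contDiffOn.2 (ha i)).comp (c'.smooth_ψ'.mono inter_subset_left)
      fun q hq => ⟨hq.2, (c'.mapsTo_ψ' hq.1).2⟩
  · have := hsum (c'.ψ q) ⟨hq.2, (c'.mapsTo_ψ' hq.1).2⟩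
    simp only [Function.comp_apply, c'.left_inv' hq.1] at this
    rw [this, hψ]; rfl

/-- A smooth injective map `ι` is an initial embedding if its inverse is smooth on its range. -/
structure InitEmb (I : ModelWithCorners ℝ E H) (I' : ModelWithCorners ℝ E' H') (ι : P → P') :
    Prop where
  contMDiff : ContMDiff I I' ∞ ι
  exists_leftInverse : ∃ χ : P' → P, Function.LeftInverse χ ι ∧ ContMDiffOn I' I ∞ χ (range ι)

namespace InitEmb

variable {ι : P → P'} (h : InitEmb I I' ι)
include h

lemma injective : Function.Injective ι :=
  let ⟨_, hχ, _⟩ := h.exists_leftInverse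
  hχ.injective

lemma isEmbedding : IsEmbedding ι := by
  obtain ⟨χ, hχ, hs⟩ := h.exists_leftInverse
  refine ⟨isInducing_iff_nhds.2 fun x => le_antisymm
    (h.contMDiff.continuous.continuousAt.tendsto.le_comap) ?_, h.injective⟩
  have h1 : Tendsto χ (𝓝[range ι] (ι x)) (𝓝 (χ (ι x))) := (hs _ ⟨x, rfl⟩).continuousWithinAt
  have h2 : Tendsto ι (comap ι (𝓝 (ι x))) (𝓝[range ι] (ι x)) :=
    tendsto_nhdsWithin_iff.2 ⟨tendsto_comap, Eventually.of_forall fun y => ⟨y, rfl⟩⟩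
  have h3 := h1.comp h2
  rwa [hχ.comp_eq_id, hχ x] at h3

lemma contMDiffWithinAt_iff {g : P'' → P} {s : Set P''} {x : P''} :
    ContMDiffWithinAt I'' I ∞ g s x ↔ ContMDiffWithinAt I'' I' ∞ (ι ∘ g) s x := by
  refine ⟨fun hg => h.contMDiff.contMDiffAt.comp_contMDiffWithinAt x hg, fun hg => ?_⟩
  obtain ⟨χ, hχ, hs⟩ := h.exists_leftInverse
  have := ContMDiffWithinAt.comp (t := range ι) x (hs (ι (g x)) ⟨g x, rfl⟩) hg fun y _ => ⟨g y, rfl⟩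
  rwa [← Function.comp_assoc, hχ.comp_eq_id] at this

lemma contMDiffOn_iff {g : P'' → P} {s : Set P''} :
    ContMDiffOn I'' I ∞ g s ↔ ContMDiffOn I'' I' ∞ (ι ∘ g) s :=
  forall₂_congr fun _ _ => h.contMDiffWithinAt_iff

lemma contMDiff_iff {g : P'' → P} : ContMDiff I'' I ∞ g ↔ ContMDiff I'' I' ∞ (ι ∘ g) := by
  rw [← contMDiffOn_univ, ← contMDiffOn_univ, h.contMDiffOn_iff]

lemma comp {ι' : P' → P''} (h' : InitEmb I' I'' ι') : InitEmb I I'' (ι' ∘ ι) := by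
  obtain ⟨χ, hχ, hs⟩ := h.exists_leftInverse
  obtain ⟨χ', hχ', hs'⟩ := h'.exists_leftInverse
  refine ⟨h'.contMDiff.comp h.contMDiff, χ ∘ χ', hχ'.comp hχ, ?_⟩
  refine hs.comp (hs'.mono (range_comp_subset_range _ _)) ?_
  rintro _ ⟨x, rfl⟩
  exact ⟨x, (hχ' _).symm⟩

lemma prodMap {Q Q' : Type*} [TopologicalSpace Q] [TopologicalSpace Q'] {D G D' G' : Type*}
    [NormedAddCommGroup D] [NormedSpace ℝ D] [TopologicalSpace G] {L : ModelWithCorners ℝ D G}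
    [ChartedSpace G Q] [NormedAddCommGroup D'] [NormedSpace ℝ D'] [TopologicalSpace G']
    {L' : ModelWithCorners ℝ D' G'} [ChartedSpace G' Q'] {κ : Q → Q'} (hκ : InitEmb L L' κ) :
    InitEmb (I.prod L) (I'.prod L') (Prod.map ι κ) := by
  obtain ⟨χ, hχ, hs⟩ := h.exists_leftInverse
  obtain ⟨χ', hχ', hs'⟩ := hκ.exists_leftInverse
  refine ⟨h.contMDiff.prodMap hκ.contMDiff, Prod.map χ χ', fun x => Prod.ext (hχ x.1) (hχ' x.2), ?_⟩
  rw [range_prodMap]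
  exact hs.prodMap hs'

lemma of_comp {g : P' → P''} {ι' : P → P''} (h' : ∀ x, ι' x = g (ι x)) {χ : P'' → P'}
    (hg : ContMDiffOn I' I'' ∞ g (range ι)) (hχ : ContMDiffOn I'' I' ∞ χ (range ι'))
    (hχι : ∀ x, χ (ι' x) = ι x) : InitEmb I I'' ι' := by
  obtain ⟨χ₀, hχ₀, hs⟩ := h.exists_leftInverse
  obtain rfl : ι' = g ∘ ι := funext h'
  refine ⟨?_, χ₀ ∘ χ, fun x => (congrArg χ₀ (hχι x)).trans (hχ₀ x), ?_⟩
  · rw [← contMDiffOn_univ]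
    exact hg.comp h.contMDiff.contMDiffOn fun x _ => ⟨x, rfl⟩
  · refine hs.comp hχ ?_
    rintro _ ⟨x, rfl⟩
    exact ⟨x, (hχι x).symm⟩

/-- Coordinates on the range of an initial embedding are coordinates on the source. -/
lemma exists_cornerChart {m : ℕ} (c : EmbChart I' (range ι) m) : ∃ c' : CornerChart I P m,
    c'.U = ι ⁻¹' c.U ∧ c'.O = c.O ∧ c'.J = c.J ∧ (∀ q, c'.ψ q = c.ψ (ι q)) ∧
    ∀ x ∈ c.O ∩ cornerSet c.J, ι (c'.χ x) = c.χ x := by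
  obtain ⟨χ, hχ, hs⟩ := h.exists_leftInverse
  have hχ' : ∀ y ∈ range ι, ι (χ y) = y := by rintro _ ⟨x, rfl⟩; rw [hχ x]
  refine ⟨⟨ι ⁻¹' c.U, c.O, c.J, c.ψ ∘ ι, χ ∘ c.χ, c.isOpen_U.preimage h.contMDiff.continuous,
    c.isOpen_O, c.smooth_ψ.comp h.contMDiff.contMDiffOn fun x hx => ⟨⟨x, rfl⟩, hx.2⟩,
    hs.comp c.smooth_χ fun x hx => (c.mapsTo_χ hx).1, fun x hx => c.mapsTo_ψ ⟨⟨x, rfl⟩, hx.2⟩,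
    fun x hx => ⟨mem_univ _, ?_⟩, fun x hx => ?_, fun x hx => ?_⟩, rfl, rfl, rfl, fun _ => rfl,
    fun x hx => hχ' _ (c.mapsTo_χ hx).1⟩
  · change ι (χ (c.χ x)) ∈ c.U
    rw [hχ' _ (c.mapsTo_χ hx).1]; exact (c.mapsTo_χ hx).2
  · change χ (c.χ (c.ψ (ι x))) = x
    rw [c.left_inv ⟨⟨x, rfl⟩, hx.2⟩, hχ x]
  · change c.ψ (ι (χ (c.χ x))) = x
    rw [hχ' _ (c.mapsTo_χ hx).1, c.right_inv hx]

end InitEmb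

lemma initEmb_id : InitEmb I I (id : P → P) := ⟨contMDiff_id, id, fun _ => rfl, contMDiffOn_id⟩

/-! ### Standard coordinate systems -/

lemma exists_cornerChart_quadrant {n : ℕ} {M : Type*} [TopologicalSpace M]
    [ChartedSpace (EuclideanQuadrant n) M] [IsManifold (𝓠 n) ∞ M] (p : M) :
    ∃ c : CornerChart (𝓠 n) M n, p ∈ c.U ∧ c.U = (chartAt (EuclideanQuadrant n) p).source ∧
      c.J = Finset.univ ∧ c.ψ = extChartAt (𝓠 n) p ∧
      c.χ = (extChartAt (𝓠 n) p).symm ∧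
      c.O ∩ cornerSet c.J = (extChartAt (𝓠 n) p).target := by
  have hr : range (𝓠 n) = cornerSet (Finset.univ : Finset (Fin n)) := by
    rw [show range (𝓠 n) = _ from range_euclideanQuadrant n]
    simp [cornerSet]
  have ht : (𝓠 n).symm ⁻¹' (chartAt (EuclideanQuadrant n) p).target ∩
      cornerSet Finset.univ = (extChartAt (𝓠 n) p).target := by
    rw [extChartAt_target, hr]
  refine ⟨⟨(chartAt (EuclideanQuadrant n) p).source,
    (𝓠 n).symm ⁻¹' (chartAt (EuclideanQuadrant n) p).target, Finset.univ,
    extChartAt (𝓠 n) p, (extChartAt (𝓠 n) p).symm,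
    (chartAt (EuclideanQuadrant n) p).open_source,
    (chartAt (EuclideanQuadrant n) p).open_target.preimage (𝓠 n).continuous_symm,
    contMDiffOn_extChartAt.mono inter_subset_right, ?_, ?_, ?_, ?_, ?_⟩, ?_, rfl, rfl, rfl, rfl, ht⟩
  · rw [ht]; exact contMDiffOn_extChartAt_symm p
  · rw [ht]; rintro x ⟨-, hx⟩
    exact (extChartAt (𝓠 n) p).map_source (by rwa [extChartAt_source])
  · rw [ht]; intro x hx
    exact ⟨mem_univ _, by simpa using (extChartAt (𝓠 n) p).map_target hx⟩
  · rintro x ⟨-, hx⟩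
    exact (extChartAt (𝓠 n) p).left_inv (by rwa [extChartAt_source])
  · rw [ht]; intro x hx
    exact (extChartAt (𝓠 n) p).right_inv hx
  · exact mem_chart_source _ p

/-- Concatenation of coordinate vectors. -/
def appendVec {m₁ m₂ : ℕ} (a : 𝓔 m₁ × 𝓔 m₂) : 𝓔 (m₁ + m₂) :=
  toLp 2 (Fin.addCases (fun i => a.1 i) (fun i => a.2 i))

/-- The first coordinates of a vector. -/
def leftVec {m₁ m₂ : ℕ} (x : 𝓔 (m₁ + m₂)) :
    𝓔 m₁ := toLp 2 fun i => x (Fin.castAdd m₂ i)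

/-- The last coordinates of a vector. -/
def rightVec {m₁ m₂ : ℕ} (x : 𝓔 (m₁ + m₂)) :
    𝓔 m₂ := toLp 2 fun i => x (Fin.natAdd m₁ i)

section appendVec

variable {m₁ m₂ : ℕ}

@[simp] theorem appendVec_castAdd (a : 𝓔 m₁ × 𝓔 m₂)
    (i : Fin m₁) : appendVec a (Fin.castAdd m₂ i) = a.1 i := by simp [appendVec]

@[simp] theorem appendVec_natAdd (a : 𝓔 m₁ × 𝓔 m₂)
    (i : Fin m₂) : appendVec a (Fin.natAdd m₁ i) = a.2 i := by simp [appendVec]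

@[simp] theorem leftVec_appendVec (a : 𝓔 m₁ × 𝓔 m₂) :
    leftVec (appendVec a) = a.1 := by ext i; simp [leftVec]

@[simp] theorem rightVec_appendVec (a : 𝓔 m₁ × 𝓔 m₂) :
    rightVec (appendVec a) = a.2 := by ext i; simp [rightVec]

@[simp] theorem appendVec_left_right (x : 𝓔 (m₁ + m₂)) :
    appendVec (leftVec x, rightVec x) = x := by
  ext i; refine Fin.addCases (fun i => ?_) (fun i => ?_) i <;> simp [leftVec, rightVec]

lemma contDiff_appendVec : ContDiff ℝ ∞ (appendVec (m₁ := m₁) (m₂ := m₂)) := by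
  rw [contDiff_euclidean]
  intro i; refine Fin.addCases (fun i => ?_) (fun i => ?_) i
  · simp only [appendVec_castAdd]; fun_prop
  · simp only [appendVec_natAdd]; fun_prop

lemma contDiff_leftVec : ContDiff ℝ ∞ (leftVec (m₁ := m₁) (m₂ := m₂)) := by
  rw [contDiff_euclidean]; intro i; simp only [leftVec]; fun_prop

lemma contDiff_rightVec : ContDiff ℝ ∞ (rightVec (m₁ := m₁) (m₂ := m₂)) := by
  rw [contDiff_euclidean]; intro i; simp only [rightVec]; fun_prop

/-- The index set of a product of corners. -/
def appendFinset (J₁ : Finset (Fin m₁)) (J₂ : Finset (Fin m₂)) : Finset (Fin (m₁ + m₂)) :=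
  (J₁.map (Fin.castAddEmb m₂)) ∪ (J₂.map (Fin.natAddEmb m₁))

@[simp] theorem castAdd_mem_appendFinset {J₁ : Finset (Fin m₁)} {J₂ : Finset (Fin m₂)} {i : Fin m₁} :
    Fin.castAdd m₂ i ∈ appendFinset J₁ J₂ ↔ i ∈ J₁ := by
  simp only [appendFinset, Finset.mem_union, Finset.mem_map, Fin.castAddEmb_apply,
    Fin.natAddEmb_apply]
  constructor
  · rintro (⟨a, ha, h⟩ | ⟨a, ha, h⟩)
    · rwa [← Fin.castAdd_injective _ _ h]
    · simp [Fin.ext_iff] at h; omega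
  · exact fun h => Or.inl ⟨i, h, rfl⟩

@[simp] theorem natAdd_mem_appendFinset {J₁ : Finset (Fin m₁)} {J₂ : Finset (Fin m₂)} {i : Fin m₂} :
    Fin.natAdd m₁ i ∈ appendFinset J₁ J₂ ↔ i ∈ J₂ := by
  simp only [appendFinset, Finset.mem_union, Finset.mem_map, Fin.castAddEmb_apply,
    Fin.natAddEmb_apply]
  constructor
  · rintro (⟨a, ha, h⟩ | ⟨a, ha, h⟩)
    · simp [Fin.ext_iff] at h; omega
    · rwa [← Fin.natAdd_injective _ _ h]
  · exact fun h => Or.inr ⟨i, h, rfl⟩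

lemma forall_mem_appendFinset {J₁ : Finset (Fin m₁)} {J₂ : Finset (Fin m₂)}
    {p : Fin (m₁ + m₂) → Prop} : (∀ i ∈ appendFinset J₁ J₂, p i) ↔
      (∀ i ∈ J₁, p (Fin.castAdd m₂ i)) ∧ ∀ i ∈ J₂, p (Fin.natAdd m₁ i) := by
  refine ⟨fun h => ⟨fun i hi => h _ (by simpa), fun i hi => h _ (by simpa)⟩, fun h i => ?_⟩
  refine Fin.addCases (fun i => ?_) (fun i => ?_) i
  · simpa using h.1 i
  · simpa using h.2 i

lemma mem_cornerSet_appendFinset {J₁ : Finset (Fin m₁)} {J₂ : Finset (Fin m₂)}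
    {x : 𝓔 (m₁ + m₂)} : x ∈ cornerSet (appendFinset J₁ J₂) ↔
      leftVec x ∈ cornerSet J₁ ∧ rightVec x ∈ cornerSet J₂ := by
  simp only [cornerSet, mem_ofPred_eq, forall_mem_appendFinset, leftVec, rightVec]

end appendVec

/-- Product coordinates. -/
def EmbChart.prod {m₁ m₂ : ℕ} (c₁ : EmbChart I (univ : Set P) m₁)
    (c₂ : EmbChart I' (univ : Set P') m₂) : EmbChart (I.prod I') (univ : Set (P × P')) (m₁ + m₂) where
  U := c₁.U ×ˢ c₂.U
  O := leftVec ⁻¹' c₁.O ∩ rightVec ⁻¹' c₂.O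
  J := appendFinset c₁.J c₂.J
  ψ := fun q => appendVec (c₁.ψ q.1, c₂.ψ q.2)
  χ := fun x => (c₁.χ (leftVec x), c₂.χ (rightVec x))
  isOpen_U := c₁.isOpen_U.prod c₂.isOpen_U
  isOpen_O := (c₁.isOpen_O.preimage contDiff_leftVec.continuous).inter
    (c₂.isOpen_O.preimage contDiff_rightVec.continuous)
  smooth_ψ := by
    rw [univ_inter]
    exact contDiff_appendVec.contMDiff.comp_contMDiffOn
      ((c₁.smooth_ψ'.comp contMDiffOn_fst fun x hx => hx.1).prodMk_space
        (c₂.smooth_ψ'.comp contMDiffOn_snd fun x hx => hx.2))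
  smooth_χ := (c₁.smooth_χ.comp contDiff_leftVec.contMDiff.contMDiffOn fun _ hx =>
      ⟨hx.1.1, (mem_cornerSet_appendFinset.1 hx.2).1⟩).prodMk
    (c₂.smooth_χ.comp contDiff_rightVec.contMDiff.contMDiffOn fun _ hx =>
      ⟨hx.1.2, (mem_cornerSet_appendFinset.1 hx.2).2⟩)
  mapsTo_ψ := by
    rintro ⟨x, y⟩ ⟨-, hx, hy⟩
    refine ⟨⟨?_, ?_⟩, mem_cornerSet_appendFinset.2 ⟨?_, ?_⟩⟩
    · simpa using (c₁.mapsTo_ψ' hx).1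
    · simpa using (c₂.mapsTo_ψ' hy).1
    · simpa using (c₁.mapsTo_ψ' hx).2
    · simpa using (c₂.mapsTo_ψ' hy).2
  mapsTo_χ := fun _ hx => ⟨mem_univ _, c₁.mapsTo_χ' ⟨hx.1.1, (mem_cornerSet_appendFinset.1 hx.2).1⟩,
    c₂.mapsTo_χ' ⟨hx.1.2, (mem_cornerSet_appendFinset.1 hx.2).2⟩⟩
  left_inv := by
    rintro ⟨x, y⟩ ⟨-, hx, hy⟩
    simp [c₁.left_inv' hx, c₂.left_inv' hy]
  right_inv := fun x hx => by
    have h1 := c₁.right_inv ⟨hx.1.1, (mem_cornerSet_appendFinset.1 hx.2).1⟩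
    have h2 := c₂.right_inv ⟨hx.1.2, (mem_cornerSet_appendFinset.1 hx.2).2⟩
    simp [h1, h2]

/-- The identity coordinates of a Euclidean space. -/
def EmbChart.refl (m : ℕ) : CornerChart (𝓡 m) (𝓔 m) m where
  U := univ
  O := univ
  J := ∅
  ψ := id
  χ := id
  isOpen_U := isOpen_univ
  isOpen_O := isOpen_univ
  smooth_ψ := contMDiffOn_id
  smooth_χ := contMDiffOn_id
  mapsTo_ψ := fun _ _ => ⟨mem_univ _, fun _ h => by simp at h⟩
  mapsTo_χ := fun _ _ => ⟨mem_univ _, mem_univ _⟩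
  left_inv := fun _ _ => rfl
  right_inv := fun _ _ => rfl

end Charts

/-! ### Subsets of manifolds that are manifolds with corners -/

section Embedded

variable {W : Set P} {m : ℕ}

open Classical in
/-- The extension by zero to the ambient space of a chart of `W`, with values in the model vector
space. -/
def ambientChart (φ : OpenPartialHomeomorph W (EuclideanQuadrant m)) (a : P) :
    𝓔 m := if h : a ∈ W then (φ ⟨a, h⟩).1 else 0

lemma ambientChart_coe (φ : OpenPartialHomeomorph W (EuclideanQuadrant m)) (w : W) :
    ambientChart φ w = (φ w).1 := by simp [ambientChart]

/-- The charts of `W` that are compatible with the smooth structure of the ambient manifold. -/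
def IsCompatibleChart (I : ModelWithCorners ℝ E H)
    (φ : OpenPartialHomeomorph W (EuclideanQuadrant m)) : Prop :=
  ContMDiffOn I 𝓘(ℝ, 𝓔 m) ∞ (ambientChart φ) (Subtype.val '' φ.source) ∧
  ContMDiffOn 𝓘(ℝ, 𝓔 m) I ∞ (fun x => ((φ.symm ((𝓠 m).symm x) : W) : P))
    ((𝓠 m).symm ⁻¹' φ.target ∩ range (𝓠 m))

lemma 𝓠_symm_apply {x : 𝓔 m} (hx : ∀ i, 0 ≤ x i) : ((𝓠 m).symm x).1 = x := by
  have : x ∈ range (𝓠 m) := by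
    rw [show range (𝓠 m) = _ from range_euclideanQuadrant m]; exact hx
  exact (𝓠 m).right_inv this

lemma range_𝓠 : range (𝓠 m) = {x | ∀ i, 0 ≤ x i} := range_euclideanQuadrant m

lemma EmbChart.exists_compatibleChart (c : EmbChart I W m) {q : W} (hq : (q : P) ∈ c.U) :
    ∃ φ : OpenPartialHomeomorph W (EuclideanQuadrant m), q ∈ φ.source ∧ IsCompatibleChart I φ := by
  classical
  set s : 𝓔 m := toLp 2 fun j => if j ∈ c.J then 0 else 1 - c.ψ q j with hs
  have hsJ : ∀ j ∈ c.J, s j = 0 := fun j hj => by simp [hs, hj]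
  set src : Set W := {w | (w : P) ∈ c.U ∧ ∀ j ∉ c.J, 0 < c.ψ w j + s j} with hsrc
  set tgt : Set (EuclideanQuadrant m) := {x | x.1 - s ∈ c.O ∧ ∀ j ∉ c.J, 0 < x.1 j} with htgt
  have hnn : ∀ w ∈ src, ∀ i, 0 ≤ (c.ψ w + s) i := by
    intro w hw i
    by_cases hi : i ∈ c.J
    · have := (c.mapsTo_ψ ⟨w.2, hw.1⟩).2 i hi
      simpa [hsJ i hi] using this
    · exact (hw.2 i hi).le
  have hval : ∀ w ∈ src, ((𝓠 m).symm (c.ψ w + s)).1 = c.ψ w + s := fun w hw =>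
    𝓠_symm_apply (hnn w hw)
  have htV : ∀ x ∈ tgt, x.1 - s ∈ c.O ∩ cornerSet c.J := fun x hx => ⟨hx.1, fun j hj => by
    have := x.2 j
    simpa [hsJ j hj] using this⟩
  have hcont : ContinuousOn (fun w : W => c.ψ w) {w | (w : P) ∈ c.U} :=
    c.smooth_ψ.continuousOn.comp continuous_subtype_val.continuousOn fun w hw => ⟨w.2, hw⟩
  have hopen : IsOpen {w : W | (w : P) ∈ c.U} := c.isOpen_U.preimage continuous_subtype_val
  let inv : EuclideanQuadrant m → W := fun x =>
    if h : c.χ (x.1 - s) ∈ W then ⟨c.χ (x.1 - s), h⟩ else q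
  have hinv : ∀ x ∈ tgt, (inv x : P) = c.χ (x.1 - s) := fun x hx => by
    have := (c.mapsTo_χ (htV x hx)).1
    simp only [inv, dif_pos this]
  have hcontinv : ContinuousOn inv tgt := by
    rw [continuousOn_iff_continuous_domRestrict, continuous_induced_rng]
    rw [show Subtype.val ∘ tgt.domRestrict inv = tgt.domRestrict (fun x => c.χ (x.1 - s)) from
      funext fun x => hinv x.1 x.2, ← continuousOn_iff_continuous_domRestrict]
    exact c.smooth_χ.continuousOn.comp (by fun_prop) htV
  let φ : OpenPartialHomeomorph W (EuclideanQuadrant m) :=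
    { toFun := fun w => (𝓠 m).symm (c.ψ w + s)
      invFun := inv
      source := src
      target := tgt
      map_source' := fun w hw => by
        refine ⟨?_, fun j hj => ?_⟩
        · rw [hval w hw, add_sub_cancel_right]; exact (c.mapsTo_ψ ⟨w.2, hw.1⟩).1
        · rw [hval w hw]; exact hw.2 j hj
      map_target' := fun x hx => by
        refine ⟨?_, fun j hj => ?_⟩
        · rw [hinv x hx]; exact (c.mapsTo_χ (htV x hx)).2
        · rw [hinv x hx, c.right_inv (htV x hx)]; simpa using hx.2 j hj
      left_inv' := fun w hw => by
        apply Subtype.ext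
        rw [hinv]
        · rw [hval w hw, add_sub_cancel_right, c.left_inv ⟨w.2, hw.1⟩]
        · refine ⟨?_, fun j hj => ?_⟩
          · rw [hval w hw, add_sub_cancel_right]; exact (c.mapsTo_ψ ⟨w.2, hw.1⟩).1
          · rw [hval w hw]; exact hw.2 j hj
      right_inv' := fun x hx => by
        apply Subtype.ext
        rw [hinv x hx, c.right_inv (htV x hx), sub_add_cancel]
        exact 𝓠_symm_apply x.2
      open_source := by
        have := hcont.isOpen_inter_preimage (t := {x | ∀ j ∉ c.J, 0 < x j + s j}) hopen (by
          simp only [Set.ofPred_forall]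
          exact isOpen_iInter_of_finite fun j => isOpen_iInter_of_finite fun _ =>
            isOpen_lt continuous_const (by fun_prop))
        exact this
      open_target := by
        have hpos : IsOpen {x : 𝓔 m | ∀ j ∉ c.J, 0 < x j} := by
          simp only [Set.ofPred_forall]
          exact isOpen_iInter_of_finite fun j => isOpen_iInter_of_finite fun _ =>
            isOpen_lt continuous_const (by fun_prop)
        exact (c.isOpen_O.preimage (continuous_subtype_val.sub continuous_const)).inter
          (hpos.preimage continuous_subtype_val)
      continuousOn_toFun := (𝓠 m).continuous_symm.comp_continuousOn
        ((hcont.mono fun w hw => hw.1).add continuousOn_const)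
      continuousOn_invFun := hcontinv }
  refine ⟨φ, ⟨hq, fun j hj => by simp [hs, hj]⟩, ?_, ?_⟩
  · have h1 : ContMDiffOn I 𝓘(ℝ, 𝓔 m) ∞ (fun a => c.ψ a + s) (Subtype.val '' src) :=
      (c.smooth_ψ.mono (by rintro _ ⟨w, hw, rfl⟩; exact ⟨w.2, hw.1⟩)).add contMDiffOn_const
    refine h1.congr ?_
    rintro _ ⟨w, hw, rfl⟩
    rw [ambientChart_coe]; exact hval w hw
  · have hx1 : ∀ x ∈ (𝓠 m).symm ⁻¹' tgt ∩ range (𝓠 m),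
        ((𝓠 m).symm x).1 = x := fun x hx => (𝓠 m).right_inv hx.2
    have h1 : ContMDiffOn 𝓘(ℝ, 𝓔 m) I ∞ (fun x => c.χ (x - s))
        ((𝓠 m).symm ⁻¹' tgt ∩ range (𝓠 m)) := by
      refine c.smooth_χ.comp (ContDiff.contMDiff (by fun_prop)).contMDiffOn fun x hx => ?_
      have := htV _ hx.1
      rwa [hx1 x hx] at this
    refine h1.congr fun x hx => ?_
    change ((inv ((𝓠 m).symm x) : W) : P) = _
    rw [hinv _ hx.1, hx1 x hx]

variable (hW : ∀ q ∈ W, ∃ c : EmbChart I W m, q ∈ c.U)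
include hW

lemma exists_compatibleChart_at (q : W) :
    ∃ φ : OpenPartialHomeomorph W (EuclideanQuadrant m), q ∈ φ.source ∧ IsCompatibleChart I φ :=
  let ⟨c, hc⟩ := hW q q.2
  c.exists_compatibleChart hc

/-- The atlas of `W`. -/
@[reducible] def embeddedChartedSpace : ChartedSpace (EuclideanQuadrant m) W where
  atlas := {φ | IsCompatibleChart I φ}
  chartAt q := (exists_compatibleChart_at hW q).choose
  mem_chart_source q := (exists_compatibleChart_at hW q).choose_spec.1
  chart_mem_atlas q := (exists_compatibleChart_at hW q).choose_spec.2

lemma isManifold_embedded : @IsManifold ℝ _ _ _ _ _ _ (𝓠 m) ∞ W _ (embeddedChartedSpace hW) := by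
  let := embeddedChartedSpace hW
  refine isManifold_of_contDiffOn _ _ _ fun e e' he he' => ?_
  rw [← contMDiffOn_iff_contDiffOn]
  have h1 : ContMDiffOn I 𝓘(ℝ, 𝓔 m) ∞ (ambientChart e') (Subtype.val '' e'.source) := he'.1
  have h2 := (he : IsCompatibleChart I e).2
  have h3 := h1.comp (s := (𝓠 m).symm ⁻¹' (e.symm.trans e').source ∩ range (𝓠 m))
    (h2.mono fun x hx => ⟨hx.1.1, hx.2⟩) fun x hx => ⟨_, hx.1.2, rfl⟩
  refine h3.congr fun x hx => ?_
  exact (ambientChart_coe e' _).symm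

lemma initEmb_subtype_val (hne : Nonempty P → Nonempty W) :
    letI := embeddedChartedSpace hW
    InitEmb (𝓠 m) I (Subtype.val : W → P) := by
  classical
  let := embeddedChartedSpace hW
  have := isManifold_embedded hW
  have hcompat : ∀ q : W, IsCompatibleChart I (chartAt (EuclideanQuadrant m) q) := fun q =>
    chart_mem_atlas (EuclideanQuadrant m) q
  refine ⟨fun q => ?_, ?_⟩
  · have h1 := (hcompat q).2
    have h2 : ContMDiffOn (𝓠 m) 𝓘(ℝ, 𝓔 m) ∞
      (extChartAt (𝓠 m) q) (chartAt (EuclideanQuadrant m) q).source :=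
      contMDiffOn_extChartAt
    have hl : ∀ w ∈ (chartAt (EuclideanQuadrant m) q).source, (chartAt (EuclideanQuadrant m) q).symm
        ((𝓠 m).symm (extChartAt (𝓠 m) q w)) = w := fun w hw => by
      have := (extChartAt (𝓠 m) q).left_inv (by rwa [extChartAt_source])
      simpa using this
    have h3 := h1.comp h2 fun w hw => by
      have := (extChartAt (𝓠 m) q).map_source (by rwa [extChartAt_source])
      rwa [extChartAt_target] at this
    have h4 : ContMDiffOn (𝓠 m) I ∞ (Subtype.val : W → P)
        (chartAt (EuclideanQuadrant m) q).source :=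
      h3.congr fun w hw => congrArg Subtype.val (hl w hw).symm
    exact h4.contMDiffAt ((chartAt (EuclideanQuadrant m) q).open_source.mem_nhds (mem_chart_source _ q))
  · rcases isEmpty_or_nonempty W with hemp | ⟨⟨q₀⟩⟩
    · rcases isEmpty_or_nonempty P with hP | hP
      · exact ⟨fun a => isEmptyElim a, fun w => isEmptyElim w, fun a => isEmptyElim a⟩
      · exact absurd (hne hP) (not_nonempty_iff.2 hemp)
    · refine ⟨fun a => if h : a ∈ W then ⟨a, h⟩ else q₀, fun w => by simp, ?_⟩
      rintro _ ⟨q, rfl⟩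
      have h1 := (hcompat q).1
      have h2 : ContMDiffOn 𝓘(ℝ, 𝓔 m) (𝓠 m) ∞
        (extChartAt (𝓠 m) q).symm (extChartAt (𝓠 m) q).target :=
        contMDiffOn_extChartAt_symm q
      have h3 := h2.comp h1 (by
        rintro _ ⟨w, hw, rfl⟩
        rw [mem_preimage, ambientChart_coe]
        exact (extChartAt (𝓠 m) q).map_source (by rwa [extChartAt_source]))
      have hnb : Subtype.val '' (chartAt (EuclideanQuadrant m) q).source ∈ 𝓝[range (Subtype.val : W → P)] (q : P) := by
        have := (chartAt (EuclideanQuadrant m) q).open_source.mem_nhds (mem_chart_source _ q)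
        rw [Subtype.range_coe]
        exact preimage_coe_mem_nhds_subtype.1 (by
          rw [preimage_image_eq _ Subtype.val_injective]; exact this)
      refine ((h3 _ ⟨q, mem_chart_source _ q, rfl⟩).congr_of_eventuallyEq ?_ ?_).mono_of_mem_nhdsWithin hnb
      · filter_upwards [self_mem_nhdsWithin]
        rintro _ ⟨w, hw, rfl⟩
        rw [dif_pos w.2, Function.comp_apply, ambientChart_coe]
        exact ((extChartAt (𝓠 m) q).left_inv (by rwa [extChartAt_source])).symm
      · rw [dif_pos q.2, Function.comp_apply, ambientChart_coe]
        exact ((extChartAt (𝓠 m) q).left_inv (by simp)).symm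

end Embedded

/-! ### Coordinates of the model blow-up -/

section Polar

variable {m : ℕ}

lemma polarMap_apply (K : Finset (Fin m)) (a : ℝ × 𝓔 m) (i : Fin m) :
    polarMap K a i = if i ∈ K then a.1 * a.2 i else a.2 i := rfl

lemma polarMap_mem_cornerSet {J K : Finset (Fin m)} {a : ℝ × 𝓔 m}
    (h1 : 0 ≤ a.1) (h2 : a.2 ∈ cornerSet J) : polarMap K a ∈ cornerSet J := fun j hj => by
  rw [polarMap_apply]
  split_ifs
  · exact mul_nonneg h1 (h2 j hj)
  · exact h2 j hj

/-- Projective coordinates on the model blow-up near a point `(r, w)` with `w_i ≠ 0`: the coordinate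
`w_i` is replaced by `r`. -/
lemma exists_embChart_polarSet {J K : Finset (Fin m)} {O : Set (𝓔 m)}
    (hO : IsOpen O) {a₀ : ℝ × 𝓔 m} (ha₀ : a₀ ∈ polarSet J K (O ∩ cornerSet J)) :
    ∃ (c : EmbChart 𝓘(ℝ, ℝ × 𝓔 m) (polarSet J K (O ∩ cornerSet J)) m)
      (i : Fin m), a₀ ∈ c.U ∧ i ∈ K ∧ c.J = insert i J ∧ (∀ a, c.ψ a i = a.1) ∧
        ∀ a, ∀ j ≠ i, c.ψ a j = a.2 j := by
  classical
  obtain ⟨h1, h2, h3, h4⟩ := ha₀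
  obtain ⟨i, hiK, hi⟩ : ∃ i ∈ K, a₀.2 i ≠ 0 := by
    by_contra! h
    rw [Finset.sum_eq_zero fun i hi => by rw [h i hi]; norm_num] at h3
    exact zero_ne_one h3
  obtain ⟨ε, hε, hpos, hεJ⟩ : ∃ ε : ℝ, ε ^ 2 = 1 ∧ 0 < ε * a₀.2 i ∧ (i ∈ J → ε = 1) := by
    rcases lt_or_gt_of_ne hi with h | h
    · exact ⟨-1, by norm_num, by linarith, fun hJ => absurd (h2 i hJ) (not_le.2 h)⟩
    · exact ⟨1, by norm_num, by linarith, fun _ => rfl⟩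
  have hε0 : ε ≠ 0 := by rintro rfl; norm_num at hε
  let χ : 𝓔 m → ℝ × 𝓔 m := fun c =>
    (c i, toLp 2 fun j => if j = i then ε * √(1 - ∑ k ∈ K.erase i, c k ^ 2) else c j)
  let ψ : ℝ × 𝓔 m → 𝓔 m := fun a =>
    toLp 2 fun j => if j = i then a.1 else a.2 j
  have hψi : ∀ a, ψ a i = a.1 := fun a => by simp [ψ]
  have hψj : ∀ a, ∀ j ≠ i, ψ a j = a.2 j := fun a j hj => by simp [ψ, hj]
  have hχi : ∀ c, (χ c).2 i = ε * √(1 - ∑ k ∈ K.erase i, c k ^ 2) := fun c => by simp [χ]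
  have hχj : ∀ c, ∀ j ≠ i, (χ c).2 j = c j := fun c j hj => by simp [χ, hj]
  have hχ1 : ∀ c, (χ c).1 = c i := fun c => rfl
  let T : Set (𝓔 m) := {c | ∑ k ∈ K.erase i, c k ^ 2 < 1}
  have hT : IsOpen T := isOpen_lt (by fun_prop) continuous_const
  have hχT : ContDiffOn ℝ ∞ χ T := by
    refine ContDiffOn.prodMk (by fun_prop) ?_
    rw [contDiffOn_euclidean]
    intro j
    by_cases hj : j = i
    · subst hj
      refine ContDiffOn.congr (f := fun c : 𝓔 m =>
        ε * √(1 - ∑ k ∈ K.erase j, c k ^ 2)) ?_ fun c _ => hχi c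
      refine contDiffOn_const.mul (ContDiffOn.sqrt (by fun_prop) fun c hc => ?_)
      have : ∑ k ∈ K.erase j, c k ^ 2 < 1 := hc
      exact (sub_pos.2 this).ne'
    · exact ContDiffOn.congr (f := fun c : 𝓔 m => c j) (by fun_prop) fun c _ => hχj c j hj
  have hψs : ContDiff ℝ ∞ ψ := by
    rw [contDiff_euclidean]
    intro j
    by_cases hj : j = i
    · subst hj; simp only [hψi]; fun_prop
    · simp only [hψj _ j hj]; fun_prop
  have hsum : ∀ a : ℝ × 𝓔 m, ∑ k ∈ K.erase i, ψ a k ^ 2 =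
      ∑ k ∈ K, a.2 k ^ 2 - a.2 i ^ 2 := fun a => by
    rw [← Finset.add_sum_erase K (fun k => a.2 k ^ 2) hiK, add_sub_cancel_left]
    exact Finset.sum_congr rfl fun k hk => by rw [hψj a k (Finset.ne_of_mem_erase hk)]
  have hχψ : ∀ a : ℝ × 𝓔 m, ∑ k ∈ K, a.2 k ^ 2 = 1 → 0 < ε * a.2 i →
      χ (ψ a) = a := fun a ha hp => by
    refine Prod.ext (hψi a) ?_
    ext j
    by_cases hj : j = i
    · subst hj
      rw [hχi, hsum, ha, sub_sub_cancel]
      have : a.2 j ^ 2 = (ε * a.2 j) ^ 2 := by rw [mul_pow, hε, one_mul]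
      rw [this, Real.sqrt_sq hp.le, ← mul_assoc, ← pow_two, hε, one_mul]
    · rw [hχj _ j hj, hψj _ j hj]
  have hψχ : ∀ c, ψ (χ c) = c := fun c => by
    ext j
    by_cases hj : j = i
    · subst hj; rw [hψi]
    · rw [hψj _ j hj, hχj _ j hj]
  refine ⟨⟨{a | 0 < ε * a.2 i}, T ∩ (fun c => polarMap K (χ c)) ⁻¹' O, insert i J, ψ, χ, ?_, ?_,
    hψs.contMDiff.contMDiffOn, ?_, ?_, ?_, ?_, fun c _ => hψχ c⟩, i, hpos, hiK, rfl, hψi, hψj⟩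
  · exact isOpen_lt continuous_const (by fun_prop)
  · exact ((contDiff_polarMap K).continuous.comp_continuousOn hχT.continuousOn).isOpen_inter_preimage
      hT hO
  · exact contMDiffOn_iff_contDiffOn.2 (hχT.mono fun c hc => hc.1.1)
  · rintro a ⟨⟨b1, b2, b3, b4⟩, hp⟩
    refine ⟨⟨?_, ?_⟩, fun j hj => ?_⟩
    · change ∑ k ∈ K.erase i, ψ a k ^ 2 < 1
      rw [hsum, b3]
      have hp : 0 < ε * a.2 i := hp
      have : 0 < a.2 i ^ 2 := by
        have := pow_pos hp 2
        rwa [mul_pow, hε, one_mul] at this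
      linarith
    · change polarMap K (χ (ψ a)) ∈ O
      rw [hχψ a b3 hp]; exact b4.1
    · by_cases h : j = i
      · subst h; rw [hψi]; exact b1
      · rw [hψj _ j h]; exact b2 j (Finset.mem_of_mem_insert_of_ne hj h)
  · rintro c ⟨⟨hcT, hcO⟩, hcJ⟩
    have hcT : ∑ k ∈ K.erase i, c k ^ 2 < 1 := hcT
    have hs : 0 < √(1 - ∑ k ∈ K.erase i, c k ^ 2) := Real.sqrt_pos.2 (by linarith)
    have h0 : 0 ≤ (χ c).1 := hcJ i (Finset.mem_insert_self _ _)
    have hJ : (χ c).2 ∈ cornerSet J := fun j hj => by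
      by_cases h : j = i
      · subst h; rw [hχi, hεJ hj, one_mul]; exact hs.le
      · rw [hχj _ j h]; exact hcJ j (Finset.mem_insert_of_mem hj)
    refine ⟨⟨h0, hJ, ?_, hcO, polarMap_mem_cornerSet h0 hJ⟩, ?_⟩
    · have hk : ∑ k ∈ K.erase i, (χ c).2 k ^ 2 = ∑ k ∈ K.erase i, c k ^ 2 :=
        Finset.sum_congr rfl fun k hk => by rw [hχj _ k (Finset.ne_of_mem_erase hk)]
      rw [← Finset.add_sum_erase K _ hiK, hχi, mul_pow, hε, one_mul, Real.sq_sqrt (by linarith), hk]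
      ring
    · change 0 < ε * (χ c).2 i
      rw [hχi, ← mul_assoc, ← pow_two, hε, one_mul]; exact hs
  · rintro a ⟨ha, hp⟩
    exact hχψ a ha.2.2.1 hp

end Polar

/-! ### The blow-up of the zero set of a map, as the closure of a graph -/

section BlowUpGraph

lemma contMDiffOn_normalize {F : Type*} [NormedAddCommGroup F] [InnerProductSpace ℝ F] :
    ContMDiffOn 𝓘(ℝ, F) 𝓘(ℝ, F) ∞ (fun v : F => ‖v‖⁻¹ • v) {v | v ≠ 0} :=
  contMDiffOn_iff_contDiffOn.2 fun v hv =>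
    (((contDiffAt_norm ℝ hv).inv (norm_ne_zero_iff.2 hv)).smul contDiffAt_id).contDiffWithinAt

variable {F : Type} [NormedAddCommGroup F] [InnerProductSpace ℝ F] {m : ℕ}

local notation "⟪" x ", " y "⟫" => inner ℝ x y

/-- The closure of the graph of `f / ‖f‖`. -/
def blowUpGraph (f : M → F) : Set (M × F) := closure {x | f x.1 ≠ 0 ∧ x.2 = ‖f x.1‖⁻¹ • f x.1}

/-- The components of `f` and the coordinates with index in `K` generate the same ideal. -/
structure IsGenChart (c : CornerChart I M m) (K : Finset (Fin m)) (f : M → F)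
    (C A : Fin m → M → F) : Prop where
  smooth_f : ContMDiffOn I 𝓘(ℝ, F) ∞ f c.U
  smooth_C : ∀ i, ContMDiffOn I 𝓘(ℝ, F) ∞ (C i) c.U
  smooth_A : ∀ i, ContMDiffOn I 𝓘(ℝ, F) ∞ (A i) c.U
  coord : ∀ q ∈ c.U, ∀ i ∈ K, c.ψ q i = ⟪C i q, f q⟫
  sum : ∀ q ∈ c.U, f q = ∑ i ∈ K, c.ψ q i • A i q

lemma blowUpGraph_eqOn_inter {f : M → F} {N : Set (M × F)} (hN : IsOpen N) {T : Type*}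
    [TopologicalSpace T] [T2Space T] {g h : M × F → T} (hg : ContinuousOn g (blowUpGraph f ∩ N))
    (hh : ContinuousOn h (blowUpGraph f ∩ N))
    (heq : ∀ x ∈ N, f x.1 ≠ 0 → x.2 = ‖f x.1‖⁻¹ • f x.1 → g x = h x) {x : M × F}
    (hx : x ∈ blowUpGraph f) (hxN : x ∈ N) : g x = h x := by
  have h1 : EqOn g h ({x | f x.1 ≠ 0 ∧ x.2 = ‖f x.1‖⁻¹ • f x.1} ∩ N) := fun y hy =>
    heq y hy.2 hy.1.1 hy.1.2
  exact h1.of_subset_closure (t := blowUpGraph f ∩ N) hg hh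
    (inter_subset_inter_left _ subset_closure) (fun y hy => hN.closure_inter hy) ⟨hx, hxN⟩

lemma blowUpGraph_eqOn {f : M → F} {N : Set (M × F)} (hN : IsOpen N) {T : Type*}
    [TopologicalSpace T] [T2Space T] {g h : M × F → T} (hg : ContinuousOn g N)
    (hh : ContinuousOn h N)
    (heq : ∀ x ∈ N, f x.1 ≠ 0 → x.2 = ‖f x.1‖⁻¹ • f x.1 → g x = h x) {x : M × F}
    (hx : x ∈ blowUpGraph f) (hxN : x ∈ N) : g x = h x :=
  blowUpGraph_eqOn_inter hN (hg.mono inter_subset_right) (hh.mono inter_subset_right) heq hx hxN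

lemma norm_of_mem_blowUpGraph {f : M → F} {x : M × F} (hx : x ∈ blowUpGraph f) : ‖x.2‖ = 1 :=
  blowUpGraph_eqOn isOpen_univ (g := fun x => ‖x.2‖) (h := fun _ => 1) (by fun_prop) (by fun_prop)
    (fun y _ hy hy' => by
      rw [hy', norm_smul, norm_inv, norm_norm, inv_mul_cancel₀ (norm_ne_zero_iff.2 hy)]) hx
    (mem_univ _)

lemma smul_of_mem_blowUpGraph {f : M → F} (hf : Continuous f) {x : M × F}
    (hx : x ∈ blowUpGraph f) : ‖f x.1‖ • x.2 = f x.1 :=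
  blowUpGraph_eqOn isOpen_univ (g := fun x => ‖f x.1‖ • x.2) (h := fun x => f x.1)
    (by fun_prop) (by fun_prop) (fun y _ hy hy' => by
      rw [hy', smul_smul, mul_inv_cancel₀ (norm_ne_zero_iff.2 hy), one_smul]) hx (mem_univ _)

lemma isOpen_dom (c : CornerChart I M m) (F : Type*) [TopologicalSpace F] :
    IsOpen {x : M × F | x.1 ∈ c.U} := c.isOpen_U.preimage continuous_fst

lemma contMDiffOn_χ_polarMap (c : CornerChart I M m) (K : Finset (Fin m)) : ContMDiffOn 𝓘(ℝ, ℝ × 𝓔 m) I ∞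
    (fun a => c.χ (polarMap K a)) (polarSet c.J K (c.O ∩ cornerSet c.J)) :=
  c.smooth_χ.comp (contDiff_polarMap K).contMDiff.contMDiffOn fun _ ha => ha.2.2.2

lemma exists_tendsto_polarSet (c : CornerChart I M m) (K : Finset (Fin m)) {a : ℝ × 𝓔 m}
    (ha : a ∈ polarSet c.J K (c.O ∩ cornerSet c.J)) :
    Tendsto (fun t : ℝ => (a.1 + t, a.2)) (𝓝[>] 0)
      (𝓝[polarSet c.J K (c.O ∩ cornerSet c.J) ∩ {a | 0 < a.1}] a) := by
  have h0 : Continuous fun t : ℝ => (a.1 + t, a.2) := by fun_prop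
  have h1 : Tendsto (fun t : ℝ => (a.1 + t, a.2)) (𝓝[>] 0) (𝓝 a) := by
    have := h0.tendsto 0
    rw [add_zero] at this
    exact this.mono_left nhdsWithin_le_nhds
  refine tendsto_nhdsWithin_iff.2 ⟨h1, ?_⟩
  have h2 := h1.eventually (((contDiff_polarMap K).continuous.continuousAt (x := a)).eventually
    (c.isOpen_O.mem_nhds ha.2.2.2.1))
  filter_upwards [h2, self_mem_nhdsWithin] with t ht (ht0 : 0 < t)
  have h3 : 0 < a.1 + t := add_pos_of_nonneg_of_pos ha.1 ht0
  exact ⟨⟨h3.le, ha.2.1, ha.2.2.1, ht, polarMap_mem_cornerSet h3.le ha.2.1⟩, h3⟩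

namespace IsGenChart

variable {c : CornerChart I M m} {K : Finset (Fin m)} {f : M → F} {C A : Fin m → M → F}

/-- The radial factor of the polar coordinates of a point of the blow-up. -/
def radius (K : Finset (Fin m)) (C : Fin m → M → F) (x : M × F) : ℝ :=
  √(∑ i ∈ K, ⟪C i x.1, x.2⟫ ^ 2)

open Classical in
/-- Polar coordinates on the blow-up. -/
def polarCoord (c : CornerChart I M m) (K : Finset (Fin m)) (C : Fin m → M → F)
    (x : M × F) : ℝ × 𝓔 m :=
  (∑ i ∈ K, c.ψ x.1 i * (⟪C i x.1, x.2⟫ / radius K C x),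
    toLp 2 fun i => if i ∈ K then ⟪C i x.1, x.2⟫ / radius K C x else c.ψ x.1 i)

/-- The direction with given polar coordinates. -/
def polarDir (c : CornerChart I M m) (K : Finset (Fin m)) (A : Fin m → M → F)
    (a : ℝ × 𝓔 m) : F := ∑ i ∈ K, a.2 i • A i (c.χ (polarMap K a))

/-- The inverse of the polar coordinates. -/
def polarInv (c : CornerChart I M m) (K : Finset (Fin m)) (A : Fin m → M → F)
    (a : ℝ × 𝓔 m) : M × F :=
  (c.χ (polarMap K a), ‖polarDir c K A a‖⁻¹ • polarDir c K A a)

variable (h : IsGenChart c K f C A)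
include h

lemma continuousOn_inner (i : Fin m) :
    ContinuousOn (fun x : M × F => ⟪C i x.1, x.2⟫) {x : M × F | x.1 ∈ c.U} :=
  ((h.smooth_C i).continuousOn.comp continuousOn_fst fun _ hx => hx).inner continuousOn_snd

lemma coord_graph {x : M × F} (hx : x ∈ blowUpGraph f) (hxU : x.1 ∈ c.U) {i : Fin m}
    (hi : i ∈ K) : c.ψ x.1 i = ‖f x.1‖ * ⟪C i x.1, x.2⟫ :=
  blowUpGraph_eqOn (isOpen_dom c F) (g := fun x => c.ψ x.1 i)
    (h := fun x => ‖f x.1‖ * ⟪C i x.1, x.2⟫)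
    ((c.smooth_coord i).continuousOn.comp continuousOn_fst fun _ hx => hx)
    (((h.smooth_f.continuousOn.comp continuousOn_fst fun _ hx => hx).norm).mul
      (h.continuousOn_inner i))
    (fun y hy hf hy' => by
      rw [hy', real_inner_smul_right, ← mul_assoc, mul_inv_cancel₀ (norm_ne_zero_iff.2 hf), one_mul]
      exact h.coord _ hy i hi) hx hxU

lemma dir_graph {x : M × F} (hx : x ∈ blowUpGraph f) (hxU : x.1 ∈ c.U) :
    x.2 = ∑ i ∈ K, ⟪C i x.1, x.2⟫ • A i x.1 :=
  blowUpGraph_eqOn (isOpen_dom c F) (g := fun x => x.2)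
    (h := fun x => ∑ i ∈ K, ⟪C i x.1, x.2⟫ • A i x.1) continuousOn_snd
    (continuousOn_finsetSum _ fun i _ => (h.continuousOn_inner i).smul
      ((h.smooth_A i).continuousOn.comp continuousOn_fst fun _ hx => hx))
    (fun y hy hf hy' => by
      have h1 : y.2 = ‖f y.1‖⁻¹ • ∑ i ∈ K, c.ψ y.1 i • A i y.1 := by rw [← h.sum _ hy, hy']
      refine h1.trans ((Finset.smul_sum ..).trans (Finset.sum_congr rfl fun i hi => ?_))
      rw [h.coord _ hy i hi, hy', real_inner_smul_right, smul_smul]) hx hxU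

lemma nonneg_graph {x : M × F} (hx : x ∈ blowUpGraph f) (hxU : x.1 ∈ c.U) {i : Fin m}
    (hi : i ∈ K) (hiJ : i ∈ c.J) : 0 ≤ ⟪C i x.1, x.2⟫ := by
  have := blowUpGraph_eqOn (isOpen_dom c F) (g := fun x => |⟪C i x.1, x.2⟫|)
    (h := fun x => ⟪C i x.1, x.2⟫) (h.continuousOn_inner i).abs (h.continuousOn_inner i)
    (fun y hy hf hy' => by
      refine abs_of_nonneg ?_
      rw [hy', real_inner_smul_right, ← h.coord _ hy i hi]
      exact mul_nonneg (by positivity) ((c.mapsTo_ψ' hy).2 i hiJ)) hx hxU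
  rw [← this]; exact abs_nonneg _

lemma radius_pos {x : M × F} (hx : x ∈ blowUpGraph f) (hxU : x.1 ∈ c.U) : 0 < radius K C x := by
  refine Real.sqrt_pos.2 (lt_of_le_of_ne (Finset.sum_nonneg fun i _ => sq_nonneg _) fun h0 => ?_)
  have h1 := h.dir_graph hx hxU
  rw [Finset.sum_eq_zero fun i hi => by
    rw [pow_eq_zero_iff two_ne_zero |>.1 ((Finset.sum_eq_zero_iff_of_nonneg
      fun i _ => sq_nonneg _).1 h0.symm i hi), zero_smul]] at h1
  have := norm_of_mem_blowUpGraph hx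
  rw [h1, norm_zero] at this
  exact zero_ne_one this

lemma sum_sq_div {x : M × F} (hx : x ∈ blowUpGraph f) (hxU : x.1 ∈ c.U) :
    ∑ i ∈ K, (⟪C i x.1, x.2⟫ / radius K C x) ^ 2 = 1 := by
  have h1 := h.radius_pos hx hxU
  simp only [div_pow, ← Finset.sum_div]
  rw [div_eq_one_iff_eq (pow_pos h1 2).ne']
  exact (Real.sq_sqrt (Finset.sum_nonneg fun i _ => sq_nonneg _)).symm

lemma polarCoord_fst {x : M × F} (hx : x ∈ blowUpGraph f) (hxU : x.1 ∈ c.U) :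
    (polarCoord c K C x).1 = ‖f x.1‖ * radius K C x := by
  have h1 := h.radius_pos hx hxU
  have : (polarCoord c K C x).1 =
      ‖f x.1‖ * radius K C x * ∑ i ∈ K, (⟪C i x.1, x.2⟫ / radius K C x) ^ 2 := by
    rw [Finset.mul_sum]
    refine Finset.sum_congr rfl fun i hi => ?_
    rw [h.coord_graph hx hxU hi]
    field_simp
  rw [this, h.sum_sq_div hx hxU, mul_one]

lemma polarMap_polarCoord {x : M × F} (hx : x ∈ blowUpGraph f) (hxU : x.1 ∈ c.U) :
    polarMap K (polarCoord c K C x) = c.ψ x.1 := by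
  have h1 := h.radius_pos hx hxU
  ext i
  rw [polarMap_apply]
  split_ifs with hi
  · rw [h.polarCoord_fst hx hxU, h.coord_graph hx hxU hi]
    simp only [polarCoord, if_pos hi]
    field_simp
  · simp [polarCoord, hi]

lemma polarCoord_mem {x : M × F} (hx : x ∈ blowUpGraph f) (hxU : x.1 ∈ c.U) :
    polarCoord c K C x ∈ polarSet c.J K (c.O ∩ cornerSet c.J) := by
  have h1 := h.radius_pos hx hxU
  refine ⟨?_, fun j hj => ?_, ?_, ?_⟩
  · rw [h.polarCoord_fst hx hxU]; positivity
  · simp only [polarCoord]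
    split_ifs with hi
    · exact div_nonneg (h.nonneg_graph hx hxU hi hj) h1.le
    · exact (c.mapsTo_ψ' hxU).2 j hj
  · rw [← h.sum_sq_div hx hxU]
    exact Finset.sum_congr rfl fun i hi => by simp [polarCoord, hi]
  · rw [h.polarMap_polarCoord hx hxU]; exact c.mapsTo_ψ' hxU

lemma smul_polarDir {a : ℝ × 𝓔 m} (ha : a ∈ polarSet c.J K (c.O ∩ cornerSet c.J)) :
    f (c.χ (polarMap K a)) = a.1 • polarDir c K A a := by
  rw [h.sum _ (c.mapsTo_χ' ha.2.2.2), polarDir, Finset.smul_sum]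
  refine Finset.sum_congr rfl fun i hi => ?_
  rw [c.right_inv ha.2.2.2, polarMap_apply, if_pos hi, smul_smul]

lemma contMDiffOn_polarDir : ContMDiffOn 𝓘(ℝ, ℝ × 𝓔 m) 𝓘(ℝ, F) ∞
    (polarDir c K A) (polarSet c.J K (c.O ∩ cornerSet c.J)) := by
  refine contMDiffOn_finsetSum fun i _ => ?_
  have h1 : ContDiff ℝ ∞ fun a : ℝ × 𝓔 m => a.2 i := by fun_prop
  exact h1.contMDiff.contMDiffOn.smul
    ((h.smooth_A i).comp (contMDiffOn_χ_polarMap c K) fun a ha => c.mapsTo_χ' ha.2.2.2)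

lemma inner_polarDir {a : ℝ × 𝓔 m}
    (ha : a ∈ polarSet c.J K (c.O ∩ cornerSet c.J)) {i : Fin m} (hi : i ∈ K) :
    ⟪C i (c.χ (polarMap K a)), polarDir c K A a⟫ = a.2 i := by
  have hcont : ContinuousOn (fun a => ⟪C i (c.χ (polarMap K a)), polarDir c K A a⟫)
      (polarSet c.J K (c.O ∩ cornerSet c.J)) :=
    ((h.smooth_C i).comp (contMDiffOn_χ_polarMap c K) fun a ha => c.mapsTo_χ' ha.2.2.2).continuousOn.inner
      h.contMDiffOn_polarDir.continuousOn
  have h1 := ((hcont a ha).mono inter_subset_left).tendsto.comp (exists_tendsto_polarSet c K ha)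
  have h2 : Tendsto (fun _ : ℝ => a.2 i) (𝓝[>] 0) (𝓝 (a.2 i)) := tendsto_const_nhds
  refine tendsto_nhds_unique (h1.congr' ?_) h2
  filter_upwards [(exists_tendsto_polarSet c K ha).eventually self_mem_nhdsWithin] with t ht
  have h3 := h.coord _ (c.mapsTo_χ' ht.1.2.2.2) i hi
  rw [h.smul_polarDir ht.1, c.right_inv ht.1.2.2.2, polarMap_apply, if_pos hi,
    real_inner_smul_right] at h3
  exact (mul_left_cancel₀ ht.2.ne' h3).symm

lemma polarDir_ne_zero {a : ℝ × 𝓔 m}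
    (ha : a ∈ polarSet c.J K (c.O ∩ cornerSet c.J)) : polarDir c K A a ≠ 0 := fun h0 => by
  have h3 := ha.2.2.1
  rw [Finset.sum_eq_zero fun i hi => by
    rw [← h.inner_polarDir ha hi, h0, inner_zero_right]; norm_num] at h3
  exact zero_ne_one h3

lemma contMDiffOn_polarInv : ContMDiffOn 𝓘(ℝ, ℝ × 𝓔 m) (I.prod 𝓘(ℝ, F)) ∞
    (polarInv c K A) (polarSet c.J K (c.O ∩ cornerSet c.J)) := by
  refine (contMDiffOn_χ_polarMap c K).prodMk ?_
  exact contMDiffOn_normalize.comp h.contMDiffOn_polarDir fun a ha =>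
    h.polarDir_ne_zero ha

lemma polarInv_mem {a : ℝ × 𝓔 m}
    (ha : a ∈ polarSet c.J K (c.O ∩ cornerSet c.J)) : polarInv c K A a ∈ blowUpGraph f := by
  have h1 := ((h.contMDiffOn_polarInv.continuousOn a ha).mono inter_subset_left).tendsto.comp
    (exists_tendsto_polarSet c K ha)
  refine mem_closure_of_tendsto h1 ?_
  filter_upwards [(exists_tendsto_polarSet c K ha).eventually self_mem_nhdsWithin] with t ht
  have h2 := h.smul_polarDir ht.1
  have h3 := h.polarDir_ne_zero ht.1
  have h4 : 0 < a.1 + t := ht.2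
  refine ⟨?_, ?_⟩
  · change f (c.χ (polarMap K _)) ≠ 0
    rw [h2]; exact smul_ne_zero h4.ne' h3
  · change ‖polarDir c K A _‖⁻¹ • polarDir c K A _ = ‖f (c.χ (polarMap K _))‖⁻¹ • f (c.χ (polarMap K _))
    rw [h2, norm_smul, Real.norm_of_nonneg h4.le, smul_smul]
    congr 1
    have := norm_ne_zero_iff.2 h3
    field_simp

lemma polarCoord_polarInv {a : ℝ × 𝓔 m}
    (ha : a ∈ polarSet c.J K (c.O ∩ cornerSet c.J)) : polarCoord c K C (polarInv c K A a) = a := by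
  have hn : 0 < ‖polarDir c K A a‖ := norm_pos_iff.2 (h.polarDir_ne_zero ha)
  have h1 : ∀ i ∈ K, ⟪C i (polarInv c K A a).1, (polarInv c K A a).2⟫ =
      ‖polarDir c K A a‖⁻¹ * a.2 i := fun i hi => by
    rw [polarInv, real_inner_smul_right, h.inner_polarDir ha hi]
  have h2 : radius K C (polarInv c K A a) = ‖polarDir c K A a‖⁻¹ := by
    rw [radius, Finset.sum_congr rfl fun i hi => by rw [h1 i hi, mul_pow], ← Finset.mul_sum,
      ha.2.2.1, mul_one, Real.sqrt_sq (inv_nonneg.2 hn.le)]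
  have h3 : ∀ i ∈ K, ⟪C i (polarInv c K A a).1, (polarInv c K A a).2⟫ /
      radius K C (polarInv c K A a) = a.2 i := fun i hi => by
    rw [h1 i hi, h2]; field_simp
  have h4 : c.ψ (polarInv c K A a).1 = polarMap K a := c.right_inv ha.2.2.2
  refine Prod.ext ?_ ?_
  · change ∑ i ∈ K, _ = _
    rw [Finset.sum_congr rfl fun i hi => by
      rw [h3 i hi, h4, polarMap_apply, if_pos hi, mul_assoc, ← pow_two], ← Finset.mul_sum,
      ha.2.2.1, mul_one]
  · ext i
    simp only [polarCoord]
    split_ifs with hi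
    · exact h3 i hi
    · rw [h4, polarMap_apply, if_neg hi]

lemma polarInv_polarCoord {x : M × F} (hx : x ∈ blowUpGraph f) (hxU : x.1 ∈ c.U) :
    polarInv c K A (polarCoord c K C x) = x := by
  have h1 := h.radius_pos hx hxU
  have h2 : c.χ (polarMap K (polarCoord c K C x)) = x.1 := by
    rw [h.polarMap_polarCoord hx hxU, c.left_inv' hxU]
  have h3 : polarDir c K A (polarCoord c K C x) = (radius K C x)⁻¹ • x.2 := by
    conv_rhs => rw [h.dir_graph hx hxU, Finset.smul_sum]
    rw [polarDir]
    refine Finset.sum_congr rfl fun i hi => ?_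
    rw [h2, smul_smul]
    simp only [polarCoord, if_pos hi]
    rw [div_eq_inv_mul]
  refine Prod.ext h2 ?_
  change ‖polarDir c K A _‖⁻¹ • polarDir c K A _ = _
  rw [h3, norm_smul, norm_of_mem_blowUpGraph hx, norm_inv, Real.norm_of_nonneg h1.le, mul_one,
    inv_inv, smul_smul, mul_inv_cancel₀ h1.ne', one_smul]

lemma contMDiffOn_polarCoord : ContMDiffOn (I.prod 𝓘(ℝ, F)) 𝓘(ℝ, ℝ × 𝓔 m) ∞
    (polarCoord c K C) (blowUpGraph f ∩ {x | x.1 ∈ c.U}) := by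
  have hin : ∀ i, ContMDiffOn (I.prod 𝓘(ℝ, F)) 𝓘(ℝ, ℝ) ∞ (fun x : M × F => ⟪C i x.1, x.2⟫)
      (blowUpGraph f ∩ {x | x.1 ∈ c.U}) := fun i => by
    have h1 : ContDiff ℝ ∞ fun v : F × F => ⟪v.1, v.2⟫ := contDiff_inner
    exact h1.contMDiff.comp_contMDiffOn
      (((h.smooth_C i).comp contMDiffOn_fst fun _ hx => hx.2).prodMk_space contMDiffOn_snd)
  have hψ : ∀ i, ContMDiffOn (I.prod 𝓘(ℝ, F)) 𝓘(ℝ, ℝ) ∞ (fun x : M × F => c.ψ x.1 i)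
      (blowUpGraph f ∩ {x | x.1 ∈ c.U}) := fun i =>
    (c.smooth_coord i).comp contMDiffOn_fst fun _ hx => hx.2
  have hrad : ContMDiffOn (I.prod 𝓘(ℝ, F)) 𝓘(ℝ, ℝ) ∞ (radius K C)
      (blowUpGraph f ∩ {x | x.1 ∈ c.U}) := by
    have h1 : ContDiffOn ℝ ∞ Real.sqrt {t | t ≠ 0} := fun t ht =>
      (Real.contDiffAt_sqrt ht).contDiffWithinAt
    refine (contMDiffOn_iff_contDiffOn.2 h1).comp
      (contMDiffOn_finsetSum fun i _ => (hin i).pow 2) fun x hx => ?_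
    exact (Real.sqrt_pos.1 (h.radius_pos hx.1 hx.2)).ne'
  have hw : ∀ i, ContMDiffOn (I.prod 𝓘(ℝ, F)) 𝓘(ℝ, ℝ) ∞
      (fun x : M × F => ⟪C i x.1, x.2⟫ / radius K C x) (blowUpGraph f ∩ {x | x.1 ∈ c.U}) :=
    fun i => (hin i).div₀ hrad fun x hx => (h.radius_pos hx.1 hx.2).ne'
  refine ContMDiffOn.prodMk_space (contMDiffOn_finsetSum fun i _ => (hψ i).mul (hw i)) ?_
  have hlp : ContDiff ℝ ∞ fun g : Fin m → ℝ => (toLp 2 g : 𝓔 m) := by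
    fun_prop
  refine hlp.contMDiff.comp_contMDiffOn (contMDiffOn_pi_space.2 fun i => ?_)
  by_cases hi : i ∈ K
  · simpa only [if_pos hi] using hw i
  · simpa only [if_neg hi] using hψ i

end IsGenChart

end BlowUpGraph

/-! ### Existence and uniqueness of blow-ups -/

section Transport

variable {E₁ H₁ : Type*} [NormedAddCommGroup E₁] [NormedSpace ℝ E₁] [TopologicalSpace H₁]
  {I₁ : ModelWithCorners ℝ E₁ H₁} {P₁ : Type*} [TopologicalSpace P₁] [ChartedSpace H₁ P₁] {m : ℕ}

/-- Transport of coordinates by a diffeomorphism between subsets of manifolds. -/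
lemma EmbChart.exists_transport {W₁ : Set P₁} (c : EmbChart I₁ W₁ m) {W N : Set P} (hN : IsOpen N)
    {Φ : P → P₁} {Ξ : P₁ → P} (hΦ : ContMDiffOn I I₁ ∞ Φ (W ∩ N)) (hΦW : MapsTo Φ (W ∩ N) W₁)
    (hΞ : ContMDiffOn I₁ I ∞ Ξ (W₁ ∩ c.U)) (hΞW : MapsTo Ξ (W₁ ∩ c.U) (W ∩ N))
    (hΞΦ : ∀ x ∈ W ∩ N, Φ x ∈ c.U → Ξ (Φ x) = x) (hΦΞ : LeftInvOn Φ Ξ (W₁ ∩ c.U)) :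
    ∃ c' : EmbChart I W m, (∀ x ∈ W, x ∈ c'.U ↔ x ∈ N ∧ Φ x ∈ c.U) ∧ c'.O = c.O ∧ c'.J = c.J ∧
      c'.ψ = c.ψ ∘ Φ ∧ c'.χ = Ξ ∘ c.χ ∧ c'.U ⊆ N := by
  obtain ⟨u, hu, huV⟩ := continuousOn_iff'.1 hΦ.continuousOn c.U c.isOpen_U
  have hmem : ∀ x ∈ W ∩ N, x ∈ u ↔ Φ x ∈ c.U := fun x hx =>
    ⟨fun h => (huV.symm.subset ⟨h, hx⟩).1, fun h => (huV.subset ⟨h, hx⟩).1⟩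
  have hU : ∀ x ∈ W, x ∈ N ∩ u ↔ x ∈ N ∧ Φ x ∈ c.U := fun x hx =>
    ⟨fun h => ⟨h.1, (hmem x ⟨hx, h.1⟩).1 h.2⟩, fun h => ⟨h.1, (hmem x ⟨hx, h.1⟩).2 h.2⟩⟩
  have hsub : ∀ x ∈ W ∩ (N ∩ u), Φ x ∈ W₁ ∩ c.U := fun x hx =>
    ⟨hΦW ⟨hx.1, hx.2.1⟩, (hmem x ⟨hx.1, hx.2.1⟩).1 hx.2.2⟩
  refine ⟨⟨N ∩ u, c.O, c.J, c.ψ ∘ Φ, Ξ ∘ c.χ, hN.inter hu, c.isOpen_O,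
    c.smooth_ψ.comp (hΦ.mono fun x hx => ⟨hx.1, hx.2.1⟩) hsub,
    hΞ.comp c.smooth_χ c.mapsTo_χ, fun x hx => c.mapsTo_ψ (hsub x hx), fun x hx => ?_,
    fun x hx => ?_, fun x hx => ?_⟩, hU, rfl, rfl, rfl, rfl, inter_subset_left⟩
  · have h1 := hΞW (c.mapsTo_χ hx)
    refine ⟨h1.1, (hU _ h1.1).2 ⟨h1.2, ?_⟩⟩
    have h2 : Φ (Ξ (c.χ x)) = c.χ x := hΦΞ (c.mapsTo_χ hx)
    change Φ (Ξ (c.χ x)) ∈ c.U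
    rw [h2]; exact (c.mapsTo_χ hx).2
  · have h1 := hsub x hx
    simp only [Function.comp_apply, c.left_inv h1]
    exact hΞΦ x ⟨hx.1, hx.2.1⟩ h1.2
  · simp only [Function.comp_apply, hΦΞ (c.mapsTo_χ hx), c.right_inv hx]

end Transport

section Centre

variable {F : Type} [NormedAddCommGroup F] [InnerProductSpace ℝ F] {m : ℕ}

local notation "⟪" x ", " y "⟫" => inner ℝ x y

lemma IsGenChart.eq_zero_iff {c : CornerChart I M m} {K : Finset (Fin m)} {f : M → F}
    {C A : Fin m → M → F} (h : IsGenChart c K f C A) {q : M} (hq : q ∈ c.U) :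
    f q = 0 ↔ ∀ i ∈ K, c.ψ q i = 0 :=
  ⟨fun h0 i hi => by rw [h.coord q hq i hi, h0, inner_zero_right], fun h0 => by
    rw [h.sum q hq]; exact Finset.sum_eq_zero fun i hi => by rw [h0 i hi, zero_smul]⟩

/-- The zero set of `f` is a `p`-submanifold of positive codimension, and the components of `f`
generate its ideal. -/
structure IsCentre (I : ModelWithCorners ℝ E H) (m : ℕ) (S : Set M) (f : M → F) : Prop where
  contMDiff : ContMDiff I 𝓘(ℝ, F) ∞ f
  mem_iff : ∀ q, q ∈ S ↔ f q = 0
  exists_chart : ∀ p ∈ S, ∃ (c : CornerChart I M m) (K : Finset (Fin m)) (C A : Fin m → M → F),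
    p ∈ c.U ∧ K.Nonempty ∧ IsGenChart c K f C A

/-- By Hadamard's lemma, coordinates that generate a submodule of the ideal of `f` with the same
zero set generate this ideal. -/
lemma EmbChart.exists_isGenChart [CompleteSpace F] (c : CornerChart I M m) {K : Finset (Fin m)}
    {f : M → F} {C : Fin m → M → F} {p : M} (hp : p ∈ c.U) (hfp : f p = 0)
    (hf : ContMDiffOn I 𝓘(ℝ, F) ∞ f c.U)
    (hC : ∀ i, ContMDiffOn I 𝓘(ℝ, F) ∞ (C i) c.U)
    (hcoord : ∀ q ∈ c.U, ∀ i ∈ K, c.ψ q i = ⟪C i q, f q⟫)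
    (hzero : ∀ q ∈ c.U, (∀ i ∈ K, c.ψ q i = 0) → f q = 0) :
    ∃ (c' : CornerChart I M m) (A : Fin m → M → F), p ∈ c'.U ∧ c'.U ⊆ c.U ∧ c'.J = c.J ∧
      c'.ψ = c.ψ ∧ c'.χ = c.χ ∧ c'.O ⊆ c.O ∧ IsGenChart c' K f C A := by
  obtain ⟨U', hU', hpU', hU'c, -, A, hA, hsum⟩ := c.exists_eq_sum_smul (S := {q | f q = 0}) (K := K)
    (fun q hq => ⟨fun (h0 : f q = 0) i hi => by rw [hcoord q hq i hi, h0, inner_zero_right],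
      hzero q hq⟩) hfp c.isOpen_U hp hp hf fun _ _ h => h
  obtain ⟨c', h1, h2, h3, h4, h5⟩ := c.exists_restrict hU'
  have h6 : c'.U ⊆ c.U := by rw [h1]; exact inter_subset_left
  have h7 : c'.U ⊆ U' := by rw [h1]; exact inter_subset_right
  refine ⟨c', A, by rw [h1]; exact ⟨hp, hpU'⟩, h6, h2, h3, h4, h5, hf.mono h6,
    fun i => (hC i).mono h6, fun i => (hA i).mono h7, fun q hq i hi => ?_, fun q hq => ?_⟩
  · rw [h3]; exact hcoord q (h6 hq) i hi
  · rw [h3]; exact hsum q (h7 hq)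

namespace IsCentre

variable {S : Set M} {f : M → F} (hf : IsCentre I m S f)
include hf

lemma isClosed : IsClosed S := by
  have : S = f ⁻¹' {0} := Set.ext fun q => hf.mem_iff q
  rw [this]; exact isClosed_singleton.preimage hf.contMDiff.continuous

lemma exists_mem_compl {p : M} {U : Set M} (hU : IsOpen U) (hp : p ∈ U) : ∃ p' ∈ U, p' ∉ S := by
  classical
  by_cases hpS : p ∈ S
  swap
  · exact ⟨p, hp, hpS⟩
  obtain ⟨c, K, C, A, hpc, ⟨i, hi⟩, hg⟩ := hf.exists_chart p hpS
  obtain ⟨c', h1, h2, h3, h4, h5⟩ := c.exists_restrict hU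
  have hpc' : p ∈ c'.U := by rw [h1]; exact ⟨hpc, hp⟩
  have hx := c'.mapsTo_ψ' hpc'
  have hcont : Continuous fun t : ℝ => c'.ψ p + t • single i (1 : ℝ) := by fun_prop
  have hev : ∀ᶠ t : ℝ in 𝓝[>] 0, c'.ψ p + t • single i (1 : ℝ) ∈ c'.O :=
    (hcont.tendsto 0).mono_left nhdsWithin_le_nhds |>.eventually
      (c'.isOpen_O.mem_nhds (by simpa using hx.1))
  obtain ⟨t, ht, ht0 : 0 < t⟩ := (hev.and self_mem_nhdsWithin).exists
  have hy : c'.ψ p + t • single i (1 : ℝ) ∈ c'.O ∩ cornerSet c'.J := by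
    refine ⟨ht, fun j hj => ?_⟩
    have := hx.2 j hj
    by_cases hji : j = i
    · subst hji; simp; linarith
    · simpa [hji] using this
  have hm := c'.mapsTo_χ' hy
  refine ⟨c'.χ _, (h1.subset hm).2, fun hS => ?_⟩
  have h6 := (hg.eq_zero_iff (h1.subset hm).1).1 ((hf.mem_iff _).1 hS) i hi
  have h7 := (hg.eq_zero_iff hpc).1 ((hf.mem_iff _).1 hpS) i hi
  rw [← h3, c'.right_inv hy] at h6
  rw [← h3] at h7
  simp [h7] at h6
  exact ht0.ne' h6

lemma exists_isGenChart [CompleteSpace F] {m' : ℕ} (c : CornerChart I M m') {K : Finset (Fin m')}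
    (hc : ∀ q ∈ c.U, q ∈ S ↔ ∀ i ∈ K, c.ψ q i = 0) {p : M} (hp : p ∈ c.U) (hpS : p ∈ S) :
    ∃ (c' : CornerChart I M m') (C A : Fin m' → M → F), p ∈ c'.U ∧ c'.U ⊆ c.U ∧ c'.J = c.J ∧
      c'.ψ = c.ψ ∧ c'.χ = c.χ ∧ c'.O ⊆ c.O ∧ IsGenChart c' K f C A := by
  classical
  obtain ⟨d, L, C, A, hpd, -, hd⟩ := hf.exists_chart p hpS
  let g : M → EuclideanSpace ℝ (Fin m') := fun q => toLp 2 fun i => if i ∈ K then c.ψ q i else 0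
  have hg : ContMDiffOn I 𝓘(ℝ, EuclideanSpace ℝ (Fin m')) ∞ g c.U := by
    have hlp : ContDiff ℝ ∞ fun g : Fin m' → ℝ => (toLp 2 g : EuclideanSpace ℝ (Fin m')) := by
      fun_prop
    refine hlp.contMDiff.comp_contMDiffOn (contMDiffOn_pi_space.2 fun i => ?_)
    by_cases hi : i ∈ K
    · simpa only [if_pos hi] using c.smooth_coord i
    · simpa only [if_neg hi] using contMDiffOn_const
  obtain ⟨U', hU', hpU', hU'd, hU'c, a, ha, hsum⟩ := d.exists_eq_sum_smul (S := S) (K := L)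
    (fun q hq => (hf.mem_iff q).trans (hd.eq_zero_iff hq)) hpS c.isOpen_U hp hpd hg
    fun q hq hqS => by
      ext i
      by_cases hi : i ∈ K
      · simpa [g, hi] using (hc q hq).1 hqS i hi
      · simp [g, hi]
  obtain ⟨c₁, h1, h2, h3, h4, h5⟩ := c.exists_restrict hU'
  have hp₁ : p ∈ c₁.U := by rw [h1]; exact ⟨hp, hpU'⟩
  have h6 : c₁.U ⊆ c.U := by rw [h1]; exact inter_subset_left
  have h7 : c₁.U ⊆ U' := by rw [h1]; exact inter_subset_right
  obtain ⟨c', A', k1, k2, k3, k4, k5, k6, k7⟩ := c₁.exists_isGenChart (K := K) (f := f)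
    (C := fun k q => ∑ i ∈ L, a i q k • C i q) hp₁ ((hf.mem_iff p).1 hpS)
    hf.contMDiff.contMDiffOn
    (fun k => contMDiffOn_finsetSum fun i _ => by
      have h8 : ContMDiffOn I 𝓘(ℝ, ℝ) ∞ (fun q => a i q k) c₁.U :=
        (coordL k).contMDiff.comp_contMDiffOn ((ha i).mono h7)
      exact h8.smul ((hd.smooth_C i).mono (h7.trans hU'd)))
    (fun q hq k hk => by
      have := congrArg (fun v : EuclideanSpace ℝ (Fin m') => v k) (hsum q (h7 hq))
      simp only [g, if_pos hk] at this
      rw [h3, this, sum_inner]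
      simp only [WithLp.ofLp_sum, Finset.sum_apply, PiLp.smul_apply, smul_eq_mul]
      refine Finset.sum_congr rfl fun i hi => ?_
      rw [hd.coord q (hU'd (h7 hq)) i hi, real_inner_smul_left, mul_comm])
    (fun q hq h0 => (hf.mem_iff q).1 ((hc q (h6 hq)).2 (by rwa [h3] at h0)))
  exact ⟨c', _, A', k1, k2.trans h6, k3.trans h2, k4.trans h3, k5.trans h4, k6.trans h5, k7⟩

lemma exists_embChart (hM : ∀ p : M, ∃ c : CornerChart I M m, p ∈ c.U) (x : M × F)
    (hx : x ∈ blowUpGraph f) : ∃ c : EmbChart (I.prod 𝓘(ℝ, F)) (blowUpGraph f) m, x ∈ c.U := by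
  by_cases h0 : f x.1 = 0
  · obtain ⟨c, K, C, A, hpc, -, hg⟩ := hf.exists_chart x.1 ((hf.mem_iff _).2 h0)
    obtain ⟨d, i, h1, -, -, -, -⟩ := exists_embChart_polarSet c.isOpen_O (hg.polarCoord_mem hx hpc)
    obtain ⟨d', hd', -⟩ := d.exists_transport (W := blowUpGraph f) (isOpen_dom c F)
      (Φ := IsGenChart.polarCoord c K C) (Ξ := IsGenChart.polarInv c K A) hg.contMDiffOn_polarCoord
      (fun y hy => hg.polarCoord_mem hy.1 hy.2) (hg.contMDiffOn_polarInv.mono inter_subset_left)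
      (fun a ha => ⟨hg.polarInv_mem ha.1, c.mapsTo_χ' ha.1.2.2.2⟩)
      (fun y hy _ => hg.polarInv_polarCoord hy.1 hy.2)
      (fun a ha => hg.polarCoord_polarInv ha.1)
    exact ⟨d', (hd' x hx).2 ⟨hpc, h1⟩⟩
  · obtain ⟨c, hc⟩ := hM x.1
    have hN : IsOpen {q | f q ≠ 0} := isOpen_compl_singleton.preimage hf.contMDiff.continuous
    obtain ⟨c', h1, -⟩ := c.exists_restrict hN
    have hsub : c'.U ⊆ {q | f q ≠ 0} := by rw [h1]; exact inter_subset_right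
    obtain ⟨d', hd', -⟩ := c'.exists_transport (W := blowUpGraph f) (isOpen_dom c' F)
      (Φ := Prod.fst) (Ξ := fun q => (q, ‖f q‖⁻¹ • f q)) (I := I.prod 𝓘(ℝ, F)) contMDiffOn_fst
      (fun y hy => mem_univ _)
      (contMDiffOn_id.prodMk (contMDiffOn_normalize.comp hf.contMDiff.contMDiffOn
        fun q hq => hsub hq.2))
      (fun q hq => ⟨subset_closure ⟨hsub hq.2, rfl⟩, hq.2⟩)
      (fun y hy h2 => Prod.ext rfl (by
        rw [← smul_of_mem_blowUpGraph hf.contMDiff.continuous hy.1, norm_smul,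
          norm_of_mem_blowUpGraph hy.1, mul_one, norm_norm, smul_smul,
          inv_mul_cancel₀ (norm_ne_zero_iff.2 (hsub h2)), one_smul]))
      (fun q hq => rfl)
    exact ⟨d', (hd' x hx).2 ⟨h1.symm.subset ⟨hc, h0⟩, h1.symm.subset ⟨hc, h0⟩⟩⟩

omit hf in
lemma snd_eq_of_mem_blowUpGraph (hf : Continuous f) {x : M × F} (hx : x ∈ blowUpGraph f)
    (h0 : f x.1 ≠ 0) : x.2 = ‖f x.1‖⁻¹ • f x.1 := by
  conv_rhs => rw [← smul_of_mem_blowUpGraph hf hx]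
  rw [norm_smul, norm_of_mem_blowUpGraph hx, mul_one, norm_norm, smul_smul,
    inv_mul_cancel₀ (norm_ne_zero_iff.2 h0), one_smul]

lemma isBlowUp {β : M' → M} {α : M' → F} (hι : InitEmb I' (I.prod 𝓘(ℝ, F)) fun q => (β q, α q))
    (hr : range (fun q => (β q, α q)) = blowUpGraph f) : IsBlowUp I I' β S := by
  obtain ⟨χ, hχ, hs⟩ := hι.exists_leftInverse
  have hβ : ContMDiff I' I ∞ β := contMDiff_fst.comp hι.contMDiff
  have hmem : ∀ q, (β q, α q) ∈ blowUpGraph f := fun q => hr.subset ⟨q, rfl⟩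
  have hrinv : ∀ x ∈ blowUpGraph f, (β (χ x), α (χ x)) = x := fun x hx => by
    obtain ⟨q, rfl⟩ := hr.symm.subset hx
    have := hχ q
    simp only at this
    rw [this]
  rw [hr] at hs
  refine ⟨hf.isClosed, hβ, ?_, fun p hp => ?_⟩
  · have hg : ∀ q ∈ Sᶜ, f q ≠ 0 := fun q hq h0 => hq ((hf.mem_iff q).2 h0)
    have hgr : ∀ q ∈ Sᶜ, (q, ‖f q‖⁻¹ • f q) ∈ blowUpGraph f := fun q hq =>
      subset_closure ⟨hg q hq, rfl⟩
    have hβγ : ∀ q ∈ Sᶜ, β (χ (q, ‖f q‖⁻¹ • f q)) = q := fun q hq =>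
      congrArg Prod.fst (hrinv _ (hgr q hq))
    refine ⟨fun q => χ (q, ‖f q‖⁻¹ • f q), ?_, fun q hq => ?_, hβγ, fun q hq => ?_⟩
    · exact hs.comp (contMDiffOn_id.prodMk (contMDiffOn_normalize.comp
        hf.contMDiff.contMDiffOn hg)) hgr
    · rw [mem_preimage, hβγ q hq]; exact hq
    · have h1 := snd_eq_of_mem_blowUpGraph hf.contMDiff.continuous (hmem q) (hg _ hq)
      simp only at h1 ⊢
      rw [← h1]; exact hχ q
  · obtain ⟨c, K, C, A, hpc, -, hg⟩ := hf.exists_chart p hp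
    refine ⟨m, c.J, K, c.U, c.ψ, c.O ∩ cornerSet c.J, hpc,
      c.isAdaptedChart fun q hq => (hf.mem_iff q).trans (hg.eq_zero_iff hq),
      fun q => IsGenChart.polarCoord c K C (β q, α q), ⟨?_, ⟨fun q hq => ?_, ?_, fun a ha => ?_⟩, ?_⟩,
      fun q hq => hg.polarMap_polarCoord (hmem q) hq⟩
    · exact hg.contMDiffOn_polarCoord.comp hι.contMDiff.contMDiffOn fun q hq => ⟨hmem q, hq⟩
    · exact hg.polarCoord_mem (hmem q) hq
    · intro q hq q' hq' he
      refine hι.injective ?_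
      have h1 := hg.polarInv_polarCoord (hmem q) hq
      rw [show IsGenChart.polarCoord c K C (β q, α q) = IsGenChart.polarCoord c K C (β q', α q') from he,
        hg.polarInv_polarCoord (hmem q') hq'] at h1
      exact h1.symm
    · have h1 := hrinv _ (hg.polarInv_mem ha)
      refine ⟨χ (IsGenChart.polarInv c K A a), ?_, ?_⟩
      · have h2 : β (χ (IsGenChart.polarInv c K A a)) = c.χ (polarMap K a) := congrArg Prod.fst h1
        rw [mem_preimage, h2]; exact c.mapsTo_χ' ha.2.2.2
      · simp only [h1]; exact hg.polarCoord_polarInv ha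
    · refine fun q hq => ⟨fun a => χ (IsGenChart.polarInv c K A a), fun q' hq' => ?_, ?_⟩
      · simp only [hg.polarInv_polarCoord (hmem q') hq']; exact hχ q'
      · exact (hs.comp hg.contMDiffOn_polarInv fun a ha => hg.polarInv_mem ha) _
          (hg.polarCoord_mem (hmem q) hq)

lemma exists_local [CompleteSpace F] {β : M' → M} (hβ : IsBlowUp I I' β S) (p : M) :
    ∃ (U : Set M) (a : M' → F) (χ : M × F → M'), IsOpen U ∧ p ∈ U ∧
      ContMDiffOn I' 𝓘(ℝ, F) ∞ a (β ⁻¹' U) ∧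
      ContMDiffOn (I.prod 𝓘(ℝ, F)) I' ∞ χ (blowUpGraph f ∩ {x | x.1 ∈ U}) ∧
      (∀ q ∈ β ⁻¹' U, (β q, a q) ∈ blowUpGraph f ∧ χ (β q, a q) = q) ∧
      ∀ x ∈ blowUpGraph f, x.1 ∈ U → (β (χ x), a (χ x)) = x := by
  obtain ⟨γ, hγ, hγS, hβγ, hγβ⟩ := hβ.diffeo_compl
  by_cases hp : p ∈ S
  · obtain ⟨m', J, K, U, ψ, V, hpU, had, ψ', hψ', hpol⟩ := hβ.polar p hp
    obtain ⟨c, rfl, rfl, rfl, rfl⟩ := had.exists_cornerChart ⟨p, hpU⟩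
    obtain ⟨p', hp'U, hp'S⟩ := hf.exists_mem_compl c.isOpen_U hpU
    obtain ⟨χ, hχ1, hχ2, hχ3, hχ4⟩ := hψ'.exists_inverse
      ⟨γ p', by rw [mem_preimage, hβγ hp'S]; exact hp'U⟩
    obtain ⟨c', C, A, hpc', hsub, hJ, hψ, hχ, hO, hg⟩ := hf.exists_isGenChart c had.mem_iff hpU hp
    have hps : polarSet c'.J K (c'.O ∩ cornerSet c'.J) ⊆ polarSet c.J K (c.O ∩ cornerSet c.J) := by
      rw [hJ]; exact fun a ha => ⟨ha.1, ha.2.1, ha.2.2.1, hO ha.2.2.2.1, ha.2.2.2.2⟩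
    have hmem : ∀ q ∈ β ⁻¹' c'.U, ψ' q ∈ polarSet c'.J K (c'.O ∩ cornerSet c'.J) := fun q hq => by
      have h1 := hψ'.bijOn.mapsTo (hsub hq)
      refine ⟨h1.1, by rw [hJ]; exact h1.2.1, h1.2.2.1, ?_⟩
      rw [hpol q (hsub hq), ← hψ]
      exact c'.mapsTo_ψ' hq
    have hinv : ∀ q ∈ β ⁻¹' c'.U, (β q, (IsGenChart.polarInv c' K A (ψ' q)).2) =
        IsGenChart.polarInv c' K A (ψ' q) := fun q hq => Prod.ext (by
      change β q = c'.χ (polarMap K (ψ' q))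
      rw [hpol q (hsub hq), ← hψ, c'.left_inv' hq]) rfl
    refine ⟨c'.U, fun q => (IsGenChart.polarInv c' K A (ψ' q)).2,
      fun x => χ (IsGenChart.polarCoord c' K C x), c'.isOpen_U, hpc', ?_, ?_, fun q hq => ⟨?_, ?_⟩,
      fun x hx hxU => ?_⟩
    · exact contMDiff_snd.comp_contMDiffOn
        (hg.contMDiffOn_polarInv.comp (hψ'.contMDiffOn.mono (preimage_mono hsub)) hmem)
    · exact hχ4.comp hg.contMDiffOn_polarCoord fun x hx => hps (hg.polarCoord_mem hx.1 hx.2)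
    · rw [hinv q hq]; exact hg.polarInv_mem (hmem q hq)
    · rw [hinv q hq]
      exact (congrArg χ (hg.polarCoord_polarInv (hmem q hq))).trans (hχ1 (hsub hq))
    · have h1 := hps (hg.polarCoord_mem hx hxU)
      have h2 : β (χ (IsGenChart.polarCoord c' K C x)) = x.1 := by
        have h3 := hpol _ (hχ3 h1)
        rw [hχ2 h1, hg.polarMap_polarCoord hx hxU, hψ] at h3
        rw [← c.left_inv' (hsub hxU), h3, c.left_inv' (hχ3 h1)]
      refine Prod.ext h2 ?_
      simp only [hχ2 h1, hg.polarInv_polarCoord hx hxU]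
  · have h0 : ∀ q ∈ Sᶜ, f q ≠ 0 := fun q hq h0 => hq ((hf.mem_iff q).2 h0)
    refine ⟨Sᶜ, fun q => ‖f (β q)‖⁻¹ • f (β q), fun x => γ x.1, hf.isClosed.isOpen_compl, hp, ?_,
      hγ.comp contMDiffOn_fst fun x hx => hx.2, fun q hq => ⟨subset_closure ⟨h0 _ hq, rfl⟩, hγβ hq⟩,
      fun x hx hxS => ?_⟩
    · exact contMDiffOn_normalize.comp (hf.contMDiff.comp hβ.contMDiff).contMDiffOn
        fun q hq => h0 _ hq
    · simp only [hβγ hxS]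
      exact Prod.ext rfl (snd_eq_of_mem_blowUpGraph hf.contMDiff.continuous hx (h0 _ hxS)).symm

/-- A blow-up with centre `f = 0` is the closure of the graph of `f / ‖f‖`. -/
lemma exists_initEmb [CompleteSpace F] {β : M' → M} (hβ : IsBlowUp I I' β S) : ∃ α : M' → F,
    InitEmb I' (I.prod 𝓘(ℝ, F)) (fun q => (β q, α q)) ∧
      range (fun q => (β q, α q)) = blowUpGraph f := by
  choose U a χ hU hpU ha hχ hmem hinv using hf.exists_local hβ
  have huniq : ∀ p p' q, β q ∈ U p → β q ∈ U p' → a p' q = a p q := fun p p' q hq hq' => by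
    have hN : IsOpen {x : M × F | x.1 ∈ U p ∩ U p'} :=
      ((hU p).inter (hU p')).preimage continuous_fst
    have hchi : MapsTo (χ p) (blowUpGraph f ∩ {x | x.1 ∈ U p ∩ U p'}) (β ⁻¹' U p') := fun x hx => by
      have h2 : β (χ p x) = x.1 := congrArg Prod.fst (hinv p x hx.1 hx.2.1)
      rw [mem_preimage, h2]; exact hx.2.2
    have h1 := blowUpGraph_eqOn_inter (f := f) hN (g := fun x => a p' (χ p x)) (h := fun x => x.2)
      ((ha p').continuousOn.comp ((hχ p).continuousOn.mono fun x hx => ⟨hx.1, hx.2.1⟩) hchi)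
      continuousOn_snd (fun x hx h0 hx2 => by
        have hxg : x ∈ blowUpGraph f := subset_closure ⟨h0, hx2⟩
        have h2 := (hmem p' _ (hchi ⟨hxg, hx⟩)).1
        have h3 : β (χ p x) = x.1 := congrArg Prod.fst (hinv p x hxg hx.1)
        rw [h3] at h2
        exact (snd_eq_of_mem_blowUpGraph hf.contMDiff.continuous h2 h0).trans hx2.symm)
      (hmem p q hq).1 (show _ ∈ U p ∩ U p' from ⟨hq, hq'⟩)
    simpa only [(hmem p q hq).2] using h1
  have hα : ∀ p, ∀ q ∈ β ⁻¹' U p, a (β q) q = a p q := fun p q hq => huniq p (β q) q hq (hpU _)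
  have hr : range (fun q => (β q, a (β q) q)) = blowUpGraph f := by
    apply subset_antisymm
    · rintro _ ⟨q, rfl⟩
      exact (hmem (β q) q (hpU _)).1
    · intro x hx
      have h1 := hinv x.1 x hx (hpU _)
      have h2 : β (χ x.1 x) = x.1 := congrArg Prod.fst h1
      have h3 : a (β (χ x.1 x)) (χ x.1 x) = a x.1 (χ x.1 x) := by rw [h2]
      exact ⟨χ x.1 x, (congrArg (Prod.mk (β (χ x.1 x))) h3).trans h1⟩
  refine ⟨fun q => a (β q) q, ⟨fun q => ?_, fun x => χ x.1 x, fun q => (hmem (β q) q (hpU _)).2, ?_⟩,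
    hr⟩
  · have ho : β ⁻¹' U (β q) ∈ 𝓝 q := ((hU _).preimage hβ.contMDiff.continuous).mem_nhds (hpU _)
    refine hβ.contMDiff.contMDiffAt.prodMk ?_
    exact ((ha (β q)).contMDiffAt ho).congr_of_eventuallyEq
      (eventually_of_mem ho fun q' hq' => hα _ _ hq')
  · rw [hr]
    intro x hx
    have ho : {y : M × F | y.1 ∈ U x.1} ∈ 𝓝 x := ((hU _).preimage continuous_fst).mem_nhds (hpU _)
    have h1 : ContMDiffWithinAt (I.prod 𝓘(ℝ, F)) I' ∞ (χ x.1) (blowUpGraph f) x :=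
      (hχ x.1 x ⟨hx, hpU _⟩).mono_of_mem_nhdsWithin
        (inter_mem self_mem_nhdsWithin (mem_nhdsWithin_of_mem_nhds ho))
    refine h1.congr_of_eventuallyEq ?_ rfl
    filter_upwards [self_mem_nhdsWithin, mem_nhdsWithin_of_mem_nhds ho] with y hy hyU
    have h2 := hinv y.1 y hy (hpU _)
    have h3 : β (χ y.1 y) = y.1 := congrArg Prod.fst h2
    have h4 : a y.1 (χ y.1 y) = a x.1 (χ y.1 y) :=
      huniq x.1 y.1 _ (by rw [h3]; exact hyU) (by rw [h3]; exact hpU _)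
    have h5 := (hmem x.1 (χ y.1 y) (by rw [mem_preimage, h3]; exact hyU)).2
    rw [← h4, h2] at h5
    exact h5.symm

end IsCentre

end Centre

/-! ### Coordinates extending given functions -/

lemma exists_completion_functionals {n : ℕ} {Λ : Type*} (B : Finset Λ)
    (d : Λ → 𝓔 n →L[ℝ] ℝ) (hd : LinearIndependent ℝ fun b : B => d b) :
    ∃ (lab : Fin n → Option Λ) (idx : Fin n → Fin n), (∀ b ∈ B, ∃ i, lab i = some b) ∧
      (∀ i b, lab i = some b → b ∈ B) ∧ (∀ i j b, lab i = some b → lab j = some b → i = j) ∧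
      ∀ x : 𝓔 n, (∀ i b, lab i = some b → d b x = 0) →
        (∀ i, lab i = none → x (idx i) = 0) → x = 0 := by
  classical
  let v : B ⊕ Fin n → 𝓔 n →L[ℝ] ℝ := Sum.elim (fun b => d b) fun i => coordL i
  have hs : LinearIndepOn ℝ v (range Sum.inl) := by
    rw [linearIndepOn_range_iff Sum.inl_injective]; exact hd
  obtain ⟨s, -, hs1, hs2, hs3⟩ := exists_linearIndepOn_extension hs (subset_univ _)
  have hker : ∀ x : 𝓔 n, (∀ a ∈ s, v a x = 0) → x = 0 := fun x hx => by
    ext i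
    have h1 : v (Sum.inr i) ∈ Submodule.span ℝ (v '' s) := hs2 ⟨_, mem_univ _, rfl⟩
    have h2 : Submodule.span ℝ (v '' s) ≤
        LinearMap.ker (ContinuousLinearMap.apply ℝ ℝ x : (𝓔 n →L[ℝ] ℝ) →L[ℝ] ℝ).toLinearMap := by
      rw [Submodule.span_le]
      rintro _ ⟨a, ha, rfl⟩
      exact hx a ha
    exact h2 h1
  have htop : Submodule.span ℝ (v '' s) = ⊤ := by
    refine eq_top_iff.2 fun φ _ => ?_
    have : φ = ∑ i, φ (single i 1) • v (Sum.inr i) := by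
      ext x
      have hx : x = ∑ i, x i • single i (1 : ℝ) := by
        ext j; simp [Finset.sum_apply, Pi.single_apply]
      conv_lhs => rw [hx]
      simp [v, mul_comm]
    rw [this]
    exact Submodule.sum_mem _ fun i _ => Submodule.smul_mem _ _ (hs2 ⟨_, mem_univ _, rfl⟩)
  have hfin : Module.finrank ℝ (𝓔 n →L[ℝ] ℝ) = n := by
    rw [← (LinearMap.toContinuousLinearMap (𝕜 := ℝ) (E := 𝓔 n) (F' := ℝ)).finrank_eq]
    exact (Subspace.dual_finrank_eq (K := ℝ) (V := 𝓔 n)).trans (by simp)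
  have hcard : Fintype.card s = n := by
    refine (Module.finrank_eq_card_basis (Module.Basis.mk hs3 ?_)).symm.trans hfin
    rw [← image_eq_range, htop]
  let e : Fin n ≃ s := (Fintype.equivFinOfCardEq hcard).symm
  refine ⟨fun i => (e i).1.elim (fun b => some b.1) fun _ => none,
    fun i => (e i).1.elim (fun _ => i) id, fun b hb => ?_, fun i b h => ?_, fun i j b hi hj => ?_,
    fun x h1 h2 => hker x fun a ha => ?_⟩
  · refine ⟨e.symm ⟨Sum.inl ⟨b, hb⟩, hs1 ⟨_, rfl⟩⟩, ?_⟩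
    simp
  · rcases hei : (e i).1 with b' | j
    · simp only [hei, Sum.elim_inl, Option.some.injEq] at h
      exact h ▸ b'.2
    · simp [hei] at h
  · apply e.injective
    apply Subtype.ext
    rcases hei : (e i).1 with b' | k
    · rcases hej : (e j).1 with b'' | k
      · simp only [hei, hej, Sum.elim_inl, Option.some.injEq] at hi hj
        rw [show b' = b'' from Subtype.ext (hi.trans hj.symm)]
      · simp [hej] at hj
    · simp [hei] at hi
  · rcases a with b | j
    · exact h1 (e.symm ⟨_, ha⟩) b.1 (by simp)
    · have := h2 (e.symm ⟨_, ha⟩) (by simp)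
      have hv : v (Sum.inr j) x = x j := rfl
      rw [hv]; simpa using this

section ExtendingChart

variable {n : ℕ} {X : Type u} [TopologicalSpace X] [ChartedSpace (EuclideanQuadrant n) X]
  [IsManifold (𝓠 n) ∞ X]

lemma isInteriorPoint_iff_coord {p q : X} (hq : q ∈ (chartAt (EuclideanQuadrant n) p).source) :
    q ∈ (𝓠 n).interior X ↔ extChartAt (𝓠 n) p q ∈ interior (cornerSet Finset.univ) := by
  have h1 := ModelWithCorners.isInteriorPoint_iff_of_mem_atlas (I := 𝓠 n) (n := ∞)
    (by simp) (chart_mem_atlas (EuclideanQuadrant n) p) hq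
  obtain ⟨c, hpc, hU, hJ, hψ, hχ, hV⟩ := exists_cornerChart_quadrant (n := n) p
  refine h1.trans ?_
  change extChartAt (𝓠 n) p q ∈ interior (extChartAt (𝓠 n) p).target ↔ _
  rw [← hV, hJ, interior_inter, c.isOpen_O.interior_eq]
  have h2 := c.mapsTo_ψ' (q := q) (by rw [hU]; exact hq)
  rw [hψ] at h2
  exact ⟨fun h => h.2, fun h => ⟨h2.1, h⟩⟩

/-- Functions with independent differentials at `p` are coordinates near `p`, if some of them are
nonnegative and define the boundary. -/
lemma exists_cornerChart_extending {Λ : Type*} (g : Λ → X → ℝ) (B JB : Finset Λ) (hJB : JB ⊆ B)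
    (hg : ∀ b ∈ B, ContMDiff (𝓠 n) 𝓘(ℝ, ℝ) ∞ (g b)) (p : X)
    (hind : LinearIndependent ℝ fun b : B =>
      (differential n (g b) p : 𝓔 n →L[ℝ] ℝ))
    (hnn : ∀ b ∈ JB, ∀ q, 0 ≤ g b q) {N : Set X} (hN : IsOpen N) (hpN : p ∈ N)
    (hbd : ∀ q ∈ N, q ∈ (𝓠 n).interior X ↔ ∀ b ∈ JB, g b q ≠ 0) :
    ∃ (c : CornerChart (𝓠 n) X n) (lab : Fin n → Option Λ), p ∈ c.U ∧ c.U ⊆ N ∧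
      (∀ b ∈ B, ∃ i, lab i = some b) ∧ (∀ i b, lab i = some b → b ∈ B) ∧
      (∀ i j b, lab i = some b → lab j = some b → i = j) ∧
      (∀ i, i ∈ c.J ↔ ∃ b ∈ JB, lab i = some b) ∧
      ∀ i b, lab i = some b → ∀ q ∈ c.U, c.ψ q i = g b q := by
  classical
  obtain ⟨lab, idx, l1, l2, l3, l4⟩ := exists_completion_functionals B
    (fun b => (differential n (g b) p : 𝓔 n →L[ℝ] ℝ)) hind
  obtain ⟨c₀, hpc₀, hU₀, hJ₀, hψ₀, hχ₀, hV₀⟩ := exists_cornerChart_quadrant (n := n) p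
  obtain ⟨c, hU, hJ, hψ, hχ, hO⟩ := c₀.exists_restrict hN
  have hpc : p ∈ c.U := by rw [hU]; exact ⟨hpc₀, hpN⟩
  have hJu : c.J = Finset.univ := hJ.trans hJ₀
  have hUN : c.U ⊆ N := by rw [hU]; exact inter_subset_right
  have hUs : c.U ⊆ (chartAt (EuclideanQuadrant n) p).source := by
    rw [hU, hU₀]; exact inter_subset_left
  have hψe : c.ψ = extChartAt (𝓠 n) p := hψ.trans hψ₀
  have hχe : c.χ = (extChartAt (𝓠 n) p).symm := hχ.trans hχ₀
  let J' : Finset (Fin n) := {i | ∃ b ∈ JB, lab i = some b}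
  have hJ' : ∀ i, i ∈ J' ↔ ∃ b ∈ JB, lab i = some b := fun i => by simp [J']
  let fi : Fin n → 𝓔 n → ℝ := fun i x =>
    (lab i).elim (x (idx i)) fun b => g b (c.χ x)
  have hfi : ∀ i b, lab i = some b → ∀ x, fi i x = g b (c.χ x) := fun i b h x => by simp [fi, h]
  have hfi' : ∀ i, lab i = none → ∀ x, fi i x = x (idx i) := fun i h x => by simp [fi, h]
  let f : 𝓔 n → 𝓔 n := fun x => toLp 2 fun i => fi i x
  have hfs : ContDiffOn ℝ ∞ f (c.O ∩ cornerSet c.J) := by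
    rw [contDiffOn_euclidean]
    intro i
    rcases hl : lab i with _ | b
    · exact ContDiffOn.congr (f := fun x : 𝓔 n => x (idx i)) (by fun_prop) fun x _ => hfi' i hl x
    · refine ContDiffOn.congr (f := g b ∘ c.χ) ?_ fun x _ => hfi i b hl x
      exact contMDiffOn_iff_contDiffOn.1 ((hg b (l2 i b hl)).comp_contMDiffOn c.smooth_χ)
  have hpx := c.mapsTo_ψ' hpc
  have hVr : c.O ∩ cornerSet c.J ⊆ range (𝓠 n) := by
    rw [range_𝓠, hJu]; exact fun x hx i => hx.2 i (Finset.mem_univ i)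
  have hder : ∀ b ∈ B, HasFDerivWithinAt (fun x => g b (c.χ x))
      (differential n (g b) p : 𝓔 n →L[ℝ] ℝ) (c.O ∩ cornerSet c.J) (c.ψ p) := by
    intro b hb
    have h1 := ((hg b hb).mdifferentiableAt (by simp) (x := p)).hasMFDerivAt.2
    rw [hψe, hχe]
    exact h1.mono hVr
  have hinj : Function.Injective (fderivWithin ℝ f (c.O ∩ cornerSet c.J) (c.ψ p)) := by
    have hu : UniqueDiffWithinAt ℝ (c.O ∩ cornerSet c.J) (c.ψ p) :=
      uniqueDiffOn_inter_cornerSet c.isOpen_O _ hpx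
    have hd := (hfs.differentiableOn (by simp) _ hpx).hasFDerivWithinAt
    have hdi : ∀ i, HasFDerivWithinAt (fi i)
        ((coordL i).comp (fderivWithin ℝ f (c.O ∩ cornerSet c.J) (c.ψ p)))
        (c.O ∩ cornerSet c.J) (c.ψ p) := fun i =>
      (coordL i).hasFDerivAt.comp_hasFDerivWithinAt _ hd
    refine (injective_iff_map_eq_zero _).2 fun x hx => l4 x (fun i b hl => ?_) fun i hl => ?_
    · have h1 := hdi i
      rw [show fi i = fun x => g b (c.χ x) from funext (hfi i b hl)] at h1
      rw [hu.eq (hder b (l2 i b hl)) h1]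
      simp [hx]
    · have h1 := hdi i
      rw [show fi i = fun x => x (idx i) from funext (hfi' i hl)] at h1
      have h2 : HasFDerivWithinAt (fun x : 𝓔 n => x (idx i)) (coordL (idx i)) (c.O ∩ cornerSet c.J)
        (c.ψ p) := (coordL (idx i)).hasFDerivWithinAt
      have h3 := congrArg (fun φ : 𝓔 n →L[ℝ] ℝ => φ x) (hu.eq h2 h1)
      simpa [hx] using h3
  have hmaps : MapsTo f (c.O ∩ cornerSet c.J) (cornerSet J') := fun x _ i hi => by
    obtain ⟨b, hb, hl⟩ := (hJ' i).1 hi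
    change 0 ≤ fi i x
    rw [hfi i b hl]; exact hnn b hb _
  have hint : ∀ x ∈ c.O ∩ cornerSet c.J,
      x ∈ interior (cornerSet c.J) ↔ f x ∈ interior (cornerSet J') := by
    intro x hx
    have hm := c.mapsTo_χ' hx
    have h1 := isInteriorPoint_iff_coord (hUs hm)
    have h2 : extChartAt (𝓠 n) p (c.χ x) = x := by rw [← hψe, c.right_inv hx]
    rw [h2, ← hJu] at h1
    rw [← h1, hbd _ (hUN hm), interior_cornerSet]
    constructor
    · intro h i hi
      obtain ⟨b, hb, hl⟩ := (hJ' i).1 hi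
      change 0 < fi i x
      rw [hfi i b hl]; exact lt_of_le_of_ne (hnn b hb _) (h b hb).symm
    · intro h b hb
      obtain ⟨i, hl⟩ := l1 b (hJB hb)
      have := h i ((hJ' i).2 ⟨b, hb, hl⟩)
      change 0 < fi i x at this
      rw [hfi i b hl] at this
      exact this.ne'
  obtain ⟨O₁, O₂, γ, k1, k2, k3, k4, k5, k6, k7, k8, k9⟩ :=
    exists_cornerSet_inverse c.isOpen_O hfs hpx hmaps hint hinj
  have hsub : O₁ ∩ cornerSet c.J ⊆ c.O ∩ cornerSet c.J := inter_subset_inter_left _ k3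
  refine ⟨⟨c.U ∩ c.ψ ⁻¹' O₁, O₂, J', f ∘ c.ψ, c.χ ∘ γ,
    c.smooth_ψ'.continuousOn.isOpen_inter_preimage c.isOpen_U k1, k4,
    (contMDiffOn_iff_contDiffOn.2 hfs).comp (c.smooth_ψ'.mono fun q hq => hq.2.1) fun q hq =>
      c.mapsTo_ψ' hq.2.1,
    c.smooth_χ.comp (contMDiffOn_iff_contDiffOn.2 k9) fun x hx => hsub (k6 hx),
    fun q hq => k5 ⟨hq.2.2, (c.mapsTo_ψ' hq.2.1).2⟩, fun x hx => ⟨mem_univ _, ?_, ?_⟩,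
    fun q hq => ?_, fun x hx => ?_⟩, lab, ⟨hpc, k2⟩, inter_subset_left.trans hUN, l1, l2, l3, hJ',
    fun i b hl q hq => ?_⟩
  · exact c.mapsTo_χ' (hsub (k6 hx))
  · change c.ψ (c.χ (γ x)) ∈ O₁
    rw [c.right_inv (hsub (k6 hx))]; exact (k6 hx).1
  · change c.χ (γ (f (c.ψ q))) = q
    rw [k7 ⟨hq.2.2, (c.mapsTo_ψ' hq.2.1).2⟩, c.left_inv' hq.2.1]
  · change f (c.ψ (c.χ (γ x))) = x
    rw [c.right_inv (hsub (k6 hx)), k8 hx]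
  · change fi i (c.ψ q) = g b q
    rw [hfi i b hl, c.left_inv' hq.1]

end ExtendingChart

/-! ### Coordinates adapted to a fibered boundary -/

lemma exists_isOpen_injOn {k : ℕ} {J : Finset (Fin k)} {O : Set (𝓔 k)}
    (hO : IsOpen O) {F : Type*} [NormedAddCommGroup F] [NormedSpace ℝ F]
    {f : 𝓔 k → F} (hf : ContDiffOn ℝ ∞ f (O ∩ cornerSet J))
    {p : 𝓔 k} (hp : p ∈ O ∩ cornerSet J)
    (hinj : Function.Injective (fderivWithin ℝ f (O ∩ cornerSet J) p)) :
    ∃ O', IsOpen O' ∧ p ∈ O' ∧ O' ⊆ O ∧ InjOn f (O' ∩ cornerSet J) := by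
  set V := O ∩ cornerSet J with hV
  have hVu : UniqueDiffOn ℝ V := uniqueDiffOn_inter_cornerSet hO
  obtain ⟨K, hK, hanti⟩ := LinearMap.exists_antilipschitzWith
    (fderivWithin ℝ f V p).toLinearMap (LinearMap.ker_eq_bot.2 hinj)
  have hder : ContinuousOn (fderivWithin ℝ f V) V := hf.continuousOn_fderivWithin hVu (by simp)
  have hK' : 0 < (2 * (K : ℝ))⁻¹ := by positivity
  have ev1 : ∀ᶠ x in 𝓝[V] p, ‖fderivWithin ℝ f V x - fderivWithin ℝ f V p‖ < (2 * (K : ℝ))⁻¹ := by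
    have := hder p hp
    rw [ContinuousWithinAt, Metric.tendsto_nhds] at this
    simpa [dist_eq_norm] using this _ hK'
  obtain ⟨δ, hδ, hball⟩ := Metric.mem_nhdsWithin_iff.1 ev1
  obtain ⟨δ', hδ', hball'⟩ := Metric.isOpen_iff.1 hO p hp.1
  have hDO : Metric.ball p (min δ δ') ⊆ O :=
    (Metric.ball_subset_ball (min_le_right _ _)).trans hball'
  have hDV : Metric.ball p (min δ δ') ∩ cornerSet J ⊆ V := inter_subset_inter_left _ hDO
  refine ⟨_, Metric.isOpen_ball, Metric.mem_ball_self (lt_min hδ hδ'), hDO, fun x hx y hy hxy => ?_⟩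
  have h1 := Convex.norm_image_sub_le_of_norm_hasFDerivWithin_le' (f := f)
    (s := Metric.ball p (min δ δ') ∩ cornerSet J) (φ := fderivWithin ℝ f V p)
    (f' := fderivWithin ℝ f V) (C := (2 * (K : ℝ))⁻¹) (fun z hz =>
      (hf.differentiableOn (by simp) z (hDV hz)).hasFDerivWithinAt.mono hDV)
    (fun z hz => le_of_lt (hball ⟨Metric.ball_subset_ball (min_le_left _ _) hz.1, hDV hz⟩)) ((convex_ball _ _).inter convex_cornerSet) hy hx
  rw [hxy, sub_self, zero_sub, norm_neg] at h1
  have h2 := hanti.le_mul_dist x y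
  simp only [dist_eq_norm, ← map_sub] at h2
  by_contra hne
  have h3 : 0 < ‖x - y‖ := norm_pos_iff.2 (sub_ne_zero.2 hne)
  have h4 : ‖(fderivWithin ℝ f V p) (x - y)‖ ≤ (2 * (K : ℝ))⁻¹ * ‖x - y‖ := h1
  have h5 : ‖x - y‖ ≤ K * ((2 * (K : ℝ))⁻¹ * ‖x - y‖) := h2.trans (mul_le_mul_of_nonneg_left h4 K.2)
  have hKp : (0 : ℝ) < K := hK
  have h6 : (K : ℝ) * ((2 * (K : ℝ))⁻¹ * ‖x - y‖) = ‖x - y‖ / 2 := by field_simp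
  linarith

lemma exists_isOpen_injOn_manifold {k : ℕ} {Y : Type*} [TopologicalSpace Y]
    [ChartedSpace (EuclideanQuadrant k) Y] [IsManifold (𝓠 k) ∞ Y] {U : Set Y}
    (hU : IsOpen U) {y : Y} (hy : y ∈ U) {ι : Type*} [Finite ι] {g : ι → Y → ℝ}
    (hg : ∀ i, ContMDiffOn (𝓠 k) 𝓘(ℝ, ℝ) ∞ (g i) U)
    (hinj : ∀ v : 𝓔 k, (∀ i, (differential k (g i) y : 𝓔 k →L[ℝ] ℝ) v = 0) → v = 0) :
    ∃ U', IsOpen U' ∧ y ∈ U' ∧ U' ⊆ U ∧ ∀ u ∈ U', ∀ u' ∈ U', (∀ i, g i u = g i u') → u = u' := by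
  have := Fintype.ofFinite ι
  obtain ⟨c₀, hyc₀, hU₀, hJ₀, hψ₀, hχ₀, hV₀⟩ := exists_cornerChart_quadrant (n := k) y
  obtain ⟨c, hcU, hJ, hψ, hχ, hO⟩ := c₀.exists_restrict hU
  have hyc : y ∈ c.U := by rw [hcU]; exact ⟨hyc₀, hy⟩
  have hUU : c.U ⊆ U := by rw [hcU]; exact inter_subset_right
  have hψe : c.ψ = extChartAt (𝓠 k) y := hψ.trans hψ₀
  have hχe : c.χ = (extChartAt (𝓠 k) y).symm := hχ.trans hχ₀
  have hyx := c.mapsTo_ψ' hyc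
  have hVr : c.O ∩ cornerSet c.J ⊆ range (𝓠 k) := by
    rw [range_𝓠, hJ, hJ₀]; exact fun x hx i => hx.2 i (Finset.mem_univ i)
  have hfs : ContDiffOn ℝ ∞ (fun x i => g i (c.χ x)) (c.O ∩ cornerSet c.J) := by
    refine contDiffOn_pi.2 fun i => ?_
    exact contMDiffOn_iff_contDiffOn.1 ((hg i).comp c.smooth_χ fun x hx => hUU (c.mapsTo_χ' hx))
  have hu : UniqueDiffWithinAt ℝ (c.O ∩ cornerSet c.J) (c.ψ y) :=
    uniqueDiffOn_inter_cornerSet c.isOpen_O _ hyx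
  obtain ⟨O', hO', hyO', hO'O, hinjO⟩ := exists_isOpen_injOn c.isOpen_O hfs hyx (by
    refine (injective_iff_map_eq_zero _).2 fun v hv => hinj v fun i => ?_
    have h1 := (((hg i).contMDiffAt (hU.mem_nhds hy)).mdifferentiableAt (by simp)).hasMFDerivAt.2
    have h2 : HasFDerivWithinAt (fun x => g i (c.χ x))
        (differential k (g i) y : 𝓔 k →L[ℝ] ℝ) (c.O ∩ cornerSet c.J) (c.ψ y) := by
      rw [hψe, hχe]; exact h1.mono hVr
    have h3 := hasFDerivWithinAt_pi'.1 (hfs.differentiableOn (by simp) _ hyx).hasFDerivWithinAt i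
    rw [hu.eq h2 h3]
    exact congrFun hv i)
  refine ⟨c.U ∩ c.ψ ⁻¹' O', c.smooth_ψ'.continuousOn.isOpen_inter_preimage c.isOpen_U hO',
    ⟨hyc, hyO'⟩, inter_subset_left.trans hUU, fun u hu u' hu' h => ?_⟩
  rw [← c.left_inv' hu.1, ← c.left_inv' hu'.1]
  refine congrArg c.χ (hinjO ⟨hu.2, (c.mapsTo_ψ' hu.1).2⟩ ⟨hu'.2, (c.mapsTo_ψ' hu'.1).2⟩ ?_)
  funext i
  simp only [c.left_inv' hu.1, c.left_inv' hu'.1, h i]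

section Fibered

variable {n k l : ℕ} {X : Type u} {Y : Type v} {Z : Type w}
  [TopologicalSpace X] [ChartedSpace (EuclideanQuadrant n) X]
  [TopologicalSpace Y] [ChartedSpace (EuclideanQuadrant k) Y]
  [TopologicalSpace Z] [ChartedSpace (𝓔 l) Z]
  {S : FiberedBoundary (n := n) (k := k) (l := l) X Y Z}

namespace FiberedBoundary

variable (S)

/-- The boundary defining functions, together with further functions. -/
def gen {ι : Type*} (h : ι → X → ℝ) : Option (Option ι) → X → ℝ
  | none => S.x₀
  | some none => S.x₁
  | some (some j) => h j

lemma mem_interior_iff (p : X) : p ∈ (𝓠 n).interior X ↔ S.x₀ p ≠ 0 ∧ S.x₁ p ≠ 0 := by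
  rw [← (𝓠 n).compl_boundary, S.boundary_eq]
  simp

/-- The index set of the boundary coordinates at `p`. -/
def IsBdLabel {ι : Type*} (p : X) (a : Option (Option ι)) : Prop :=
  (a = none ∧ S.x₀ p = 0) ∨ (a = some none ∧ S.x₁ p = 0)

variable [IsManifold (𝓠 n) ∞ X]

lemma exists_cornerChart_gen {ι : Type*} {h : ι → X → ℝ}
    (hh : ∀ i, ContMDiff (𝓠 n) 𝓘(ℝ, ℝ) ∞ (h i)) (p : X)
    (B : Finset (Option (Option ι))) (hB : ∀ a, S.IsBdLabel p a → a ∈ B)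
    (hind : LinearIndependent ℝ fun b : B =>
      (differential n (S.gen h b) p : 𝓔 n →L[ℝ] ℝ))
    {N : Set X} (hN : IsOpen N) (hpN : p ∈ N) :
    ∃ (c : CornerChart (𝓠 n) X n) (lab : Fin n → Option (Option (Option ι))), p ∈ c.U ∧ c.U ⊆ N ∧
      (∀ b ∈ B, ∃ i, lab i = some b) ∧ (∀ i b, lab i = some b → b ∈ B) ∧
      (∀ i j b, lab i = some b → lab j = some b → i = j) ∧
      (∀ i, i ∈ c.J ↔ ∃ b, S.IsBdLabel p b ∧ lab i = some b) ∧
      (∀ i b, lab i = some b → ∀ q ∈ c.U, c.ψ q i = S.gen h b q) ∧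
      (S.x₀ p ≠ 0 → ∀ q ∈ c.U, S.x₀ q ≠ 0) ∧ (S.x₁ p ≠ 0 → ∀ q ∈ c.U, S.x₁ q ≠ 0) := by
  classical
  have hg : ∀ a, ContMDiff (𝓠 n) 𝓘(ℝ, ℝ) ∞ (S.gen h a) := by
    rintro (_ | _ | j)
    exacts [S.contMDiff_x₀, S.contMDiff_x₁, hh j]
  let N' : Set X := N ∩ ({q | S.x₀ p ≠ 0 → S.x₀ q ≠ 0} ∩ {q | S.x₁ p ≠ 0 → S.x₁ q ≠ 0})
  have hop : ∀ g : X → ℝ, Continuous g → IsOpen {q | g p ≠ 0 → g q ≠ 0} := fun g hg => by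
    by_cases h0 : g p = 0
    · simp [h0]
    · simp only [ne_eq, h0, not_false_eq_true, forall_const]
      exact isOpen_compl_singleton.preimage hg
  have hN' : IsOpen N' := hN.inter ((hop _ S.contMDiff_x₀.continuous).inter
    (hop _ S.contMDiff_x₁.continuous))
  obtain ⟨c, lab, h1, h2, h3, h4, h5, h6, h7⟩ := exists_cornerChart_extending (S.gen h) B
    (B.filter (S.IsBdLabel p)) (Finset.filter_subset _ _) (fun a _ => hg a) p hind
    (fun a ha q => by
      rcases (Finset.mem_filter.1 ha).2 with ⟨rfl, -⟩ | ⟨rfl, -⟩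
      exacts [S.x₀_nonneg q, S.x₁_nonneg q]) hN' ⟨hpN, fun h => h, fun h => h⟩ (fun q hq => by
      rw [S.mem_interior_iff]
      constructor
      · rintro ⟨h0, h1⟩ a ha
        rcases (Finset.mem_filter.1 ha).2 with ⟨rfl, -⟩ | ⟨rfl, -⟩
        exacts [h0, h1]
      · intro H
        refine ⟨fun h0 => ?_, fun h0 => ?_⟩
        · have hp0 : S.x₀ p = 0 := by by_contra hp; exact hq.2.1 hp h0
          have hb : S.IsBdLabel p (none : Option (Option ι)) := Or.inl ⟨rfl, hp0⟩
          exact H none (Finset.mem_filter.2 ⟨hB _ hb, hb⟩) h0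
        · have hp0 : S.x₁ p = 0 := by by_contra hp; exact hq.2.2 hp h0
          have hb : S.IsBdLabel p (some none : Option (Option ι)) := Or.inr ⟨rfl, hp0⟩
          exact H (some none) (Finset.mem_filter.2 ⟨hB _ hb, hb⟩) h0)
  refine ⟨c, lab, h1, fun q hq => (h2 hq).1, h3, h4, h5, fun i => (h6 i).trans ?_, h7,
    fun hp q hq => (h2 hq).2.1 hp, fun hp q hq => (h2 hq).2.2 hp⟩
  exact ⟨fun ⟨b, hb, hl⟩ => ⟨b, (Finset.mem_filter.1 hb).2, hl⟩, fun ⟨b, hb, hl⟩ =>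
    ⟨b, Finset.mem_filter.2 ⟨hB b hb, hb⟩, hl⟩⟩

lemma exists_cornerChart_bd (p : X) {N : Set X} (hN : IsOpen N) (hpN : p ∈ N) :
    ∃ (c : CornerChart (𝓠 n) X n) (lab : Fin n → Option (Option (Option Empty))),
      p ∈ c.U ∧ c.U ⊆ N ∧
      (∀ b, S.IsBdLabel p b → ∃ i, lab i = some b) ∧ (∀ i b, lab i = some b → S.IsBdLabel p b) ∧
      (∀ i j b, lab i = some b → lab j = some b → i = j) ∧
      (∀ i, i ∈ c.J ↔ ∃ b, S.IsBdLabel p b ∧ lab i = some b) ∧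
      (∀ i b, lab i = some b → ∀ q ∈ c.U, c.ψ q i = S.gen Empty.elim b q) ∧
      (S.x₀ p ≠ 0 → ∀ q ∈ c.U, S.x₀ q ≠ 0) ∧ (S.x₁ p ≠ 0 → ∀ q ∈ c.U, S.x₁ q ≠ 0) := by
  classical
  obtain ⟨c, lab, h1, h2, h3, h4, h5, h6, h7, h8⟩ := S.exists_cornerChart_gen (h := Empty.elim)
    (fun i => i.elim) p (Finset.univ.filter (S.IsBdLabel p)) (fun a ha => by simpa using ha) (by
      refine linearIndepOn_finset_iff (v := fun a =>
        (differential n (S.gen Empty.elim a) p : 𝓔 n →L[ℝ] ℝ)).2 fun c hc => ?_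
      simp only [Finset.sum_filter, Fintype.sum_option, Finset.univ_eq_empty, Finset.sum_empty,
        IsBdLabel, true_and, reduceCtorEq, false_and, or_false, false_or, add_zero,
        Option.some.injEq] at hc
      have hx₀ : S.x₀ p = 0 → (differential n S.x₀ p : 𝓔 n →L[ℝ] ℝ) ≠ 0 := S.d_x₀_ne p
      have hx₁ : S.x₁ p = 0 → (differential n S.x₁ p : 𝓔 n →L[ℝ] ℝ) ≠ 0 := S.d_x₁_ne p
      have hpair := fun h0 h1 => LinearIndependent.pair_iff.1 (S.independent p h0 h1)
      have key : (S.x₀ p = 0 → c none = 0) ∧ (S.x₁ p = 0 → c (some none) = 0) := by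
        by_cases h0 : S.x₀ p = 0 <;> by_cases h1 : S.x₁ p = 0
        · rw [if_pos h0, if_pos h1] at hc
          have := hpair h0 h1 _ _ hc
          exact ⟨fun _ => this.1, fun _ => this.2⟩
        · rw [if_pos h0, if_neg h1, add_zero] at hc
          exact ⟨fun _ => (smul_eq_zero.1 hc).resolve_right (hx₀ h0), fun h => absurd h h1⟩
        · rw [if_neg h0, if_pos h1, zero_add] at hc
          exact ⟨fun h => absurd h h0, fun _ => (smul_eq_zero.1 hc).resolve_right (hx₁ h1)⟩
        · exact ⟨fun h => absurd h h0, fun h => absurd h h1⟩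
      intro a ha
      rcases (Finset.mem_filter.1 ha).2 with ⟨rfl, h0⟩ | ⟨rfl, h1⟩
      exacts [key.1 h0, key.2 h1]) hN hpN
  exact ⟨c, lab, h1, h2, fun b hb => h3 b (by simpa using hb), fun i b hl => by
    simpa using h4 i b hl, h5, h6, h7, h8⟩

end FiberedBoundary

namespace FiberedBoundary

variable (S)

lemma exists_section {p : X} (hp : S.x₀ p = 0) : ∃ (U : Set Y) (s : Y → X), IsOpen U ∧ S.φ p ∈ U ∧
    ContMDiffOn (𝓠 k) (𝓠 n) ∞ s U ∧
    (∀ u ∈ U, S.x₀ (s u) = 0 ∧ S.φ (s u) = u) ∧ s (S.φ p) = p := by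
  obtain ⟨U, τ, hU, hy, hτ, h1, h2⟩ := S.locally_trivial (S.φ p)
  obtain ⟨ρ, -, h3, -⟩ := h2 p hp hy
  exact ⟨U, fun u => τ (u, ρ p), hU, hy, hτ.comp (contMDiffOn_id.prodMk contMDiffOn_const)
    fun u hu => ⟨hu, mem_univ _⟩, fun u hu => h1 u hu _, h3 p hp hy⟩

variable [IsManifold (𝓠 n) ∞ X]

lemma differential_x₁_section_ne {p : X} (hp : S.x₀ p = 0) (hp₁ : S.x₁ p = 0) {U : Set Y}
    {s : Y → X} (hU : IsOpen U) (hy : S.φ p ∈ U)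
    (hs : ContMDiffOn (𝓠 k) (𝓠 n) ∞ s U)
    (hsU : ∀ u ∈ U, S.x₀ (s u) = 0 ∧ S.φ (s u) = u) :
    (differential k (fun u => S.x₁ (s u)) (S.φ p) : 𝓔 k →L[ℝ] ℝ) ≠ 0 := by
  intro h0
  obtain ⟨c, lab, h1, -, h3, h4, h5, h6, h7, -, -⟩ := S.exists_cornerChart_bd p isOpen_univ
    (mem_univ p)
  obtain ⟨i₀, hi₀⟩ := h3 none (Or.inl ⟨rfl, hp⟩)
  obtain ⟨i₁, hi₁⟩ := h3 (some none) (Or.inr ⟨rfl, hp₁⟩)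
  have hne : i₀ ≠ i₁ := fun h => by rw [h, hi₁] at hi₀; cases hi₀
  let ℓ : ℝ → 𝓔 n := fun t => c.ψ p + t • single i₁ (1 : ℝ)
  have hℓ : ContDiff ℝ ∞ ℓ := by fun_prop
  have hℓ0 : ℓ 0 = c.ψ p := by simp [ℓ]
  let T : Set ℝ := Ici 0 ∩ ℓ ⁻¹' c.O
  have hTV : MapsTo ℓ T (c.O ∩ cornerSet c.J) := fun t ht => ⟨ht.2, fun j hj => by
    have h8 := (c.mapsTo_ψ' h1).2 j hj
    have ht0 : 0 ≤ t := ht.1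
    by_cases hji : j = i₁
    · subst hji; simp [ℓ]; linarith
    · simpa [ℓ, hji] using h8⟩
  have h0T : (0 : ℝ) ∈ T := ⟨self_mem_Ici, by rw [mem_preimage, hℓ0]; exact (c.mapsTo_ψ' h1).1⟩
  have hx₀ : ∀ t ∈ T, S.x₀ (c.χ (ℓ t)) = 0 := fun t ht => by
    have h8 := h7 i₀ none hi₀ _ (c.mapsTo_χ' (hTV ht))
    have h9 := h7 i₀ none hi₀ p h1
    rw [c.right_inv (hTV ht)] at h8
    have h8 : ℓ t i₀ = S.x₀ (c.χ (ℓ t)) := h8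
    have h9 : c.ψ p i₀ = S.x₀ p := h9
    rw [← h8, ← hp, ← h9]
    simp [ℓ, hne]
  have hx₁ : ∀ t ∈ T, S.x₁ (c.χ (ℓ t)) = t := fun t ht => by
    have h8 := h7 i₁ _ hi₁ _ (c.mapsTo_χ' (hTV ht))
    have h9 := h7 i₁ _ hi₁ p h1
    rw [c.right_inv (hTV ht)] at h8
    have h8 : ℓ t i₁ = S.x₁ (c.χ (ℓ t)) := h8
    have h9 : c.ψ p i₁ = S.x₁ p := h9
    rw [← h8]
    simp [ℓ, h9, hp₁]
  have hγ : ContMDiffOn 𝓘(ℝ, ℝ) (𝓠 k) ∞ (fun t => S.φ (c.χ (ℓ t))) T :=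
    S.contMDiffOn_φ.comp (c.smooth_χ.comp hℓ.contMDiff.contMDiffOn hTV) hx₀
  have hγ0 : S.φ (c.χ (ℓ 0)) = S.φ p := by rw [hℓ0, c.left_inv' h1]
  have hd1 := (hγ 0 h0T).mdifferentiableWithinAt (by simp) |>.hasMFDerivWithinAt
  have hd2 := ((S.contMDiff_x₁.comp_contMDiffOn hs).contMDiffAt (hU.mem_nhds hy)).mdifferentiableAt
    (by simp) |>.hasMFDerivAt
  have hd2' : HasMFDerivAt (𝓠 k) 𝓘(ℝ, ℝ) (S.x₁ ∘ s) (S.φ (c.χ (ℓ 0))) (0 : 𝓔 k →L[ℝ] ℝ) := by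
    rw [hγ0]
    rw [show mfderiv (𝓠 k) 𝓘(ℝ, ℝ) (S.x₁ ∘ s) (S.φ p) = 0 from h0] at hd2
    exact hd2
  have hd3 := HasMFDerivAt.comp_hasMFDerivWithinAt (0 : ℝ) hd2' hd1
  have hd4 : HasFDerivWithinAt (fun t : ℝ => S.x₁ (s (S.φ (c.χ (ℓ t))))) (0 : ℝ →L[ℝ] ℝ) T 0 := by
    have := hd3.hasFDerivWithinAt
    refine this.congr_fderiv ?_
    exact ContinuousLinearMap.zero_comp _
  have hTn : T ∈ 𝓝[≥] (0 : ℝ) := inter_mem self_mem_nhdsWithin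
    (mem_nhdsWithin_of_mem_nhds ((c.isOpen_O.preimage hℓ.continuous).mem_nhds h0T.2))
  have hd5 := hd4.mono_of_mem_nhdsWithin hTn
  have hev : (fun t : ℝ => S.x₁ (s (S.φ (c.χ (ℓ t))))) =ᶠ[𝓝[≥] 0] fun t => t := by
    have hcont := (hγ.continuousOn 0 h0T).mono_of_mem_nhdsWithin hTn
    have hUn := hcont.eventually (hU.mem_nhds (by simpa only [hγ0] using hy))
    filter_upwards [hTn, hUn] with t ht htU
    rw [← hx₁ t ht]
    have h10 := hsU _ htU
    rw [hx₁ t ht, S.x₁_const _ _ h10.1 (hx₀ t ht) h10.2, hx₁ t ht]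
  have hd6 : HasFDerivWithinAt (fun t : ℝ => t) (0 : ℝ →L[ℝ] ℝ) (Ici 0) 0 :=
    hd5.congr_of_eventuallyEq hev.symm (hev.self_of_nhdsWithin self_mem_Ici).symm
  have hd7 : HasFDerivWithinAt (fun t : ℝ => t) (ContinuousLinearMap.id ℝ ℝ) (Ici 0) 0 :=
    hasFDerivWithinAt_id _ _
  have := congrArg (fun φ : ℝ →L[ℝ] ℝ => φ 1) ((uniqueDiffOn_Ici (0 : ℝ) 0 self_mem_Ici).eq hd6 hd7)
  simp at this

/-- Smooth functions on `X` whose restrictions to `∂₀X` are the pullbacks of the components of an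
embedding of `Y`. -/
structure BaseFunctions (N : ℕ) where
  e : Y → 𝓔 N
  ext : Fin N → X → ℝ
  smooth_e : ContMDiff (𝓠 k) (𝓡 N) ∞ e
  injective_e : Function.Injective e
  injective_mfderiv_e : ∀ y, Function.Injective (mfderiv (𝓠 k) (𝓡 N) e y)
  smooth_ext : ∀ j, ContMDiff (𝓠 n) 𝓘(ℝ, ℝ) ∞ (ext j)
  ext_eq : ∀ j p, S.x₀ p = 0 → ext j p = e (S.φ p) j

lemma exists_baseFunctions [T2Space X] [CompactSpace X] [T2Space Y] [CompactSpace Y]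
    [IsManifold (𝓠 k) ∞ Y] : ∃ N, Nonempty (S.BaseFunctions N) := by
  obtain ⟨N, e, he, hemb, hinj⟩ := exists_embedding_euclidean_of_compact (I := 𝓠 k) (M := Y)
  have hext : ∃ g : C^∞⟮𝓠 n, X; 𝓘(ℝ, 𝓔 N), 𝓔 N⟯, ∀ p, g p ∈ {v | S.x₀ p = 0 → v = e (S.φ p)} := by
    refine exists_contMDiffMap_forall_mem_convex_of_local (𝓠 n) (fun p => ?_) fun p => ?_
    · by_cases h0 : S.x₀ p = 0
      · simp [h0]
      · simpa [h0] using convex_univ (𝕜 := ℝ) (E := 𝓔 N)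
    · by_cases h0 : S.x₀ p = 0
      · obtain ⟨c, lab, h1, -, h3, h4, h5, h6, h7, -, -⟩ := S.exists_cornerChart_bd p isOpen_univ
          (mem_univ p)
        obtain ⟨i₀, hi₀⟩ := h3 none (Or.inl ⟨rfl, h0⟩)
        have hψ : ∀ q ∈ c.U, c.ψ q i₀ = S.x₀ q := fun q hq => h7 i₀ none hi₀ q hq
        let π : 𝓔 n → 𝓔 n := fun x =>
          x - x i₀ • single i₀ (1 : ℝ)
        have hπ : ContDiff ℝ ∞ π := by fun_prop
        have hπi : ∀ x, π x i₀ = 0 := fun x => by simp [π]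
        have hπj : ∀ x, ∀ j ≠ i₀, π x j = x j := fun x j hj => by simp [π, hj]
        have hπ0 : ∀ x, x i₀ = 0 → π x = x := fun x hx => by simp [π, hx]
        let U' : Set X := c.U ∩ c.ψ ⁻¹' (π ⁻¹' c.O)
        have hU' : IsOpen U' := c.smooth_ψ'.continuousOn.isOpen_inter_preimage c.isOpen_U
          (c.isOpen_O.preimage hπ.continuous)
        have hpU' : p ∈ U' := ⟨h1, by
          rw [mem_preimage, mem_preimage, hπ0 _ (by rw [hψ p h1, h0])]; exact (c.mapsTo_ψ' h1).1⟩
        have hm : MapsTo (fun q => π (c.ψ q)) U' (c.O ∩ cornerSet c.J) := fun q hq =>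
          ⟨hq.2, fun j hj => by
            by_cases h : j = i₀
            · rw [h, hπi]
            · rw [hπj _ j h]; exact (c.mapsTo_ψ' hq.1).2 j hj⟩
        have hm0 : ∀ q ∈ U', S.x₀ (c.χ (π (c.ψ q))) = 0 := fun q hq => by
          rw [← hψ _ (c.mapsTo_χ' (hm hq)), c.right_inv (hm hq), hπi]
        refine ⟨U', hU'.mem_nhds hpU', fun q => e (S.φ (c.χ (π (c.ψ q)))), ?_, fun q hq hq0 => ?_⟩
        · exact he.comp_contMDiffOn (S.contMDiffOn_φ.comp (c.smooth_χ.comp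
            (hπ.contMDiff.comp_contMDiffOn (c.smooth_ψ'.mono inter_subset_left)) hm) hm0)
        · simp only [hπ0 _ (show c.ψ q i₀ = 0 by rw [hψ q hq.1, hq0]), c.left_inv' hq.1]
      · refine ⟨{q | S.x₀ q ≠ 0}, (isOpen_compl_singleton.preimage S.contMDiff_x₀.continuous).mem_nhds
          h0, fun _ => 0, contMDiffOn_const, fun q hq h => absurd h hq⟩
  obtain ⟨g, hg⟩ := hext
  refine ⟨N, ⟨⟨e, fun j q => g q j, he, hemb.injective, hinj, fun j => ?_, fun j p hp => ?_⟩⟩⟩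
  · exact (coordL j).contMDiff.comp g.contMDiff
  · rw [hg p hp]

/-- Coordinates at `p`, some of which are boundary defining functions or given functions; these
include the boundary defining functions that vanish at `p`. -/
structure LabChart {N : ℕ} (b : S.BaseFunctions N) (p : X) where
  c : CornerChart (𝓠 n) X n
  lab : Fin n → Option (𝓛 N)
  mem : p ∈ c.U
  lab_inj : ∀ i j a, lab i = some a → lab j = some a → i = j
  mem_J : ∀ i, i ∈ c.J ↔ ∃ a, S.IsBdLabel p a ∧ lab i = some a
  exists_lab : ∀ a, S.IsBdLabel p a → ∃ i, lab i = some a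
  coord : ∀ i a, lab i = some a → ∀ q ∈ c.U, c.ψ q i = S.gen b.ext a q
  x₀_ne : S.x₀ p ≠ 0 → ∀ q ∈ c.U, S.x₀ q ≠ 0
  x₁_ne : S.x₁ p ≠ 0 → ∀ q ∈ c.U, S.x₁ q ≠ 0

variable {S} in
omit [IsManifold (𝓠 n) ∞ X] in
lemma BaseFunctions.contMDiff_gen {N : ℕ} (b : S.BaseFunctions N) (a : 𝓛 N) :
    ContMDiff (𝓠 n) 𝓘(ℝ, ℝ) ∞ (S.gen b.ext a) := by
  rcases a with _ | _ | j
  exacts [S.contMDiff_x₀, S.contMDiff_x₁, b.smooth_ext j]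

variable {S} in
omit [IsManifold (𝓠 n) ∞ X] in
lemma BaseFunctions.gen_section {N : ℕ} (b : S.BaseFunctions N) {q : X} (hq : S.x₀ q = 0)
    {s : Y → X} (hs : S.x₀ (s (S.φ q)) = 0 ∧ S.φ (s (S.φ q)) = S.φ q) (a : Option (Fin N)) :
    S.gen b.ext (some a) (s (S.φ q)) = S.gen b.ext (some a) q := by
  rcases a with _ | j
  · exact S.x₁_const _ _ hs.1 hq hs.2
  · change b.ext j _ = b.ext j q
    rw [b.ext_eq j _ hs.1, b.ext_eq j q hq, hs.2]

omit [IsManifold (𝓠 n) ∞ X] in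
lemma exists_differential_section {N : ℕ} (b : S.BaseFunctions N) {p : X} (hp : S.x₀ p = 0)
    {U : Set Y} {s : Y → X} (hU : IsOpen U) (hy : S.φ p ∈ U)
    (hsU : ∀ u ∈ U, S.x₀ (s u) = 0 ∧ S.φ (s u) = u) :
    ∃ A : 𝓔 k →L[ℝ] 𝓔 n, (∀ a, (differential k (fun u => S.gen b.ext (some a) (s u)) (S.φ p) :
        𝓔 k →L[ℝ] ℝ) = (differential n (S.gen b.ext (some a)) p : 𝓔 n →L[ℝ] ℝ).comp A) ∧
      (differential n S.x₀ p : 𝓔 n →L[ℝ] ℝ).comp A = 0 := by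
  obtain ⟨U₁, s₁, hU₁, hy₁, hs₁, hsU₁, hsp⟩ := S.exists_section hp
  have h1 := ((hs₁.contMDiffAt (hU₁.mem_nhds hy₁)).mdifferentiableAt (by simp)).hasMFDerivAt
  refine ⟨mfderiv (𝓠 k) (𝓠 n) s₁ (S.φ p), fun a => ?_, ?_⟩
  · have h2 := ((b.contMDiff_gen (some a)).mdifferentiableAt (by simp) (x := s₁ (S.φ p))).hasMFDerivAt
    have h3 := (h2.comp (S.φ p) h1).mfderiv
    have h5 : (fun u => S.gen b.ext (some a) (s u)) =ᶠ[𝓝 (S.φ p)] S.gen b.ext (some a) ∘ s₁ :=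
      eventually_of_mem (inter_mem (hU.mem_nhds hy) (hU₁.mem_nhds hy₁)) fun u hu => by
        have h6 := hsU u hu.1
        have h7 := hsU₁ u hu.2
        have h8 := b.gen_section h7.1 (s := s) (by rw [h7.2]; exact h6) a
        rwa [h7.2] at h8
    have h6 : differential k (fun u => S.gen b.ext (some a) (s u)) (S.φ p) = _ :=
      h5.mfderiv_eq.trans h3
    refine h6.trans ?_
    rw [hsp]; rfl
  · have h2 := (S.contMDiff_x₀.mdifferentiableAt (by simp) (x := s₁ (S.φ p))).hasMFDerivAt
    have h3 := (h2.comp (S.φ p) h1).mfderiv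
    have h4 : mfderiv (𝓠 k) 𝓘(ℝ, ℝ) (S.x₀ ∘ s₁) (S.φ p) = (0 : 𝓔 k →L[ℝ] ℝ) := by
      have h5 : S.x₀ ∘ s₁ =ᶠ[𝓝 (S.φ p)] fun _ => 0 :=
        eventually_of_mem (hU₁.mem_nhds hy₁) fun u hu => (hsU₁ u hu).1
      rw [h5.mfderiv_eq]
      exact mfderiv_const
    rw [hsp] at h3
    exact h3.symm.trans h4

/-- Near a point of `Y`, some of the base functions are coordinates; together with `x₀` they are
independent on `X`. -/
lemma exists_base_labels {N : ℕ} (b : S.BaseFunctions N) [IsManifold (𝓠 k) ∞ Y] {p : X}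
    (hp : S.x₀ p = 0) : ∃ (Bf : Finset (Option (Fin N))) (W : Set Y), (S.x₁ p = 0 → none ∈ Bf) ∧
      (∀ p', S.x₀ p' = 0 → S.φ p' = S.φ p → LinearIndepOn ℝ
        (fun a => (differential n (S.gen b.ext a) p' : 𝓔 n →L[ℝ] ℝ))
        (insert none (Bf.map ⟨some, Option.some_injective _⟩) : Finset (𝓛 N))) ∧
      IsOpen W ∧ S.φ p ∈ W ∧ ∀ q q', S.φ q ∈ W → S.φ q' ∈ W → S.x₀ q = 0 → S.x₀ q' = 0 →
        (∀ a ∈ Bf, S.gen b.ext (some a) q = S.gen b.ext (some a) q') → S.φ q = S.φ q' := by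
  classical
  obtain ⟨U, s, hU, hy, hs, hsU, hsp⟩ := S.exists_section hp
  let g : Option (Fin N) → Y → ℝ := fun a u => S.gen b.ext (some a) (s u)
  have hg : ∀ a, ContMDiffOn (𝓠 k) 𝓘(ℝ, ℝ) ∞ (g a) U := fun a =>
    (b.contMDiff_gen (some a)).comp_contMDiffOn hs
  let d : Option (Fin N) → 𝓔 k →L[ℝ] ℝ := fun a => differential k (g a) (S.φ p)
  have hd : ∀ a, HasMFDerivAt (𝓠 k) 𝓘(ℝ, ℝ) (g a) (S.φ p) (d a) := fun a =>
    (((hg a).contMDiffAt (hU.mem_nhds hy)).mdifferentiableAt (by simp)).hasMFDerivAt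
  have hdsome : ∀ j, d (some j) = (coordL j).comp (mfderiv (𝓠 k) (𝓡 N) b.e (S.φ p) :
        𝓔 k →L[ℝ] 𝓔 N) := fun j => by
    have h1 := (b.smooth_e.mdifferentiableAt (by simp) (x := S.φ p)).hasMFDerivAt
    have h2 : HasMFDerivAt (𝓡 N) 𝓘(ℝ, ℝ) (coordL j) (b.e (S.φ p)) (coordL j) := ContinuousLinearMap.hasMFDerivAt _
    have h3 := h2.comp (S.φ p) h1
    have h4 : g (some j) =ᶠ[𝓝 (S.φ p)] (coordL j) ∘ b.e :=
      eventually_of_mem (hU.mem_nhds hy) fun u hu => by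
        change b.ext j (s u) = _
        rw [b.ext_eq j _ (hsU u hu).1, (hsU u hu).2]; rfl
    exact (hd (some j)).mfderiv.symm.trans (h4.mfderiv_eq.trans h3.mfderiv)
  let t : Set (Option (Fin N)) := {a | a = none → S.x₁ p = 0}
  let s₀ : Set (Option (Fin N)) := {a | a = none ∧ S.x₁ p = 0}
  have hs₀ : LinearIndepOn ℝ d s₀ := by
    by_cases h1 : S.x₁ p = 0
    · have : s₀ = {none} := by ext a; simp [s₀, h1]
      rw [this]
      exact LinearIndepOn.singleton (S.differential_x₁_section_ne hp h1 hU hy hs hsU)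
    · have : s₀ = ∅ := by ext a; simp [s₀, h1]
      rw [this]
      exact linearIndepOn_empty _ _
  obtain ⟨B, hBt, hsB, hspan, hB⟩ := exists_linearIndepOn_extension hs₀
    (show s₀ ⊆ t from fun a ha _ => ha.2)
  have hker : ∀ v : 𝓔 k, (∀ a ∈ B, d a v = 0) → v = 0 := fun v hv => by
    have h1 : ∀ j, d (some j) v = 0 := fun j => by
      have h2 : Submodule.span ℝ (d '' B) ≤ LinearMap.ker (ContinuousLinearMap.apply ℝ ℝ v :
          (𝓔 k →L[ℝ] ℝ) →L[ℝ] ℝ).toLinearMap := by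
        rw [Submodule.span_le]
        rintro _ ⟨a, ha, rfl⟩
        exact hv a ha
      exact h2 (hspan (mem_image_of_mem d (show some j ∈ t from fun h => by simp at h)))
    refine (injective_iff_map_eq_zero (mfderiv (𝓠 k) (𝓡 N) b.e (S.φ p))).1
      (b.injective_mfderiv_e _) v ?_
    refine PiLp.ext fun j => ?_
    have := h1 j
    rw [hdsome j] at this
    exact this
  let Bf : Finset (Option (Fin N)) := B.toFinite.toFinset
  have hBf : ∀ a, a ∈ Bf ↔ a ∈ B := fun a => by simp [Bf]
  obtain ⟨U', hU', hyU', hU'U, hsep⟩ := exists_isOpen_injOn_manifold hU hy (ι := B)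
    (g := fun a => g a.1) (fun a => hg a.1) fun v hv => hker v fun a ha => hv ⟨a, ha⟩
  refine ⟨Bf, U', fun h => (hBf _).2 (hsB ⟨rfl, h⟩), fun p' hp' hφ => ?_, hU', hyU',
    fun q q' hq hq' hq0 hq0' h => ?_⟩
  · obtain ⟨A, hdpull, hx₀pull⟩ := S.exists_differential_section b hp' hU (by rw [hφ]; exact hy) hsU
    rw [hφ] at hdpull
    obtain ⟨D, hD, hdpull, hx₀pull⟩ : ∃ D : 𝓛 N → 𝓔 n →L[ℝ] ℝ,
        (D = fun a => (differential n (S.gen b.ext a) p' : 𝓔 n →L[ℝ] ℝ)) ∧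
        (∀ a, d a = (D (some a)).comp A) ∧ (D none).comp A = 0 := ⟨_, rfl, hdpull, hx₀pull⟩
    have hind : LinearIndepOn ℝ D
        (insert none (Bf.map ⟨some, Option.some_injective _⟩) : Finset (𝓛 N)) := by
      refine linearIndepOn_finset_iff (v := D).2 fun c hc => ?_
      rw [Finset.sum_insert (by simp), Finset.sum_map] at hc
      have hB' := (linearIndepOn_finset_iff (v := d) (s := Bf)).1 (by
        rw [show (Bf : Set (Option (Fin N))) = B from by ext a; simp [hBf]]; exact hB)
        (fun a => c (some a)) (ContinuousLinearMap.ext fun v => by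
          have h10 := congrArg (fun φ : 𝓔 n →L[ℝ] ℝ => φ (A v)) hc
          have h11 : D none (A v) = 0 := congrArg (fun φ : 𝓔 k →L[ℝ] ℝ => φ v) hx₀pull
          simp only [add_apply, smul_apply, h11, smul_zero, zero_add, zero_apply,
            sum_apply] at h10 ⊢
          rw [← h10]
          exact Finset.sum_congr rfl fun a _ => by rw [hdpull a]; rfl)
      rw [Finset.sum_eq_zero fun a ha => by
        rw [show c ((⟨some, Option.some_injective _⟩ : Option (Fin N) ↪ _) a) = 0 from hB' a ha,
          zero_smul], add_zero] at hc
      intro a ha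
      rcases Finset.mem_insert.1 ha with rfl | ha
      · exact (smul_eq_zero.1 hc).resolve_right (by rw [hD]; exact S.d_x₀_ne p' hp')
      · obtain ⟨a', ha', rfl⟩ := Finset.mem_map.1 ha
        exact hB' a' ha'
    exact hD ▸ hind
  · refine hsep _ hq _ hq' fun a => ?_
    have h1 := b.gen_section hq0 (hsU _ (hU'U hq)) a.1
    have h2 := b.gen_section hq0' (hsU _ (hU'U hq')) a.1
    exact h1.trans ((h a.1 ((hBf _).2 a.2)).trans h2.symm)

lemma exists_labChart_pair {N : ℕ} (b : S.BaseFunctions N) [IsManifold (𝓠 k) ∞ Y]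
    {p p' : X} (hp : S.x₀ p = 0) (hp' : S.x₀ p' = 0) (hφ : S.φ p = S.φ p') :
    ∃ (L : S.LabChart b p) (L' : S.LabChart b p'),
      (∀ a, (∃ i, L.lab i = some a) ↔ ∃ i, L'.lab i = some a) ∧
      ∀ q ∈ L.c.U, ∀ q' ∈ L'.c.U, S.x₀ q = 0 → S.x₀ q' = 0 →
        (∀ i a, L'.lab i = some a → S.gen b.ext a q = S.gen b.ext a q') → S.φ q = S.φ q' := by
  classical
  obtain ⟨Bf, W, hB1, hind, hW, hpW, hsep⟩ := S.exists_base_labels b hp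
  obtain ⟨W', hW', hWU'⟩ := continuousOn_iff'.1 S.contMDiffOn_φ.continuousOn W hW
  have hmem : ∀ q, S.x₀ q = 0 → (q ∈ W' ↔ S.φ q ∈ W) := fun q hq =>
    ⟨fun h => (hWU'.symm.subset ⟨h, hq⟩).1, fun h => (hWU'.subset ⟨h, hq⟩).1⟩
  have key : ∀ p', S.x₀ p' = 0 → S.φ p = S.φ p' → ∃ L : S.LabChart b p', L.c.U ⊆ W' ∧
      ∀ a, (∃ i, L.lab i = some a) ↔ a ∈ (insert none (Bf.map ⟨some, Option.some_injective _⟩) :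
        Finset (𝓛 N)) := by
    intro p' hp' hφ
    have hbd : ∀ a, S.IsBdLabel p' a → a ∈ (insert none (Bf.map ⟨some, Option.some_injective _⟩) :
        Finset (𝓛 N)) := fun a ha => by
      rcases ha with ⟨rfl, -⟩ | ⟨rfl, h⟩
      · exact Finset.mem_insert_self _ _
      · exact Finset.mem_insert_of_mem (Finset.mem_map_of_mem _ (hB1
          ((S.x₁_const p p' hp hp' hφ).trans h)))
    obtain ⟨c, lab, h1, h2, h3, h4, h5, h6, h7, h8, h9⟩ := S.exists_cornerChart_gen b.smooth_ext p' _
      hbd (hind p' hp' hφ.symm) hW' ((hmem p' hp').2 (by rwa [← hφ]))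
    exact ⟨⟨c, lab, h1, h5, h6, fun a ha => h3 a (hbd a ha), h7, h8, h9⟩, h2, fun a =>
      ⟨fun ⟨i, hi⟩ => h4 i a hi, h3 a⟩⟩
  obtain ⟨L, hL, hLl⟩ := key p hp rfl
  obtain ⟨L', hL', hLl'⟩ := key p' hp' hφ
  refine ⟨L, L', fun a => (hLl a).trans (hLl' a).symm, fun q hq q' hq' hq0 hq0' h =>
    hsep q q' ((hmem q hq0).1 (hL hq)) ((hmem q' hq0').1 (hL' hq')) hq0 hq0' fun a ha => ?_⟩
  obtain ⟨i, hi⟩ := (hLl' (some a)).2 (Finset.mem_insert_of_mem (Finset.mem_map_of_mem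
    ⟨some, Option.some_injective _⟩ ha))
  exact h i _ hi

/-- Coordinates at `p` that separate the fibres of `φ` by the given functions. -/
lemma exists_labChart {N : ℕ} (b : S.BaseFunctions N) [IsManifold (𝓠 k) ∞ Y] (p : X) :
    ∃ L : S.LabChart b p, ∀ q ∈ L.c.U, ∀ q' ∈ L.c.U, S.x₀ q = 0 → S.x₀ q' = 0 →
        (∀ i a, L.lab i = some a → S.gen b.ext a q = S.gen b.ext a q') → S.φ q = S.φ q' := by
  classical
  by_cases hp : S.x₀ p = 0
  swap
  · obtain ⟨c, lab, h1, h2, h3, h4, h5, h6, h7, h8, h9⟩ := S.exists_cornerChart_gen b.smooth_ext p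
      (if S.x₁ p = 0 then {some none} else ∅) (fun a ha => by
        rcases ha with ⟨-, h⟩ | ⟨rfl, h⟩
        · exact absurd h hp
        · simp [h]) (by
        by_cases h1 : S.x₁ p = 0
        · rw [if_pos h1]
          have := S.d_x₁_ne p h1
          refine linearIndepOn_finset_iff (v := fun a =>
            (differential n (S.gen b.ext a) p : 𝓔 n →L[ℝ] ℝ)).2 fun c hc a ha => ?_
          rw [Finset.mem_singleton.1 ha]
          rw [Finset.sum_singleton] at hc
          exact (smul_eq_zero.1 hc).resolve_right this
        · rw [if_neg h1]
          exact linearIndependent_empty_type) isOpen_univ (mem_univ p)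
    exact ⟨⟨c, lab, h1, h5, h6, fun a ha => by
      obtain ⟨-, h⟩ | ⟨rfl, h⟩ := id ha
      · exact absurd h hp
      · exact h3 _ (by simp [h]), h7, h8, h9⟩, fun q hq _ _ h => absurd h (h8 hp q hq)⟩
  obtain ⟨L, L', hLL', hsep⟩ := S.exists_labChart_pair b hp hp rfl
  obtain ⟨c', h1, h2, h3, h4, h5⟩ := L.c.exists_restrict L'.c.isOpen_U
  have hU : c'.U ⊆ L.c.U := by rw [h1]; exact inter_subset_left
  refine ⟨⟨c', L.lab, by rw [h1]; exact ⟨L.mem, L'.mem⟩, L.lab_inj, by rw [h2]; exact L.mem_J,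
    L.exists_lab, fun i a hi q hq => by rw [h3]; exact L.coord i a hi q (hU hq),
    fun h q hq => L.x₀_ne h q (hU hq), fun h q hq => L.x₁_ne h q (hU hq)⟩,
    fun q hq q' hq' hq0 hq0' h => hsep q (hU hq) q' (h1.subset hq').2 hq0 hq0' fun i a hi => ?_⟩
  obtain ⟨j, hj⟩ := (hLL' a).2 ⟨i, hi⟩
  exact h j a hj

end FiberedBoundary

/-! ### Blow-ups of pairs of boundary hypersurfaces -/

section Push

lemma EmbChart.exists_push {m : ℕ} (c : CornerChart I P m) {q : P} (hq : q ∈ c.U) (i : Fin m) :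
    ∃ γ : ℝ → P, Tendsto γ (𝓝[>] 0) (𝓝 q) ∧ ∀ᶠ t in 𝓝[>] 0, γ t ∈ c.U ∧
      c.ψ (γ t) i = c.ψ q i + t ∧ ∀ j ≠ i, c.ψ (γ t) j = c.ψ q j := by
  have hx := c.mapsTo_ψ' hq
  let ℓ : ℝ → 𝓔 m := fun t => c.ψ q + t • single i (1 : ℝ)
  have hcont : Continuous ℓ := by fun_prop
  have hℓ : Tendsto ℓ (𝓝[>] 0) (𝓝 (c.ψ q)) := by
    have := hcont.tendsto 0
    simp only [ℓ, zero_smul, add_zero] at this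
    exact this.mono_left nhdsWithin_le_nhds
  have hev : ∀ᶠ t : ℝ in 𝓝[>] 0, ℓ t ∈ c.O ∩ cornerSet c.J := by
    filter_upwards [hℓ.eventually (c.isOpen_O.mem_nhds hx.1), self_mem_nhdsWithin] with t ht
      (ht0 : 0 < t)
    refine ⟨ht, fun j hj => ?_⟩
    have := hx.2 j hj
    by_cases hji : j = i
    · subst hji; simp [ℓ]; linarith
    · simpa [ℓ, hji] using this
  refine ⟨fun t => c.χ (ℓ t), ?_, ?_⟩
  · have h1 : Tendsto c.χ (𝓝[c.O ∩ cornerSet c.J] (c.ψ q)) (𝓝 (c.χ (c.ψ q))) :=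
      c.smooth_χ.continuousOn _ hx
    rw [c.left_inv' hq] at h1
    exact h1.comp (tendsto_nhdsWithin_iff.2 ⟨hℓ, hev⟩)
  · filter_upwards [hev] with t ht
    refine ⟨c.mapsTo_χ' ht, ?_, fun j hj => ?_⟩
    · rw [c.right_inv ht]; simp [ℓ]
    · rw [c.right_inv ht]; simp [ℓ, hj]

end Push

section Persist

variable {F : Type} [NormedAddCommGroup F] [InnerProductSpace ℝ F] {m : ℕ}
  {S : Set M} {f : M → F} {β : M' → M} {α : M' → F}

/-- Projective coordinates on a blow-up. -/
lemma IsGenChart.exists_lift {c : CornerChart I M m} {K : Finset (Fin m)}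
    {C A : Fin m → M → F} (hg : IsGenChart c K f C A)
    (hι : InitEmb I' (I.prod 𝓘(ℝ, F)) fun q => (β q, α q))
    (hr : range (fun q => (β q, α q)) = blowUpGraph f) {q : M'} (hq : β q ∈ c.U) :
    ∃ (c' : CornerChart I' M' m) (i : Fin m), q ∈ c'.U ∧ (∀ q' ∈ c'.U, β q' ∈ c.U) ∧ i ∈ K ∧
      c'.J = insert i c.J ∧ (∀ q' ∈ c'.U, c'.ψ q' i = 0 ↔ f (β q') = 0) ∧
      ∀ q' ∈ c'.U, ∀ j ∉ K, c'.ψ q' j = c.ψ (β q') j := by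
  have hmem : ∀ q, (β q, α q) ∈ blowUpGraph f := fun q => hr.subset ⟨q, rfl⟩
  obtain ⟨d, i, h1, hiK, hJ, hdi, hdj⟩ := exists_embChart_polarSet c.isOpen_O
    (hg.polarCoord_mem (hmem q) hq)
  obtain ⟨d', hd', hO, hJ', hψ, hχ, hN⟩ := d.exists_transport (W := blowUpGraph f) (isOpen_dom c F)
    (Φ := IsGenChart.polarCoord c K C) (Ξ := IsGenChart.polarInv c K A) hg.contMDiffOn_polarCoord
    (fun y hy => hg.polarCoord_mem hy.1 hy.2) (hg.contMDiffOn_polarInv.mono inter_subset_left)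
    (fun a ha => ⟨hg.polarInv_mem ha.1, c.mapsTo_χ' ha.1.2.2.2⟩)
    (fun y hy _ => hg.polarInv_polarCoord hy.1 hy.2)
    (fun a ha => hg.polarCoord_polarInv ha.1)
  obtain ⟨c', k1, k2, k3, k4, k5⟩ := hι.exists_cornerChart (hr.symm ▸ d')
  have hcast : ∀ (T : Set (M × F)) (hT : blowUpGraph f = T), (hT ▸ d').U = d'.U ∧
      (hT ▸ d').J = d'.J ∧ (hT ▸ d').ψ = d'.ψ := by rintro _ rfl; exact ⟨rfl, rfl, rfl⟩
  obtain ⟨j1, j2, j3⟩ := hcast _ hr.symm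
  rw [j1] at k1
  rw [j2] at k3
  rw [j3] at k4
  have hβU : ∀ q' ∈ c'.U, β q' ∈ c.U := fun q' hq' => hN (k1.subset hq')
  refine ⟨c', i, ?_, hβU, hiK, by rw [k3, hJ', hJ], fun q' hq' => ?_, fun q' hq' j hj => ?_⟩
  · rw [k1]; exact (hd' _ (hmem q)).2 ⟨hq, h1⟩
  · rw [k4, hψ, Function.comp_apply, hdi, hg.polarCoord_fst (hmem q') (hβU q' hq')]
    simp [(hg.radius_pos (hmem q') (hβU q' hq')).ne']
  · rw [k4, hψ, Function.comp_apply, hdj _ j (fun h => hj (h ▸ hiK))]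
    simp [IsGenChart.polarCoord, hj]

lemma EmbChart.exists_lift_of_ne_zero (c : CornerChart I M m) (hf : ContMDiff I 𝓘(ℝ, F) ∞ f)
    (hι : InitEmb I' (I.prod 𝓘(ℝ, F)) fun q => (β q, α q))
    (hr : range (fun q => (β q, α q)) = blowUpGraph f) {q : M'} (hq : β q ∈ c.U) (h0 : f (β q) ≠ 0) :
    ∃ c' : CornerChart I' M' m, q ∈ c'.U ∧ (∀ q' ∈ c'.U, β q' ∈ c.U ∧ f (β q') ≠ 0) ∧
      c'.J = c.J ∧ ∀ q' ∈ c'.U, c'.ψ q' = c.ψ (β q') := by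
  have hmem : ∀ q, (β q, α q) ∈ blowUpGraph f := fun q => hr.subset ⟨q, rfl⟩
  have hN : IsOpen {q | f q ≠ 0} := isOpen_compl_singleton.preimage hf.continuous
  obtain ⟨c₁, h1, h2, h3, h4, h5⟩ := c.exists_restrict hN
  have hsub : c₁.U ⊆ {q | f q ≠ 0} := by rw [h1]; exact inter_subset_right
  obtain ⟨d', hd', hO, hJ', hψ, hχ, hN'⟩ := c₁.exists_transport (W := blowUpGraph f) (isOpen_dom c₁ F)
    (Φ := Prod.fst) (Ξ := fun q => (q, ‖f q‖⁻¹ • f q)) (I := I.prod 𝓘(ℝ, F)) contMDiffOn_fst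
    (fun y hy => mem_univ _)
    (contMDiffOn_id.prodMk (contMDiffOn_normalize.comp hf.contMDiffOn fun q hq => hsub hq.2))
    (fun q hq => ⟨subset_closure ⟨hsub hq.2, rfl⟩, hq.2⟩)
    (fun y hy h2 => Prod.ext rfl
      (IsCentre.snd_eq_of_mem_blowUpGraph hf.continuous hy.1 (hsub h2)).symm)
    (fun q hq => rfl)
  obtain ⟨c', k1, k2, k3, k4, k5⟩ := hι.exists_cornerChart (hr.symm ▸ d')
  have hcast : ∀ (T : Set (M × F)) (hT : blowUpGraph f = T), (hT ▸ d').U = d'.U ∧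
      (hT ▸ d').J = d'.J ∧ (hT ▸ d').ψ = d'.ψ := by rintro _ rfl; exact ⟨rfl, rfl, rfl⟩
  obtain ⟨j1, j2, j3⟩ := hcast _ hr.symm
  rw [j1] at k1
  rw [j2] at k3
  rw [j3] at k4
  have hβU : ∀ q' ∈ c'.U, β q' ∈ c₁.U := fun q' hq' => hN' (k1.subset hq')
  refine ⟨c', ?_, fun q' hq' => h1.subset (hβU q' hq'), by rw [k3, hJ', h2], fun q' hq' => ?_⟩
  · rw [k1]; exact (hd' _ (hmem q)).2 ⟨h1.symm.subset ⟨hq, h0⟩, h1.symm.subset ⟨hq, h0⟩⟩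
  · rw [k4, hψ, h3]; rfl

end Persist

section Pair

variable {m : ℕ}

/-- The map to the plane with given components. -/
def pairMap (g g' : M → ℝ) (p : M) : 𝓔 2 := !₂[g p, g' p]

omit [TopologicalSpace M] in
lemma pairMap_eq_zero {g g' : M → ℝ} {p : M} : pairMap g g' p = 0 ↔ g p = 0 ∧ g' p = 0 := by
  constructor
  · intro h
    exact ⟨congrArg (fun v : 𝓔 2 => v 0) h, congrArg (fun v : 𝓔 2 => v 1) h⟩
  · rintro ⟨h, h'⟩
    ext i; fin_cases i
    exacts [h, h']

lemma contMDiffOn_pairMap {g g' : M → ℝ} {U : Set M} (hg : ContMDiffOn I 𝓘(ℝ, ℝ) ∞ g U)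
    (hg' : ContMDiffOn I 𝓘(ℝ, ℝ) ∞ g' U) :
    ContMDiffOn I 𝓘(ℝ, 𝓔 2) ∞ (pairMap g g') U := by
  have hlp : ContDiff ℝ ∞ fun g : Fin 2 → ℝ => (toLp 2 g : 𝓔 2) := by
    fun_prop
  refine hlp.contMDiff.comp_contMDiffOn (contMDiffOn_pi_space.2 fun i => ?_)
  fin_cases i
  exacts [hg, hg']

/-- Two functions are coordinates where both vanish. -/
def IsCoordPair (I : ModelWithCorners ℝ E H) (m : ℕ) (g g' : M → ℝ) : Prop :=
  ∀ p, g p = 0 → g' p = 0 → ∃ (c : CornerChart I M m) (i i' : Fin m), p ∈ c.U ∧ i ≠ i' ∧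
    ∀ q ∈ c.U, c.ψ q i = g q ∧ c.ψ q i' = g' q

lemma isGenChart_pair {g g' : M → ℝ} (hg : ContMDiff I 𝓘(ℝ, ℝ) ∞ g)
    (hg' : ContMDiff I 𝓘(ℝ, ℝ) ∞ g') (c : CornerChart I M m) {i i' : Fin m} (hne : i ≠ i')
    (hc : ∀ q ∈ c.U, c.ψ q i = g q ∧ c.ψ q i' = g' q) :
    IsGenChart c {i, i'} (pairMap g g') (fun j _ => if j = i then single 0 1 else single 1 1)
      (fun j _ => if j = i then single 0 1 else single 1 1) where
  smooth_f := contMDiffOn_pairMap hg.contMDiffOn hg'.contMDiffOn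
  smooth_C _ := contMDiffOn_const
  smooth_A _ := contMDiffOn_const
  coord q hq j hj := by
    rcases Finset.mem_insert.1 hj with rfl | hj
    · simp [EuclideanSpace.inner_single_left, pairMap, (hc q hq).1]
    · rw [Finset.mem_singleton.1 hj]
      simp [EuclideanSpace.inner_single_left, pairMap, (hc q hq).2, hne.symm]
  sum q hq := by
    rw [Finset.sum_pair hne]
    ext j
    fin_cases j
    · simp [pairMap, (hc q hq).1, hne.symm]
    · simp [pairMap, (hc q hq).2, hne.symm]

lemma IsCoordPair.isCentre {g g' : M → ℝ} (h : IsCoordPair I m g g')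
    (hg : ContMDiff I 𝓘(ℝ, ℝ) ∞ g) (hg' : ContMDiff I 𝓘(ℝ, ℝ) ∞ g') :
    IsCentre I m {p | g p = 0 ∧ g' p = 0} (pairMap g g') where
  contMDiff := contMDiffOn_univ.1 (contMDiffOn_pairMap hg.contMDiffOn hg'.contMDiffOn)
  mem_iff _ := pairMap_eq_zero.symm
  exists_chart p hp := by
    obtain ⟨c, i, i', hpc, hne, hc⟩ := h p hp.1 hp.2
    exact ⟨c, {i, i'}, _, _, hpc, ⟨i, by simp⟩, isGenChart_pair hg hg' c hne hc⟩

lemma IsCoordPair.mem_blowUpGraph_iff {g g' : M → ℝ} (h : IsCoordPair I m g g')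
    (hg : ContMDiff I 𝓘(ℝ, ℝ) ∞ g) (hg' : ContMDiff I 𝓘(ℝ, ℝ) ∞ g') (h0 : ∀ p, 0 ≤ g p)
    (h0' : ∀ p, 0 ≤ g' p) (x : M × 𝓔 2) :
    x ∈ blowUpGraph (pairMap g g') ↔ ‖x.2‖ = 1 ∧ 0 ≤ x.2 0 ∧ 0 ≤ x.2 1 ∧
      g x.1 * x.2 1 = g' x.1 * x.2 0 := by
  have hf := (h.isCentre hg hg').contMDiff
  have hnorm : ∀ v : 𝓔 2, ‖v‖ = 1 ↔ v 0 ^ 2 + v 1 ^ 2 = 1 := fun v => by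
    rw [EuclideanSpace.norm_eq, Real.sqrt_eq_one]; simp [Fin.sum_univ_two]
  constructor
  · intro hx
    have h2 := blowUpGraph_eqOn isOpen_univ (g := fun x : M × 𝓔 2 => |x.2 0|)
      (h := fun x => x.2 0) (by fun_prop) (by fun_prop) (fun y _ _ hy => abs_of_nonneg (by
        rw [hy]; exact mul_nonneg (by positivity) (h0 _))) hx (mem_univ _)
    have h3 := blowUpGraph_eqOn isOpen_univ (g := fun x : M × 𝓔 2 => |x.2 1|)
      (h := fun x => x.2 1) (by fun_prop) (by fun_prop) (fun y _ _ hy => abs_of_nonneg (by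
        rw [hy]; exact mul_nonneg (by positivity) (h0' _))) hx (mem_univ _)
    refine ⟨norm_of_mem_blowUpGraph hx, abs_eq_self.1 h2, abs_eq_self.1 h3, ?_⟩
    have h4 := smul_of_mem_blowUpGraph hf.continuous hx
    have h5 : ‖pairMap g g' x.1‖ * x.2 0 = g x.1 := congrArg (fun v : 𝓔 2 => v 0) h4
    have h6 : ‖pairMap g g' x.1‖ * x.2 1 = g' x.1 := congrArg (fun v : 𝓔 2 => v 1) h4
    rw [← h5, ← h6]; ring
  · rintro ⟨h1, h2, h3, h4⟩
    rw [hnorm] at h1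
    by_cases hz : pairMap g g' x.1 = 0
    · obtain ⟨hz1, hz2⟩ := pairMap_eq_zero.1 hz
      obtain ⟨c, i, i', hpc, hne, hc⟩ := h x.1 hz1 hz2
      have hG := isGenChart_pair hg hg' c hne hc
      let w : 𝓔 m := toLp 2 fun j =>
        if j = i then x.2 0 else if j = i' then x.2 1 else c.ψ x.1 j
      have hwi : w i = x.2 0 := by simp [w]
      have hwi' : w i' = x.2 1 := by simp [w, hne.symm]
      have hpm : polarMap {i, i'} ((0 : ℝ), w) = c.ψ x.1 := by
        ext j
        rw [polarMap_apply]
        by_cases hj : j = i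
        · simp [hj, (hc x.1 hpc).1, hz1]
        · by_cases hj' : j = i'
          · simp [hj', (hc x.1 hpc).2, hz2]
          · simp [hj, hj', w]
      have ha : ((0 : ℝ), w) ∈ polarSet c.J {i, i'} (c.O ∩ cornerSet c.J) := by
        refine ⟨le_rfl, fun j hj => ?_, ?_, ?_⟩
        · by_cases hji : j = i
          · subst hji; exact hwi ▸ h2
          · by_cases hji' : j = i'
            · subst hji'; exact hwi' ▸ h3
            · simpa [w, hji, hji'] using (c.mapsTo_ψ' hpc).2 j hj
        · rw [Finset.sum_pair hne, hwi, hwi', h1]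
        · rw [hpm]; exact c.mapsTo_ψ' hpc
      have h5 := hG.polarInv_mem ha
      have hdir : IsGenChart.polarDir c {i, i'} (fun j _ => if j = i then single 0 1
          else single 1 1) ((0 : ℝ), w) = x.2 := by
        rw [IsGenChart.polarDir, Finset.sum_pair hne, hwi, hwi']
        ext j; fin_cases j <;> simp [hne.symm]
      have h6 : IsGenChart.polarInv c {i, i'} (fun j _ => if j = i then single 0 1
          else single 1 1) ((0 : ℝ), w) = x := by
        refine Prod.ext ?_ ?_
        · change c.χ (polarMap {i, i'} ((0 : ℝ), w)) = x.1
          rw [hpm, c.left_inv' hpc]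
        · simp only [IsGenChart.polarInv]
          rw [hdir, (hnorm _).2 h1]; simp
      rwa [h6] at h5
    · refine subset_closure ⟨hz, ?_⟩
      have h5 : 0 < g x.1 ^ 2 + g' x.1 ^ 2 := by
        refine lt_of_le_of_ne (by positivity) fun h => hz (pairMap_eq_zero.2 ?_)
        constructor <;> nlinarith [sq_nonneg (g x.1), sq_nonneg (g' x.1)]
      have h6 : ‖pairMap g g' x.1‖ = √(g x.1 ^ 2 + g' x.1 ^ 2) := by
        rw [EuclideanSpace.norm_eq]; simp [Fin.sum_univ_two, pairMap]
      have h7 : 0 < √(g x.1 ^ 2 + g' x.1 ^ 2) := Real.sqrt_pos.2 h5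
      have h8 : √(g x.1 ^ 2 + g' x.1 ^ 2) = g x.1 * x.2 0 + g' x.1 * x.2 1 := by
        rw [Real.sqrt_eq_iff_mul_self_eq h5.le (by
          have := h0 x.1; have := h0' x.1; positivity)]
        linear_combination (g x.1 * x.2 1 - g' x.1 * x.2 0) * h4 - (g x.1 ^ 2 + g' x.1 ^ 2) * h1
      ext j
      rw [h6]
      fin_cases j
      · change x.2 0 = (√(g x.1 ^ 2 + g' x.1 ^ 2))⁻¹ * g x.1
        rw [eq_inv_mul_iff_mul_eq₀ h7.ne', h8]
        linear_combination g x.1 * h1 - x.2 1 * h4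
      · change x.2 1 = (√(g x.1 ^ 2 + g' x.1 ^ 2))⁻¹ * g' x.1
        rw [eq_inv_mul_iff_mul_eq₀ h7.ne', h8]
        linear_combination g' x.1 * h1 + x.2 0 * h4

end Pair

/-! ### The b-double space -/

section ExistsBlowUp

lemma IsCentre.exists_blowUp {E H : Type*} [NormedAddCommGroup E] [NormedSpace ℝ E]
    [TopologicalSpace H] {I : ModelWithCorners ℝ E H} {M : Type u} [TopologicalSpace M]
    [ChartedSpace H M] {F : Type} [NormedAddCommGroup F] [InnerProductSpace ℝ F] [CompleteSpace F]
    {m : ℕ} {S : Set M} {f : M → F} (hf : IsCentre I m S f)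
    (hM : ∀ p : M, ∃ c : CornerChart I M m, p ∈ c.U) :
    ∃ (M' : Type u) (_ : TopologicalSpace M') (_ : ChartedSpace (EuclideanQuadrant m) M')
      (_ : IsManifold (𝓠 m) ∞ M') (β : M' → M) (α : M' → F),
      InitEmb (𝓠 m) (I.prod 𝓘(ℝ, F)) (fun q => (β q, α q)) ∧
      range (fun q => (β q, α q)) = blowUpGraph f := by
  have hW := hf.exists_embChart hM
  refine ⟨blowUpGraph f, inferInstance, embeddedChartedSpace hW, isManifold_embedded hW,
    fun q => q.1.1, fun q => q.1.2, initEmb_subtype_val hW fun ⟨x⟩ => ?_, Subtype.range_coe⟩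
  obtain ⟨p, -, hp⟩ := hf.exists_mem_compl isOpen_univ (mem_univ x.1)
  exact ⟨⟨(p, ‖f p‖⁻¹ • f p), subset_closure ⟨fun h => hp ((hf.mem_iff p).2 h), rfl⟩⟩⟩

end ExistsBlowUp

namespace FiberedBoundary

variable (S)

/-- The defining functions of `∂₀X` from the left and right factor. -/
def pair₀ : X × X → 𝓔 2 := pairMap (fun w => S.x₀ w.1) fun w => S.x₀ w.2

/-- The defining functions of `∂₁X` from the left and right factor. -/
def pair₁ {M : Type*} (β : M → X × X) : M → 𝓔 2 :=
  pairMap (fun q => S.x₁ (β q).1) fun q => S.x₁ (β q).2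

variable [IsManifold (𝓠 n) ∞ X]

omit [IsManifold (𝓠 n) ∞ X] in
lemma contMDiff_x₀_fst : ContMDiff ((𝓠 n).prod (𝓠 n)) 𝓘(ℝ, ℝ) ∞
    fun w : X × X => S.x₀ w.1 := S.contMDiff_x₀.comp contMDiff_fst

omit [IsManifold (𝓠 n) ∞ X] in
lemma contMDiff_x₀_snd : ContMDiff ((𝓠 n).prod (𝓠 n)) 𝓘(ℝ, ℝ) ∞
    fun w : X × X => S.x₀ w.2 := S.contMDiff_x₀.comp contMDiff_snd

lemma isCoordPair₀ : IsCoordPair ((𝓠 n).prod (𝓠 n)) (n + n)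
    (fun w : X × X => S.x₀ w.1) fun w : X × X => S.x₀ w.2 := by
  rintro ⟨p, p'⟩ (h : S.x₀ p = 0) (h' : S.x₀ p' = 0)
  obtain ⟨c, lab, h1, -, h3, -, -, -, h7, -, -⟩ := S.exists_cornerChart_bd p isOpen_univ (mem_univ p)
  obtain ⟨c', lab', h1', -, h3', -, -, -, h7', -, -⟩ :=
    S.exists_cornerChart_bd p' isOpen_univ (mem_univ p')
  obtain ⟨i, hi⟩ := h3 none (Or.inl ⟨rfl, h⟩)
  obtain ⟨i', hi'⟩ := h3' none (Or.inl ⟨rfl, h'⟩)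
  refine ⟨c.prod c', Fin.castAdd n i, Fin.natAdd n i', ⟨h1, h1'⟩, ?_, fun q hq => ⟨?_, ?_⟩⟩
  · intro h; have := congrArg Fin.val h; simp at this; omega
  · exact (appendVec_castAdd _ i).trans (h7 i none hi _ hq.1)
  · exact (appendVec_natAdd _ i').trans (h7' i' none hi' _ hq.2)

lemma isCentre₀ : IsCentre ((𝓠 n).prod (𝓠 n)) (n + n) (S.bd₀ ×ˢ S.bd₀) S.pair₀ :=
  S.isCoordPair₀.isCentre S.contMDiff_x₀_fst S.contMDiff_x₀_snd

section Stage

variable {X0 : Type*} [TopologicalSpace X0] [ChartedSpace (EuclideanQuadrant (n + n)) X0]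
  {β₀ : X0 → X × X} {α₀ : X0 → 𝓔 2}
  (hι : InitEmb (𝓠 (n + n)) (((𝓠 n).prod (𝓠 n)).prod (𝓡 2)) fun q => (β₀ q, α₀ q))
  (hr : range (fun q => (β₀ q, α₀ q)) = blowUpGraph S.pair₀)
include hι hr

/-- Coordinates where `x₁` vanishes on both factors, one of which vanishes only on the front face
if the point lies on it. -/
lemma exists_cornerChart_stage {q : X0} (h : S.x₁ (β₀ q).1 = 0) (h' : S.x₁ (β₀ q).2 = 0) :
    ∃ (c : CornerChart (𝓠 (n + n)) X0 (n + n)) (i i' : Fin (n + n)), q ∈ c.U ∧ i ≠ i' ∧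
      (∀ q ∈ c.U, c.ψ q i = S.x₁ (β₀ q).1 ∧ c.ψ q i' = S.x₁ (β₀ q).2) ∧
      (S.pair₀ (β₀ q) = 0 → ∃ j, j ≠ i ∧ j ≠ i' ∧ ∀ q ∈ c.U, c.ψ q j = 0 ↔ S.pair₀ (β₀ q) = 0) := by
  classical
  obtain ⟨c, lab, h1, -, h3, -, -, -, h7, -, -⟩ :=
    S.exists_cornerChart_bd (β₀ q).1 isOpen_univ (mem_univ _)
  obtain ⟨c', lab', h1', -, h3', -, -, -, h7', -, -⟩ :=
    S.exists_cornerChart_bd (β₀ q).2 isOpen_univ (mem_univ _)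
  obtain ⟨i, hi⟩ := h3 (some none) (Or.inr ⟨rfl, h⟩)
  obtain ⟨i', hi'⟩ := h3' (some none) (Or.inr ⟨rfl, h'⟩)
  have hc : ∀ w ∈ (c.prod c').U, (c.prod c').ψ w (Fin.castAdd n i) = S.x₁ w.1 ∧
      (c.prod c').ψ w (Fin.natAdd n i') = S.x₁ w.2 := fun w hw =>
    ⟨(appendVec_castAdd _ i).trans (h7 i _ hi _ hw.1), (appendVec_natAdd _ i').trans (h7' i' _ hi' _ hw.2)⟩
  have hne : ∀ i i' : Fin n, Fin.castAdd n i ≠ Fin.natAdd n i' := fun i i' h => by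
    have := congrArg Fin.val h; simp at this; omega
  by_cases hz : S.pair₀ (β₀ q) = 0
  · obtain ⟨hz1, hz2⟩ := pairMap_eq_zero.1 hz
    obtain ⟨j, hj⟩ := h3 none (Or.inl ⟨rfl, hz1⟩)
    obtain ⟨j', hj'⟩ := h3' none (Or.inl ⟨rfl, hz2⟩)
    have hji : j ≠ i := fun h => by rw [h, hi] at hj; simp at hj
    have hji' : j' ≠ i' := fun h => by rw [h, hi'] at hj'; simp at hj'
    have hg := isGenChart_pair S.contMDiff_x₀_fst S.contMDiff_x₀_snd (c.prod c') (hne j j') fun w hw =>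
      ⟨(appendVec_castAdd _ j).trans (h7 j _ hj _ hw.1), (appendVec_natAdd _ j').trans (h7' j' _ hj' _ hw.2)⟩
    obtain ⟨d, s, k1, k2, k3, -, k5, k6⟩ := hg.exists_lift hι hr (q := q) ⟨h1, h1'⟩
    have hiK : Fin.castAdd n i ∉ ({Fin.castAdd n j, Fin.natAdd n j'} : Finset _) := by
      rw [Finset.mem_insert, Finset.mem_singleton, Fin.castAdd_inj]
      exact not_or.2 ⟨hji.symm, hne _ _⟩
    have hiK' : Fin.natAdd n i' ∉ ({Fin.castAdd n j, Fin.natAdd n j'} : Finset _) := by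
      rw [Finset.mem_insert, Finset.mem_singleton, Fin.natAdd_inj]
      exact not_or.2 ⟨(hne _ _).symm, hji'.symm⟩
    have hs : s ≠ Fin.castAdd n i ∧ s ≠ Fin.natAdd n i' := ⟨fun h => hiK (h ▸ k3), fun h => hiK' (h ▸ k3)⟩
    exact ⟨d, _, _, k1, hne i i', fun q' hq' => ⟨(k6 q' hq' _ hiK).trans (hc _ (k2 q' hq')).1,
      (k6 q' hq' _ hiK').trans (hc _ (k2 q' hq')).2⟩,
      fun _ => ⟨s, hs.1, hs.2, k5⟩⟩
  · obtain ⟨d, k1, k2, -, k4⟩ := (c.prod c').exists_lift_of_ne_zero S.isCentre₀.contMDiff hι hr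
      (q := q) ⟨h1, h1'⟩ hz
    exact ⟨d, _, _, k1, hne i i', fun q' hq' => by rw [k4 q' hq']; exact hc _ (k2 q' hq').1,
      fun h => absurd h hz⟩

lemma isCoordPair₁ : IsCoordPair (𝓠 (n + n)) (n + n)
    (fun q => S.x₁ (β₀ q).1) fun q => S.x₁ (β₀ q).2 := fun _ h h' =>
  let ⟨c, i, i', h1, h2, h3, _⟩ := S.exists_cornerChart_stage hι hr h h'
  ⟨c, i, i', h1, h2, h3⟩

lemma blowUpLift_bd₁ : blowUpLift β₀ (S.bd₀ ×ˢ S.bd₀) (S.bd₁ ×ˢ S.bd₁) =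
    {q | S.x₁ (β₀ q).1 = 0 ∧ S.x₁ (β₀ q).2 = 0} := by
  have hβ : Continuous β₀ := (contMDiff_fst.comp hι.contMDiff).continuous
  have hx₁ := S.contMDiff_x₁.continuous
  refine Subset.antisymm (closure_minimal (fun q hq => ⟨hq.1.1, hq.1.2⟩) ?_) fun q hq => ?_
  · exact (isClosed_eq (by fun_prop) continuous_const).inter (isClosed_eq (by fun_prop) continuous_const)
  · by_cases hz : S.pair₀ (β₀ q) = 0
    · obtain ⟨c, i, i', h1, h2, h3, h4⟩ := S.exists_cornerChart_stage hι hr hq.1 hq.2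
      obtain ⟨j, hji, hji', hj⟩ := h4 hz
      obtain ⟨γ, hγ, hev⟩ := c.exists_push h1 j
      refine mem_closure_of_tendsto hγ ?_
      filter_upwards [hev, self_mem_nhdsWithin] with t ht (ht0 : 0 < t)
      obtain ⟨ht1, ht2, ht3⟩ := ht
      have h5 := h3 _ ht1
      rw [ht3 i hji.symm, ht3 i' hji'.symm, (h3 q h1).1, (h3 q h1).2, hq.1, hq.2] at h5
      refine ⟨⟨h5.1.symm, h5.2.symm⟩, fun h => ?_⟩
      have h6 := (hj _ ht1).2 (pairMap_eq_zero.2 ⟨h.1, h.2⟩)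
      rw [ht2, (hj q h1).2 hz] at h6
      linarith
    · exact subset_closure ⟨⟨hq.1, hq.2⟩, fun h => hz (pairMap_eq_zero.2 ⟨h.1, h.2⟩)⟩

lemma isCentre₁ : IsCentre (𝓠 (n + n)) (n + n)
    (blowUpLift β₀ (S.bd₀ ×ˢ S.bd₀) (S.bd₁ ×ˢ S.bd₁)) (S.pair₁ β₀) := by
  rw [S.blowUpLift_bd₁ hι hr]
  have hβ : ContMDiff (𝓠 (n + n)) ((𝓠 n).prod (𝓠 n)) ∞ β₀ := contMDiff_fst.comp hι.contMDiff
  exact (S.isCoordPair₁ hι hr).isCentre (S.contMDiff_x₁.comp (contMDiff_fst.comp hβ))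
    (S.contMDiff_x₁.comp (contMDiff_snd.comp hβ))

end Stage

omit [IsManifold (𝓠 n) ∞ X] in
/-- `X²_b`, with its blow-down map, as a subset of a product. -/
structure IsBDouble {Xb : Type*} [TopologicalSpace Xb] [ChartedSpace (EuclideanQuadrant (n + n)) Xb]
    (β : Xb → X × X) (a b : Xb → 𝓔 2) : Prop where
  initEmb : InitEmb (𝓠 (n + n))
    ((((𝓠 n).prod (𝓠 n)).prod (𝓡 2)).prod (𝓡 2)) fun q => ((β q, a q), b q)
  mem_range_iff : ∀ x, x ∈ range (fun q => ((β q, a q), b q)) ↔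
    (‖x.1.2‖ = 1 ∧ 0 ≤ x.1.2 0 ∧ 0 ≤ x.1.2 1 ∧ S.x₀ x.1.1.1 * x.1.2 1 = S.x₀ x.1.1.2 * x.1.2 0) ∧
    (‖x.2‖ = 1 ∧ 0 ≤ x.2 0 ∧ 0 ≤ x.2 1 ∧ S.x₁ x.1.1.1 * x.2 1 = S.x₁ x.1.1.2 * x.2 0)

lemma isBDouble_of_initEmb {X0 : Type*} [TopologicalSpace X0]
    [ChartedSpace (EuclideanQuadrant (n + n)) X0]
    {β₀ : X0 → X × X} {α₀ : X0 → 𝓔 2}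
    {Xb : Type*} [TopologicalSpace Xb] [ChartedSpace (EuclideanQuadrant (n + n)) Xb]
    {β₁ : Xb → X0} {α₁ : Xb → 𝓔 2}
    (hι : InitEmb (𝓠 (n + n)) (((𝓠 n).prod (𝓠 n)).prod (𝓡 2)) fun q => (β₀ q, α₀ q))
    (hr : range (fun q => (β₀ q, α₀ q)) = blowUpGraph S.pair₀)
    (hι' : InitEmb (𝓠 (n + n)) ((𝓠 (n + n)).prod (𝓡 2)) fun q => (β₁ q, α₁ q))
    (hr' : range (fun q => (β₁ q, α₁ q)) = blowUpGraph (S.pair₁ β₀)) :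
    S.IsBDouble (β₀ ∘ β₁) (α₀ ∘ β₁) α₁ := by
  have hβ : ContMDiff (𝓠 (n + n)) ((𝓠 n).prod (𝓠 n)) ∞ β₀ := contMDiff_fst.comp hι.contMDiff
  refine ⟨hι'.comp (hι.prodMap initEmb_id), fun x => ?_⟩
  have h0 := S.isCoordPair₀.mem_blowUpGraph_iff S.contMDiff_x₀_fst S.contMDiff_x₀_snd
    (fun w => S.x₀_nonneg w.1) (fun w => S.x₀_nonneg w.2)
  have h1 := (S.isCoordPair₁ hι hr).mem_blowUpGraph_iff
    (S.contMDiff_x₁.comp (contMDiff_fst.comp hβ)) (S.contMDiff_x₁.comp (contMDiff_snd.comp hβ))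
    (fun q => S.x₁_nonneg (β₀ q).1) (fun q => S.x₁_nonneg (β₀ q).2)
  constructor
  · rintro ⟨q, rfl⟩
    have e0 := (h0 (β₀ (β₁ q), α₀ (β₁ q))).1 (hr.subset (mem_range_self (β₁ q)))
    have e1 := (h1 (β₁ q, α₁ q)).1 (hr'.subset (mem_range_self q))
    exact ⟨e0, e1⟩
  · rintro ⟨hx, hx'⟩
    obtain ⟨q₀, hq₀⟩ := hr.symm.subset ((h0 x.1).2 hx)
    have hq₁ : β₀ q₀ = x.1.1 := congrArg Prod.fst hq₀
    rw [← hq₁] at hx'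
    obtain ⟨q, hq⟩ := hr'.symm.subset ((h1 (q₀, x.2)).2 hx')
    have e1 : β₁ q = q₀ := congrArg Prod.fst hq
    have e2 : α₁ q = x.2 := congrArg Prod.snd hq
    refine ⟨q, Prod.ext ?_ e2⟩
    simp only [Function.comp_apply, e1]
    exact hq₀

lemma exists_bDouble : ∃ (X0 : Type u) (_ : TopologicalSpace X0)
    (_ : ChartedSpace (EuclideanQuadrant (n + n)) X0) (_ : IsManifold (𝓠 (n + n)) ∞ X0)
    (Xb : Type u) (_ : TopologicalSpace Xb)
    (_ : ChartedSpace (EuclideanQuadrant (n + n)) Xb) (_ : IsManifold (𝓠 (n + n)) ∞ Xb)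
    (β₀ : X0 → X × X) (β₁ : Xb → X0) (a b : Xb → 𝓔 2),
    IsBlowUp ((𝓠 n).prod (𝓠 n)) (𝓠 (n + n)) β₀ (S.bd₀ ×ˢ S.bd₀) ∧
    IsBlowUp (𝓠 (n + n)) (𝓠 (n + n)) β₁
      (blowUpLift β₀ (S.bd₀ ×ˢ S.bd₀) (S.bd₁ ×ˢ S.bd₁)) ∧ S.IsBDouble (β₀ ∘ β₁) a b := by
  obtain ⟨X0, t0, c0, m0, β₀, α₀, h1, h2⟩ := S.isCentre₀.exists_blowUp fun p => by
    obtain ⟨c, hc, -⟩ := exists_cornerChart_quadrant (n := n) p.1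
    obtain ⟨c', hc', -⟩ := exists_cornerChart_quadrant (n := n) p.2
    exact ⟨c.prod c', hc, hc'⟩
  obtain ⟨Xb, tb, cb, mb, β₁, α₁, h3, h4⟩ := (S.isCentre₁ h1 h2).exists_blowUp fun p =>
    let ⟨c, hc, _⟩ := exists_cornerChart_quadrant (n := n + n) p
    ⟨c, hc⟩
  exact ⟨X0, t0, c0, m0, Xb, tb, cb, mb, β₀, β₁, _, _, S.isCentre₀.isBlowUp h1 h2,
    (S.isCentre₁ h1 h2).isBlowUp h3 h4, S.isBDouble_of_initEmb h1 h2 h3 h4⟩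

lemma exists_isBDouble {X0 : Type*} [TopologicalSpace X0]
    [ChartedSpace (EuclideanQuadrant (n + n)) X0]
    {β₀ : X0 → X × X} {Xb : Type*} [TopologicalSpace Xb] [ChartedSpace (EuclideanQuadrant (n + n)) Xb]
    {β₁ : Xb → X0}
    (h₀ : IsBlowUp ((𝓠 n).prod (𝓠 n)) (𝓠 (n + n)) β₀ (S.bd₀ ×ˢ S.bd₀))
    (h₁ : IsBlowUp (𝓠 (n + n)) (𝓠 (n + n)) β₁ (blowUpLift β₀ (S.bd₀ ×ˢ S.bd₀) (S.bd₁ ×ˢ S.bd₁))) :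
    ∃ a b : Xb → 𝓔 2, S.IsBDouble (β₀ ∘ β₁) a b := by
  obtain ⟨α₀, h1, h2⟩ := S.isCentre₀.exists_initEmb h₀
  obtain ⟨α₁, h3, h4⟩ := (S.isCentre₁ h1 h2).exists_initEmb h₁
  exact ⟨_, _, S.isBDouble_of_initEmb h1 h2 h3 h4⟩

end FiberedBoundary

/-! ### The centre of the second blow-up -/

/-- The unit vector with given slope. -/
def slopeDir (s : ℝ) : 𝓔 2 := !₂[(√(1 + s ^ 2))⁻¹, s * (√(1 + s ^ 2))⁻¹]

lemma slopeDir_zero_pos (s : ℝ) : 0 < slopeDir s 0 := by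
  change 0 < (√(1 + s ^ 2))⁻¹
  positivity

lemma slopeDir_one (s : ℝ) : slopeDir s 1 = s * slopeDir s 0 := rfl

lemma norm_eq_one_iff_fin_two (v : 𝓔 2) : ‖v‖ = 1 ↔ v 0 ^ 2 + v 1 ^ 2 = 1 := by
  rw [EuclideanSpace.norm_eq, Real.sqrt_eq_one]; simp [Fin.sum_univ_two]

lemma norm_slopeDir (s : ℝ) : ‖slopeDir s‖ = 1 := by
  rw [norm_eq_one_iff_fin_two, slopeDir_one]
  change (√(1 + s ^ 2))⁻¹ ^ 2 + (s * (√(1 + s ^ 2))⁻¹) ^ 2 = 1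
  have h : (0 : ℝ) < 1 + s ^ 2 := by positivity
  rw [mul_pow, inv_pow, Real.sq_sqrt h.le]
  field_simp

lemma eq_slopeDir {v : 𝓔 2} (h : ‖v‖ = 1) (h0 : 0 < v 0) : v = slopeDir (v 1 / v 0) := by
  have h1 := (norm_eq_one_iff_fin_two v).1 h
  have h2 := (norm_eq_one_iff_fin_two _).1 (norm_slopeDir (v 1 / v 0))
  have h3 := slopeDir_zero_pos (v 1 / v 0)
  have h4 := slopeDir_one (v 1 / v 0)
  have h5 : v 1 = v 1 / v 0 * v 0 := by field_simp
  have h6 : v 0 = slopeDir (v 1 / v 0) 0 := by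
    rw [h4] at h2
    rw [h5] at h1
    have h7 : (1 + (v 1 / v 0) ^ 2) * (v 0 ^ 2 - slopeDir (v 1 / v 0) 0 ^ 2) = 0 := by
      linear_combination h1 - h2
    have h8 : v 0 ^ 2 = slopeDir (v 1 / v 0) 0 ^ 2 := by
      have : (1 + (v 1 / v 0) ^ 2) ≠ 0 := by positivity
      linarith [(mul_eq_zero.1 h7).resolve_left this]
    exact (pow_left_inj₀ h0.le h3.le two_ne_zero).1 h8
  ext j
  fin_cases j
  · exact h6
  · change v 1 = slopeDir (v 1 / v 0) 1
    rw [h4, ← h6]; exact h5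

lemma contDiff_slopeDir : ContDiff ℝ ∞ slopeDir := by
  have h1 : ContDiff ℝ ∞ fun s : ℝ => (√(1 + s ^ 2))⁻¹ := by
    refine ContDiff.inv (ContDiff.sqrt (by fun_prop) fun s => by positivity) fun s => by positivity
  refine (PiLp.contDiff_toLp (p := 2)).comp (contDiff_pi.2 fun i => ?_)
  fin_cases i
  exacts [h1, contDiff_id.mul h1]

/-- The value of a labelled function at a displaced point: boundary defining functions are
multiplied, other functions are translated. -/
def moveLabel {ι : Type*} : Option (Option ι) → ℝ → ℝ → ℝ
  | none, h, z => h * (1 + z)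
  | some none, h, z => h * (1 + z)
  | some (some _), h, z => h + z

lemma contDiff_moveLabel {ι : Type*} (a : Option (Option ι)) :
    ContDiff ℝ ∞ fun x : ℝ × ℝ => moveLabel a x.1 x.2 := by
  rcases a with _ | _ | j <;> simp only [moveLabel] <;> fun_prop

namespace FiberedBoundary

/-- The ambient space of `X²_b`. -/
abbrev BAmbient (X : Type*) := ((X × X) × 𝓔 2) × 𝓔 2

/-- The model of the ambient space of `X²_b`. -/
abbrev bModel (n : ℕ) := (((𝓠 n).prod (𝓠 n)).prod (𝓡 2)).prod (𝓡 2)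

variable {N : ℕ}

/-- Functions on the ambient space of `X²_b` that vanish at the lift of the fibre product. -/
def BaseFunctions.num (B : S.BaseFunctions N) : 𝓛 N → BAmbient X → ℝ
  | none, y => y.1.2 1 - y.1.2 0
  | some none, y => y.2 1 - y.2 0
  | some (some j), y => B.ext j y.1.1.2 - B.ext j y.1.1.1

/-- Denominators that turn the functions `num` into displacements. -/
def den : 𝓛 N → BAmbient X → ℝ
  | none, y => y.1.2 0
  | some none, y => y.2 0
  | some (some _), _ => 1

variable (S) in
/-- A defining function of the front face over `(∂₀X)²`. -/
def frontFun (y : BAmbient X) : ℝ := S.x₀ y.1.1.1 * y.1.2 0 + S.x₀ y.1.1.2 * y.1.2 1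

/-- The functions defining the lift of the fibre product. -/
def BaseFunctions.centreMap (B : S.BaseFunctions N) (y : BAmbient X) :
    ℱ N :=
  toLp 2 fun o => o.elim (S.frontFun y) fun a => B.num a y

/-- The coordinates of a displaced point. -/
def BaseFunctions.moveVec (B : S.BaseFunctions N) (lab : Fin n → Option (𝓛 N)) (w : X × 𝓔 n) :
    𝓔 n :=
  toLp 2 fun i => (lab i).elim (w.2 i) fun a => moveLabel a (S.gen B.ext a w.1) (w.2 i)

section Smooth

lemma contMDiff_left : ContMDiff (bModel n) (𝓠 n) ∞ fun y : BAmbient X => y.1.1.1 :=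
  contMDiff_fst.comp (contMDiff_fst.comp contMDiff_fst)

lemma contMDiff_right : ContMDiff (bModel n) (𝓠 n) ∞ fun y : BAmbient X => y.1.1.2 :=
  contMDiff_snd.comp (contMDiff_fst.comp contMDiff_fst)

lemma contMDiff_slope₀ (i : Fin 2) : ContMDiff (bModel n) 𝓘(ℝ, ℝ) ∞ fun y : BAmbient X => y.1.2 i :=
  (coordL i).contMDiff.comp (contMDiff_snd.comp contMDiff_fst)

lemma contMDiff_slope₁ (i : Fin 2) : ContMDiff (bModel n) 𝓘(ℝ, ℝ) ∞ fun y : BAmbient X => y.2 i :=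
  (coordL i).contMDiff.comp contMDiff_snd

lemma BaseFunctions.contMDiff_num (B : S.BaseFunctions N) (a : 𝓛 N) :
    ContMDiff (bModel n) 𝓘(ℝ, ℝ) ∞ (B.num a) := by
  rcases a with _ | _ | j
  · exact (contMDiff_slope₀ 1).sub (contMDiff_slope₀ 0)
  · exact (contMDiff_slope₁ 1).sub (contMDiff_slope₁ 0)
  · exact ((B.smooth_ext j).comp contMDiff_right).sub ((B.smooth_ext j).comp contMDiff_left)

lemma contMDiff_den (a : 𝓛 N) : ContMDiff (bModel n) 𝓘(ℝ, ℝ) ∞ (den a : BAmbient X → ℝ) := by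
  rcases a with _ | _ | j
  exacts [contMDiff_slope₀ 0, contMDiff_slope₁ 0, contMDiff_const]

variable (S) in
lemma contMDiff_frontFun : ContMDiff (bModel n) 𝓘(ℝ, ℝ) ∞ S.frontFun :=
  ((S.contMDiff_x₀.comp contMDiff_left).mul (contMDiff_slope₀ 0)).add
    ((S.contMDiff_x₀.comp contMDiff_right).mul (contMDiff_slope₀ 1))

lemma BaseFunctions.contMDiff_centreMap (B : S.BaseFunctions N) : ContMDiff (bModel n)
    𝓘(ℝ, ℱ N) ∞ B.centreMap := by
  refine (PiLp.contDiff_toLp (p := 2)).contMDiff.comp (contMDiff_pi_space.2 fun o => ?_)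
  rcases o with _ | a
  exacts [S.contMDiff_frontFun, B.contMDiff_num a]

lemma BaseFunctions.contMDiff_moveVec (B : S.BaseFunctions N) (lab : Fin n → Option (𝓛 N)) :
    ContMDiff (𝓣 n) (𝓡 n) ∞ (B.moveVec lab) := by
  refine (PiLp.contDiff_toLp (p := 2)).contMDiff.comp (contMDiff_pi_space.2 fun i => ?_)
  have h : ContMDiff (𝓣 n) 𝓘(ℝ, ℝ) ∞ fun w : X × 𝓔 n => w.2 i :=
    (coordL i).contMDiff.comp contMDiff_snd
  rcases hl : lab i with _ | a
  · simpa [hl] using h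
  · simp only [Option.elim_some]
    exact (contDiff_moveLabel a).contMDiff.comp
      (((B.contMDiff_gen a).comp contMDiff_fst).prodMk_space h)

end Smooth

/-- The part of the ambient space of `X²_b` that contains the centre of the second blow-up. -/
def bPos (X : Type*) : Set (BAmbient X) := {y | (0 < y.1.2 0 ∧ 0 < y.1.2 1) ∧ 0 < y.2 0 ∧ 0 < y.2 1}

omit [ChartedSpace (EuclideanQuadrant n) X] in
lemma isOpen_bPos : IsOpen (bPos X) := by
  have h : ∀ i, IsOpen {y : BAmbient X | 0 < y.1.2 i} := fun i =>
    isOpen_lt continuous_const (by fun_prop)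
  have h' : ∀ i, IsOpen {y : BAmbient X | 0 < y.2 i} := fun i =>
    isOpen_lt continuous_const (by fun_prop)
  exact ((h 0).inter (h 1)).inter ((h' 0).inter (h' 1))

omit [TopologicalSpace X] [ChartedSpace (EuclideanQuadrant n) X] in
lemma den_pos {y : BAmbient X} (hy : y ∈ bPos X) (a : 𝓛 N) : 0 < den a y := by
  rcases a with _ | _ | j
  exacts [hy.1.1, hy.2.1, one_pos]

variable (S) in
/-- The equations of `X²_b`. -/
def BEq (y : BAmbient X) : Prop :=
  (‖y.1.2‖ = 1 ∧ 0 ≤ y.1.2 0 ∧ 0 ≤ y.1.2 1 ∧ S.x₀ y.1.1.1 * y.1.2 1 = S.x₀ y.1.1.2 * y.1.2 0) ∧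
    (‖y.2‖ = 1 ∧ 0 ≤ y.2 0 ∧ 0 ≤ y.2 1 ∧ S.x₁ y.1.1.1 * y.2 1 = S.x₁ y.1.1.2 * y.2 0)

lemma BaseFunctions.gen_right (B : S.BaseFunctions N) {y : BAmbient X} (hy : S.BEq y)
    (hpos : y ∈ bPos X) (a : 𝓛 N) :
    S.gen B.ext a y.1.1.2 = moveLabel a (S.gen B.ext a y.1.1.1) (B.num a y / den a y) := by
  rcases a with _ | _ | j
  · have h1 := hpos.1.1.ne'
    simp only [gen, moveLabel, num, den]
    field_simp
    linear_combination -hy.1.2.2.2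
  · have h1 := hpos.2.1.ne'
    simp only [gen, moveLabel, num, den]
    field_simp
    linear_combination -hy.2.2.2.2
  · simp [gen, moveLabel, num, den]

lemma x₀_left_eq {y : BAmbient X} (hy : S.BEq y) : S.x₀ y.1.1.1 = S.frontFun y * y.1.2 0 := by
  have h := (norm_eq_one_iff_fin_two _).1 hy.1.1
  rw [frontFun]
  linear_combination -S.x₀ y.1.1.1 * h + y.1.2 1 * hy.1.2.2.2

lemma x₀_right_eq {y : BAmbient X} (hy : S.BEq y) : S.x₀ y.1.1.2 = S.frontFun y * y.1.2 1 := by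
  have h := (norm_eq_one_iff_fin_two _).1 hy.1.1
  rw [frontFun]
  linear_combination -S.x₀ y.1.1.2 * h - y.1.2 0 * hy.1.2.2.2

lemma frontFun_nonneg {y : BAmbient X} (hy : S.BEq y) : 0 ≤ S.frontFun y :=
  add_nonneg (mul_nonneg (S.x₀_nonneg _) hy.1.2.1) (mul_nonneg (S.x₀_nonneg _) hy.1.2.2.1)

lemma BaseFunctions.centreMap_eq_zero_iff (B : S.BaseFunctions N) {y : BAmbient X} (hy : S.BEq y) :
    B.centreMap y = 0 ↔ (S.x₀ y.1.1.1 = 0 ∧ S.x₀ y.1.1.2 = 0 ∧ S.φ y.1.1.1 = S.φ y.1.1.2) ∧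
      y.1.2 0 = y.1.2 1 ∧ y.2 0 = y.2 1 := by
  constructor
  · intro h
    have h' : ∀ o, B.centreMap y o = 0 := fun o => by rw [h]; rfl
    have h0 : S.frontFun y = 0 := h' none
    have h1 : ∀ a, B.num a y = 0 := fun a => h' (some a)
    have h2 : S.x₀ y.1.1.1 = 0 := by rw [x₀_left_eq hy, h0, zero_mul]
    have h3 : S.x₀ y.1.1.2 = 0 := by rw [x₀_right_eq hy, h0, zero_mul]
    refine ⟨⟨h2, h3, B.injective_e ?_⟩, (sub_eq_zero.1 (h1 none)).symm,
      (sub_eq_zero.1 (h1 (some none))).symm⟩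
    ext j
    rw [← B.ext_eq j _ h2, ← B.ext_eq j _ h3]
    exact (sub_eq_zero.1 (h1 (some (some j)))).symm
  · rintro ⟨⟨h1, h2, h3⟩, h4, h5⟩
    ext o
    rcases o with _ | _ | _ | j
    · change S.frontFun y = 0
      rw [frontFun, h1, h2]; simp
    · exact sub_eq_zero.2 h4.symm
    · exact sub_eq_zero.2 h5.symm
    · change B.ext j _ - B.ext j _ = 0
      rw [B.ext_eq j _ h1, B.ext_eq j _ h2, h3, sub_self]

omit [TopologicalSpace X] [ChartedSpace (EuclideanQuadrant n) X] in
lemma pos_of_norm_eq_one {v : 𝓔 2} (h : ‖v‖ = 1) (h0 : 0 ≤ v 0)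
    (h1 : v 0 = v 1) : 0 < v 0 ∧ 0 < v 1 := by
  have h2 := (norm_eq_one_iff_fin_two v).1 h
  have h3 : v 0 ≠ 0 := fun h => by rw [← h1, h] at h2; norm_num at h2
  have h4 := lt_of_le_of_ne h0 h3.symm
  exact ⟨h4, h1 ▸ h4⟩

lemma BaseFunctions.mem_bPos (B : S.BaseFunctions N) {y : BAmbient X} (hy : S.BEq y)
    (h : B.centreMap y = 0) : y ∈ bPos X :=
  have h' := ((B.centreMap_eq_zero_iff hy).1 h).2
  ⟨pos_of_norm_eq_one hy.1.1 hy.1.2.1 h'.1, pos_of_norm_eq_one hy.2.1 hy.2.2.1 h'.2⟩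

end FiberedBoundary

variable {N : ℕ} {B : S.BaseFunctions N} {D : PhiBDouble S}

namespace FiberedBoundary

section Labels

/-- The moved coordinates satisfy the inequalities of the corner. -/
lemma LabChart.moveVec_mem {p : X} (L : S.LabChart B p) {w : X × 𝓔 n}
    (hpos : ∀ i, (L.lab i = some none ∨ L.lab i = some (some none)) → 0 < 1 + w.2 i) :
    B.moveVec L.lab w ∈ cornerSet L.c.J := by
  intro i hi
  obtain ⟨a, ha, hia⟩ := (L.mem_J i).1 hi
  simp only [BaseFunctions.moveVec, hia, Option.elim_some]
  rcases ha with ⟨rfl, -⟩ | ⟨rfl, -⟩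
  · exact mul_nonneg (S.x₀_nonneg _) (hpos i (Or.inl hia)).le
  · exact mul_nonneg (S.x₁_nonneg _) (hpos i (Or.inr hia)).le

lemma LabChart.gen_moveVec {p : X} (L : S.LabChart B p) {w : X × 𝓔 n}
    (hw : B.moveVec L.lab w ∈ L.c.O ∩ cornerSet L.c.J) {i : Fin n} {a : 𝓛 N}
    (hi : L.lab i = some a) :
    S.gen B.ext a (L.c.χ (B.moveVec L.lab w)) = moveLabel a (S.gen B.ext a w.1) (w.2 i) := by
  rw [← L.coord i a hi _ (L.c.mapsTo_χ' hw), L.c.right_inv hw]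
  simp [BaseFunctions.moveVec, hi]

end Labels

/-- Coordinates of the second factor relative to the first one. -/
def LabChart.relCoord {p : X} (L : S.LabChart B p) (y : BAmbient X) : 𝓔 n :=
  toLp 2 fun i => (L.lab i).elim (L.c.ψ y.1.1.2 i) fun a => B.num a y / den a y

section Chart

lemma LabChart.contMDiffOn_relCoord {p : X} (L : S.LabChart B p) :
    ContMDiffOn (bModel n) (𝓡 n) ∞ L.relCoord (bPos X ∩ {y | y.1.1.2 ∈ L.c.U}) := by
  refine (PiLp.contDiff_toLp (p := 2)).contMDiff.comp_contMDiffOn (contMDiffOn_pi_space.2 fun i => ?_)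
  rcases hl : L.lab i with _ | a
  · simp only [Option.elim_none]
    exact (L.c.smooth_coord i).comp contMDiff_right.contMDiffOn fun y hy => hy.2
  · simp only [Option.elim_some]
    exact (B.contMDiff_num a).contMDiffOn.div₀ (contMDiff_den a).contMDiffOn fun y hy =>
      (den_pos hy.1 a).ne'

lemma LabChart.moveVec_relCoord {p : X} (L : S.LabChart B p) {y : BAmbient X} (hy : S.BEq y)
    (hpos : y ∈ bPos X) (hU : y.1.1.2 ∈ L.c.U) :
    B.moveVec L.lab (y.1.1.1, L.relCoord y) = L.c.ψ y.1.1.2 := by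
  ext i
  simp only [BaseFunctions.moveVec, relCoord]
  rcases hl : L.lab i with _ | a
  · simp
  · simp only [Option.elim_some]
    rw [L.coord i a hl _ hU, B.gen_right hy hpos]

lemma LabChart.one_add_relCoord {p : X} (L : S.LabChart B p) {y : BAmbient X}
    (hpos : y ∈ bPos X) (i : Fin n) :
    (L.lab i = some none → 1 + L.relCoord y i = y.1.2 1 / y.1.2 0) ∧
      (L.lab i = some (some none) → 1 + L.relCoord y i = y.2 1 / y.2 0) := by
  have h1 := hpos.1.1.ne'
  have h2 := hpos.2.1.ne'
  constructor <;> intro h <;>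
    simp only [relCoord, h, Option.elim_some, BaseFunctions.num, den] <;> field_simp <;> ring

/-- Coordinates near the centre of the second blow-up: coordinates of the left factor and relative
coordinates of the right factor. -/
lemma exists_embChart_BEq {W : Set (BAmbient X)} (hW : ∀ y, y ∈ W ↔ S.BEq y) {p p' : X}
    (L : S.LabChart B p) (L' : S.LabChart B p') (hp' : S.x₀ p' = 0)
    (hlab : ∀ a, (∃ i, L.lab i = some a) ↔ ∃ i, L'.lab i = some a) :
    ∃ c : EmbChart (bModel n) W (n + n),
      (∀ y ∈ W, y ∈ c.U ↔ y ∈ bPos X ∧ y.1.1.1 ∈ L.c.U ∧ y.1.1.2 ∈ L'.c.U) ∧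
      c.ψ = fun y => appendVec (L.c.ψ y.1.1.1, L'.relCoord y) := by
  classical
  obtain ⟨i₀, hi₀⟩ := L'.exists_lab none (Or.inl ⟨rfl, hp'⟩)
  let W₁ : Set (X × 𝓔 n) := {w | B.moveVec L'.lab w ∈ L'.c.O} ∩
    {w | ∀ i, (L'.lab i = some none ∨ L'.lab i = some (some none)) → 0 < 1 + w.2 i}
  have hW₁ : IsOpen W₁ := by
    refine (L'.c.isOpen_O.preimage (B.contMDiff_moveVec L'.lab).continuous).inter ?_
    simp only [ofPred_forall]
    exact isOpen_iInter_of_finite fun i => isOpen_iInter_of_finite fun _ =>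
      isOpen_lt continuous_const (by fun_prop)
  obtain ⟨c₀, h1, h2, h3, h4, h5⟩ := (L.c.prod (EmbChart.refl n)).exists_restrict hW₁
  have hcU : ∀ w, w ∈ c₀.U ↔ w.1 ∈ L.c.U ∧ w ∈ W₁ := fun w => by
    rw [h1]; exact ⟨fun h => ⟨h.1.1, h.2⟩, fun h => ⟨⟨h.1, mem_univ _⟩, h.2⟩⟩
  have hmv : ∀ w ∈ c₀.U, B.moveVec L'.lab w ∈ L'.c.O ∩ cornerSet L'.c.J := fun w hw =>
    ⟨((hcU w).1 hw).2.1, L'.moveVec_mem ((hcU w).1 hw).2.2⟩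
  have hR : ContMDiffOn (𝓣 n) (𝓠 n) ∞ (fun w => L'.c.χ (B.moveVec L'.lab w)) c₀.U :=
    L'.c.smooth_χ.comp (B.contMDiff_moveVec L'.lab).contMDiffOn hmv
  have hcoord : ∀ i, ContMDiff (𝓣 n) 𝓘(ℝ, ℝ) ∞
      fun w : X × 𝓔 n => 1 + w.2 i := fun i => contMDiff_const.add
    ((coordL i).contMDiff.comp contMDiff_snd)
  -- the ratio of the values of `x₁`
  obtain ⟨s₁, hs, hspos, hsx, hsq⟩ : ∃ s₁ : X × 𝓔 n → ℝ,
      ContMDiffOn (𝓣 n) 𝓘(ℝ, ℝ) ∞ s₁ c₀.U ∧ (∀ w ∈ c₀.U, 0 < s₁ w) ∧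
      (∀ w ∈ c₀.U, S.x₁ (L'.c.χ (B.moveVec L'.lab w)) = S.x₁ w.1 * s₁ w ∧
        ∀ i, L'.lab i = some (some none) → s₁ w = 1 + w.2 i) ∧
      ∀ y, S.BEq y → y ∈ bPos X → y.1.1.1 ∈ L.c.U → y.1.1.2 ∈ L'.c.U →
        y.2 1 / y.2 0 = s₁ (y.1.1.1, L'.relCoord y) := by
    by_cases hx : ∃ i, L'.lab i = some (some none)
    · obtain ⟨i, hi⟩ := hx
      refine ⟨fun w => 1 + w.2 i, (hcoord i).contMDiffOn, fun w hw => ((hcU w).1 hw).2.2 i (Or.inr hi),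
        fun w hw => ⟨L'.gen_moveVec (hmv w hw) hi, fun j hj => by rw [L'.lab_inj i j _ hi hj]⟩,
        fun y _ hpos _ _ => ((L'.one_add_relCoord hpos i).2 hi).symm⟩
    · have hx' : ¬ ∃ i, L.lab i = some (some none) := fun h => hx ((hlab _).1 h)
      have hne : ∀ q ∈ L.c.U, S.x₁ q ≠ 0 := L.x₁_ne fun h => hx' (L.exists_lab _ (Or.inr ⟨rfl, h⟩))
      have hne' : ∀ q ∈ L'.c.U, S.x₁ q ≠ 0 := L'.x₁_ne fun h => hx (L'.exists_lab _ (Or.inr ⟨rfl, h⟩))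
      have hpos : ∀ q, S.x₁ q ≠ 0 → 0 < S.x₁ q := fun q h => lt_of_le_of_ne (S.x₁_nonneg q) h.symm
      refine ⟨fun w => S.x₁ (L'.c.χ (B.moveVec L'.lab w)) / S.x₁ w.1, ?_, fun w hw => ?_,
        fun w hw => ⟨?_, fun i hi => absurd ⟨i, hi⟩ hx⟩, fun y hy hyp hyU hyU' => ?_⟩
      · exact (S.contMDiff_x₁.comp_contMDiffOn hR).div₀ (S.contMDiff_x₁.comp contMDiff_fst).contMDiffOn
          fun w hw => hne _ ((hcU w).1 hw).1
      · exact div_pos (hpos _ (hne' _ (L'.c.mapsTo_χ' (hmv w hw)))) (hpos _ (hne _ ((hcU w).1 hw).1))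
      · have := hne _ ((hcU w).1 hw).1
        field_simp
      · have h6 := hne _ hyU
        have h7 := hyp.2.1.ne'
        simp only [L'.moveVec_relCoord hy hyp hyU', L'.c.left_inv' hyU']
        field_simp
        linear_combination hy.2.2.2.2
  have hN : IsOpen (bPos X ∩ {y | y.1.1.1 ∈ L.c.U ∧ y.1.1.2 ∈ L'.c.U}) :=
    isOpen_bPos.inter ((L.c.isOpen_U.preimage (contMDiff_left (n := n)).continuous).inter
      (L'.c.isOpen_U.preimage (contMDiff_right (n := n)).continuous))
  obtain ⟨c, k1, k2, k3, k4, k5, k6⟩ := c₀.exists_transport (W := W) hN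
    (Φ := fun y => (y.1.1.1, L'.relCoord y))
    (Ξ := fun w => (((w.1, L'.c.χ (B.moveVec L'.lab w)), slopeDir (1 + w.2 i₀)), slopeDir (s₁ w)))
    (I := bModel n)
    (contMDiff_left.contMDiffOn.prodMk (L'.contMDiffOn_relCoord.mono fun y hy => ⟨hy.2.1, hy.2.2.2⟩))
    (fun y hy => mem_univ _)
    (((contMDiffOn_fst.prodMk (hR.mono inter_subset_right)).prodMk
      (contDiff_slopeDir.contMDiff.comp_contMDiffOn (hcoord i₀).contMDiffOn)).prodMk
        (contDiff_slopeDir.contMDiff.comp_contMDiffOn (hs.mono inter_subset_right)))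
    (fun w ⟨_, hw⟩ => by
      have hs0 := ((hcU w).1 hw).2.2 i₀ (Or.inl hi₀)
      have hs1 := hspos w hw
      have d0 := slopeDir_zero_pos (1 + w.2 i₀)
      have d1 := slopeDir_zero_pos (s₁ w)
      have d0' : 0 < slopeDir (1 + w.2 i₀) 1 := by rw [slopeDir_one]; positivity
      have d1' : 0 < slopeDir (s₁ w) 1 := by rw [slopeDir_one]; positivity
      refine ⟨(hW _).2 ⟨⟨norm_slopeDir _, d0.le, d0'.le, ?_⟩, norm_slopeDir _, d1.le, d1'.le, ?_⟩,
        ⟨⟨d0, d0'⟩, d1, d1'⟩, ((hcU w).1 hw).1, L'.c.mapsTo_χ' (hmv w hw)⟩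
      · have h6 : S.x₀ (L'.c.χ (B.moveVec L'.lab w)) = S.x₀ w.1 * (1 + w.2 i₀) :=
          L'.gen_moveVec (hmv w hw) hi₀
        simp only [slopeDir_one, h6]; ring
      · simp only [slopeDir_one, (hsx w hw).1]; ring)
    (fun y ⟨hy, hpos, hyU, hyU'⟩ _ => by
      have hy' := (hW y).1 hy
      simp only [L'.moveVec_relCoord hy' hpos hyU', L'.c.left_inv' hyU',
        (L'.one_add_relCoord hpos i₀).1 hi₀, ← hsq y hy' hpos hyU hyU',
        ← eq_slopeDir hy'.1.1 hpos.1.1, ← eq_slopeDir hy'.2.1 hpos.2.1])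
    (fun w ⟨_, hw⟩ => by
      refine Prod.ext rfl ?_
      ext i
      simp only [LabChart.relCoord]
      rcases hl : L'.lab i with _ | _ | _ | j
      · simp only [Option.elim_none, L'.c.right_inv (hmv w hw)]
        simp [BaseFunctions.moveVec, hl]
      · have := (slopeDir_zero_pos (1 + w.2 i₀)).ne'
        simp only [Option.elim_some, BaseFunctions.num, den, slopeDir_one]
        rw [L'.lab_inj i i₀ _ hl hi₀]
        field_simp; ring
      · have := (slopeDir_zero_pos (s₁ w)).ne'
        simp only [Option.elim_some, BaseFunctions.num, den, slopeDir_one]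
        have h6 := (hsx w hw).2 i hl
        field_simp
        linarith
      · have h6 : B.ext j (L'.c.χ (B.moveVec L'.lab w)) = B.ext j w.1 + w.2 i :=
          L'.gen_moveVec (hmv w hw) hl
        simp [BaseFunctions.num, den, h6])
  refine ⟨c, fun y hy => ?_, by rw [k4, h3]; rfl⟩
  rw [k1 y hy]
  refine ⟨fun h => h.1, fun h => ⟨h, (hcU _).2 ⟨h.2.1, ?_, fun i hi => ?_⟩⟩⟩
  · change B.moveVec _ _ ∈ L'.c.O
    rw [L'.moveVec_relCoord ((hW y).1 hy) h.1 h.2.2]; exact (L'.c.mapsTo_ψ' h.2.2).1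
  · have h6 := L'.one_add_relCoord h.1 i
    rcases hi with hi | hi
    · rw [h6.1 hi]; exact div_pos h.1.1.2 h.1.1.1
    · rw [h6.2 hi]; exact div_pos h.1.2.2 h.1.2.1

end Chart

end FiberedBoundary

lemma InitEmb.tendsto_nhds_iff {E H E' H' : Type*} [NormedAddCommGroup E] [NormedSpace ℝ E]
    [TopologicalSpace H] [NormedAddCommGroup E'] [NormedSpace ℝ E'] [TopologicalSpace H']
    {I : ModelWithCorners ℝ E H} {I' : ModelWithCorners ℝ E' H'} {P P' : Type*}
    [TopologicalSpace P] [ChartedSpace H P] [TopologicalSpace P'] [ChartedSpace H' P'] {ι : P → P'}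
    (h : InitEmb I I' ι) {T : Type*} {l : Filter T} {g : T → P} {x : P} :
    Tendsto g l (𝓝 x) ↔ Tendsto (ι ∘ g) l (𝓝 (ι x)) :=
  h.isEmbedding.tendsto_nhds_iff

namespace FiberedBoundary

section Push

variable [IsManifold (𝓠 n) ∞ X]

variable (S) in
lemma exists_push_x₀ {p : X} (hp : S.x₀ p = 0) : ∃ γ : ℝ → X, Tendsto γ (𝓝[>] 0) (𝓝 p) ∧
    ∀ᶠ t in 𝓝[>] 0, S.x₀ (γ t) = t ∧ (S.x₁ p = 0 → S.x₁ (γ t) = 0) := by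
  obtain ⟨c, lab, h1, -, h3, -, -, -, h7, -, -⟩ := S.exists_cornerChart_bd p isOpen_univ (mem_univ p)
  obtain ⟨i, hi⟩ := h3 none (Or.inl ⟨rfl, hp⟩)
  obtain ⟨γ, hγ, hev⟩ := c.exists_push h1 i
  have hc : ∀ q ∈ c.U, c.ψ q i = S.x₀ q := h7 i none hi
  refine ⟨γ, hγ, hev.mono fun t ht => ⟨?_, fun hx => ?_⟩⟩
  · rw [← hc _ ht.1, ht.2.1, hc p h1, hp, zero_add]
  · obtain ⟨j, hj⟩ := h3 (some none) (Or.inr ⟨rfl, hx⟩)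
    have hcj : ∀ q ∈ c.U, c.ψ q j = S.x₁ q := h7 j _ hj
    rw [← hcj _ ht.1, ht.2.2 j (fun h => by rw [h, hi] at hj; simp at hj), hcj p h1, hx]

variable (S) in
lemma exists_push_x₁ {p : X} (hp : S.x₁ p = 0) : ∃ γ : ℝ → X, Tendsto γ (𝓝[>] 0) (𝓝 p) ∧
    ∀ᶠ t in 𝓝[>] 0, S.x₁ (γ t) = t ∧ (S.x₀ p = 0 → S.x₀ (γ t) = 0) := by
  obtain ⟨c, lab, h1, -, h3, -, -, -, h7, -, -⟩ := S.exists_cornerChart_bd p isOpen_univ (mem_univ p)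
  obtain ⟨i, hi⟩ := h3 (some none) (Or.inr ⟨rfl, hp⟩)
  obtain ⟨γ, hγ, hev⟩ := c.exists_push h1 i
  have hc : ∀ q ∈ c.U, c.ψ q i = S.x₁ q := h7 i _ hi
  refine ⟨γ, hγ, hev.mono fun t ht => ⟨?_, fun hx => ?_⟩⟩
  · rw [← hc _ ht.1, ht.2.1, hc p h1, hp, zero_add]
  · obtain ⟨j, hj⟩ := h3 none (Or.inl ⟨rfl, hx⟩)
    have hcj : ∀ q ∈ c.U, c.ψ q j = S.x₀ q := h7 j _ hj
    rw [← hcj _ ht.1, ht.2.2 j (fun h => by rw [h, hi] at hj; simp at hj), hcj p h1, hx]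

end Push

/-- The direction `a` is that of the vector with nonnegative components `s`, `s'`. -/
def SlopeEq (s s' : ℝ) (a : 𝓔 2) : Prop := ‖a‖ = 1 ∧ 0 ≤ a 0 ∧ 0 ≤ a 1 ∧ s * a 1 = s' * a 0

omit [ChartedSpace (EuclideanQuadrant n) X] in
lemma exists_tendsto_slope {g : X → ℝ} (hg : Continuous g) (h0 : ∀ p, 0 ≤ g p) {T : Type*}
    {l : Filter T} {w : T → X × X} {x : X × X} (hw : Tendsto w l (𝓝 x))
    {a : 𝓔 2} (ha : SlopeEq (g x.1) (g x.2) a)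
    (hz : g x.1 = 0 → g x.2 = 0 → ∀ᶠ t in l, SlopeEq (g (w t).1) (g (w t).2) a) :
    ∃ aT : T → 𝓔 2, Tendsto aT l (𝓝 a) ∧ ∀ᶠ t in l, SlopeEq (g (w t).1) (g (w t).2) (aT t) := by
  by_cases hx : g x.1 = 0 ∧ g x.2 = 0
  · exact ⟨fun _ => a, tendsto_const_nhds, hz hx.1 hx.2⟩
  · let v : X × X → 𝓔 2 := pairMap (fun w => g w.1) fun w => g w.2
    have hv : Continuous v := by
      refine (PiLp.continuous_toLp 2 _).comp (continuous_pi fun i => ?_)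
      fin_cases i
      exacts [hg.comp continuous_fst, hg.comp continuous_snd]
    have hvx : v x ≠ 0 := fun h => hx (pairMap_eq_zero.1 h)
    obtain ⟨h1, h2, h3, h4⟩ := ha
    have h5 := (norm_eq_one_iff_fin_two a).1 h1
    have h6 : v x = (g x.1 * a 0 + g x.2 * a 1) • a := by
      ext i
      fin_cases i
      · change g x.1 = (g x.1 * a 0 + g x.2 * a 1) * a 0
        linear_combination -g x.1 * h5 + a 1 * h4
      · change g x.2 = (g x.1 * a 0 + g x.2 * a 1) * a 1
        linear_combination -g x.2 * h5 - a 0 * h4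
    have h7 : 0 ≤ g x.1 * a 0 + g x.2 * a 1 :=
      add_nonneg (mul_nonneg (h0 _) h2) (mul_nonneg (h0 _) h3)
    have h8 : ‖v x‖⁻¹ • v x = a := by
      have h9 : g x.1 * a 0 + g x.2 * a 1 ≠ 0 := fun h => hvx (by rw [h6, h, zero_smul])
      have : ‖v x‖ = g x.1 * a 0 + g x.2 * a 1 := by
        rw [h6, norm_smul, h1, mul_one, Real.norm_of_nonneg h7]
      rw [this, h6, smul_smul, inv_mul_cancel₀ h9, one_smul]
    have hcont : ContinuousAt (fun y => ‖v y‖⁻¹ • v y) x :=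
      (hv.norm.continuousAt.inv₀ (norm_ne_zero_iff.2 hvx)).smul hv.continuousAt
    refine ⟨fun t => ‖v (w t)‖⁻¹ • v (w t), h8 ▸ hcont.tendsto.comp hw, ?_⟩
    filter_upwards [hw.eventually ((isOpen_ne_fun hv continuous_const).mem_nhds hvx)] with t ht
    refine ⟨?_, mul_nonneg (by positivity) (h0 _), mul_nonneg (by positivity) (h0 _), ?_⟩
    · rw [norm_smul, norm_inv, norm_norm, inv_mul_cancel₀ (norm_ne_zero_iff.2 ht)]
    · change g (w t).1 * (‖v (w t)‖⁻¹ * g (w t).2) = g (w t).2 * (‖v (w t)‖⁻¹ * g (w t).1)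
      ring

variable {Xb : Type*} [TopologicalSpace Xb] [ChartedSpace (EuclideanQuadrant (n + n)) Xb]
  {β : Xb → X × X} {a b : Xb → 𝓔 2}

namespace IsBDouble

lemma bEq (h : S.IsBDouble β a b) (q : Xb) : S.BEq ((β q, a q), b q) :=
  (h.mem_range_iff _).1 ⟨q, rfl⟩

lemma exists_tendsto (h : S.IsBDouble β a b) {T : Type*} {l : Filter T} {q : Xb} {w : T → X × X}
    {aT bT : T → 𝓔 2} (hw : Tendsto w l (𝓝 (β q)))
    (ha : Tendsto aT l (𝓝 (a q))) (hb : Tendsto bT l (𝓝 (b q)))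
    (hev : ∀ᶠ t in l, S.BEq ((w t, aT t), bT t)) :
    ∃ γ : T → Xb, Tendsto γ l (𝓝 q) ∧ ∀ᶠ t in l, β (γ t) = w t := by
  classical
  let γ : T → Xb := fun t => if ht : S.BEq ((w t, aT t), bT t) then
    ((h.mem_range_iff _).2 ht).choose else q
  have hγ : ∀ t, S.BEq ((w t, aT t), bT t) → ((β (γ t), a (γ t)), b (γ t)) = ((w t, aT t), bT t) :=
    fun t ht => by
      simp only [γ, dif_pos ht]
      exact ((h.mem_range_iff _).2 ht).choose_spec
  refine ⟨γ, h.initEmb.tendsto_nhds_iff.2 (((hw.prodMk_nhds ha).prodMk_nhds hb).congr' ?_), ?_⟩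
  · exact hev.mono fun t ht => (hγ t ht).symm
  · exact hev.mono fun t ht => congrArg (fun y => y.1.1) (hγ t ht)

/-- Deformation of a point of `X²_b` with given deformations of its projections to `X`. -/
lemma exists_tendsto_of_left (h : S.IsBDouble β a b) {T : Type*} {l : Filter T} {q : Xb}
    {w : T → X × X} (hw : Tendsto w l (𝓝 (β q)))
    (h₀ : S.x₀ (β q).1 = 0 → S.x₀ (β q).2 = 0 →
      ∀ᶠ t in l, SlopeEq (S.x₀ (w t).1) (S.x₀ (w t).2) (a q))
    (h₁ : S.x₁ (β q).1 = 0 → S.x₁ (β q).2 = 0 →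
      ∀ᶠ t in l, SlopeEq (S.x₁ (w t).1) (S.x₁ (w t).2) (b q)) :
    ∃ γ : T → Xb, Tendsto γ l (𝓝 q) ∧ ∀ᶠ t in l, β (γ t) = w t := by
  obtain ⟨aT, ha, ha'⟩ := exists_tendsto_slope S.contMDiff_x₀.continuous S.x₀_nonneg hw (h.bEq q).1 h₀
  obtain ⟨bT, hb, hb'⟩ := exists_tendsto_slope S.contMDiff_x₁.continuous S.x₁_nonneg hw (h.bEq q).2 h₁
  exact h.exists_tendsto hw ha hb (ha'.and hb')

variable [IsManifold (𝓠 n) ∞ X] [IsManifold (𝓠 k) ∞ Y]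

lemma exists_isGenChart (h : S.IsBDouble β a b) (B : S.BaseFunctions N) {q : Xb}
    (hq : B.centreMap ((β q, a q), b q) = 0) :
    ∃ (c : CornerChart (𝓠 (n + n)) Xb (n + n)) (K : Finset (Fin (n + n)))
      (C A : Fin (n + n) → Xb → ℱ N), q ∈ c.U ∧
      IsGenChart c K (fun q => B.centreMap ((β q, a q), b q)) C A ∧
      (∀ q' ∈ c.U, ((β q', a q'), b q') ∈ bPos X) ∧
      (∃ i ∈ K, ∀ q', C i q' = a q' 0 • single none 1) ∧
      (S.x₁ (β q).1 = 0 → ∃ i ∉ K, ∀ q' ∈ c.U, c.ψ q' i = S.x₁ (β q').1) := by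
  classical
  have hy := h.bEq q
  obtain ⟨⟨hp, hp', hφ⟩, -⟩ := (B.centreMap_eq_zero_iff hy).1 hq
  obtain ⟨L, L', hlab, hsep⟩ := S.exists_labChart_pair B hp hp' hφ
  obtain ⟨c₀, hc₀, hψ₀⟩ := exists_embChart_BEq (h.mem_range_iff) L L' hp' hlab
  obtain ⟨c, k1, -, -, k4, -⟩ := h.initEmb.exists_cornerChart c₀
  have hcU : ∀ q', q' ∈ c.U ↔ ((β q', a q'), b q') ∈ bPos X ∧ (β q').1 ∈ L.c.U ∧ (β q').2 ∈ L'.c.U :=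
    fun q' => by rw [k1]; exact hc₀ _ ⟨q', rfl⟩
  have hleft : ∀ q' i, c.ψ q' (Fin.castAdd n i) = L.c.ψ (β q').1 i := fun q' i => by
    rw [k4, hψ₀]; exact appendVec_castAdd _ i
  have hright : ∀ q' i, c.ψ q' (Fin.natAdd n i) = L'.relCoord ((β q', a q'), b q') i := fun q' i => by
    rw [k4, hψ₀]; exact appendVec_natAdd _ i
  have hqU : q ∈ c.U := (hcU q).2 ⟨B.mem_bPos hy hq, L.mem, L'.mem⟩
  obtain ⟨i₀, hi₀⟩ := L.exists_lab none (Or.inl ⟨rfl, hp⟩)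
  have hx₀ : ∀ q' ∈ c.U, c.ψ q' (Fin.castAdd n i₀) = S.x₀ (β q').1 := fun q' hq' => by
    rw [hleft]; exact L.coord i₀ none hi₀ _ ((hcU q').1 hq').2.1
  let K : Finset (Fin (n + n)) := appendFinset {i₀} (Finset.univ.filter fun i => L'.lab i ≠ none)
  let C : Fin (n + n) → Xb → ℱ N := fun j q' =>
    Fin.addCases (fun _ => a q' 0 • single none (1 : ℝ)) (fun i => (L'.lab i).elim 0
      fun o => (den o ((β q', a q'), b q'))⁻¹ • single (some o) (1 : ℝ)) j
  have hιs := h.initEmb.contMDiff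
  have hCs : ∀ j, ContMDiffOn (𝓠 (n + n)) 𝓘(ℝ, ℱ N) ∞ (C j) c.U := by
    intro j
    refine Fin.addCases (fun i => ?_) (fun i => ?_) j
    · simp only [C, Fin.addCases_left]
      exact (((contMDiff_slope₀ 0).comp hιs).smul contMDiff_const).contMDiffOn
    · simp only [C, Fin.addCases_right]
      rcases hl : L'.lab i with _ | o
      · exact contMDiffOn_const
      · simp only [Option.elim_some]
        exact (((contMDiff_den o).comp hιs).contMDiffOn.inv₀ fun q' hq' =>
          (den_pos ((hcU q').1 hq').1 o).ne').smul contMDiffOn_const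
  obtain ⟨c', A, l1, l2, l3, l4, l5, l6, hg⟩ := c.exists_isGenChart (K := K)
    (f := fun q => B.centreMap ((β q, a q), b q)) (C := C) hqU hq
    (B.contMDiff_centreMap.comp hιs).contMDiffOn hCs (fun q' hq' => by
      refine (forall_mem_appendFinset (p := fun j => c.ψ q' j = inner ℝ (C j q')
        (B.centreMap ((β q', a q'), b q')))).2 ⟨fun i hi => ?_, fun i hi => ?_⟩
      · rw [Finset.mem_singleton.1 hi, hx₀ q' hq']
        simp only [C, Fin.addCases_left, real_inner_smul_left, EuclideanSpace.inner_single_left]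
        have := x₀_left_eq (h.bEq q')
        simp only at this
        rw [this, mul_comm]; simp [BaseFunctions.centreMap]
      · rw [hright]
        simp only [C, Fin.addCases_right, LabChart.relCoord]
        rcases hl : L'.lab i with _ | o
        · simp [hl] at hi
        · simp only [Option.elim_some, real_inner_smul_left, EuclideanSpace.inner_single_left]
          simp [BaseFunctions.centreMap, div_eq_inv_mul])
    (fun q' hq' h0 => by
      have hK := (forall_mem_appendFinset (p := fun j => c.ψ q' j = 0)).1 h0
      have hy' := h.bEq q'
      obtain ⟨hpos, hU, hU'⟩ := (hcU q').1 hq'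
      have h0' : S.x₀ (β q').1 = 0 := by rw [← hx₀ q' hq']; exact hK.1 i₀ (Finset.mem_singleton_self _)
      have hnum : ∀ i o, L'.lab i = some o → B.num o ((β q', a q'), b q') = 0 := fun i o hi => by
        have := hK.2 i (by simp [hi])
        rw [hright] at this
        simp only [LabChart.relCoord, hi, Option.elim_some] at this
        exact (div_eq_zero_iff.1 this).resolve_right (den_pos hpos o).ne'
      obtain ⟨j₀, hj₀⟩ := L'.exists_lab none (Or.inl ⟨rfl, hp'⟩)
      have ha : a q' 1 = a q' 0 := sub_eq_zero.1 (hnum j₀ none hj₀)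
      have h0'' : S.x₀ (β q').2 = 0 := by
        have := hy'.1.2.2.2
        simp only [h0', zero_mul] at this
        exact (mul_eq_zero.1 this.symm).resolve_right hpos.1.1.ne'
      have hgen : ∀ i o, L'.lab i = some o → S.gen B.ext o (β q').1 = S.gen B.ext o (β q').2 :=
        fun i o hi => by
          have := B.gen_right hy' hpos o
          rw [hnum i o hi, zero_div] at this
          rw [this]
          rcases o with _ | _ | j <;> simp [moveLabel]
      have hφ' := hsep _ hU _ hU' h0' h0'' hgen
      refine (B.centreMap_eq_zero_iff hy').2 ⟨⟨h0', h0'', hφ'⟩, ha.symm, ?_⟩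
      have hx := S.x₁_const _ _ h0' h0'' hφ'
      by_cases hl : ∃ i, L'.lab i = some (some none)
      · obtain ⟨i, hi⟩ := hl
        exact (sub_eq_zero.1 (hnum i _ hi)).symm
      · have hne : S.x₁ (β q').2 ≠ 0 := L'.x₁_ne (fun h => hl (L'.exists_lab _ (Or.inr ⟨rfl, h⟩))) _ hU'
        have := hy'.2.2.2.2
        simp only [hx] at this
        exact (mul_left_cancel₀ hne this).symm)
  refine ⟨c', K, C, A, l1, hg, fun q' hq' => ((hcU q').1 (l2 hq')).1, ⟨Fin.castAdd n i₀, by simp [K],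
    fun q' => by simp [C]⟩, fun hx => ?_⟩
  obtain ⟨i, hi⟩ := L.exists_lab (some none) (Or.inr ⟨rfl, hx⟩)
  refine ⟨Fin.castAdd n i, ?_, fun q' hq' => ?_⟩
  · simp only [K, castAdd_mem_appendFinset, Finset.mem_singleton]
    rintro rfl
    rw [hi] at hi₀; simp at hi₀
  · rw [l4, hleft]; exact L.coord i _ hi _ ((hcU q').1 (l2 hq')).2.1

lemma isCentre (h : S.IsBDouble β a b) (B : S.BaseFunctions N) :
    IsCentre (𝓠 (n + n)) (n + n) {q | B.centreMap ((β q, a q), b q) = 0}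
      fun q => B.centreMap ((β q, a q), b q) where
  contMDiff := B.contMDiff_centreMap.comp h.initEmb.contMDiff
  mem_iff _ := Iff.rfl
  exists_chart q hq := by
    obtain ⟨c, K, C, A, h1, h2, -, ⟨i, hi, -⟩, -⟩ := h.exists_isGenChart B hq
    exact ⟨c, K, C, A, h1, ⟨i, hi⟩, h2⟩

omit [IsManifold (𝓠 k) ∞ Y] in
/-- Points of `X²_b` on the front face over `(∂₀X)²` are limits of points with `x₀ ≠ 0`, in
particular off this face. -/
lemma mem_closure_x₀_ne (h : S.IsBDouble β a b) {q : Xb} (h0 : S.x₀ (β q).1 = 0)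
    (h0' : S.x₀ (β q).2 = 0) : q ∈ closure {q | S.x₀ (β q).1 ≠ 0} := by
  obtain ⟨γ, hγ, hev⟩ := S.exists_push_x₀ h0
  obtain ⟨γ', hγ', hev'⟩ := S.exists_push_x₀ h0'
  have hu : ∀ c : ℝ, 0 ≤ c → Tendsto (fun t : ℝ => t * (c + t)) (𝓝[>] 0) (𝓝[>] 0) := by
    intro c hc
    refine tendsto_nhdsWithin_iff.2 ⟨?_, ?_⟩
    · have : Continuous fun t : ℝ => t * (c + t) := by fun_prop
      have := (this.tendsto 0).mono_left (nhdsWithin_le_nhds (s := Ioi 0))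
      simpa using this
    · filter_upwards [self_mem_nhdsWithin] with t (ht : 0 < t)
      exact mul_pos ht (by linarith)
  obtain ⟨ha1, ha2, ha3, -⟩ := (h.bEq q).1
  simp only at ha1 ha2 ha3
  let v : ℝ → 𝓔 2 := fun t => !₂[a q 0 + t, a q 1 + t]
  have hv : Continuous v := by
    refine (PiLp.continuous_toLp 2 _).comp (continuous_pi fun i => ?_)
    fin_cases i <;> simp <;> fun_prop
  have hv0 : v 0 = a q := by ext i; fin_cases i <;> simp [v]
  have hvn : ‖v 0‖ ≠ 0 := by rw [hv0, ha1]; exact one_ne_zero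
  have hcont : ContinuousAt (fun t => ‖v t‖⁻¹ • v t) 0 :=
    (hv.norm.continuousAt.inv₀ hvn).smul hv.continuousAt
  have haT := hcont.tendsto.mono_left (nhdsWithin_le_nhds (s := Ioi 0))
  rw [hv0, ha1, inv_one, one_smul] at haT
  have hw : Tendsto (fun t : ℝ => (γ (t * (a q 0 + t)), γ' (t * (a q 1 + t)))) (𝓝[>] 0)
      (𝓝 (β q)) := (hγ.comp (hu _ ha2)).prodMk_nhds (hγ'.comp (hu _ ha3))
  have e1 := (hu _ ha2).eventually hev
  have e2 := (hu _ ha3).eventually hev'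
  obtain ⟨bT, hb, hb'⟩ := exists_tendsto_slope S.contMDiff_x₁.continuous S.x₁_nonneg hw (h.bEq q).2
    fun hx hx' => by
      filter_upwards [e1, e2] with t ht ht'
      simp only [ht.2 hx, ht'.2 hx']
      exact ⟨(h.bEq q).2.1, (h.bEq q).2.2.1, (h.bEq q).2.2.2.1, by simp⟩
  obtain ⟨δ, hδ, hδ'⟩ := h.exists_tendsto hw haT hb (by
    filter_upwards [e1, e2, hb', self_mem_nhdsWithin] with t ht ht' hbt (ht0 : 0 < t)
    refine ⟨⟨?_, mul_nonneg (by positivity) (show 0 ≤ a q 0 + t by linarith),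
      mul_nonneg (by positivity) (show 0 ≤ a q 1 + t by linarith), ?_⟩, hbt⟩
    · have : v t ≠ 0 := fun h => by
        have : a q 0 + t = 0 := congrArg (fun v : 𝓔 2 => v 0) h
        linarith
      simp only
      rw [norm_smul, norm_inv, norm_norm, inv_mul_cancel₀ (norm_ne_zero_iff.2 this)]
    · simp only [ht.1, ht'.1]
      change t * (a q 0 + t) * (‖v t‖⁻¹ * (a q 1 + t)) = t * (a q 1 + t) * (‖v t‖⁻¹ * (a q 0 + t))
      ring)
  refine mem_closure_of_tendsto hδ ?_
  filter_upwards [hδ', e1, self_mem_nhdsWithin] with t ht ht' (ht0 : 0 < t)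
  simp only [ht, ht'.1]
  have : 0 < t * (a q 0 + t) := mul_pos ht0 (by linarith)
  exact this.ne'

lemma liftedFiberProduct_eq (h : S.IsBDouble β a b) (B : S.BaseFunctions N) :
    S.liftedFiberProduct β = {q | B.centreMap ((β q, a q), b q) = 0} := by
  have hιs := h.initEmb.contMDiff
  have hβ : Continuous β := (contMDiff_fst.comp (contMDiff_fst.comp hιs)).continuous
  have ha : Continuous a := (contMDiff_snd.comp (contMDiff_fst.comp hιs)).continuous
  have hlim : ∀ q, a q 0 ≠ 0 → Tendsto (fun q => S.x₀ (β q).2 / S.x₀ (β q).1)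
      (𝓝[{q | S.x₀ (β q).1 ≠ 0}] q) (𝓝 (a q 1 / a q 0)) := fun q hq => by
    have h1 : Tendsto (fun q => a q 1 / a q 0) (𝓝[{q | S.x₀ (β q).1 ≠ 0}] q)
        (𝓝 (a q 1 / a q 0)) := by
      refine Tendsto.mono_left (ContinuousAt.tendsto ?_) nhdsWithin_le_nhds
      exact ContinuousAt.div (by fun_prop) (by fun_prop) hq
    refine h1.congr' ?_
    have hne : ∀ᶠ q' in 𝓝[{q | S.x₀ (β q).1 ≠ 0}] q, a q' 0 ≠ 0 :=
      nhdsWithin_le_nhds ((isOpen_ne_fun (by fun_prop) continuous_const).mem_nhds hq)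
    filter_upwards [hne, self_mem_nhdsWithin] with q' hq' (hx : S.x₀ (β q').1 ≠ 0)
    rw [div_eq_div_iff hq' hx]
    linear_combination (h.bEq q').1.2.2.2
  refine Subset.antisymm (closure_minimal ?_ (h.isCentre B).isClosed) fun q hq => ?_
  · rintro q ⟨⟨⟨h0 : S.x₀ (β q).1 = 0, h0' : S.x₀ (β q).2 = 0, hφ⟩, h1⟩, ht⟩
    refine (B.centreMap_eq_zero_iff (h.bEq q)).2 ⟨⟨h0, h0', hφ⟩, ?_, ?_⟩
    · have := mem_closure_iff_nhdsWithin_neBot.1 (h.mem_closure_x₀_ne h0 h0')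
      have h2 : Tendsto (fun q' => a q' 1) (𝓝[{q | S.x₀ (β q).1 ≠ 0}] q) (𝓝 (a q 1)) :=
        (Continuous.tendsto (by fun_prop) q).mono_left nhdsWithin_le_nhds
      have h3 : Tendsto (fun q' => a q' 0) (𝓝[{q | S.x₀ (β q).1 ≠ 0}] q) (𝓝 (a q 0)) :=
        (Continuous.tendsto (by fun_prop) q).mono_left nhdsWithin_le_nhds
      have h4 := ht.mul h3
      rw [one_mul] at h4
      refine tendsto_nhds_unique (h4.congr' ?_) h2
      filter_upwards [self_mem_nhdsWithin] with q' (hx : S.x₀ (β q').1 ≠ 0)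
      field_simp
      linear_combination -(h.bEq q').1.2.2.2
    · have hx : S.x₁ (β q).1 = S.x₁ (β q).2 := S.x₁_const _ _ h0 h0' hφ
      have hne : S.x₁ (β q).2 ≠ 0 := fun h => h1 ⟨hx.trans h, h⟩
      have := (h.bEq q).2.2.2.2
      simp only [hx] at this
      exact (mul_left_cancel₀ hne this).symm
  · obtain ⟨⟨h0, h0', hφ⟩, h1, h2⟩ := (B.centreMap_eq_zero_iff (h.bEq q)).1 hq
    have key : ∀ q, B.centreMap ((β q, a q), b q) = 0 → S.x₁ (β q).1 ≠ 0 →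
        q ∈ {q | β q ∈ S.fiberProduct \ S.bd₁ ×ˢ S.bd₁ ∧ Tendsto (fun a =>
          S.x₀ (β a).2 / S.x₀ (β a).1) (𝓝[{a | S.x₀ (β a).1 ≠ 0}] q) (𝓝 1)} := by
      intro q hq hx
      obtain ⟨h0, h1, -⟩ := (B.centreMap_eq_zero_iff (h.bEq q)).1 hq
      have hne := (B.mem_bPos (h.bEq q) hq).1.1.ne'
      refine ⟨⟨h0, fun h => hx h.1⟩, ?_⟩
      have := hlim q hne
      simp only at h1
      rwa [← h1, div_self hne] at this
    by_cases hx : S.x₁ (β q).1 = 0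
    · obtain ⟨c, K, C, A, k1, k2, -, -, k4⟩ := h.exists_isGenChart B hq
      obtain ⟨i, hiK, hi⟩ := k4 hx
      obtain ⟨γ, hγ, hev⟩ := EmbChart.exists_push c k1 i
      refine mem_closure_of_tendsto hγ ?_
      filter_upwards [hev, self_mem_nhdsWithin] with t ht (ht0 : 0 < t)
      obtain ⟨ht1, ht2, ht3⟩ := ht
      refine key _ ((k2.eq_zero_iff ht1).2 fun j hj => ?_) ?_
      · rw [ht3 j (fun h => hiK (h ▸ hj))]; exact (k2.eq_zero_iff k1).1 hq j hj
      · rw [← hi _ ht1, ht2, hi q k1, hx, zero_add]; exact ht0.ne'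
    · exact subset_closure (key q hq hx)

end IsBDouble

lemma exists_phiBDouble [IsManifold (𝓠 n) ∞ X] [T2Space X] [CompactSpace X] [T2Space Y]
    [CompactSpace Y] [IsManifold (𝓠 k) ∞ Y] : Nonempty (PhiBDouble S) := by
  obtain ⟨N, ⟨B⟩⟩ := S.exists_baseFunctions
  obtain ⟨X0, _, _, _, Xb, _, _, _, β₀, β₁, a, b, h0, h1, h2⟩ := S.exists_bDouble
  obtain ⟨XΦ, _, _, _, βΦ, α, h3, h4⟩ := (h2.isCentre B).exists_blowUp fun p =>
    let ⟨c, hc, _⟩ := exists_cornerChart_quadrant (n := n + n) p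
    ⟨c, hc⟩
  refine ⟨@PhiBDouble.mk _ _ _ _ _ _ _ _ _ _ _ _ S X0 Xb XΦ _ _ _ _ _ _ _ _ _ β₀ β₁ βΦ h0 h1 ?_⟩
  rw [h2.liftedFiberProduct_eq B]
  exact (h2.isCentre B).isBlowUp h3 h4

end FiberedBoundary

/-! ### The space of the groupoid -/

namespace PhiBDouble

/-- `X²_{Φ,b}` as a subset of a product. -/
structure Model (D : PhiBDouble S) (B : S.BaseFunctions N) where
  a : D.Xb → 𝓔 2
  b : D.Xb → 𝓔 2
  α : D.XΦb → ℱ N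
  isBDouble : S.IsBDouble (D.β₀ ∘ D.β₁) a b
  initEmb : InitEmb (𝓠 (n + n)) ((𝓠 (n + n)).prod 𝓘(ℝ, ℱ N)) fun q => (D.βΦ q, α q)
  range_eq : range (fun q => (D.βΦ q, α q)) =
    blowUpGraph fun q => B.centreMap (((D.β₀ ∘ D.β₁) q, a q), b q)

lemma exists_model [IsManifold (𝓠 n) ∞ X] [IsManifold (𝓠 k) ∞ Y] (D : PhiBDouble S) (B : S.BaseFunctions N) : Nonempty (D.Model B) := by
  obtain ⟨a, b, h⟩ := S.exists_isBDouble D.isBlowUp₀ D.isBlowUp₁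
  have h1 := D.isBlowUpΦ
  rw [h.liftedFiberProduct_eq B] at h1
  obtain ⟨α, h2, h3⟩ := (h.isCentre B).exists_initEmb h1
  exact ⟨⟨a, b, α, h, h2, h3⟩⟩

namespace Model

variable (m : D.Model B)

/-- The image in the ambient space of `X²_b`. -/
def amb (q : D.XΦb) : FiberedBoundary.BAmbient X := ((D.β q, m.a (D.βΦ q)), m.b (D.βΦ q))

/-- The functions defining the centre of the second blow-up. -/
def centre (q : D.Xb) : ℱ N := B.centreMap (((D.β₀ ∘ D.β₁) q, m.a q), m.b q)

lemma bEq (q : D.XΦb) : S.BEq (m.amb q) := m.isBDouble.bEq (D.βΦ q)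

include m in
lemma contMDiff_βΦ : ContMDiff (𝓠 (n + n)) (𝓠 (n + n)) ∞ D.βΦ :=
  contMDiff_fst.comp m.initEmb.contMDiff

lemma contMDiff_α : ContMDiff (𝓠 (n + n)) 𝓘(ℝ, ℱ N) ∞ m.α := contMDiff_snd.comp m.initEmb.contMDiff

lemma contMDiff_amb : ContMDiff (𝓠 (n + n)) (FiberedBoundary.bModel n) ∞ m.amb :=
  m.isBDouble.initEmb.contMDiff.comp m.contMDiff_βΦ

lemma continuous_centre : Continuous m.centre :=
  (B.contMDiff_centreMap.comp m.isBDouble.initEmb.contMDiff).continuous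

lemma mem_graph (q : D.XΦb) : (D.βΦ q, m.α q) ∈ blowUpGraph m.centre := m.range_eq.subset ⟨q, rfl⟩

lemma smul_α (q : D.XΦb) : ‖m.centre (D.βΦ q)‖ • m.α q = m.centre (D.βΦ q) :=
  have h := smul_of_mem_blowUpGraph (x := (D.βΦ q, m.α q)) m.continuous_centre (m.mem_graph q)
  h

lemma norm_α (q : D.XΦb) : ‖m.α q‖ = 1 :=
  have h := norm_of_mem_blowUpGraph (m.mem_graph q)
  h

lemma mul_α_none (q : D.XΦb) : ‖m.centre (D.βΦ q)‖ * m.α q none = S.frontFun (m.amb q) :=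
  congrArg (fun v : ℱ N => v none) (m.smul_α q)

lemma mul_α_some (q : D.XΦb) (o : 𝓛 N) : ‖m.centre (D.βΦ q)‖ * m.α q (some o) = B.num o (m.amb q) :=
  congrArg (fun v : ℱ N => v (some o)) (m.smul_α q)

lemma α_none_nonneg (q : D.XΦb) : 0 ≤ m.α q none := by
  have := blowUpGraph_eqOn isOpen_univ (f := m.centre)
    (g := fun x => |x.2 none|) (h := fun x => x.2 none) (by fun_prop) (by fun_prop)
    (fun y _ _ hy => abs_of_nonneg (by
      rw [hy]
      exact mul_nonneg (by positivity) (FiberedBoundary.frontFun_nonneg (m.isBDouble.bEq y.1))))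
    (m.mem_graph q) (mem_univ _)
  exact abs_eq_self.1 this

lemma frontFun_eq_zero_of_β {q : D.XΦb} (h0 : S.x₀ (D.β q).1 = 0) (h0' : S.x₀ (D.β q).2 = 0) :
    S.frontFun (m.amb q) = 0 := by
  change S.x₀ (D.β q).1 * _ + S.x₀ (D.β q).2 * _ = 0
  rw [h0, h0', zero_mul, zero_mul, add_zero]

/-- The part of `X²_{Φ,b}` away from the lifts of the other boundary hypersurfaces. -/
def pos : Set D.XΦb := {q | m.amb q ∈ FiberedBoundary.bPos X ∧ 0 < m.α q none}

lemma centreMap_ne_zero {q : D.XΦb} (h : m.amb q ∉ FiberedBoundary.bPos X) :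
    m.centre (D.βΦ q) ≠ 0 := fun h0 => h (B.mem_bPos (m.bEq q) h0)

/-- Lifting of curves in `X²_b` off the centre of the second blow-up. -/
lemma exists_tendsto {q : D.XΦb} (hq : m.centre (D.βΦ q) ≠ 0) {T : Type*} {l : Filter T}
    {γ : T → D.Xb} (hγ : Tendsto γ l (𝓝 (D.βΦ q))) :
    ∃ γ' : T → D.XΦb, Tendsto γ' l (𝓝 q) ∧ ∀ᶠ t in l, D.βΦ (γ' t) = γ t := by
  classical
  let f := m.centre
  have hf : Continuous f := m.continuous_centre
  have hev : ∀ᶠ t in l, f (γ t) ≠ 0 :=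
    hγ.eventually ((isOpen_ne_fun hf continuous_const).mem_nhds hq)
  have hmem : ∀ x, f x ≠ 0 → ∃ q', (D.βΦ q', m.α q') = (x, ‖f x‖⁻¹ • f x) := fun x hx =>
    m.range_eq.symm.subset (subset_closure ⟨hx, rfl⟩)
  have : Nonempty D.XΦb := ⟨q⟩
  choose! g hg using hmem
  refine ⟨fun t => g (γ t), m.initEmb.tendsto_nhds_iff.2 ?_, hev.mono fun t ht =>
    congrArg Prod.fst (hg _ ht)⟩
  have h1 : m.α q = ‖f (D.βΦ q)‖⁻¹ • f (D.βΦ q) :=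
    have h := IsCentre.snd_eq_of_mem_blowUpGraph (x := (D.βΦ q, m.α q)) hf (m.mem_graph q) hq
    h
  have h2 : ContinuousAt (fun x => ‖f x‖⁻¹ • f x) (D.βΦ q) :=
    (hf.norm.continuousAt.inv₀ (norm_ne_zero_iff.2 hq)).smul hf.continuousAt
  rw [h1]
  have h3 := hγ.prodMk_nhds (h2.tendsto.comp hγ)
  exact h3.congr' (hev.mono fun t ht => (hg _ ht).symm)

variable [IsManifold (𝓠 n) ∞ X]

lemma pos_subset_space [IsManifold (𝓠 k) ∞ Y] : m.pos ⊆ D.space := by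
  have hα := m.contMDiff_α.continuous
  have ha : ∀ i, IsClosed {q | (m.amb q).1.2 i = 0} := fun i =>
    isClosed_eq ((FiberedBoundary.contMDiff_slope₀ i).comp m.contMDiff_amb).continuous continuous_const
  have hb : ∀ i, IsClosed {q | (m.amb q).2 i = 0} := fun i =>
    isClosed_eq ((FiberedBoundary.contMDiff_slope₁ i).comp m.contMDiff_amb).continuous continuous_const
  rintro q ⟨⟨⟨h1, h2⟩, h3, h4⟩, h5⟩ ((((hq | hq) | hq) | hq) | hq)
  · refine h1.ne' (closure_minimal (fun q' hq' => ?_) (ha 0) hq)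
    have h0 : S.x₀ (D.β q').1 = 0 := hq'.1.1
    have h0' : S.x₀ (D.β q').2 ≠ 0 := fun h => hq'.2 ⟨h0, h⟩
    have h6 : S.x₀ (D.β q').1 * (m.amb q').1.2 1 = S.x₀ (D.β q').2 * (m.amb q').1.2 0 :=
      (m.bEq q').1.2.2.2
    rw [h0, zero_mul] at h6
    exact (mul_eq_zero.1 h6.symm).resolve_left h0'
  · have hcl : IsClosed {q | m.α q none = 0} := isClosed_eq (by fun_prop) continuous_const
    refine h5.ne' (closure_minimal (fun q' hq' => ?_) hcl hq)
    have h6 := m.mul_α_none q'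
    rw [m.frontFun_eq_zero_of_β hq'.1.1 hq'.1.2] at h6
    refine (mul_eq_zero.1 h6).resolve_left (norm_ne_zero_iff.2 fun h0 => hq'.2 ?_)
    rw [m.isBDouble.liftedFiberProduct_eq B]
    exact h0
  · refine h2.ne' (closure_minimal (fun q' hq' => ?_) (ha 1) hq)
    have h0 : S.x₀ (D.β q').2 = 0 := hq'.1.2
    have h0' : S.x₀ (D.β q').1 ≠ 0 := fun h => hq'.2 ⟨h, h0⟩
    have h6 : S.x₀ (D.β q').1 * (m.amb q').1.2 1 = S.x₀ (D.β q').2 * (m.amb q').1.2 0 :=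
      (m.bEq q').1.2.2.2
    rw [h0, zero_mul] at h6
    exact (mul_eq_zero.1 h6).resolve_left h0'
  · refine h3.ne' (closure_minimal (fun q' hq' => ?_) (hb 0) hq)
    have h0 : S.x₁ (D.β q').1 = 0 := hq'.1.1
    have h0' : S.x₁ (D.β q').2 ≠ 0 := fun h => hq'.2 ⟨h0, h⟩
    have h6 : S.x₁ (D.β q').1 * (m.amb q').2 1 = S.x₁ (D.β q').2 * (m.amb q').2 0 :=
      (m.bEq q').2.2.2.2
    rw [h0, zero_mul] at h6
    exact (mul_eq_zero.1 h6.symm).resolve_left h0'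
  · refine h4.ne' (closure_minimal (fun q' hq' => ?_) (hb 1) hq)
    have h0 : S.x₁ (D.β q').2 = 0 := hq'.1.2
    have h0' : S.x₁ (D.β q').1 ≠ 0 := fun h => hq'.2 ⟨h, h0⟩
    have h6 : S.x₁ (D.β q').1 * (m.amb q').2 1 = S.x₁ (D.β q').2 * (m.amb q').2 0 :=
      (m.bEq q').2.2.2.2
    rw [h0, zero_mul] at h6
    exact (mul_eq_zero.1 h6).resolve_left h0'

omit [IsManifold (𝓠 n) ∞ X] in
/-- A point off the centre that lies over a limit of suitable pairs is a limit of points over these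
pairs. -/
lemma mem_closure_of_pairs {q : D.XΦb} (hq : m.amb q ∉ FiberedBoundary.bPos X) {w : ℝ → X × X}
    (hw : Tendsto w (𝓝[>] 0) (𝓝 (D.β q)))
    (h₀ : S.x₀ (D.β q).1 = 0 → S.x₀ (D.β q).2 = 0 → ∀ᶠ t in 𝓝[>] 0,
      FiberedBoundary.SlopeEq (S.x₀ (w t).1) (S.x₀ (w t).2) (m.amb q).1.2)
    (h₁ : S.x₁ (D.β q).1 = 0 → S.x₁ (D.β q).2 = 0 → ∀ᶠ t in 𝓝[>] 0,
      FiberedBoundary.SlopeEq (S.x₁ (w t).1) (S.x₁ (w t).2) (m.amb q).2)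
    {T : Set (X × X)} (hT : ∀ᶠ t in 𝓝[>] 0, w t ∈ T) : q ∈ closure (D.β ⁻¹' T) := by
  obtain ⟨γ, hγ, hev⟩ := m.isBDouble.exists_tendsto_of_left hw h₀ h₁
  obtain ⟨γ', hγ', hev'⟩ := m.exists_tendsto (m.centreMap_ne_zero hq) hγ
  refine mem_closure_of_tendsto hγ' ?_
  filter_upwards [hev, hev', hT] with t h1 h2 h3
  change D.β₀ (D.β₁ (D.βΦ (γ' t))) ∈ T
  rw [h2]; change (D.β₀ ∘ D.β₁) (γ t) ∈ T
  rwa [h1]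

lemma space_subset_pos [IsManifold (𝓠 k) ∞ Y] : (D.space : Set D.XΦb) ⊆ m.pos := by
  intro q hq
  by_contra hpos
  refine hq ?_
  have hy := m.bEq q
  have hyb := hy.2
  have hya := hy.1
  by_cases hb : m.amb q ∈ FiberedBoundary.bPos X
  · have h0 : m.α q none = 0 := by
      by_contra h0
      exact hpos ⟨hb, lt_of_le_of_ne (m.α_none_nonneg q) (Ne.symm h0)⟩
    refine Or.inl (Or.inl (Or.inl (Or.inr ?_)))
    have hfront : ∀ q', S.frontFun (m.amb q') = 0 → S.x₀ (D.β q').1 = 0 ∧ S.x₀ (D.β q').2 = 0 :=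
      fun q' h => ⟨by rw [← zero_mul]; rw [← h]; exact FiberedBoundary.x₀_left_eq (m.bEq q'),
        by rw [← zero_mul]; rw [← h]; exact FiberedBoundary.x₀_right_eq (m.bEq q')⟩
    by_cases hz : m.centre (D.βΦ q) = 0
    swap
    · refine subset_closure ⟨hfront q ?_, fun h => hz ?_⟩
      · rw [← m.mul_α_none, h0, mul_zero]
      · rw [m.isBDouble.liftedFiberProduct_eq B] at h; exact h
    obtain ⟨c, K, C, A, k1, k2, k3, ⟨i, hiK, hi⟩, -⟩ := m.isBDouble.exists_isGenChart B hz
    have hx := m.mem_graph q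
    have hmem := k2.polarCoord_mem hx k1
    have hlim := exists_tendsto_polarSet c K hmem
    have h1 := (k2.contMDiffOn_polarInv.continuousOn _ hmem).mono inter_subset_left |>.tendsto.comp hlim
    rw [k2.polarInv_polarCoord hx k1] at h1
    have h2 : (IsGenChart.polarCoord c K C (D.βΦ q, m.α q)).2 i = 0 := by
      have e : inner ℝ (C i (D.βΦ q)) (m.α q) = 0 := by
        rw [hi, real_inner_smul_left, EuclideanSpace.inner_single_left, h0, mul_zero, mul_zero]
      simp [IsGenChart.polarCoord, hiK, e]
    generalize IsGenChart.polarCoord c K C (D.βΦ q, m.α q) = w at hlim h1 h2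
    have hall := hlim.eventually self_mem_nhdsWithin
    have hlift : ∀ t, (w.1 + t, w.2) ∈ polarSet c.J K (c.O ∩ cornerSet c.J) → ∃ q',
        (D.βΦ q', m.α q') = IsGenChart.polarInv c K A (w.1 + t, w.2) := fun t ht =>
      m.range_eq.symm.subset (k2.polarInv_mem ht)
    have : Nonempty D.XΦb := ⟨q⟩
    choose! γ hγ using hlift
    refine mem_closure_of_tendsto (f := γ) (b := 𝓝[>] 0) (m.initEmb.tendsto_nhds_iff.2
      (h1.congr' (hall.mono fun t ht => (hγ t ht.1).symm))) ?_
    filter_upwards [hall] with t ht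
    have e1 : D.βΦ (γ t) = c.χ (polarMap K (w.1 + t, w.2)) := congrArg Prod.fst (hγ t ht.1)
    have e2 : m.centre (D.βΦ (γ t)) = (w.1 + t) • IsGenChart.polarDir c K A (w.1 + t, w.2) := by
      rw [e1]; exact k2.smul_polarDir ht.1
    have e3 : m.centre (D.βΦ (γ t)) ≠ 0 := by
      rw [e2]; exact smul_ne_zero (ne_of_gt ht.2) (k2.polarDir_ne_zero ht.1)
    have e4 : D.βΦ (γ t) ∈ c.U := by rw [e1]; exact c.mapsTo_χ' ht.1.2.2.2
    have e5 : S.frontFun (m.amb (γ t)) = 0 := by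
      have e6 := k2.coord _ e4 i hiK
      rw [hi, real_inner_smul_left, EuclideanSpace.inner_single_left, e1, c.right_inv ht.1.2.2.2,
        polarMap_apply, if_pos hiK, ← e1] at e6
      simp only [h2, mul_zero, map_one, one_mul] at e6
      exact (mul_eq_zero.1 e6.symm).resolve_left (k3 _ e4).1.1.ne'
    refine ⟨hfront _ e5, fun h => e3 ?_⟩
    rw [m.isBDouble.liftedFiberProduct_eq B] at h; exact h
  · have key : ((m.amb q).1.2 0 = 0 ∨ (m.amb q).1.2 1 = 0) ∨ ((m.amb q).2 0 = 0 ∨ (m.amb q).2 1 = 0) := by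
      by_contra! h
      exact hb ⟨⟨lt_of_le_of_ne hya.2.1 h.1.1.symm, lt_of_le_of_ne hya.2.2.1 h.1.2.symm⟩,
        lt_of_le_of_ne hyb.2.1 h.2.1.symm, lt_of_le_of_ne hyb.2.2.1 h.2.2.symm⟩
    have hne : ∀ v : 𝓔 2, ‖v‖ = 1 → (v 0 = 0 → v 1 ≠ 0) := fun v hv h h' => by
      have := (norm_eq_one_iff_fin_two v).1 hv
      rw [h, h'] at this; norm_num at this
    have ha4 : S.x₀ (D.β q).1 * (m.amb q).1.2 1 = S.x₀ (D.β q).2 * (m.amb q).1.2 0 := hya.2.2.2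
    have hb4 : S.x₁ (D.β q).1 * (m.amb q).2 1 = S.x₁ (D.β q).2 * (m.amb q).2 0 := hyb.2.2.2
    have hslope : ∀ v : 𝓔 2, ‖v‖ = 1 → 0 ≤ v 0 → 0 ≤ v 1 →
        FiberedBoundary.SlopeEq 0 0 v := fun v h h' h'' => ⟨h, h', h'', by simp⟩
    rcases key with (h | h) | (h | h)
    · have h0 : S.x₀ (D.β q).1 = 0 := by
        rw [h, mul_zero] at ha4; exact (mul_eq_zero.1 ha4).resolve_right (hne _ hya.1 h)
      refine Or.inl (Or.inl (Or.inl (Or.inl ?_)))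
      by_cases h0' : S.x₀ (D.β q).2 = 0
      swap
      · exact subset_closure ⟨⟨h0, mem_univ _⟩, fun h => h0' h.2⟩
      obtain ⟨γ, hγ, hev⟩ := S.exists_push_x₀ h0'
      refine m.mem_closure_of_pairs hb (w := fun t => ((D.β q).1, γ t))
        (tendsto_const_nhds.prodMk_nhds hγ) (fun _ _ => hev.mono fun t ht => ?_)
        (fun e e' => hev.mono fun t ht => ?_) ?_
      · exact ⟨hya.1, hya.2.1, hya.2.2.1, by rw [h0, h]; simp⟩
      · rw [e, ht.2 e']; exact hslope _ hyb.1 hyb.2.1 hyb.2.2.1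
      · filter_upwards [hev, self_mem_nhdsWithin] with t ht (ht0 : 0 < t)
        exact ⟨⟨h0, mem_univ _⟩, fun e => ht0.ne' (ht.1.symm.trans e.2)⟩
    · have h0 : S.x₀ (D.β q).2 = 0 := by
        rw [h, mul_zero] at ha4
        exact (mul_eq_zero.1 ha4.symm).resolve_right fun h' => hne _ hya.1 h' h
      refine Or.inl (Or.inl (Or.inr ?_))
      by_cases h0' : S.x₀ (D.β q).1 = 0
      swap
      · exact subset_closure ⟨⟨mem_univ _, h0⟩, fun h => h0' h.1⟩
      obtain ⟨γ, hγ, hev⟩ := S.exists_push_x₀ h0'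
      refine m.mem_closure_of_pairs hb (w := fun t => (γ t, (D.β q).2))
        (hγ.prodMk_nhds tendsto_const_nhds) (fun _ _ => hev.mono fun t ht => ?_)
        (fun e e' => hev.mono fun t ht => ?_) ?_
      · exact ⟨hya.1, hya.2.1, hya.2.2.1, by rw [h0, h]; simp⟩
      · rw [e', ht.2 e]; exact hslope _ hyb.1 hyb.2.1 hyb.2.2.1
      · filter_upwards [hev, self_mem_nhdsWithin] with t ht (ht0 : 0 < t)
        exact ⟨⟨mem_univ _, h0⟩, fun e => ht0.ne' (ht.1.symm.trans e.1)⟩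
    · have h0 : S.x₁ (D.β q).1 = 0 := by
        rw [h, mul_zero] at hb4; exact (mul_eq_zero.1 hb4).resolve_right (hne _ hyb.1 h)
      refine Or.inl (Or.inr ?_)
      by_cases h0' : S.x₁ (D.β q).2 = 0
      swap
      · exact subset_closure ⟨⟨h0, mem_univ _⟩, fun h => h0' h.2⟩
      obtain ⟨γ, hγ, hev⟩ := S.exists_push_x₁ h0'
      refine m.mem_closure_of_pairs hb (w := fun t => ((D.β q).1, γ t))
        (tendsto_const_nhds.prodMk_nhds hγ) (fun e e' => hev.mono fun t ht => ?_)
        (fun _ _ => hev.mono fun t ht => ?_) ?_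
      · rw [e, ht.2 e']; exact hslope _ hya.1 hya.2.1 hya.2.2.1
      · exact ⟨hyb.1, hyb.2.1, hyb.2.2.1, by rw [h0, h]; simp⟩
      · filter_upwards [hev, self_mem_nhdsWithin] with t ht (ht0 : 0 < t)
        exact ⟨⟨h0, mem_univ _⟩, fun e => ht0.ne' (ht.1.symm.trans e.2)⟩
    · have h0 : S.x₁ (D.β q).2 = 0 := by
        rw [h, mul_zero] at hb4
        exact (mul_eq_zero.1 hb4.symm).resolve_right fun h' => hne _ hyb.1 h' h
      refine Or.inr ?_
      by_cases h0' : S.x₁ (D.β q).1 = 0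
      swap
      · exact subset_closure ⟨⟨mem_univ _, h0⟩, fun h => h0' h.1⟩
      obtain ⟨γ, hγ, hev⟩ := S.exists_push_x₁ h0'
      refine m.mem_closure_of_pairs hb (w := fun t => (γ t, (D.β q).2))
        (hγ.prodMk_nhds tendsto_const_nhds) (fun e e' => hev.mono fun t ht => ?_)
        (fun _ _ => hev.mono fun t ht => ?_) ?_
      · rw [e', ht.2 e]; exact hslope _ hya.1 hya.2.1 hya.2.2.1
      · exact ⟨hyb.1, hyb.2.1, hyb.2.2.1, by rw [h0, h]; simp⟩
      · filter_upwards [hev, self_mem_nhdsWithin] with t ht (ht0 : 0 < t)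
        exact ⟨⟨mem_univ _, h0⟩, fun e => ht0.ne' (ht.1.symm.trans e.1)⟩

end Model

end PhiBDouble

lemma initEmb_opens {E H : Type*} [NormedAddCommGroup E] [NormedSpace ℝ E] [TopologicalSpace H]
    {I : ModelWithCorners ℝ E H} {M : Type*} [TopologicalSpace M] [ChartedSpace H M]
    (U : TopologicalSpace.Opens M) (hU : Nonempty M → Nonempty U) :
    InitEmb I I (Subtype.val : U → M) := by
  classical
  refine ⟨contMDiff_subtype_val, ?_⟩
  rcases isEmpty_or_nonempty M with hM | hM
  · exact ⟨fun x => isEmptyElim x, fun x => isEmptyElim (x : M), fun x => isEmptyElim x⟩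
  · obtain ⟨u₀⟩ := hU hM
    refine ⟨fun x => if h : x ∈ U then ⟨x, h⟩ else u₀, fun x => by simp, ?_⟩
    rintro _ ⟨x, rfl⟩
    refine ContMDiffAt.contMDiffWithinAt (contMDiffAt_subtype_iff.1 ?_)
    have : (fun x : U => if h : (x : M) ∈ U then (⟨x, h⟩ : U) else u₀) = id := by ext x; simp
    rw [this]; exact contMDiffAt_id

namespace FiberedBoundary

/-- The ambient space of the groupoid. -/
abbrev GAmbient (X : Type*) (N : ℕ) := (X × X) × 𝓖 N

/-- The model of the ambient space of the groupoid. -/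
abbrev gModel (n N : ℕ) := ((𝓠 n).prod (𝓠 n)).prod 𝓘(ℝ, 𝓖 N)

variable (S) in
/-- The displacement with label `l`, the quotient of the values of the labelled function for boundary
defining functions, less one. -/
def disp (x : GAmbient X N) (l : 𝓛 N) : ℝ := S.x₀ x.1.1 * x.2 l

variable (S) in
/-- The ratios of boundary defining functions are positive. -/
def ratioPos : Set (GAmbient X N) := {x | 0 < 1 + S.disp x none ∧ 0 < 1 + S.disp x (some none)}

variable (S) in
/-- The point of the ambient space of `X²_b` determined by a point of the groupoid. -/
def bPoint (x : GAmbient X N) : BAmbient X :=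
  ((x.1, slopeDir (1 + S.disp x none)), slopeDir (1 + S.disp x (some none)))

variable (S) in
/-- A vector with the direction determined by a point of the groupoid. -/
def dirVec (x : GAmbient X N) : ℱ N :=
  toLp 2 fun o => o.elim 1 fun l => x.2 l * ((S.bPoint x).1.2 0 * den l (S.bPoint x))

lemma contMDiff_fst_fst : ContMDiff (gModel n N) (𝓠 n) ∞
    fun x : GAmbient X N => x.1.1 := contMDiff_fst.comp contMDiff_fst

lemma contMDiff_fst_snd : ContMDiff (gModel n N) (𝓠 n) ∞
    fun x : GAmbient X N => x.1.2 := contMDiff_snd.comp contMDiff_fst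

lemma contMDiff_snd_apply (l : 𝓛 N) : ContMDiff (gModel n N) 𝓘(ℝ, ℝ) ∞
    fun x : GAmbient X N => x.2 l :=
  (coordL l).contMDiff.comp contMDiff_snd

lemma contMDiff_disp (l : 𝓛 N) :
    ContMDiff (gModel n N) 𝓘(ℝ, ℝ) ∞ fun x : GAmbient X N => S.disp x l :=
  (S.contMDiff_x₀.comp contMDiff_fst_fst).mul (contMDiff_snd_apply l)

lemma contMDiff_bPoint : ContMDiff (gModel n N) (bModel n) ∞
    (S.bPoint : GAmbient X N → BAmbient X) :=
  (contMDiff_fst.prodMk (contDiff_slopeDir.contMDiff.comp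
    (contMDiff_const.add (contMDiff_disp none)))).prodMk (contDiff_slopeDir.contMDiff.comp
    (contMDiff_const.add (contMDiff_disp (some none))))

lemma contMDiff_dirVec : ContMDiff (gModel n N) 𝓘(ℝ, ℱ N) ∞ (S.dirVec : GAmbient X N → _) := by
  refine (PiLp.contDiff_toLp (p := 2)).contMDiff.comp (contMDiff_pi_space.2 fun o => ?_)
  rcases o with _ | l
  · exact contMDiff_const
  · exact (contMDiff_snd_apply l).mul (((contMDiff_slope₀ 0).comp contMDiff_bPoint).mul
      ((contMDiff_den l).comp contMDiff_bPoint))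

omit [TopologicalSpace X] [ChartedSpace (EuclideanQuadrant n) X] in
lemma slopeDir_mem_bPos {s₀ s₁ : ℝ} (h₀ : 0 < s₀) (h₁ : 0 < s₁) (w : X × X) :
    ((w, slopeDir s₀), slopeDir s₁) ∈ bPos X :=
  ⟨⟨slopeDir_zero_pos _, mul_pos h₀ (slopeDir_zero_pos _)⟩,
    slopeDir_zero_pos _, mul_pos h₁ (slopeDir_zero_pos _)⟩

lemma dirVec_ne_zero (x : GAmbient X N) : S.dirVec x ≠ 0 := fun h =>
  one_ne_zero (congrArg (fun v : ℱ N => v none) h : (1 : ℝ) = 0)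

lemma contMDiff_unit_dirVec : ContMDiff (gModel n N) 𝓘(ℝ, ℱ N) ∞
    fun x : GAmbient X N => ‖S.dirVec x‖⁻¹ • S.dirVec x := by
  rw [← contMDiffOn_univ]
  exact contMDiffOn_normalize.comp contMDiff_dirVec.contMDiffOn fun x _ => dirVec_ne_zero x

end FiberedBoundary

namespace PhiBDouble.Model

open FiberedBoundary

variable (m : D.Model B)

/-- The embedding of the groupoid on the level of the ambient spaces. -/
def embAux (x : D.Xb × ℱ N) :
    GAmbient X N :=
  ((D.β₀ ∘ D.β₁) x.1, toLp 2 fun o => x.2 (some o) /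
    (x.2 none * m.a x.1 0 * den o (((D.β₀ ∘ D.β₁) x.1, m.a x.1), m.b x.1)))

/-- The embedding of the groupoid: pairs of points with the quotients of the differences of the
labelled functions by their orders of vanishing. -/
def emb (q : D.XΦb) : GAmbient X N := m.embAux (D.βΦ q, m.α q)

lemma emb_snd (q : D.XΦb) (o : 𝓛 N) : (m.emb q).2 o =
    m.α q (some o) / (m.α q none * (m.amb q).1.2 0 * den o (m.amb q)) := rfl

lemma num_div_den {q : D.XΦb} (hq : q ∈ m.pos) (o : 𝓛 N) :
    B.num o (m.amb q) / den o (m.amb q) = S.disp (m.emb q) o := by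
  have h1 := (den_pos hq.1 o).ne'
  have h2 := hq.2.ne'
  have h3 := hq.1.1.1.ne'
  have h4 : S.x₀ (m.emb q).1.1 = _ := x₀_left_eq (m.bEq q)
  rw [disp, h4, emb_snd, ← m.mul_α_some, ← m.mul_α_none]
  field_simp

lemma gen_right {q : D.XΦb} (hq : q ∈ m.pos) (o : 𝓛 N) :
    S.gen B.ext o (D.β q).2 = moveLabel o (S.gen B.ext o (D.β q).1) (S.disp (m.emb q) o) := by
  rw [← m.num_div_den hq]
  exact B.gen_right (m.bEq q) hq.1 o

lemma one_add_disp {q : D.XΦb} (hq : q ∈ m.pos) :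
    1 + S.disp (m.emb q) none = (m.amb q).1.2 1 / (m.amb q).1.2 0 ∧
    1 + S.disp (m.emb q) (some none) = (m.amb q).2 1 / (m.amb q).2 0 := by
  have h1 := hq.1.1.1.ne'
  have h2 := hq.1.2.1.ne'
  constructor
  · rw [← m.num_div_den hq]; simp only [BaseFunctions.num, den]; field_simp; ring
  · rw [← m.num_div_den hq]; simp only [BaseFunctions.num, den]; field_simp; ring

lemma emb_mem_ratioPos {q : D.XΦb} (hq : q ∈ m.pos) : m.emb q ∈ S.ratioPos := by
  obtain ⟨h1, h2⟩ := m.one_add_disp hq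
  exact ⟨h1 ▸ div_pos hq.1.1.2 hq.1.1.1, h2 ▸ div_pos hq.1.2.2 hq.1.2.1⟩

lemma bPoint_emb {q : D.XΦb} (hq : q ∈ m.pos) : S.bPoint (m.emb q) = m.amb q := by
  obtain ⟨h1, h2⟩ := m.one_add_disp hq
  rw [bPoint, h1, h2, ← eq_slopeDir (m.bEq q).1.1 hq.1.1.1, ← eq_slopeDir (m.bEq q).2.1 hq.1.2.1]
  rfl

lemma unit_dirVec_emb {q : D.XΦb} (hq : q ∈ m.pos) :
    ‖S.dirVec (m.emb q)‖⁻¹ • S.dirVec (m.emb q) = m.α q := by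
  have h : S.dirVec (m.emb q) = (m.α q none)⁻¹ • m.α q := by
    have h0 := hq.2.ne'
    ext o
    rcases o with _ | o
    · change 1 = (m.α q none)⁻¹ * m.α q none
      rw [inv_mul_cancel₀ h0]
    · have h1 := (den_pos hq.1 o).ne'
      have h3 := hq.1.1.1.ne'
      change (m.emb q).2 o * ((S.bPoint (m.emb q)).1.2 0 * den o (S.bPoint (m.emb q))) =
        (m.α q none)⁻¹ * m.α q (some o)
      rw [m.bPoint_emb hq, emb_snd]
      field_simp
  rw [h, norm_smul, m.norm_α, mul_one, norm_inv, Real.norm_of_nonneg hq.2.le, inv_inv, smul_smul,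
    mul_inv_cancel₀ hq.2.ne', one_smul]

/-- A point of the groupoid over a pair of points off `∂₀X`. -/
lemma exists_mem_pos {p p' : X} {s₀ s₁ : ℝ} (h₀ : 0 < s₀) (h₁ : 0 < s₁) (hp : S.x₀ p ≠ 0)
    (hs₀ : S.x₀ p' = S.x₀ p * s₀) (hs₁ : S.x₁ p' = S.x₁ p * s₁) :
    ∃ q ∈ m.pos, m.amb q = (((p, p'), slopeDir s₀), slopeDir s₁) := by
  have d0 := slopeDir_zero_pos s₀
  have d1 := slopeDir_zero_pos s₁
  have hb := slopeDir_mem_bPos h₀ h₁ (p, p')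
  obtain ⟨xb, hxb⟩ := (m.isBDouble.mem_range_iff (((p, p'), slopeDir s₀), slopeDir s₁)).2
    ⟨⟨norm_slopeDir _, d0.le, hb.1.2.le, by simp only [slopeDir_one, hs₀]; ring⟩,
      norm_slopeDir _, d1.le, hb.2.2.le, by simp only [slopeDir_one, hs₁]; ring⟩
  have hc : m.centre xb = B.centreMap (((p, p'), slopeDir s₀), slopeDir s₁) := by
    rw [← hxb]; rfl
  have hfront : 0 < S.frontFun (((p, p'), slopeDir s₀), slopeDir s₁) := by
    have : 0 < S.x₀ p := lt_of_le_of_ne (S.x₀_nonneg p) hp.symm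
    exact add_pos_of_pos_of_nonneg (mul_pos this d0) (mul_nonneg (S.x₀_nonneg _) hb.1.2.le)
  have hne : m.centre xb ≠ 0 := fun h => hfront.ne' (by
    rw [hc] at h
    exact congrArg (fun v : ℱ N => v none) h)
  obtain ⟨q, hq⟩ := m.range_eq.symm.subset
    (show (xb, ‖m.centre xb‖⁻¹ • m.centre xb) ∈ blowUpGraph m.centre from subset_closure ⟨hne, rfl⟩)
  have hβ : D.βΦ q = xb := congrArg Prod.fst hq
  have hα : m.α q = ‖m.centre xb‖⁻¹ • m.centre xb := congrArg Prod.snd hq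
  have hamb : m.amb q = (((p, p'), slopeDir s₀), slopeDir s₁) := by
    rw [← hxb, ← hβ]; rfl
  refine ⟨q, ⟨hamb ▸ hb, ?_⟩, hamb⟩
  rw [hα, hc]
  exact mul_pos (inv_pos.2 (norm_pos_iff.2 (hc ▸ hne))) hfront

variable [IsManifold (𝓠 n) ∞ X] [IsManifold (𝓠 k) ∞ Y]

lemma mem_pos (g : D.space) : (g : D.XΦb) ∈ m.pos := m.space_subset_pos g.2

omit [IsManifold (𝓠 k) ∞ Y] in
variable (S) in
lemma _root_.FiberedBoundary.exists_x₀_ne (p : X) : ∃ p' : X, S.x₀ p' ≠ 0 := by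
  by_cases hp : S.x₀ p = 0
  · obtain ⟨γ, -, hev⟩ := S.exists_push_x₀ hp
    obtain ⟨t, ht, ht0⟩ := (hev.and self_mem_nhdsWithin).exists
    exact ⟨γ t, by rw [ht.1]; exact ne_of_gt ht0⟩
  · exact ⟨p, hp⟩

include m in
lemma nonempty_space (h : Nonempty D.XΦb) : Nonempty D.space := by
  obtain ⟨q⟩ := h
  obtain ⟨p, hp⟩ := S.exists_x₀_ne (D.β q).1
  obtain ⟨q, hq, -⟩ := m.exists_mem_pos (p := p) (p' := p) one_pos one_pos hp (by simp) (by simp)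
  exact ⟨⟨q, m.pos_subset_space hq⟩⟩

lemma initEmb_emb : InitEmb (𝓠 (n + n)) (gModel n N) fun g : D.space => m.emb g := by
  have h1 := (initEmb_opens D.space m.nonempty_space).comp m.initEmb
  obtain ⟨χ, hχ, hs⟩ := m.isBDouble.initEmb.exists_leftInverse
  have hb : ∀ g : D.space, S.bPoint (m.emb g) ∈ range fun q => (((D.β₀ ∘ D.β₁) q, m.a q), m.b q) :=
    fun g => ⟨D.βΦ g, (m.bPoint_emb (m.mem_pos g)).symm⟩
  refine h1.of_comp (g := m.embAux) (χ := fun x => (χ (S.bPoint x), ‖S.dirVec x‖⁻¹ • S.dirVec x))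
    (fun _ => rfl) ?_ ?_ fun g => ?_
  · have hfst : ContMDiff ((𝓠 (n + n)).prod 𝓘(ℝ, ℱ N)) (bModel n) ∞ fun x : D.Xb × ℱ N =>
          (((D.β₀ ∘ D.β₁) x.1, m.a x.1), m.b x.1) := m.isBDouble.initEmb.contMDiff.comp contMDiff_fst
    have hcoord : ∀ o, ContMDiff ((𝓠 (n + n)).prod 𝓘(ℝ, ℱ N)) 𝓘(ℝ, ℝ) ∞
        fun x : D.Xb × ℱ N => x.2 o := fun o =>
      (coordL o : ℱ N →L[ℝ] ℝ).contMDiff.comp contMDiff_snd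
    refine ContMDiffOn.prodMk (contMDiff_fst.comp (contMDiff_fst.comp hfst)).contMDiffOn
      ((PiLp.contDiff_toLp (p := 2)).contMDiff.comp_contMDiffOn (contMDiffOn_pi_space.2 fun o => ?_))
    refine (hcoord _).contMDiffOn.div₀ (((hcoord none).mul ((contMDiff_slope₀ 0).comp hfst)).mul
      ((contMDiff_den o).comp hfst)).contMDiffOn ?_
    rintro _ ⟨g, rfl⟩
    have hg := m.mem_pos g
    exact (mul_pos (mul_pos hg.2 hg.1.1.1) (den_pos hg.1 o)).ne'
  · refine ContMDiffOn.prodMk (hs.comp contMDiff_bPoint.contMDiffOn ?_)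
      contMDiff_unit_dirVec.contMDiffOn
    rintro _ ⟨g, rfl⟩
    exact hb g
  · refine Prod.ext ?_ (m.unit_dirVec_emb (m.mem_pos g))
    simp only [m.bPoint_emb (m.mem_pos g)]
    exact hχ (D.βΦ g)

include m in
lemma mem_closure_x₀_ne (g : D.space) : g ∈ closure {g : D.space | S.x₀ (D.β g).1 ≠ 0} := by
  have h1 : (g : D.XΦb) ∈ closure {q | m.centre (D.βΦ q) ≠ 0} := by
    rw [m.initEmb.isEmbedding.closure_eq_preimage_closure_image]
    refine closure_mono ?_ (m.mem_graph g)
    rintro x ⟨hx, hx'⟩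
    obtain ⟨q, hq⟩ := m.range_eq.symm.subset
      (show x ∈ blowUpGraph m.centre from subset_closure ⟨hx, hx'⟩)
    refine ⟨q, ?_, hq⟩
    have : D.βΦ q = x.1 := congrArg Prod.fst hq
    rw [mem_ofPred_eq, this]; exact hx
  refine closure_mono (fun g' hg' => ?_)
    (D.space.isOpen.isOpenMap_subtype_val.preimage_closure_subset_closure_preimage h1)
  have hpos := m.mem_pos g'
  have h2 : S.x₀ (D.β g').1 = _ := x₀_left_eq (m.bEq g')
  rw [mem_ofPred_eq, h2, ← m.mul_α_none]
  exact mul_ne_zero (mul_ne_zero (norm_ne_zero_iff.2 hg') hpos.2.ne') hpos.1.1.1.ne'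

lemma mem_range_emb_of_closure {x : GAmbient X N} (hx : x ∈ closure (range fun g : D.space => m.emb g))
    (hpos : x ∈ S.ratioPos) : x ∈ range fun g : D.space => m.emb g := by
  obtain ⟨χ, hχ, hs⟩ := m.isBDouble.initEmb.exists_leftInverse
  let ιb : D.Xb → BAmbient X := fun q => (((D.β₀ ∘ D.β₁) q, m.a q), m.b q)
  have hχc : ContinuousOn χ (range ιb) := hs.continuousOn
  have hr : ∀ y, S.BEq y → y ∈ range ιb := fun y hy => (m.isBDouble.mem_range_iff y).2 hy
  have hb : Continuous (S.bPoint : GAmbient X N → BAmbient X) := contMDiff_bPoint.continuous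
  have hcl : IsClosed {x : GAmbient X N | S.BEq (S.bPoint x)} := by
    have e1 := hb
    have c0 : ∀ i, Continuous fun x : GAmbient X N => (S.bPoint x).1.2 i := fun i =>
      ((contMDiff_slope₀ i).comp contMDiff_bPoint).continuous
    have c1 : ∀ i, Continuous fun x : GAmbient X N => (S.bPoint x).2 i := fun i =>
      ((contMDiff_slope₁ i).comp contMDiff_bPoint).continuous
    have l := (contMDiff_left.comp (contMDiff_bPoint (S := S) (N := N))).continuous
    have r := (contMDiff_right.comp (contMDiff_bPoint (S := S) (N := N))).continuous
    have x0 := S.contMDiff_x₀.continuous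
    have x1 := S.contMDiff_x₁.continuous
    refine IsClosed.inter (IsClosed.inter (isClosed_eq (continuous_snd.comp
      (continuous_fst.comp hb)).norm continuous_const) (IsClosed.inter (isClosed_le continuous_const
      (c0 0)) (IsClosed.inter (isClosed_le continuous_const (c0 1)) (isClosed_eq ((x0.comp l).mul (c0 1))
      ((x0.comp r).mul (c0 0)))))) (IsClosed.inter (isClosed_eq (continuous_snd.comp hb).norm
      continuous_const) (IsClosed.inter (isClosed_le continuous_const
      (c1 0)) (IsClosed.inter (isClosed_le continuous_const (c1 1)) (isClosed_eq ((x1.comp l).mul (c1 1))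
      ((x1.comp r).mul (c1 0))))))
  have hsub : range (fun g : D.space => m.emb g) ⊆ {x | S.BEq (S.bPoint x)} := by
    rintro _ ⟨g, rfl⟩
    simp only [mem_ofPred_eq, m.bPoint_emb (m.mem_pos g)]
    exact m.bEq g
  have hBx : S.BEq (S.bPoint x) := closure_minimal hsub hcl hx
  have hcont : ContinuousWithinAt (fun x => (χ (S.bPoint x), ‖S.dirVec x‖⁻¹ • S.dirVec x))
      (range fun g : D.space => m.emb g) x := by
    refine ContinuousWithinAt.prodMk ?_ contMDiff_unit_dirVec.continuous.continuousWithinAt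
    exact ContinuousWithinAt.comp (t := range ιb) (g := χ) (f := S.bPoint) (hχc _ (hr _ hBx))
      hb.continuousWithinAt fun y hy => hr _ (hsub hy)
  have hmem : (χ (S.bPoint x), ‖S.dirVec x‖⁻¹ • S.dirVec x) ∈ blowUpGraph m.centre := by
    have hcl' : IsClosed (blowUpGraph m.centre) := isClosed_closure
    refine hcl'.closure_subset_iff.2 ?_ (hcont.mem_closure_image hx)
    rintro _ ⟨_, ⟨g, rfl⟩, rfl⟩
    simp only [m.bPoint_emb (m.mem_pos g), m.unit_dirVec_emb (m.mem_pos g)]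
    have : χ (m.amb g) = D.βΦ g := hχ (D.βΦ g)
    rw [this]; exact m.mem_graph g
  obtain ⟨q, hq⟩ := m.range_eq.symm.subset hmem
  have hβ : D.βΦ q = χ (S.bPoint x) := congrArg Prod.fst hq
  have hα : m.α q = ‖S.dirVec x‖⁻¹ • S.dirVec x := congrArg Prod.snd hq
  have hamb : m.amb q = S.bPoint x := by
    obtain ⟨y, hy⟩ := hr _ hBx
    have h1 : χ (S.bPoint x) = y := by rw [← hy]; exact hχ y
    rw [← hy, ← h1, ← hβ]; rfl
  have hn := norm_pos_iff.2 (dirVec_ne_zero (S := S) x)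
  have hα0 : m.α q none = ‖S.dirVec x‖⁻¹ := by rw [hα]; exact mul_one _
  have hqpos : q ∈ m.pos := ⟨hamb ▸ slopeDir_mem_bPos hpos.1 hpos.2 x.1, hα0 ▸ inv_pos.2 hn⟩
  refine ⟨⟨q, m.pos_subset_space hqpos⟩, Prod.ext (congrArg (fun y => y.1.1) hamb) ?_⟩
  ext o
  have h1 := (den_pos hqpos.1 o).ne'
  have h2 := hqpos.1.1.1.ne'
  have h3 : m.α q (some o) = ‖S.dirVec x‖⁻¹ * (x.2 o * ((m.amb q).1.2 0 * den o (m.amb q))) := by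
    rw [hα, hamb]; rfl
  change (m.emb q).2 o = _
  rw [emb_snd, hα0, h3]
  field_simp

lemma mem_range_emb_of_x₀_ne {x : GAmbient X N} (hx : S.x₀ x.1.1 ≠ 0) (hpos : x ∈ S.ratioPos)
    (hgen : ∀ o, S.gen B.ext o x.1.2 = moveLabel o (S.gen B.ext o x.1.1) (S.disp x o)) :
    x ∈ range fun g : D.space => m.emb g := by
  obtain ⟨q, hq, hamb⟩ := m.exists_mem_pos hpos.1 hpos.2 hx (hgen none) (hgen (some none))
  refine ⟨⟨q, m.pos_subset_space hq⟩, Prod.ext (congrArg (fun y => y.1.1) hamb) ?_⟩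
  ext o
  have h1 := m.num_div_den hq o
  have h2 : S.x₀ (m.emb q).1.1 = S.x₀ x.1.1 := congrArg (fun y => S.x₀ y.1.1.1) hamb
  have h3 : B.num o (m.amb q) / den o (m.amb q) = S.disp x o := by
    rw [hamb]
    have d0 := (slopeDir_zero_pos (1 + S.disp x none)).ne'
    have d1 := (slopeDir_zero_pos (1 + S.disp x (some none))).ne'
    rcases o with _ | _ | j
    · simp only [BaseFunctions.num, den, slopeDir_one]; field_simp; ring
    · simp only [BaseFunctions.num, den, slopeDir_one]; field_simp; ring
    · have := hgen (some (some j))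
      simp only [gen, moveLabel] at this
      simp [BaseFunctions.num, den, this]
  rw [h1, disp, disp, h2] at h3
  exact mul_left_cancel₀ hx h3

end PhiBDouble.Model

/-! ### Coordinates on the groupoid adapted to the range map -/

namespace FiberedBoundary

variable (S) in
/-- Division by `x₀`. -/
lemma exists_eq_x₀_smul [IsManifold (𝓠 n) ∞ X] {r : ℕ}
    {w₀ : X × 𝓔 r} {U : Set (X × 𝓔 r)} (hU : IsOpen U)
    (hw₀ : w₀ ∈ U) {F : Type} [NormedAddCommGroup F] [NormedSpace ℝ F] [CompleteSpace F]
    {f : X × 𝓔 r → F}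
    (hf : ContMDiffOn ((𝓠 n).prod (𝓡 r)) 𝓘(ℝ, F) ∞ f U)
    (h0 : ∀ w ∈ U, S.x₀ w.1 = 0 → f w = 0) :
    ∃ U', IsOpen U' ∧ w₀ ∈ U' ∧ U' ⊆ U ∧ ∃ G : X × 𝓔 r → F,
      ContMDiffOn ((𝓠 n).prod (𝓡 r)) 𝓘(ℝ, F) ∞ G U' ∧
      ∀ w ∈ U', f w = S.x₀ w.1 • G w := by
  have hx : ContMDiff ((𝓠 n).prod (𝓡 r)) 𝓘(ℝ, ℝ) ∞
      fun w : X × 𝓔 r => S.x₀ w.1 := S.contMDiff_x₀.comp contMDiff_fst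
  by_cases hp : S.x₀ w₀.1 = 0
  · obtain ⟨c, lab, h1, -, h3, -, -, -, h7, -, -⟩ :=
      S.exists_cornerChart_bd w₀.1 isOpen_univ (mem_univ _)
    obtain ⟨i, hi⟩ := h3 none (Or.inl ⟨rfl, hp⟩)
    have hc : ∀ w ∈ (c.prod (EmbChart.refl r)).U, (c.prod (EmbChart.refl r)).ψ w (Fin.castAdd r i) =
        S.x₀ w.1 := fun w hw => (appendVec_castAdd _ i).trans (h7 i none hi _ hw.1)
    obtain ⟨U', hU', hw', -, hU'U, A, hA, hsum⟩ := (c.prod (EmbChart.refl r)).exists_eq_sum_smul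
      (S := {w | S.x₀ w.1 = 0}) (K := {Fin.castAdd r i}) (fun w hw => by simp [hc w hw]) hp hU hw₀
      ⟨h1, mem_univ _⟩ hf h0
    refine ⟨U' ∩ (c.prod (EmbChart.refl r)).U, hU'.inter (EmbChart.isOpen_U _), ⟨hw', h1, mem_univ _⟩,
      inter_subset_left.trans hU'U, _, (hA (Fin.castAdd r i)).mono inter_subset_left, fun w hw => ?_⟩
    rw [hsum w hw.1, Finset.sum_singleton, hc w hw.2]
  · refine ⟨U ∩ {w | S.x₀ w.1 ≠ 0}, hU.inter (isOpen_ne_fun hx.continuous continuous_const),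
      ⟨hw₀, hp⟩, inter_subset_left, fun w => (S.x₀ w.1)⁻¹ • f w,
      (hx.contMDiffOn.inv₀ fun w hw => hw.2).smul (hf.mono inter_subset_left), fun w hw => ?_⟩
    rw [smul_smul, mul_inv_cancel₀ hw.2, one_smul]

variable (S) in
/-- The additional factor by which the differences of the labelled functions vanish. -/
def weight : 𝓛 N → X → ℝ
  | none, p => S.x₀ p
  | some none, p => S.x₁ p
  | some (some _), _ => 1

lemma contMDiff_weight (o : 𝓛 N) : ContMDiff (𝓠 n) 𝓘(ℝ, ℝ) ∞ (S.weight o) := by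
  rcases o with _ | _ | j
  exacts [S.contMDiff_x₀, S.contMDiff_x₁, contMDiff_const]

lemma moveLabel_gen (o : 𝓛 N) (p : X) (z : ℝ) :
    moveLabel o (S.gen B.ext o p) z = S.gen B.ext o p + S.weight o p * z := by
  rcases o with _ | _ | j <;> simp only [moveLabel, gen, weight] <;> ring

variable (S) in
/-- Multiplication of the labelled coordinates by `x₀`. -/
def scaleVec (lab : Fin n → Option (𝓛 N)) (w : X × 𝓔 n) : X × 𝓔 n :=
  (w.1, toLp 2 fun i => (lab i).elim (w.2 i) fun _ => S.x₀ w.1 * w.2 i)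

lemma contMDiff_scaleVec (lab : Fin n → Option (𝓛 N)) :
    ContMDiff (𝓣 n) (𝓣 n) ∞ (S.scaleVec lab) := by
  refine contMDiff_fst.prodMk ((PiLp.contDiff_toLp (p := 2)).contMDiff.comp
    (contMDiff_pi_space.2 fun i => ?_))
  have h : ContMDiff (𝓣 n) 𝓘(ℝ, ℝ) ∞ fun w : X × 𝓔 n => w.2 i :=
    (coordL i).contMDiff.comp contMDiff_snd
  rcases lab i with _ | o
  exacts [h, (S.contMDiff_x₀.comp contMDiff_fst).mul h]

/-- Coordinates on the fibres of the range map. -/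
def LabChart.fibreCoord {p : X} (L : S.LabChart B p) (x : GAmbient X N) :
    𝓔 n :=
  toLp 2 fun i => (L.lab i).elim (L.c.ψ x.1.2 i) fun o => x.2 o

lemma LabChart.contMDiffOn_fibreCoord {p : X} (L : S.LabChart B p) :
    ContMDiffOn (gModel n N) (𝓡 n) ∞ L.fibreCoord {x | x.1.2 ∈ L.c.U} := by
  refine (PiLp.contDiff_toLp (p := 2)).contMDiff.comp_contMDiffOn (contMDiffOn_pi_space.2 fun i => ?_)
  rcases hl : L.lab i with _ | o
  · simp only [Option.elim_none]
    exact (L.c.smooth_coord i).comp contMDiff_fst_snd.contMDiffOn fun x hx => hx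
  · simp only [Option.elim_some]
    exact (contMDiff_snd_apply o).contMDiffOn

/-- `x` satisfies the equations of the groupoid. -/
def BaseFunctions.IsMoved (B : S.BaseFunctions N) (x : GAmbient X N) : Prop :=
  ∀ o, S.gen B.ext o x.1.2 = moveLabel o (S.gen B.ext o x.1.1) (S.disp x o)

lemma LabChart.moveVec_fibreCoord {p : X} (L : S.LabChart B p) {x : GAmbient X N}
    (hx : B.IsMoved x) (hU : x.1.2 ∈ L.c.U) :
    B.moveVec L.lab (S.scaleVec L.lab (x.1.1, L.fibreCoord x)) = L.c.ψ x.1.2 := by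
  ext i
  simp only [BaseFunctions.moveVec, scaleVec, fibreCoord]
  rcases hl : L.lab i with _ | o
  · simp
  · simp only [Option.elim_some]
    rw [L.coord i o hl _ hU, hx o, disp]

/-- A smooth right inverse of the coordinates of the groupoid adapted to the range map. -/
lemma LabChart.exists_rightInverse [IsManifold (𝓠 n) ∞ X] {p : X} (L : S.LabChart B p)
    {W : Set X} (hW : IsOpen W)
    (hsep : ∀ q ∈ W, ∀ q' ∈ L.c.U, S.x₀ q = 0 → S.x₀ q' = 0 →
      (∀ i a, L.lab i = some a → S.gen B.ext a q = S.gen B.ext a q') → S.φ q = S.φ q')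
    {x₀ : GAmbient X N} (hx₀ : B.IsMoved x₀) (hpos : x₀ ∈ S.ratioPos) (h1 : x₀.1.1 ∈ W)
    (h2 : x₀.1.2 ∈ L.c.U) :
    ∃ (U' : Set (X × 𝓔 n)) (Ξ : X × 𝓔 n → GAmbient X N),
      IsOpen U' ∧ (x₀.1.1, L.fibreCoord x₀) ∈ U' ∧
      ContMDiffOn (𝓣 n) (gModel n N) ∞ Ξ U' ∧
      ∀ w ∈ U', B.IsMoved (Ξ w) ∧ Ξ w ∈ S.ratioPos ∧ (Ξ w).1.1 = w.1 ∧ (Ξ w).1.2 ∈ L.c.U ∧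
        L.fibreCoord (Ξ w) = w.2 ∧
        ∀ x, B.IsMoved x → x.1.2 ∈ L.c.U → (x.1.1, L.fibreCoord x) = w →
          (Ξ w).1 = x.1 ∧ (S.x₀ x.1.1 ≠ 0 → Ξ w = x) := by
  classical
  have hcoord : ∀ i, ContMDiff (𝓣 n) 𝓘(ℝ, ℝ) ∞ fun w : X × 𝓔 n => w.2 i := fun i =>
    (coordL i).contMDiff.comp contMDiff_snd
  let mv : X × 𝓔 n → 𝓔 n := fun w =>
    B.moveVec L.lab (S.scaleVec L.lab w)
  have hmv : ContMDiff (𝓣 n) (𝓡 n) ∞ mv :=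
    (B.contMDiff_moveVec L.lab).comp (contMDiff_scaleVec L.lab)
  let U₀ : Set (X × 𝓔 n) := {w | w.1 ∈ W} ∩ ({w | mv w ∈ L.c.O} ∩
    ({w | ∀ i, (L.lab i = some none ∨ L.lab i = some (some none)) → 0 < 1 + S.x₀ w.1 * w.2 i} ∩
    {w | ∀ o : 𝓛 N, (¬ ∃ i, L.lab i = some o) → S.weight o w.1 ≠ 0}))
  have hU₀ : IsOpen U₀ := by
    refine (hW.preimage continuous_fst).inter ((L.c.isOpen_O.preimage hmv.continuous).inter
      (IsOpen.inter ?_ ?_))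
    · simp only [ofPred_forall]
      refine isOpen_iInter_of_finite fun i => isOpen_iInter_of_finite fun _ =>
        isOpen_lt continuous_const ?_
      exact continuous_const.add (((S.contMDiff_x₀.comp contMDiff_fst).mul (hcoord i)).continuous)
    · simp only [ofPred_forall]
      exact isOpen_iInter_of_finite fun o => isOpen_iInter_of_finite fun _ =>
        isOpen_ne_fun ((contMDiff_weight o).continuous.comp continuous_fst) continuous_const
  have hmem : ∀ w ∈ U₀, mv w ∈ L.c.O ∩ cornerSet L.c.J := fun w hw => ⟨hw.2.1, L.moveVec_mem
    fun i hi => by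
      have := hw.2.2.1 i hi
      rcases hi with hi | hi <;> simpa [scaleVec, hi] using this⟩
  let R : X × 𝓔 n → X := fun w => L.c.χ (mv w)
  have hR : ContMDiffOn (𝓣 n) (𝓠 n) ∞ R U₀ := L.c.smooth_χ.comp hmv.contMDiffOn hmem
  have hRU : ∀ w ∈ U₀, R w ∈ L.c.U := fun w hw => L.c.mapsTo_χ' (hmem w hw)
  have hgenR : ∀ w ∈ U₀, ∀ i o, L.lab i = some o →
      S.gen B.ext o (R w) = moveLabel o (S.gen B.ext o w.1) (S.x₀ w.1 * w.2 i) := fun w hw i o hi => by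
    have := L.gen_moveVec (hmem w hw) hi
    have e : (S.scaleVec L.lab w).2 i = S.x₀ w.1 * w.2 i := by simp [scaleVec, hi]
    rw [e] at this
    exact this
  have hwU₀ : ∀ x : GAmbient X N, B.IsMoved x → x ∈ S.ratioPos → x.1.1 ∈ W → x.1.2 ∈ L.c.U →
      (x.1.1, L.fibreCoord x) ∈ U₀ := by
    intro x hx hpos h1 h2
    refine ⟨h1, ?_, fun i hi => ?_, fun o ho h0 => ?_⟩
    · change mv _ ∈ L.c.O
      simp only [mv]
      rw [L.moveVec_fibreCoord hx h2]; exact (L.c.mapsTo_ψ' h2).1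
    · rcases hi with hi | hi
      · simpa [fibreCoord, hi, disp] using hpos.1
      · simpa [fibreCoord, hi, disp] using hpos.2
    · rcases o with _ | _ | j
      · refine L.x₀_ne (fun h => ho (L.exists_lab _ (Or.inl ⟨rfl, h⟩))) _ h2 ((hx none).trans ?_)
        rw [moveLabel_gen, show S.weight (none : 𝓛 N) x.1.1 = 0 from h0,
          show S.gen B.ext none x.1.1 = 0 from h0, zero_mul, add_zero]
      · refine L.x₁_ne (fun h => ho (L.exists_lab _ (Or.inr ⟨rfl, h⟩))) _ h2 ((hx (some none)).trans ?_)
        rw [moveLabel_gen, show S.weight (some (none : Option (Fin N))) x.1.1 = 0 from h0,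
          show S.gen B.ext (some none) x.1.1 = 0 from h0, zero_mul, add_zero]
      · exact one_ne_zero h0
  let f : X × 𝓔 n → 𝓖 N := fun w =>
    toLp 2 fun o => S.gen B.ext o (R w) - S.gen B.ext o w.1
  have hf : ContMDiffOn (𝓣 n) 𝓘(ℝ, 𝓖 N) ∞ f U₀ :=
    (PiLp.contDiff_toLp (p := 2)).contMDiff.comp_contMDiffOn (contMDiffOn_pi_space.2 fun o =>
      ((B.contMDiff_gen o).comp_contMDiffOn hR).sub ((B.contMDiff_gen o).comp contMDiff_fst).contMDiffOn)
  have hf0 : ∀ w ∈ U₀, S.x₀ w.1 = 0 → f w = 0 := by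
    intro w hw h0
    have hlab : ∀ i o, L.lab i = some o → S.gen B.ext o w.1 = S.gen B.ext o (R w) := fun i o hi => by
      rw [hgenR w hw i o hi, moveLabel_gen, h0, zero_mul, mul_zero, add_zero]
    obtain ⟨i, hi⟩ : ∃ i, L.lab i = some none := by
      by_contra h; exact hw.2.2.2 none h h0
    have h0' : S.x₀ (R w) = 0 := (hlab i _ hi).symm.trans h0
    have hφ := hsep _ hw.1 _ (hRU w hw) h0 h0' hlab
    ext o
    refine sub_eq_zero.2 ?_
    rcases o with _ | _ | j
    · exact h0'.trans h0.symm
    · exact (S.x₁_const _ _ h0 h0' hφ).symm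
    · change B.ext j (R w) = B.ext j w.1
      rw [B.ext_eq j _ h0, B.ext_eq j _ h0', hφ]
  obtain ⟨U', hU', hw₀, hU'U, G, hG, hfG⟩ := S.exists_eq_x₀_smul hU₀ (hwU₀ x₀ hx₀ hpos h1 h2) hf hf0
  have hGo : ∀ w ∈ U', ∀ o, S.gen B.ext o (R w) - S.gen B.ext o w.1 = S.x₀ w.1 * G w o :=
    fun w hw o => congrArg (fun v : 𝓖 N => v o) (hfG w hw)
  let Ω : X × 𝓔 n → 𝓖 N := fun w =>
    toLp 2 fun o => if h : ∃ i, L.lab i = some o then w.2 h.choose else G w o / S.weight o w.1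
  have hΩlab : ∀ w i o, L.lab i = some o → Ω w o = w.2 i := fun w i o hi => by
    have h : ∃ i, L.lab i = some o := ⟨i, hi⟩
    simp only [Ω, dif_pos h]
    rw [L.lab_inj _ _ _ h.choose_spec hi]
  have hΩ : ContMDiffOn (𝓣 n) 𝓘(ℝ, 𝓖 N) ∞ Ω U' := by
    refine (PiLp.contDiff_toLp (p := 2)).contMDiff.comp_contMDiffOn
      (contMDiffOn_pi_space.2 fun o => ?_)
    by_cases h : ∃ i, L.lab i = some o
    · simp only [dif_pos h]; exact (hcoord _).contMDiffOn
    · simp only [dif_neg h]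
      exact ((coordL o).contMDiff.comp_contMDiffOn hG).div₀ ((contMDiff_weight o).comp contMDiff_fst).contMDiffOn
        fun w hw => (hU'U hw).2.2.2 o h
  have hmoved : ∀ w ∈ U', B.IsMoved ((w.1, R w), Ω w) := by
    intro w hw o
    change S.gen B.ext o (R w) = moveLabel o (S.gen B.ext o w.1) (S.x₀ w.1 * Ω w o)
    by_cases h : ∃ i, L.lab i = some o
    · obtain ⟨i, hi⟩ := h
      rw [hΩlab w i o hi]; exact hgenR w (hU'U hw) i o hi
    · have h3 := (hU'U hw).2.2.2 o h
      have h4 : Ω w o = G w o / S.weight o w.1 := by simp only [Ω, dif_neg h]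
      rw [moveLabel_gen, h4, ← sub_eq_iff_eq_add', hGo w hw o]
      field_simp
  refine ⟨U', fun w => ((w.1, R w), Ω w), hU', hw₀,
    (contMDiffOn_fst.prodMk (hR.mono hU'U)).prodMk hΩ, fun w hw => ⟨hmoved w hw, ⟨?_, ?_⟩, rfl,
      hRU w (hU'U hw), ?_, fun x hx hxU hxw => ?_⟩⟩
  · by_cases h : ∃ i, L.lab i = some none
    · obtain ⟨i, hi⟩ := h
      have := (hU'U hw).2.2.1 i (Or.inl hi)
      change 0 < 1 + S.x₀ w.1 * Ω w none
      rwa [hΩlab w i _ hi]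
    · have h3 : S.x₀ (R w) = S.x₀ w.1 * (1 + _) := hmoved w hw none
      have h4 : S.x₀ (R w) ≠ 0 := L.x₀_ne (fun h' => h (L.exists_lab _ (Or.inl ⟨rfl, h'⟩))) _
        (hRU w (hU'U hw))
      have h5 : 0 < S.x₀ (R w) := lt_of_le_of_ne (S.x₀_nonneg _) h4.symm
      rw [h3] at h5
      exact pos_of_mul_pos_right h5 (S.x₀_nonneg _)
  · by_cases h : ∃ i, L.lab i = some (some none)
    · obtain ⟨i, hi⟩ := h
      have := (hU'U hw).2.2.1 i (Or.inr hi)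
      change 0 < 1 + S.x₀ w.1 * Ω w (some none)
      rwa [hΩlab w i _ hi]
    · have h3 : S.x₁ (R w) = S.x₁ w.1 * (1 + _) := hmoved w hw (some none)
      have h4 : S.x₁ (R w) ≠ 0 := L.x₁_ne (fun h' => h (L.exists_lab _ (Or.inr ⟨rfl, h'⟩))) _
        (hRU w (hU'U hw))
      have h5 : 0 < S.x₁ (R w) := lt_of_le_of_ne (S.x₁_nonneg _) h4.symm
      rw [h3] at h5
      exact pos_of_mul_pos_right h5 (S.x₁_nonneg _)
  · ext i
    simp only [fibreCoord]
    rcases hl : L.lab i with _ | o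
    · simp only [Option.elim_none, R, L.c.right_inv (hmem w (hU'U hw))]
      simp [mv, BaseFunctions.moveVec, scaleVec, hl]
    · simp only [Option.elim_some]; exact hΩlab w i o hl
  · have hRx : R w = x.1.2 := by
      simp only [R, mv, ← hxw, L.moveVec_fibreCoord hx hxU, L.c.left_inv' hxU]
    have hw1 : w.1 = x.1.1 := by rw [← hxw]
    have hfst : (w.1, R w) = x.1 := Prod.ext hw1 hRx
    refine ⟨hfst, fun hne => Prod.ext hfst ?_⟩
    ext o
    change Ω w o = x.2 o
    have h3 := hmoved w hw o
    have h4 := hx o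
    simp only [moveLabel_gen, disp, hRx, hw1] at h3 h4
    rw [h4] at h3
    by_cases h : ∃ i, L.lab i = some o
    · obtain ⟨i, hi⟩ := h
      rw [hΩlab w i o hi, ← hxw]
      simp [fibreCoord, hi]
    · have h5 := (hU'U hw).2.2.2 o h
      rw [hw1] at h5
      exact (mul_left_cancel₀ hne (mul_left_cancel₀ h5 (add_left_cancel h3))).symm

lemma BaseFunctions.IsMoved.x₀_snd {x : GAmbient X N} (hx : B.IsMoved x) :
    S.x₀ x.1.2 = S.x₀ x.1.1 * (1 + S.disp x none) := hx none

lemma BaseFunctions.IsMoved.x₁_snd {x : GAmbient X N} (hx : B.IsMoved x) :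
    S.x₁ x.1.2 = S.x₁ x.1.1 * (1 + S.disp x (some none)) := hx (some none)

lemma BaseFunctions.IsMoved.x₀_eq_zero_iff {x : GAmbient X N} (hx : B.IsMoved x)
    (hpos : x ∈ S.ratioPos) : S.x₀ x.1.2 = 0 ↔ S.x₀ x.1.1 = 0 := by
  rw [hx.x₀_snd, mul_eq_zero, or_iff_left hpos.1.ne']

lemma BaseFunctions.IsMoved.φ_eq {x : GAmbient X N} (hx : B.IsMoved x) (h0 : S.x₀ x.1.1 = 0)
    (h0' : S.x₀ x.1.2 = 0) : S.φ x.1.1 = S.φ x.1.2 := by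
  refine B.injective_e ?_
  ext j
  have h : B.ext j x.1.2 = B.ext j x.1.1 + S.disp x (some (some j)) := hx (some (some j))
  rw [← B.ext_eq j _ h0, ← B.ext_eq j _ h0', h, disp, h0, zero_mul, add_zero]

/-- Coordinates near a point in which the coordinates of the groupoid adapted to the range map have
a smooth inverse. -/
lemma exists_labChart_moved [IsManifold (𝓠 n) ∞ X] [IsManifold (𝓠 k) ∞ Y]
    {x : GAmbient X N} (hx : B.IsMoved x) :
    ∃ (L : S.LabChart B x.1.2) (W : Set X), IsOpen W ∧ x.1.1 ∈ W ∧
      ∀ q ∈ W, ∀ q' ∈ L.c.U, S.x₀ q = 0 → S.x₀ q' = 0 →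
        (∀ i a, L.lab i = some a → S.gen B.ext a q = S.gen B.ext a q') → S.φ q = S.φ q' := by
  by_cases h0 : S.x₀ x.1.1 = 0
  · have h0' : S.x₀ x.1.2 = 0 := by rw [hx.x₀_snd, h0, zero_mul]
    obtain ⟨L, L', -, h⟩ := S.exists_labChart_pair B h0 h0' (hx.φ_eq h0 h0')
    exact ⟨L', L.c.U, L.c.isOpen_U, L.mem, h⟩
  · obtain ⟨L, -⟩ := S.exists_labChart B x.1.2
    exact ⟨L, {q | S.x₀ q ≠ 0}, isOpen_ne_fun S.contMDiff_x₀.continuous continuous_const, h0,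
      fun q hq _ _ h => absurd h hq⟩

end FiberedBoundary

namespace PhiBDouble.Model

open FiberedBoundary

variable (m : D.Model B) [IsManifold (𝓠 n) ∞ X] [IsManifold (𝓠 k) ∞ Y]

lemma isMoved_emb (g : D.space) : B.IsMoved (m.emb g) := m.gen_right (m.mem_pos g)

lemma ratioPos_emb (g : D.space) : m.emb g ∈ S.ratioPos := m.emb_mem_ratioPos (m.mem_pos g)

lemma contMDiff_emb : ContMDiff (𝓠 (n + n)) (gModel n N) ∞
    fun g : D.space => m.emb g := m.initEmb_emb.contMDiff

/-- Coordinates on the groupoid in which the range map is a projection. -/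
lemma exists_chart [T2Space X] (g₀ : D.space) : ∃ (L : S.LabChart B (D.β g₀).2)
    (Φ : PartialDiffeomorph (𝓠 (n + n)) (𝓣 n) D.space (X × 𝓔 n) ∞),
    g₀ ∈ Φ.source ∧ (∀ g : D.space, Φ g = ((D.β g).1, L.fibreCoord (m.emb g))) ∧
    ∀ g ∈ Φ.source, (D.β g).2 ∈ L.c.U := by
  obtain ⟨L, W, hW, hgW, hsep⟩ := exists_labChart_moved (m.isMoved_emb g₀)
  obtain ⟨U', Ξ, hU', hg₀, hΞ, hU'Ξ⟩ := L.exists_rightInverse hW hsep (m.isMoved_emb g₀)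
    (m.ratioPos_emb g₀) hgW L.mem
  have hrange : ∀ w ∈ U', Ξ w ∈ range fun g : D.space => m.emb g := by
    have h1 : ∀ w ∈ U', S.x₀ w.1 ≠ 0 → Ξ w ∈ range fun g : D.space => m.emb g := fun w hw hne => by
      obtain ⟨h2, h3, h4, -⟩ := hU'Ξ w hw
      exact m.mem_range_emb_of_x₀_ne (by rw [h4]; exact hne) h3 h2
    intro w hw
    by_cases h0 : S.x₀ w.1 = 0
    · obtain ⟨γ, hγ, hev⟩ := S.exists_push_x₀ h0
      have hw' : Tendsto (fun t => (γ t, w.2)) (𝓝[>] 0) (𝓝 w) := hγ.prodMk_nhds tendsto_const_nhds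
      refine m.mem_range_emb_of_closure (mem_closure_of_tendsto
        (((hΞ.continuousOn.continuousAt (hU'.mem_nhds hw)).tendsto).comp hw') ?_) (hU'Ξ w hw).2.1
      filter_upwards [hev, hw'.eventually (hU'.mem_nhds hw), self_mem_nhdsWithin] with t ht htU ht0
      exact h1 _ htU (by rw [ht.1]; exact ne_of_gt ht0)
    · exact h1 w hw h0
  obtain ⟨χ, hχ, hχs⟩ := m.initEmb_emb.exists_leftInverse
  have hχ' : ∀ w ∈ U', m.emb (χ (Ξ w)) = Ξ w := fun w hw => by
    obtain ⟨g, hg⟩ := hrange w hw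
    have hg' : m.emb g = Ξ w := hg
    have h := hχ g
    simp only at h
    rw [← hg', h]
  let F : D.space → X × 𝓔 n := fun g => ((D.β g).1, L.fibreCoord (m.emb g))
  let A : Set D.space := {g | (D.β g).2 ∈ L.c.U}
  have hA : IsOpen A := L.c.isOpen_U.preimage (contMDiff_fst_snd.comp m.contMDiff_emb).continuous
  have hF : ContMDiffOn (𝓠 (n + n)) (𝓣 n) ∞ F A :=
    (contMDiff_fst_fst.comp m.contMDiff_emb).contMDiffOn.prodMk
      (L.contMDiffOn_fibreCoord.comp m.contMDiff_emb.contMDiffOn fun g hg => hg)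
  have hsrc : IsOpen (A ∩ F ⁻¹' U') := hF.continuousOn.isOpen_inter_preimage hA hU'
  have hleft : ∀ g ∈ A ∩ F ⁻¹' U', Ξ (F g) = m.emb g := by
    intro g hg
    have hne : (𝓝[{g : D.space | S.x₀ (D.β g).1 ≠ 0}] g).NeBot :=
      mem_closure_iff_nhdsWithin_neBot.1 (m.mem_closure_x₀_ne g)
    have hc1 : Tendsto (fun g => Ξ (F g)) (𝓝[{g : D.space | S.x₀ (D.β g).1 ≠ 0}] g) (𝓝 (Ξ (F g))) :=
      ((hΞ.continuousOn.continuousAt (hU'.mem_nhds hg.2)).tendsto.comp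
        (hF.continuousOn.continuousAt (hA.mem_nhds hg.1)).tendsto).mono_left nhdsWithin_le_nhds
    have hc2 : Tendsto (fun g : D.space => m.emb g) (𝓝[{g : D.space | S.x₀ (D.β g).1 ≠ 0}] g)
        (𝓝 (m.emb g)) := (m.contMDiff_emb.continuous.tendsto g).mono_left nhdsWithin_le_nhds
    refine tendsto_nhds_unique_of_eventuallyEq hc1 hc2 ?_
    filter_upwards [self_mem_nhdsWithin, mem_nhdsWithin_of_mem_nhds (hsrc.mem_nhds hg)] with g' h1 h2
    exact ((hU'Ξ _ h2.2).2.2.2.2.2 (m.emb g') (m.isMoved_emb g') h2.1 rfl).2 h1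
  have hright : ∀ w ∈ U', χ (Ξ w) ∈ A ∧ F (χ (Ξ w)) = w := fun w hw => by
    obtain ⟨-, -, h1, h2, h3, -⟩ := hU'Ξ w hw
    refine ⟨?_, Prod.ext ?_ ?_⟩
    · change (m.emb (χ (Ξ w))).1.2 ∈ L.c.U
      rw [hχ' w hw]; exact h2
    · change (m.emb (χ (Ξ w))).1.1 = w.1
      rw [hχ' w hw]; exact h1
    · change L.fibreCoord (m.emb (χ (Ξ w))) = w.2
      rw [hχ' w hw]; exact h3
  refine ⟨L, ⟨⟨F, χ ∘ Ξ, A ∩ F ⁻¹' U', U', fun g hg => hg.2, fun w hw => ?_, fun g hg => ?_,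
    fun w hw => (hright w hw).2⟩, hsrc, hU', hF.mono inter_subset_left, hχs.comp hΞ hrange⟩,
    ⟨L.mem, hg₀⟩, fun g => rfl, fun g hg => hg.1⟩
  · refine ⟨(hright w hw).1, ?_⟩
    change F (χ (Ξ w)) ∈ U'
    rw [(hright w hw).2]; exact hw
  · change χ (Ξ (F g)) = g
    rw [hleft g hg]; exact hχ g

include m in
/-- Points of the groupoid with given range near a given point. -/
lemma exists_tendsto_rng [T2Space X] (h : D.space) {T : Type*} {F : Filter T} {p : T → X}
    (hp : Tendsto p F (𝓝 (D.β h).1)) : ∃ hT : T → D.space,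
    Tendsto hT F (𝓝 h) ∧ ∀ᶠ t in F, (D.β (hT t)).1 = p t := by
  obtain ⟨L, Φ, hh, hΦ, -⟩ := m.exists_chart h
  have hw : Tendsto (fun t => (p t, L.fibreCoord (m.emb h))) F (𝓝 (Φ h)) := by
    rw [hΦ]; exact hp.prodMk_nhds tendsto_const_nhds
  have ht := Φ.map_source hh
  refine ⟨fun t => Φ.invFun (p t, L.fibreCoord (m.emb h)), ?_, ?_⟩
  · have := ((Φ.contMDiffOn_invFun.continuousOn.continuousAt (Φ.open_target.mem_nhds ht)).tendsto).comp hw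
    rwa [show Φ.invFun (Φ h) = h from Φ.left_inv hh] at this
  · filter_upwards [hw.eventually (Φ.open_target.mem_nhds ht)] with t ht'
    have := (hΦ (Φ.invFun (p t, L.fibreCoord (m.emb h)))).symm.trans (Φ.right_inv ht')
    exact congrArg Prod.fst this

end PhiBDouble.Model

/-! ### The groupoid structure -/

namespace FiberedBoundary

/-- The derivative of `moveLabel o h z` in `h`. -/
def stretch : 𝓛 N → ℝ → ℝ
  | none, z => 1 + z
  | some none, z => 1 + z
  | some (some _), _ => 1

variable (S) in
/-- The factor by which a point of the groupoid rescales the differences of the labelled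
functions. -/
def cocycle (x : GAmbient X N) (o : 𝓛 N) : ℝ := (1 + S.disp x none) * stretch o (S.disp x o)

variable (S) in
/-- The composition of the groupoid. -/
def gMul (x y : GAmbient X N) : GAmbient X N :=
  ((x.1.1, y.1.2), toLp 2 fun o => x.2 o + S.cocycle x o * y.2 o)

variable (S) in
/-- The inversion of the groupoid. -/
def gInv (x : GAmbient X N) : GAmbient X N :=
  ((x.1.2, x.1.1), toLp 2 fun o => - (x.2 o / S.cocycle x o))

/-- The units of the groupoid. -/
def gOne (N : ℕ) (p : X) : GAmbient X N := ((p, p), 0)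

lemma stretch_pos {x : GAmbient X N} (hx : x ∈ S.ratioPos) (o : 𝓛 N) :
    0 < stretch o (S.disp x o) := by
  rcases o with _ | _ | j
  exacts [hx.1, hx.2, one_pos]

lemma cocycle_pos {x : GAmbient X N} (hx : x ∈ S.ratioPos) (o : 𝓛 N) :
    0 < S.cocycle x o := mul_pos hx.1 (stretch_pos hx o)

lemma contMDiff_cocycle (o : 𝓛 N) :
    ContMDiff (gModel n N) 𝓘(ℝ, ℝ) ∞ fun x : GAmbient X N => S.cocycle x o := by
  refine (contMDiff_const.add (contMDiff_disp none)).mul ?_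
  rcases o with _ | _ | j
  exacts [contMDiff_const.add (contMDiff_disp none), contMDiff_const.add (contMDiff_disp (some none)),
    contMDiff_const]

lemma contMDiff_gMul : ContMDiff ((gModel n N).prod (gModel n N)) (gModel n N) ∞
    fun a : GAmbient X N × GAmbient X N => S.gMul a.1 a.2 := by
  refine ((contMDiff_fst_fst.comp contMDiff_fst).prodMk (contMDiff_fst_snd.comp contMDiff_snd)).prodMk
    ((PiLp.contDiff_toLp (p := 2)).contMDiff.comp (contMDiff_pi_space.2 fun o => ?_))
  exact ((contMDiff_snd_apply o).comp contMDiff_fst).add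
    (((contMDiff_cocycle o).comp contMDiff_fst).mul ((contMDiff_snd_apply o).comp contMDiff_snd))

lemma contMDiffOn_gInv : ContMDiffOn (gModel n N) (gModel n N) ∞
    (S.gInv : GAmbient X N → GAmbient X N) S.ratioPos := by
  refine (contMDiff_fst_snd.prodMk contMDiff_fst_fst).contMDiffOn.prodMk
    ((PiLp.contDiff_toLp (p := 2)).contMDiff.comp_contMDiffOn (contMDiffOn_pi_space.2 fun o => ?_))
  exact ((contMDiff_snd_apply o).contMDiffOn.div₀ (contMDiff_cocycle o).contMDiffOn
    fun x hx => (cocycle_pos hx o).ne').neg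

lemma contMDiff_gOne : ContMDiff (𝓠 n) (gModel n N) ∞ (gOne N : X → GAmbient X N) :=
  (contMDiff_id.prodMk contMDiff_id).prodMk contMDiff_const

lemma disp_gMul {x y : GAmbient X N} (hx : B.IsMoved x) (hxy : x.1.2 = y.1.1) (o : 𝓛 N) :
    S.disp (S.gMul x y) o = S.disp x o + stretch o (S.disp x o) * S.disp y o := by
  have h := hx.x₀_snd
  rw [hxy] at h
  have h1 : S.disp y o = S.x₀ x.1.1 * (1 + S.disp x none) * y.2 o := by rw [disp, h]
  rw [h1]
  simp only [disp, gMul, cocycle]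
  ring

lemma moveLabel_disp_gMul {x y : GAmbient X N} (hx : B.IsMoved x) (hxy : x.1.2 = y.1.1)
    (o : 𝓛 N) (h : ℝ) :
    moveLabel o h (S.disp (S.gMul x y) o) = moveLabel o (moveLabel o h (S.disp x o)) (S.disp y o) := by
  rw [disp_gMul hx hxy]
  rcases o with _ | _ | j <;> simp only [moveLabel, stretch] <;> ring

lemma stretch_gMul {x y : GAmbient X N} (hx : B.IsMoved x) (hxy : x.1.2 = y.1.1)
    (o : 𝓛 N) : stretch o (S.disp (S.gMul x y) o) =
      stretch o (S.disp x o) * stretch o (S.disp y o) := by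
  rw [disp_gMul hx hxy]
  rcases o with _ | _ | j <;> simp only [stretch] <;> ring

lemma cocycle_gMul {x y : GAmbient X N} (hx : B.IsMoved x) (hxy : x.1.2 = y.1.1)
    (o : 𝓛 N) : S.cocycle (S.gMul x y) o = S.cocycle x o * S.cocycle y o := by
  have h : 1 + S.disp (S.gMul x y) none = (1 + S.disp x none) * (1 + S.disp y none) :=
    stretch_gMul hx hxy none
  rw [cocycle, h, stretch_gMul hx hxy, cocycle, cocycle]
  ring

lemma _root_.FiberedBoundary.BaseFunctions.IsMoved.gMul {x y : GAmbient X N} (hx : B.IsMoved x)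
    (hy : B.IsMoved y) (hxy : x.1.2 = y.1.1) : B.IsMoved (S.gMul x y) := fun o => by
  rw [moveLabel_disp_gMul hx hxy]
  change S.gen B.ext o y.1.2 = moveLabel o (moveLabel o (S.gen B.ext o x.1.1) _) _
  rw [← hx o, hxy]
  exact hy o

lemma gMul_mem_ratioPos {x y : GAmbient X N} (hx : B.IsMoved x) (hxy : x.1.2 = y.1.1)
    (hx' : x ∈ S.ratioPos) (hy' : y ∈ S.ratioPos) : S.gMul x y ∈ S.ratioPos := by
  constructor
  · have h : 1 + S.disp (S.gMul x y) none = _ := stretch_gMul hx hxy none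
    rw [h]; exact mul_pos hx'.1 hy'.1
  · have h : 1 + S.disp (S.gMul x y) (some none) = _ := stretch_gMul hx hxy (some none)
    rw [h]; exact mul_pos hx'.2 hy'.2

lemma disp_gInv {x : GAmbient X N} (hx : B.IsMoved x) (hx' : x ∈ S.ratioPos) (o : 𝓛 N) :
    S.disp (S.gInv x) o = - (S.disp x o / stretch o (S.disp x o)) := by
  have h := hx.x₀_snd
  have h1 := hx'.1.ne'
  have h2 := (stretch_pos hx' o).ne'
  change S.x₀ x.1.2 * (- (x.2 o / S.cocycle x o)) = _
  rw [h, cocycle]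
  field_simp
  simp only [disp]

lemma stretch_gInv {x : GAmbient X N} (hx : B.IsMoved x) (hx' : x ∈ S.ratioPos) (o : 𝓛 N) :
    stretch o (S.disp (S.gInv x) o) = (stretch o (S.disp x o))⁻¹ := by
  have h2 := (stretch_pos hx' o).ne'
  rw [disp_gInv hx hx']
  rcases o with _ | _ | j <;> simp only [stretch] at h2 ⊢
  · field_simp; ring
  · field_simp; ring
  · exact inv_one.symm

lemma cocycle_gInv {x : GAmbient X N} (hx : B.IsMoved x) (hx' : x ∈ S.ratioPos)
    (o : 𝓛 N) : S.cocycle (S.gInv x) o = (S.cocycle x o)⁻¹ := by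
  have h : 1 + S.disp (S.gInv x) none = (1 + S.disp x none)⁻¹ := stretch_gInv hx hx' none
  rw [cocycle, h, stretch_gInv hx hx', cocycle, mul_inv]

lemma _root_.FiberedBoundary.BaseFunctions.IsMoved.gInv {x : GAmbient X N} (hx : B.IsMoved x)
    (hx' : x ∈ S.ratioPos) : B.IsMoved (S.gInv x) := fun o => by
  have h2 := (stretch_pos hx' o).ne'
  rw [disp_gInv hx hx']
  change S.gen B.ext o x.1.1 = moveLabel o (S.gen B.ext o x.1.2) _
  rw [hx o]
  rcases o with _ | _ | j <;> simp only [stretch, moveLabel] at h2 ⊢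
  · field_simp; ring
  · field_simp; ring
  · ring

lemma gInv_mem_ratioPos {x : GAmbient X N} (hx : B.IsMoved x) (hx' : x ∈ S.ratioPos) :
    S.gInv x ∈ S.ratioPos := by
  constructor
  · have h : 1 + S.disp (S.gInv x) none = _ := stretch_gInv hx hx' none
    rw [h]; exact inv_pos.2 hx'.1
  · have h : 1 + S.disp (S.gInv x) (some none) = _ := stretch_gInv hx hx' (some none)
    rw [h]; exact inv_pos.2 hx'.2

lemma disp_gOne (p : X) (o : 𝓛 N) : S.disp (gOne N p) o = 0 := by
  simp [disp, gOne]

lemma stretch_zero (o : 𝓛 N) : stretch o 0 = 1 := by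
  rcases o with _ | _ | j <;> simp [stretch]

lemma cocycle_gOne (p : X) (o : 𝓛 N) : S.cocycle (gOne N p) o = 1 := by
  rw [cocycle, disp_gOne, disp_gOne, stretch_zero, add_zero, one_mul]

lemma isMoved_gOne (B : S.BaseFunctions N) (p : X) : B.IsMoved (gOne N p) := fun o => by
  rw [disp_gOne, moveLabel_gen, mul_zero, add_zero]
  rfl

lemma gOne_mem_ratioPos (p : X) : gOne N p ∈ (S.ratioPos : Set (GAmbient X N)) := by
  constructor
  · rw [disp_gOne]; norm_num
  · rw [disp_gOne]; norm_num

lemma gMul_assoc {x y z : GAmbient X N} (hx : B.IsMoved x) (hxy : x.1.2 = y.1.1) :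
    S.gMul (S.gMul x y) z = S.gMul x (S.gMul y z) := by
  refine Prod.ext rfl ?_
  ext o
  change x.2 o + S.cocycle x o * y.2 o + S.cocycle (S.gMul x y) o * z.2 o =
    x.2 o + S.cocycle x o * (y.2 o + S.cocycle y o * z.2 o)
  rw [cocycle_gMul hx hxy]
  ring

lemma gOne_gMul (x : GAmbient X N) : S.gMul (gOne N x.1.1) x = x := by
  refine Prod.ext rfl ?_
  ext o
  change 0 + S.cocycle (gOne N x.1.1) o * x.2 o = x.2 o
  rw [cocycle_gOne, zero_add, one_mul]

lemma gMul_gOne (x : GAmbient X N) : S.gMul x (gOne N x.1.2) = x := by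
  refine Prod.ext rfl ?_
  ext o
  change x.2 o + S.cocycle x o * 0 = x.2 o
  rw [mul_zero, add_zero]

lemma gMul_gInv {x : GAmbient X N} (hx' : x ∈ S.ratioPos) : S.gMul x (S.gInv x) = gOne N x.1.1 := by
  refine Prod.ext rfl ?_
  ext o
  change x.2 o + S.cocycle x o * (- (x.2 o / S.cocycle x o)) = 0
  have := (cocycle_pos hx' o).ne'
  field_simp
  ring

lemma gInv_gMul {x : GAmbient X N} (hx : B.IsMoved x) (hx' : x ∈ S.ratioPos) :
    S.gMul (S.gInv x) x = gOne N x.1.2 := by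
  refine Prod.ext rfl ?_
  ext o
  change - (x.2 o / S.cocycle x o) + S.cocycle (S.gInv x) o * x.2 o = 0
  rw [cocycle_gInv hx hx']
  have := (cocycle_pos hx' o).ne'
  field_simp
  ring

lemma gInv_gInv {x : GAmbient X N} (hx : B.IsMoved x) (hx' : x ∈ S.ratioPos) :
    S.gInv (S.gInv x) = x := by
  refine Prod.ext rfl ?_
  ext o
  change - (- (x.2 o / S.cocycle x o) / S.cocycle (S.gInv x) o) = x.2 o
  rw [cocycle_gInv hx hx']
  have := (cocycle_pos hx' o).ne'
  field_simp
  try ring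

end FiberedBoundary

namespace PhiBDouble.Model

open FiberedBoundary

variable (m : D.Model B) [IsManifold (𝓠 n) ∞ X] [IsManifold (𝓠 k) ∞ Y]

lemma gMul_mem_range [T2Space X] (g h : D.space) (hgh : (D.β g).2 = (D.β h).1) :
    S.gMul (m.emb g) (m.emb h) ∈ range fun g : D.space => m.emb g := by
  have key : ∀ g h : D.space, (D.β g).2 = (D.β h).1 → S.x₀ (D.β g).1 ≠ 0 →
      S.gMul (m.emb g) (m.emb h) ∈ range fun g : D.space => m.emb g := fun g h hgh h0 =>
    m.mem_range_emb_of_x₀_ne h0 (gMul_mem_ratioPos (m.isMoved_emb g) hgh (m.ratioPos_emb g)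
      (m.ratioPos_emb h)) ((m.isMoved_emb g).gMul (m.isMoved_emb h) hgh)
  have hne : (𝓝[{g : D.space | S.x₀ (D.β g).1 ≠ 0}] g).NeBot :=
    mem_closure_iff_nhdsWithin_neBot.1 (m.mem_closure_x₀_ne g)
  have hg : Tendsto id (𝓝[{g : D.space | S.x₀ (D.β g).1 ≠ 0}] g) (𝓝 g) :=
    tendsto_id.mono_left nhdsWithin_le_nhds
  have hp : Tendsto (fun g : D.space => (D.β g).2)
      (𝓝[{g : D.space | S.x₀ (D.β g).1 ≠ 0}] g) (𝓝 (D.β h).1) := by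
    rw [← hgh]
    exact ((contMDiff_fst_snd.comp m.contMDiff_emb).continuous.tendsto g).comp hg
  obtain ⟨hT, h1, h2⟩ := m.exists_tendsto_rng h hp
  refine m.mem_range_emb_of_closure (mem_closure_of_tendsto (contMDiff_gMul.continuous.tendsto
    (m.emb g, m.emb h) |>.comp (((m.contMDiff_emb.continuous.tendsto g).comp hg).prodMk_nhds
      ((m.contMDiff_emb.continuous.tendsto h).comp h1))) ?_)
    (gMul_mem_ratioPos (m.isMoved_emb g) hgh (m.ratioPos_emb g) (m.ratioPos_emb h))
  filter_upwards [h2, self_mem_nhdsWithin] with g' h3 h4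
  exact key _ _ h3.symm h4

lemma gInv_mem_range (g : D.space) : S.gInv (m.emb g) ∈ range fun g : D.space => m.emb g := by
  refine m.mem_range_emb_of_closure ?_ (gInv_mem_ratioPos (m.isMoved_emb g) (m.ratioPos_emb g))
  have hc : Continuous fun g : D.space => S.gInv (m.emb g) :=
    (contMDiffOn_gInv.comp_contMDiff m.contMDiff_emb m.ratioPos_emb).continuous
  refine closure_mono ?_ (image_closure_subset_closure_image hc ⟨g, m.mem_closure_x₀_ne g, rfl⟩)
  rintro _ ⟨g, hg, rfl⟩
  exact m.mem_range_emb_of_x₀_ne (fun h => hg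
    (((m.isMoved_emb g).x₀_eq_zero_iff (m.ratioPos_emb g)).1 h))
    (gInv_mem_ratioPos (m.isMoved_emb g) (m.ratioPos_emb g))
    ((m.isMoved_emb g).gInv (m.ratioPos_emb g))

lemma gOne_mem_range (p : X) : gOne N p ∈ range fun g : D.space => m.emb g := by
  have key : ∀ p, S.x₀ p ≠ 0 → gOne N p ∈ range fun g : D.space => m.emb g := fun p hp =>
    m.mem_range_emb_of_x₀_ne hp (gOne_mem_ratioPos p) (isMoved_gOne B p)
  by_cases h0 : S.x₀ p = 0
  · obtain ⟨γ, hγ, hev⟩ := S.exists_push_x₀ h0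
    refine m.mem_range_emb_of_closure (mem_closure_of_tendsto
      (((contMDiff_gOne (n := n) (N := N)).continuous.tendsto p).comp hγ) ?_) (gOne_mem_ratioPos p)
    filter_upwards [hev, self_mem_nhdsWithin] with t ht ht0
    exact key _ (by rw [ht.1]; exact ne_of_gt ht0)
  · exact key p h0

/-- The left inverse of the embedding of the groupoid. -/
def ret : GAmbient X N → D.space := m.initEmb_emb.exists_leftInverse.choose

lemma emb_ret {x : GAmbient X N} (hx : x ∈ range fun g : D.space => m.emb g) :
    m.emb (m.ret x) = x := by
  obtain ⟨g, rfl⟩ := hx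
  exact congrArg (fun g : D.space => m.emb g) (m.initEmb_emb.exists_leftInverse.choose_spec.1 g)

lemma emb_injective {g h : D.space} (hgh : m.emb g = m.emb h) : g = h := m.initEmb_emb.injective hgh

include m in
lemma isCornerSubmersionAt_rng [T2Space X] (g : D.space) :
    IsCornerSubmersionAt (𝓠 (n + n)) (𝓠 n) (fun g : D.space => (D.β g).1) g := by
  obtain ⟨L, Φ, hg, hΦ, -⟩ := m.exists_chart g
  exact ⟨n, fun g => L.fibreCoord (m.emb g), Φ, hg, fun g _ => (hΦ g).symm⟩

/-- The groupoid. -/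
def gpd [T2Space X] : LieGroupoid (𝓠 (n + n)) (𝓠 n) D.space X :=
  have emb_mul : ∀ g h : D.space, (D.β g).2 = (D.β h).1 →
      m.emb (m.ret (S.gMul (m.emb g) (m.emb h))) = S.gMul (m.emb g) (m.emb h) :=
    fun g h hgh => m.emb_ret (m.gMul_mem_range g h hgh)
  have emb_inv : ∀ g : D.space, m.emb (m.ret (S.gInv (m.emb g))) = S.gInv (m.emb g) :=
    fun g => m.emb_ret (m.gInv_mem_range g)
  have emb_one : ∀ p : X, m.emb (m.ret (gOne N p)) = gOne N p :=
    fun p => m.emb_ret (m.gOne_mem_range p)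
  have dom_mul : ∀ g h : D.space, (D.β g).2 = (D.β h).1 →
      (D.β (m.ret (S.gMul (m.emb g) (m.emb h)))).2 = (D.β h).2 :=
    fun g h hgh => congrArg (fun x : GAmbient X N => x.1.2) (emb_mul g h hgh)
  have rng_mul : ∀ g h : D.space, (D.β g).2 = (D.β h).1 →
      (D.β (m.ret (S.gMul (m.emb g) (m.emb h)))).1 = (D.β g).1 :=
    fun g h hgh => congrArg (fun x : GAmbient X N => x.1.1) (emb_mul g h hgh)
  have contMDiff_inv : ContMDiff (𝓠 (n + n)) (𝓠 (n + n)) ∞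
      fun g : D.space => m.ret (S.gInv (m.emb g)) := by
    rw [m.initEmb_emb.contMDiff_iff]
    exact (contMDiffOn_gInv.comp_contMDiff m.contMDiff_emb m.ratioPos_emb).congr emb_inv
  have inv_inv : ∀ g : D.space,
      m.ret (S.gInv (m.emb (m.ret (S.gInv (m.emb g))))) = g := fun g => m.emb_injective (by
    rw [emb_inv, emb_inv, gInv_gInv (m.isMoved_emb g) (m.ratioPos_emb g)])
  { dom := fun g => (D.β g).2
    rng := fun g => (D.β g).1
    mul := fun g h => m.ret (S.gMul (m.emb g) (m.emb h))
    one := fun p => m.ret (gOne N p)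
    inv := fun g => m.ret (S.gInv (m.emb g))
    dom_mul := dom_mul
    rng_mul := rng_mul
    mul_assoc := fun g h k hgh hhk => m.emb_injective (by
      rw [emb_mul _ _ ((dom_mul g h hgh).trans hhk), emb_mul g h hgh,
        emb_mul _ _ (hgh.trans (rng_mul h k hhk).symm), emb_mul h k hhk]
      exact gMul_assoc (m.isMoved_emb g) hgh)
    dom_one := fun p => congrArg (fun x : GAmbient X N => x.1.2) (emb_one p)
    rng_one := fun p => congrArg (fun x : GAmbient X N => x.1.1) (emb_one p)
    one_mul := fun g => m.emb_injective (by
      rw [emb_mul _ _ (congrArg (fun x : GAmbient X N => x.1.2) (emb_one _)), emb_one]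
      exact gOne_gMul (m.emb g))
    mul_one := fun g => m.emb_injective (by
      rw [emb_mul _ _ (congrArg (fun x : GAmbient X N => x.1.1) (emb_one _)).symm, emb_one]
      exact gMul_gOne (m.emb g))
    dom_inv := fun g => congrArg (fun x : GAmbient X N => x.1.2) (emb_inv g)
    rng_inv := fun g => congrArg (fun x : GAmbient X N => x.1.1) (emb_inv g)
    inv_mul := fun g => m.emb_injective (by
      rw [emb_mul _ _ (congrArg (fun x : GAmbient X N => x.1.2) (emb_inv g)), emb_inv, emb_one]
      exact gInv_gMul (m.isMoved_emb g) (m.ratioPos_emb g))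
    mul_inv := fun g => m.emb_injective (by
      rw [emb_mul _ _ (congrArg (fun x : GAmbient X N => x.1.1) (emb_inv g)).symm, emb_inv, emb_one]
      exact gMul_gInv (m.ratioPos_emb g))
    contMDiff_dom := contMDiff_fst_snd.comp m.contMDiff_emb
    contMDiff_rng := contMDiff_fst_fst.comp m.contMDiff_emb
    contMDiff_one := by
      rw [m.initEmb_emb.contMDiff_iff]
      exact contMDiff_gOne.congr emb_one
    contMDiff_inv := contMDiff_inv
    contMDiffOn_mul := by
      rw [m.initEmb_emb.contMDiffOn_iff]
      exact (contMDiff_gMul.comp ((m.contMDiff_emb.comp contMDiff_fst).prodMk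
        (m.contMDiff_emb.comp contMDiff_snd))).contMDiffOn.congr fun a ha => emb_mul a.1 a.2 ha
    submersion_dom := fun g => by
      obtain ⟨r, h, Φ, hΦ, hEq⟩ := m.isCornerSubmersionAt_rng (m.ret (S.gInv (m.emb g)))
      refine ⟨r, fun g => h (m.ret (S.gInv (m.emb g))), ?_⟩
      let ν : D.space ≃ D.space := ⟨fun g => m.ret (S.gInv (m.emb g)),
        fun g => m.ret (S.gInv (m.emb g)), inv_inv, inv_inv⟩
      refine ⟨⟨ν.toPartialEquiv.trans Φ.toPartialEquiv, ?_, ?_, ?_, ?_⟩, ⟨mem_univ _, hΦ⟩,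
        fun g' hg' => ?_⟩
      · exact isOpen_univ.inter (Φ.open_source.preimage contMDiff_inv.continuous)
      · have : (ν.toPartialEquiv.trans Φ.toPartialEquiv).target = Φ.target := by
          simp [PartialEquiv.trans_target]
        rw [this]; exact Φ.open_target
      · exact Φ.contMDiffOn_toFun.comp contMDiff_inv.contMDiffOn fun g' hg' => hg'.2
      · exact contMDiff_inv.comp_contMDiffOn (Φ.contMDiffOn_invFun.mono fun w hw => hw.1)
      · refine Eq.trans ?_ (hEq hg'.2)
        exact Prod.ext (congrArg (fun x : GAmbient X N => x.1.1) (emb_inv g')).symm rfl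
    submersion_rng := m.isCornerSubmersionAt_rng }

lemma emb_mul [T2Space X] {g h : D.space} (hgh : (D.β g).2 = (D.β h).1) :
    m.emb (m.gpd.mul g h) = S.gMul (m.emb g) (m.emb h) :=
  m.emb_ret (m.gMul_mem_range g h hgh)

lemma emb_inv [T2Space X] (g : D.space) : m.emb (m.gpd.inv g) = S.gInv (m.emb g) :=
  m.emb_ret (m.gInv_mem_range g)

lemma emb_one [T2Space X] (p : X) : m.emb (m.gpd.one p) = gOne N p := m.emb_ret (m.gOne_mem_range p)

/-- The point of the groupoid over a pair of points off `∂₀X`. -/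
def pairPoint (B : S.BaseFunctions N) (w : X × X) : GAmbient X N := (w, toLp 2 fun o =>
    (S.gen B.ext o w.2 - S.gen B.ext o w.1) / (S.x₀ w.1 * S.weight o w.1))

omit [IsManifold (𝓠 n) ∞ X] [IsManifold (𝓠 k) ∞ Y] in
lemma _root_.FiberedBoundary.weight_ne_zero {p : X} (hp : p ∈ (𝓠 n).interior X)
    (o : 𝓛 N) : S.weight o p ≠ 0 := by
  rw [S.mem_interior_iff] at hp
  rcases o with _ | _ | j
  exacts [hp.1, hp.2, one_ne_zero]

lemma pairPoint_mem_range {w : X × X} (hw : w ∈ D.interiorSq) :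
    pairPoint B w ∈ range fun g : D.space => m.emb g := by
  have h1 := (S.mem_interior_iff w.1).1 hw.1
  have h2 := (S.mem_interior_iff w.2).1 hw.2
  have hmv : B.IsMoved (pairPoint B w) := fun o => by
    have h3 := weight_ne_zero (S := S) (N := N) hw.1 o
    have h4 := h1.1
    rw [moveLabel_gen]
    simp only [disp, pairPoint]
    field_simp
    ring
  refine m.mem_range_emb_of_x₀_ne h1.1 ⟨?_, ?_⟩ hmv
  · have h3 := hmv.x₀_snd
    have h4 : 0 < S.x₀ w.2 := lt_of_le_of_ne (S.x₀_nonneg _) (Ne.symm h2.1)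
    exact pos_of_mul_pos_right (lt_of_lt_of_eq h4 h3) (S.x₀_nonneg _)
  · have h3 := hmv.x₁_snd
    have h4 : 0 < S.x₁ w.2 := lt_of_le_of_ne (S.x₁_nonneg _) (Ne.symm h2.2)
    exact pos_of_mul_pos_right (lt_of_lt_of_eq h4 h3) (S.x₁_nonneg _)

omit [IsManifold (𝓠 n) ∞ X] [IsManifold (𝓠 k) ∞ Y] in
lemma eq_pairPoint {x : GAmbient X N} (hx : B.IsMoved x)
    (hw : x.1.1 ∈ (𝓠 n).interior X) : x = pairPoint B x.1 := by
  refine Prod.ext rfl ?_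
  ext o
  have h3 := weight_ne_zero (S := S) (N := N) hw o
  have h4 := ((S.mem_interior_iff _).1 hw).1
  change x.2 o = (S.gen B.ext o x.1.2 - S.gen B.ext o x.1.1) / (S.x₀ x.1.1 * S.weight o x.1.1)
  rw [hx o, moveLabel_gen, disp]
  field_simp
  ring

lemma extendsPairGroupoid [T2Space X] : D.ExtendsPairGroupoid m.gpd := by
  have hsub : D.β ⁻¹' D.interiorSq ⊆ D.space := by
    intro q hq
    refine m.pos_subset_space ?_
    have h1 := (S.mem_interior_iff _).1 hq.1
    have h2 := (S.mem_interior_iff _).1 hq.2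
    have hc : m.centre (D.βΦ q) ≠ 0 := fun h =>
      h1.1 ((B.centreMap_eq_zero_iff (m.bEq q)).1 h).1.1
    have hE := m.bEq q
    have p1 : 0 < S.x₀ (D.β q).1 := lt_of_le_of_ne (S.x₀_nonneg _) (Ne.symm h1.1)
    have p2 : 0 < S.x₀ (D.β q).2 := lt_of_le_of_ne (S.x₀_nonneg _) (Ne.symm h2.1)
    have p3 : 0 < S.x₁ (D.β q).1 := lt_of_le_of_ne (S.x₁_nonneg _) (Ne.symm h1.2)
    have p4 : 0 < S.x₁ (D.β q).2 := lt_of_le_of_ne (S.x₁_nonneg _) (Ne.symm h2.2)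
    have aux : ∀ {s s' : ℝ} {a : 𝓔 2}, 0 < s → 0 < s' → SlopeEq s s' a → 0 < a 0 ∧ 0 < a 1 := by
      intro s s' a hs hs' ha
      obtain ⟨h3, h4, h5, h6⟩ := ha
      have hne : ∀ i j : Fin 2, a i = 0 → a j = 0 → i ≠ j → False := fun i j hi hj hij => by
        have : a = 0 := by
          ext r
          have : r = i ∨ r = j := by omega
          rcases this with rfl | rfl
          exacts [hi, hj]
        rw [this, norm_zero] at h3
        exact zero_ne_one h3
      refine ⟨lt_of_le_of_ne h4 fun h => ?_, lt_of_le_of_ne h5 fun h => ?_⟩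
      · rw [← h, mul_zero] at h6
        exact hne 0 1 h.symm ((mul_eq_zero.1 h6).resolve_left hs.ne') (by decide)
      · rw [← h, mul_zero] at h6
        exact hne 0 1 ((mul_eq_zero.1 h6.symm).resolve_left hs'.ne') h.symm (by decide)
    have hb : m.amb q ∈ bPos X := ⟨aux p1 p2 hE.1, aux p3 p4 hE.2⟩
    refine ⟨hb, lt_of_le_of_ne (m.α_none_nonneg q) fun h => ?_⟩
    have h3 := m.mul_α_none q
    rw [← h, mul_zero] at h3
    have h4 : S.x₀ (D.β q).1 = _ := x₀_left_eq (m.bEq q)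
    rw [← h3, zero_mul] at h4
    exact h1.1 h4
  have hemb : ∀ w ∈ D.interiorSq, m.emb (m.ret (pairPoint B w)) = pairPoint B w := fun w hw =>
    m.emb_ret (m.pairPoint_mem_range hw)
  have heq : ∀ g : D.space, ∀ x : X × X, x ∈ D.interiorSq → D.β g = x → g = m.ret (pairPoint B x) := by
    rintro g _ hx rfl
    refine m.emb_injective ?_
    rw [hemb _ hx]
    exact eq_pairPoint (m.isMoved_emb g) hx.1
  have hβ : ∀ w ∈ D.interiorSq, D.β (m.ret (pairPoint B w)) = w := fun w hw =>
    congrArg Prod.fst (hemb w hw)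
  refine ⟨hsub, fun w => m.ret (pairPoint B w), ?_, hβ, fun g hg => (heq g _ hg rfl).symm,
    fun a ha => ⟨heq _ (a, a) ⟨ha, ha⟩ (congrArg Prod.fst (m.emb_one a)), fun b hb =>
      ⟨congrArg Prod.fst (hβ (a, b) ⟨ha, hb⟩), congrArg Prod.snd (hβ (a, b) ⟨ha, hb⟩), ?_,
        fun c hc => ?_⟩⟩⟩
  · rw [m.initEmb_emb.contMDiffOn_iff]
    refine ContMDiffOn.congr (f := pairPoint B) ?_ hemb
    refine contMDiffOn_id.prodMk
      ((PiLp.contDiff_toLp (p := 2)).contMDiff.comp_contMDiffOn (contMDiffOn_pi_space.2 fun o => ?_))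
    refine ContMDiffOn.div₀ (((B.contMDiff_gen o).comp contMDiff_snd).sub
      ((B.contMDiff_gen o).comp contMDiff_fst)).contMDiffOn
      ((S.contMDiff_x₀.comp contMDiff_fst).mul ((contMDiff_weight o).comp contMDiff_fst)).contMDiffOn
      fun w hw => mul_ne_zero ((S.mem_interior_iff _).1 hw.1).1 (weight_ne_zero hw.1 o)
  · refine heq _ (b, a) ⟨hb, ha⟩ ((congrArg Prod.fst (m.emb_inv _)).trans ?_)
    rw [hemb (a, b) ⟨ha, hb⟩]; rfl
  · refine heq _ (a, c) ⟨ha, hc⟩ ((congrArg Prod.fst (m.emb_mul ?_)).trans ?_)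
    · rw [hβ (a, b) ⟨ha, hb⟩, hβ (b, c) ⟨hb, hc⟩]
    · rw [hemb (a, b) ⟨ha, hb⟩, hemb (b, c) ⟨hb, hc⟩]; rfl

variable (S) in
include S in
omit [IsManifold (𝓠 k) ∞ Y] in
lemma _root_.FiberedBoundary.dense_interior : Dense ((𝓠 n).interior X) := by
  have h0 : ∀ p, S.x₀ p ≠ 0 → p ∈ closure ((𝓠 n).interior X) := by
    intro p hp
    by_cases h1 : S.x₁ p = 0
    · obtain ⟨γ, hγ, hev⟩ := S.exists_push_x₁ h1
      refine mem_closure_of_tendsto hγ ?_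
      filter_upwards [hev, self_mem_nhdsWithin, hγ.eventually
        ((isOpen_ne_fun S.contMDiff_x₀.continuous continuous_const).mem_nhds hp)] with t ht ht0 htx
      exact (S.mem_interior_iff _).2 ⟨htx, by rw [ht.1]; exact ne_of_gt ht0⟩
    · exact subset_closure ((S.mem_interior_iff p).2 ⟨hp, h1⟩)
  intro p
  by_cases hp : S.x₀ p = 0
  · obtain ⟨γ, hγ, hev⟩ := S.exists_push_x₀ hp
    rw [← closure_closure]
    refine mem_closure_of_tendsto hγ ?_
    filter_upwards [hev, self_mem_nhdsWithin] with t ht ht0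
    exact h0 _ (by rw [ht.1]; exact ne_of_gt ht0)
  · exact h0 p hp

lemma image_range_one [T2Space X] [CompactSpace X] :
    Subtype.val '' range m.gpd.one = D.diagonal := by
  have : T2Space D.Xb := m.isBDouble.initEmb.isEmbedding.t2Space
  have : T2Space D.XΦb := m.initEmb.isEmbedding.t2Space
  obtain ⟨hsub, j, -, -, hj, hj'⟩ := m.extendsPairGroupoid
  have hone : Continuous fun p => (m.gpd.one p : D.XΦb) :=
    continuous_subtype_val.comp m.gpd.contMDiff_one.continuous
  rw [← range_comp]
  refine Subset.antisymm ?_ (closure_minimal ?_ (isCompact_range hone).isClosed)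
  · rintro _ ⟨p, rfl⟩
    refine closure_mono ?_ (image_closure_subset_closure_image hone ⟨p, S.dense_interior p, rfl⟩)
    rintro _ ⟨p, hp, rfl⟩
    have h : D.β (m.gpd.one p) = (p, p) := congrArg Prod.fst (m.emb_one p)
    rw [mem_preimage, h]
    exact ⟨rfl, hp⟩
  · rintro q ⟨hq1, hq2⟩
    have hq : D.β q ∈ D.interiorSq := ⟨hq2, hq1 ▸ hq2⟩
    refine ⟨(D.β q).1, ?_⟩
    have h : j (D.β q) = ⟨q, hsub hq⟩ := hj ⟨q, hsub hq⟩ hq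
    rw [Function.comp_apply, (hj' _ hq2).1, show ((D.β q).1, (D.β q).1) = D.β q from Prod.ext rfl hq1, h]

end PhiBDouble.Model

/-! ### Vector fields -/

section VectorFields

open VectorField

variable {F : Type*} [NormedAddCommGroup F] [NormedSpace ℝ F]

lemma InitEmb.injective_mfderiv {ι : M → M'} (h : InitEmb I I' ι) (x : M) :
    Function.Injective (mfderiv I I' ι x) := by
  obtain ⟨χ, hχ, hs⟩ := h.exists_leftInverse
  have h1 := ((hs (ι x) ⟨x, rfl⟩).mdifferentiableWithinAt (by simp)).hasMFDerivWithinAt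
  have h2 := (h.contMDiff x).mdifferentiableAt (by simp) |>.hasMFDerivAt.hasMFDerivWithinAt (s := univ)
  have h3 := HasMFDerivWithinAt.comp x h1 h2 fun y _ => ⟨y, rfl⟩
  rw [hasMFDerivWithinAt_univ] at h3
  have h4 : HasMFDerivAt I I (χ ∘ ι) x (ContinuousLinearMap.id ℝ (TangentSpace I x)) := by
    rw [hχ.comp_eq_id]; exact hasMFDerivAt_id x
  have h5 := hasMFDerivAt_unique h3 h4
  intro v w hvw
  have h6 := fun v => DFunLike.congr_fun h5 v
  exact (h6 v).symm.trans ((congrArg _ hvw).trans (h6 w))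

variable (I) in
/-- The differential of a function with values in a vector space. -/
def vderiv (h : M → F) (x : M) : TangentSpace I x →L[ℝ] F := mfderiv I 𝓘(ℝ, F) h x

lemma vderiv_comp {h : M' → F} {f : M → M'} {x : M} (hh : ContMDiffAt I' 𝓘(ℝ, F) ∞ h (f x))
    (hf : ContMDiffAt I I' ∞ f x) (v : TangentSpace I x) :
    vderiv I (fun x => h (f x)) x v = vderiv I' h (f x) (mfderiv I I' f x v) :=
  mfderiv_comp_apply x (hh.mdifferentiableAt (by simp)) (hf.mdifferentiableAt (by simp)) v

lemma vderiv_apply {ι : Type*} [Fintype ι] {f : M → EuclideanSpace ℝ ι} {x : M}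
    (hf : ContMDiffAt I 𝓘(ℝ, EuclideanSpace ℝ ι) ∞ f x) (i : ι) (v : TangentSpace I x) :
    vderiv I (fun q => f q i) x v = vderiv I f x v i :=
  DFunLike.congr_fun ((coordL i).hasMFDerivAt
    (x := f x) |>.comp x (hf.mdifferentiableAt (by simp)).hasMFDerivAt).mfderiv v

lemma vderiv_add {f g : M → F} {x : M} (hf : ContMDiffAt I 𝓘(ℝ, F) ∞ f x)
    (hg : ContMDiffAt I 𝓘(ℝ, F) ∞ g x) (v : TangentSpace I x) :
    vderiv I (fun q => f q + g q) x v = vderiv I f x v + vderiv I g x v :=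
  DFunLike.congr_fun ((hf.mdifferentiableAt (by simp)).hasMFDerivAt.add
    (hg.mdifferentiableAt (by simp)).hasMFDerivAt).mfderiv v

lemma vderiv_mul {f g : M → ℝ} {x : M} (hf : ContMDiffAt I 𝓘(ℝ, ℝ) ∞ f x)
    (hg : ContMDiffAt I 𝓘(ℝ, ℝ) ∞ g x) (v : TangentSpace I x) :
    vderiv I (fun q => f q * g q) x v = f x * vderiv I g x v + g x * vderiv I f x v :=
  DFunLike.congr_fun ((hf.mdifferentiableAt (by simp)).hasMFDerivAt.mul
    (hg.mdifferentiableAt (by simp)).hasMFDerivAt).mfderiv v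

lemma tangentBundle_mk_eq {x y : M} (h : x = y) (a : E) :
    (⟨x, a⟩ : TangentBundle I M) = ⟨y, a⟩ := by
  subst h; rfl

/-- The derivative of a function along a smooth family of tangent vectors is smooth. -/
lemma contMDiffOn_mfderiv_apply [IsManifold I ∞ M] {h : M → F} {U : Set M} (hU : IsOpen U)
    (hh : ContMDiffOn I 𝓘(ℝ, F) ∞ h U) {σ : M' → TangentBundle I M} {s : Set M'}
    (hσ : ContMDiffOn I' I.tangent ∞ σ s) (hsU : ∀ q ∈ s, (σ q).proj ∈ U) :
    ContMDiffOn I' 𝓘(ℝ, F) ∞ (fun q => vderiv I h (σ q).proj (σ q).2) s := by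
  have : IsManifold I 1 M := IsManifold.of_le (n := ∞) (by simp)
  have h1 := (hh.contMDiffOn_tangentMapWithin (m := ∞) (by simp) hU.uniqueMDiffOn).comp hσ hsU
  refine ((contMDiff_snd_tangentBundle_modelSpace F 𝓘(ℝ, F)).comp_contMDiffOn h1).congr
    fun q hq => ?_
  exact (DFunLike.congr_fun (mfderivWithin_of_isOpen (f := h) hU (hsU q hq)) (σ q).2).symm

lemma contMDiff_mfderiv_apply [IsManifold I ∞ M] {h : M → F} (hh : ContMDiff I 𝓘(ℝ, F) ∞ h)
    {σ : M' → TangentBundle I M} (hσ : ContMDiff I' I.tangent ∞ σ) :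
    ContMDiff I' 𝓘(ℝ, F) ∞ fun q => vderiv I h (σ q).proj (σ q).2 :=
  contMDiffOn_univ.1 (contMDiffOn_mfderiv_apply isOpen_univ hh.contMDiffOn hσ.contMDiffOn
    fun _ _ => mem_univ _)

lemma two_le : (2 : WithTop ℕ∞) ≤ ∞ := 
  show ((2 : ℕ∞) : WithTop ℕ∞) ≤ ((⊤ : ℕ∞) : WithTop ℕ∞) from WithTop.coe_le_coe.2 le_top

lemma fderivWithin_comp_extChartAt_symm [IsManifold I ∞ M] {h : M → F}
    (hh : ContMDiff I 𝓘(ℝ, F) ∞ h) (x : M) {y : E} (hy : y ∈ (extChartAt I x).target)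
    (V : ∀ x : M, TangentSpace I x) :
    fderivWithin ℝ (h ∘ (extChartAt I x).symm) (range I) y
      (mpullbackWithin 𝓘(ℝ, E) I (extChartAt I x).symm V (range I) y) =
    vderiv I h ((extChartAt I x).symm y) (V ((extChartAt I x).symm y)) := by
  have : IsManifold I 1 M := IsManifold.of_le (n := ∞) (by simp)
  have hinv := isInvertible_mfderivWithin_extChartAt_symm (I := I) hy
  have hu : UniqueMDiffWithinAt 𝓘(ℝ, E) (range I) y :=
    I.uniqueMDiffOn y (extChartAt_target_subset_range x hy)
  have h1 := mfderiv_comp_mfderivWithin y ((hh _).mdifferentiableAt (by simp))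
    (mdifferentiableWithinAt_extChartAt_symm hy) hu
  rw [← mfderivWithin_eq_fderivWithin, h1, mpullbackWithin_apply]
  exact congrArg (mfderiv I 𝓘(ℝ, F) h ((extChartAt I x).symm y))
    (hinv.self_apply_inverse (V ((extChartAt I x).symm y)))

lemma mfderiv_mlieBracket [CompleteSpace E] [IsManifold I ∞ M] {h : M → F}
    (hh : ContMDiff I 𝓘(ℝ, F) ∞ h) {V W : ∀ x : M, TangentSpace I x}
    (hV : ContMDiff I I.tangent ∞ fun x => (⟨x, V x⟩ : TangentBundle I M))
    (hW : ContMDiff I I.tangent ∞ fun x => (⟨x, W x⟩ : TangentBundle I M)) (x : M) :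
    vderiv I h x (mlieBracket I V W x) =
      vderiv I (fun y => vderiv I h y (W y)) x (V x) - vderiv I (fun y => vderiv I h y (V y)) x (W x) := by
  have i1 : IsManifold I 1 M := IsManifold.of_le (n := ∞) (by simp)
  have i2 : IsManifold I 2 M := IsManifold.of_le (n := ∞) two_le
  have hx := mem_extChartAt_target (I := I) x
  have hsx : (extChartAt I x).symm (extChartAt I x x) = x := extChartAt_to_inv x
  have hdiff : ∀ {V : ∀ x : M, TangentSpace I x},
      ContMDiff I I.tangent ∞ (fun x => (⟨x, V x⟩ : TangentBundle I M)) →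
      DifferentiableWithinAt ℝ (mpullbackWithin 𝓘(ℝ, E) I (extChartAt I x).symm V (range I))
        (range I) (extChartAt I x x) := fun {V} hV => by
    have h := ((hV x).mdifferentiableAt
      (by simp)).mdifferentiableWithinAt (s := univ) |>.differentiableWithinAt_mpullbackWithin_vectorField
    rwa [preimage_univ, univ_inter] at h
  have hinner : ∀ {V W : ∀ x : M, TangentSpace I x},
      ContMDiff I I.tangent ∞ (fun x => (⟨x, W x⟩ : TangentBundle I M)) →
      fderivWithin ℝ (fun y => fderivWithin ℝ (h ∘ (extChartAt I x).symm) (range I) y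
        (mpullbackWithin 𝓘(ℝ, E) I (extChartAt I x).symm W (range I) y)) (range I) (extChartAt I x x)
        (mpullbackWithin 𝓘(ℝ, E) I (extChartAt I x).symm V (range I) (extChartAt I x x)) =
      vderiv I (fun y => vderiv I h y (W y)) x (V x) := by
    intro V W hW
    have e : (fun y => fderivWithin ℝ (h ∘ (extChartAt I x).symm) (range I) y
        (mpullbackWithin 𝓘(ℝ, E) I (extChartAt I x).symm W (range I) y)) =ᶠ[𝓝[range I] (extChartAt I x x)]
        (fun y => vderiv I h y (W y)) ∘ (extChartAt I x).symm := by
      filter_upwards [extChartAt_target_mem_nhdsWithin (I := I) x] with y hy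
      exact fderivWithin_comp_extChartAt_symm hh x hy W
    rw [e.fderivWithin_eq (fderivWithin_comp_extChartAt_symm hh x hx W),
      fderivWithin_comp_extChartAt_symm (contMDiff_mfderiv_apply hh hW) x hx V, hsx]
  have hsm : ContDiffWithinAt ℝ ∞ (h ∘ (extChartAt I x).symm) (range I) (extChartAt I x x) := by
    have h1 := (hh.contMDiffAt (x := (extChartAt I x).symm (extChartAt I x x))).comp_contMDiffWithinAt _
      (contMDiffWithinAt_extChartAt_symm_range (n := ∞) x hx)
    exact h1.contDiffWithinAt
  have hcl : extChartAt I x x ∈ closure (interior (range I)) :=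
    I.range_subset_closure_interior (mem_range_self _)
  have key := fderivWithin_apply_lieBracket hsm
    (by rw [minSmoothness_of_isRCLikeNormedField]; exact two_le) I.uniqueDiffOn hcl (mem_range_self _)
    (hdiff hW) (hdiff hV)
  rw [hinner hW, hinner hV] at key
  rw [← key, ← mlieBracketWithin_univ, mlieBracketWithin_apply, preimage_univ, univ_inter]
  have h1 := mfderiv_comp_mfderivWithin (extChartAt I x x) ((hh _).mdifferentiableAt (by simp))
    (mdifferentiableWithinAt_extChartAt_symm hx) (I.uniqueMDiffOn _ (mem_range_self _))
  rw [← mfderivWithin_eq_fderivWithin, h1]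
  have h2 : (mfderiv I 𝓘(ℝ, E) (extChartAt I x) x).inverse =
      mfderivWithin 𝓘(ℝ, E) I (extChartAt I x).symm (range I) (extChartAt I x x) :=
    ContinuousLinearMap.inverse_eq
      (by exact mfderiv_extChartAt_comp_mfderivWithin_extChartAt_symm' (mem_extChartAt_source x))
      (by exact mfderivWithin_extChartAt_symm_comp_mfderiv_extChartAt' (mem_extChartAt_source x))
  rw [h2, hsx]
  rfl

/-- Brackets of vector fields related by a smooth map are related. -/
lemma mfderiv_mlieBracket_of_related [CompleteSpace E] [CompleteSpace E'] [IsManifold I ∞ M]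
    [IsManifold I' ∞ M'] {e : M' → F} (he : ContMDiff I' 𝓘(ℝ, F) ∞ e)
    (hinj : ∀ y, Function.Injective (mfderiv I' 𝓘(ℝ, F) e y)) {f : M → M'} (hf : ContMDiff I I' ∞ f)
    {V W : ∀ x : M, TangentSpace I x} {V' W' : ∀ x : M', TangentSpace I' x}
    (hV : ContMDiff I I.tangent ∞ fun x => (⟨x, V x⟩ : TangentBundle I M))
    (hW : ContMDiff I I.tangent ∞ fun x => (⟨x, W x⟩ : TangentBundle I M))
    (hV' : ContMDiff I' I'.tangent ∞ fun x => (⟨x, V' x⟩ : TangentBundle I' M'))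
    (hW' : ContMDiff I' I'.tangent ∞ fun x => (⟨x, W' x⟩ : TangentBundle I' M'))
    (hVV' : ∀ x, mfderiv I I' f x (V x) = V' (f x)) (hWW' : ∀ x, mfderiv I I' f x (W x) = W' (f x))
    (x : M) : mfderiv I I' f x (mlieBracket I V W x) = mlieBracket I' V' W' (f x) := by
  have hd : ∀ {V : ∀ x : M, TangentSpace I x} {V' : ∀ x : M', TangentSpace I' x},
      (∀ x, mfderiv I I' f x (V x) = V' (f x)) →
      (fun y => vderiv I (fun y => e (f y)) y (V y)) = fun y => vderiv I' e (f y) (V' (f y)) :=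
    fun h => funext fun y => by rw [vderiv_comp (he _) (hf y), h]
  have key := mfderiv_mlieBracket (he.comp hf) hV hW x
  rw [Function.comp_def, hd hVV', hd hWW', vderiv_comp (he _) (hf x),
    vderiv_comp (contMDiff_mfderiv_apply he hV' _) (hf x),
    vderiv_comp (contMDiff_mfderiv_apply he hW' _) (hf x), hVV', hWW'] at key
  exact hinj _ (key.trans (mfderiv_mlieBracket he hV' hW' (f x)).symm)

/-- A function on a dense set that extends smoothly near each point extends smoothly. -/
lemma exists_contMDiff_of_dense {A : Set M} (hA : Dense A) {f : M → F}
    (hf : ∀ p, ∃ U, IsOpen U ∧ p ∈ U ∧ ∃ g : M → F, ContMDiffOn I 𝓘(ℝ, F) ∞ g U ∧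
      ∀ q ∈ U ∩ A, g q = f q) : ∃ g : M → F, ContMDiff I 𝓘(ℝ, F) ∞ g ∧ EqOn g f A := by
  choose U hU hp g hg hgf using hf
  have heq : ∀ p q, q ∈ U p → g q q = g p q := by
    intro p q hq
    have hne : (𝓝[A] q).NeBot := mem_closure_iff_nhdsWithin_neBot.1 (hA q)
    refine tendsto_nhds_unique_of_eventuallyEq (l := 𝓝[A] q)
      (((hg q).continuousOn.continuousAt ((hU q).mem_nhds (hp q))).tendsto.mono_left nhdsWithin_le_nhds)
      (((hg p).continuousOn.continuousAt ((hU p).mem_nhds hq)).tendsto.mono_left nhdsWithin_le_nhds) ?_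
    filter_upwards [self_mem_nhdsWithin, mem_nhdsWithin_of_mem_nhds ((hU q).mem_nhds (hp q)),
      mem_nhdsWithin_of_mem_nhds ((hU p).mem_nhds hq)] with y h1 h2 h3
    rw [hgf q y ⟨h2, h1⟩, hgf p y ⟨h3, h1⟩]
  refine ⟨fun p => g p p, fun p => ?_, fun q hq => hgf q q ⟨hp q, hq⟩⟩
  exact ((hg p).contMDiffAt ((hU p).mem_nhds (hp p))).congr_of_eventuallyEq
    (eventually_of_mem ((hU p).mem_nhds (hp p)) (heq p))

end VectorFields

/-! ### Fibered cusp b-vector fields in terms of the labelled functions -/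

section ChartDerivative

variable {m : ℕ} (c : CornerChart I P m) {p : P} (hp : p ∈ c.U)
include hp

lemma EmbChart.contMDiffAt_ψ : ContMDiffAt I 𝓘(ℝ, 𝓔 m) ∞ c.ψ p :=
  c.smooth_ψ'.contMDiffAt (c.isOpen_U.mem_nhds hp)

lemma EmbChart.injective_vderiv_ψ : Function.Injective (vderiv I c.ψ p) := by
  have h1 := ((c.smooth_χ _ (c.mapsTo_ψ' hp)).mdifferentiableWithinAt (by simp)).hasMFDerivWithinAt
  have h2 := ((c.contMDiffAt_ψ hp).mdifferentiableAt (by simp)).hasMFDerivAt.hasMFDerivWithinAt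
    (s := c.U)
  have h3 := (HasMFDerivWithinAt.comp p h1 h2 fun y hy => c.mapsTo_ψ' hy).hasMFDerivAt
    (c.isOpen_U.mem_nhds hp)
  have h4 := (hasMFDerivAt_id (I := I) p).congr_of_eventuallyEq
    (eventually_of_mem (c.isOpen_U.mem_nhds hp) fun y hy => c.left_inv' hy)
  intro v w hvw
  have h5 := fun v => DFunLike.congr_fun (hasMFDerivAt_unique h3 h4) v
  exact (h5 v).symm.trans ((congrArg _ hvw).trans (h5 w))

end ChartDerivative

namespace FiberedBoundary

variable [IsManifold (𝓠 n) ∞ X]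

variable (S) in
/-- Curves in `∂₀X` with given velocity. -/
lemma exists_curve {p : X} (hp : S.x₀ p = 0) {v : TangentSpace (𝓠 n) p}
    (h0 : vderiv (𝓠 n) S.x₀ p v = 0)
    (h1 : S.x₁ p = 0 → vderiv (𝓠 n) S.x₁ p v = 0) : ∃ γ : ℝ → X, γ 0 = p ∧
      (∀ᶠ t in 𝓝 0, S.x₀ (γ t) = 0) ∧ HasMFDerivAt 𝓘(ℝ, ℝ) (𝓠 n) γ 0
        (ContinuousLinearMap.toSpanSingleton ℝ (v : 𝓔 n)) := by
  obtain ⟨c, lab, hpc, -, h3, h4, -, h6, h7, -, -⟩ := S.exists_cornerChart_bd p isOpen_univ (mem_univ p)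
  let w : 𝓔 n := vderiv (𝓠 n) c.ψ p v
  have hw : ∀ i b, lab i = some b → w i = 0 := by
    intro i b hi
    have e : (fun q => c.ψ q i) =ᶠ[𝓝 p] S.gen Empty.elim b :=
      eventually_of_mem (c.isOpen_U.mem_nhds hpc) (h7 i b hi)
    have e1 : w i = vderiv (𝓠 n) (S.gen Empty.elim b) p v :=
      (vderiv_apply (c.contMDiffAt_ψ hpc) i v).symm.trans (DFunLike.congr_fun e.mfderiv_eq v)
    rw [e1]
    rcases h4 i b hi with ⟨rfl, h⟩ | ⟨rfl, h⟩
    exacts [h0, h1 h]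
  let ℓ : ℝ → 𝓔 n := fun t => c.ψ p + t • w
  have hℓ : ContDiff ℝ ∞ ℓ := by fun_prop
  have hℓ0 : ℓ 0 = c.ψ p := by simp [ℓ]
  have hT : IsOpen (ℓ ⁻¹' c.O) := c.isOpen_O.preimage hℓ.continuous
  have hTV : MapsTo ℓ (ℓ ⁻¹' c.O) (c.O ∩ cornerSet c.J) := fun t ht => ⟨ht, fun j hj => by
    obtain ⟨b, -, hb⟩ := (h6 j).1 hj
    have h8 := (c.mapsTo_ψ' hpc).2 j hj
    simpa [ℓ, hw j b hb] using h8⟩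
  have h0T : ℓ ⁻¹' c.O ∈ 𝓝 (0 : ℝ) := hT.mem_nhds (by
    rw [mem_preimage, hℓ0]; exact (c.mapsTo_ψ' hpc).1)
  have hγ0 : c.χ (ℓ 0) = p := by rw [hℓ0, c.left_inv' hpc]
  have hγ : ContMDiffAt 𝓘(ℝ, ℝ) (𝓠 n) ∞ (fun t => c.χ (ℓ t)) 0 :=
    (c.smooth_χ.comp hℓ.contMDiff.contMDiffOn hTV).contMDiffAt h0T
  refine ⟨fun t => c.χ (ℓ t), hγ0, ?_, ?_⟩
  · obtain ⟨i, hi⟩ := h3 none (Or.inl ⟨rfl, hp⟩)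
    have hx : ∀ q ∈ c.U, c.ψ q i = S.x₀ q := h7 i none hi
    filter_upwards [h0T] with t ht
    rw [← hx _ (c.mapsTo_χ' (hTV ht)), c.right_inv (hTV ht)]
    simp [ℓ, hw i none hi, hx p hpc, hp]
  · have hd := (hγ.mdifferentiableAt (by simp)).hasMFDerivAt
    have hc := ((c.contMDiffAt_ψ hpc).mdifferentiableAt (by simp)).hasMFDerivAt
    have hc' : HasMFDerivAt (𝓠 n) 𝓘(ℝ, 𝓔 n) c.ψ (c.χ (ℓ 0))
        (vderiv (𝓠 n) c.ψ p) := by rw [hγ0]; exact hc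
    have h8 := hc'.comp 0 hd
    have h9 : HasFDerivAt ℓ (ContinuousLinearMap.toSpanSingleton ℝ w) 0 := by
      have := ((ContinuousLinearMap.toSpanSingleton ℝ w).hasFDerivAt (x := (0 : ℝ))).const_add (c.ψ p)
      exact this
    have h10 : (c.ψ ∘ fun t => c.χ (ℓ t)) =ᶠ[𝓝 0] ℓ :=
      eventually_of_mem h0T fun t ht => c.right_inv (hTV ht)
    have h11 := hasMFDerivAt_unique h8 (h9.hasMFDerivAt.congr_of_eventuallyEq h10)
    have h12 : ∀ t : ℝ, mfderiv 𝓘(ℝ, ℝ) (𝓠 n) (fun t => c.χ (ℓ t)) 0 t =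
        t • (v : 𝓔 n) := fun t => by
      refine c.injective_vderiv_ψ hpc ?_
      refine (DFunLike.congr_fun h11 t).trans ?_
      exact ((vderiv (𝓠 n) c.ψ p).map_smul t v).symm
    exact hd.congr_mfderiv (ContinuousLinearMap.ext h12)

omit [IsManifold (𝓠 n) ∞ X] in
/-- The derivative of the projection to the base along a curve in `∂₀X`. -/
lemma hasMFDerivAt_φ_comp {γ : ℝ → X} (hγ : ∀ᶠ t in 𝓝 0, S.x₀ (γ t) = 0)
    {v : TangentSpace (𝓠 n) (γ 0)} (hd : HasMFDerivAt 𝓘(ℝ, ℝ) (𝓠 n) γ 0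
        (ContinuousLinearMap.toSpanSingleton ℝ (v : 𝓔 n))) :
    HasMFDerivAt 𝓘(ℝ, ℝ) (𝓠 k) (S.φ ∘ γ) 0 ((mfderivWithin (𝓠 n) (𝓠 k) S.φ S.bd₀ (γ 0)).comp
        (ContinuousLinearMap.toSpanSingleton ℝ (v : 𝓔 n))) := by
  have h1 := ((S.contMDiffOn_φ (γ 0) hγ.self_of_nhds).mdifferentiableWithinAt
    (by simp)).hasMFDerivWithinAt
  exact (HasMFDerivWithinAt.comp 0 h1 (hd.hasMFDerivWithinAt (s := {t | S.x₀ (γ t) = 0}))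
    fun t ht => ht).hasMFDerivAt hγ

lemma vderiv_gen_eq_zero {p : X} (hp : S.x₀ p = 0) {v : TangentSpace (𝓠 n) p}
    (h0 : vderiv (𝓠 n) S.x₀ p v = 0)
    (h1 : S.x₁ p = 0 → vderiv (𝓠 n) S.x₁ p v = 0)
    (hφ : mfderivWithin (𝓠 n) (𝓠 k) S.φ S.bd₀ p v = 0)
    (a : Option (Fin N)) : vderiv (𝓠 n) (S.gen B.ext (some a)) p v = 0 := by
  obtain ⟨γ, rfl, hγ, hd⟩ := S.exists_curve hp h0 h1
  obtain ⟨U, s, hU, hy, hs, hsU, -⟩ := S.exists_section hp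
  have hφγ := hasMFDerivAt_φ_comp hγ hd
  have h2 := ((((B.contMDiff_gen (some a)).comp_contMDiffOn hs).contMDiffAt
    (hU.mem_nhds hy)).mdifferentiableAt (by simp)).hasMFDerivAt.comp 0 hφγ
  have h3 := (((B.contMDiff_gen (some a)) (γ 0)).mdifferentiableAt (by simp)).hasMFDerivAt.comp 0 hd
  have h4 : (S.gen B.ext (some a) ∘ s) ∘ S.φ ∘ γ =ᶠ[𝓝 0] S.gen B.ext (some a) ∘ γ := by
    filter_upwards [hγ, hφγ.continuousAt.eventually (hU.mem_nhds hy)] with t ht htU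
    exact B.gen_section ht (hsU _ htU) a
  have h5 := hasMFDerivAt_unique h3 (h2.congr_of_eventuallyEq h4.symm)
  have h6 := DFunLike.congr_fun h5 (1 : ℝ)
  have h7 : vderiv (𝓠 n) (S.gen B.ext (some a)) (γ 0) ((1 : ℝ) • v) =
      vderiv (𝓠 k) (S.gen B.ext (some a) ∘ s) (S.φ (γ 0))
        (mfderivWithin (𝓠 n) (𝓠 k) S.φ S.bd₀ (γ 0) ((1 : ℝ) • v)) := h6
  rwa [one_smul, hφ, map_zero] at h7

lemma mfderivWithin_φ_eq_zero (B : S.BaseFunctions N) {p : X} (hp : S.x₀ p = 0)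
    {v : TangentSpace (𝓠 n) p} (h0 : vderiv (𝓠 n) S.x₀ p v = 0)
    (h1 : S.x₁ p = 0 → vderiv (𝓠 n) S.x₁ p v = 0)
    (h : ∀ j, vderiv (𝓠 n) (B.ext j) p v = 0) :
    mfderivWithin (𝓠 n) (𝓠 k) S.φ S.bd₀ p v = 0 := by
  obtain ⟨γ, rfl, hγ, hd⟩ := S.exists_curve hp h0 h1
  have hφγ := hasMFDerivAt_φ_comp hγ hd
  have h2 := ((B.smooth_e (S.φ (γ 0))).mdifferentiableAt (by simp)).hasMFDerivAt.comp 0 hφγ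
  refine B.injective_mfderiv_e _ (Eq.trans ?_ (map_zero _).symm)
  have key : ∀ j, vderiv (𝓠 k) B.e (S.φ (γ 0))
      (mfderivWithin (𝓠 n) (𝓠 k) S.φ S.bd₀ (γ 0) v) j = 0 := fun j => by
    have h3 := ((coordL j).hasMFDerivAt (x := (B.e ∘ S.φ ∘ γ) 0)).comp 0 h2
    have h4 := ((B.smooth_ext j (γ 0)).mdifferentiableAt (by simp)).hasMFDerivAt.comp 0 hd
    have h5 : (coordL j) ∘ B.e ∘ S.φ ∘ γ
        =ᶠ[𝓝 0] B.ext j ∘ γ := hγ.mono fun t ht => (B.ext_eq j _ ht).symm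
    have h6 := DFunLike.congr_fun (hasMFDerivAt_unique h4 (h3.congr_of_eventuallyEq h5.symm)) (1 : ℝ)
    have h7 : vderiv (𝓠 n) (B.ext j) (γ 0) ((1 : ℝ) • v) = (vderiv (𝓠 k) B.e (S.φ (γ 0))
        (mfderivWithin (𝓠 n) (𝓠 k) S.φ S.bd₀ (γ 0) ((1 : ℝ) • v))) j := h6
    rw [one_smul, h j] at h7
    exact h7.symm
  exact PiLp.ext key

variable (S) in
lemma exists_eq_gen_smul (b : Option (Option Empty)) {p : X} {U : Set X} (hU : IsOpen U)
    (hp : p ∈ U) {f : X → ℝ} (hf : ContMDiffOn (𝓠 n) 𝓘(ℝ, ℝ) ∞ f U)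
    (h0 : ∀ q ∈ U, S.gen Empty.elim b q = 0 → f q = 0) : ∃ U', IsOpen U' ∧ p ∈ U' ∧ U' ⊆ U ∧
      ∃ g : X → ℝ, ContMDiffOn (𝓠 n) 𝓘(ℝ, ℝ) ∞ g U' ∧
        ∀ q ∈ U', f q = S.gen Empty.elim b q * g q := by
  have hx : ContMDiff (𝓠 n) 𝓘(ℝ, ℝ) ∞ (S.gen Empty.elim b) := by
    rcases b with _ | _ | j
    exacts [S.contMDiff_x₀, S.contMDiff_x₁, j.elim]
  by_cases hb : S.gen Empty.elim b p = 0
  · obtain ⟨c, lab, h1, -, h3, -, -, -, h7, -, -⟩ := S.exists_cornerChart_bd p isOpen_univ (mem_univ p)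
    obtain ⟨i, hi⟩ := h3 b (by
      rcases b with _ | _ | j
      exacts [Or.inl ⟨rfl, hb⟩, Or.inr ⟨rfl, hb⟩, j.elim])
    obtain ⟨U', hU', hp', hU'c, hU'U, a, ha, hsum⟩ := c.exists_eq_sum_smul
      (S := {q | S.gen Empty.elim b q = 0}) (K := {i}) (fun q hq => by simp [h7 i b hi q hq]) hb hU hp
      h1 hf h0
    refine ⟨U', hU', hp', hU'U, a i, ha i, fun q hq => ?_⟩
    rw [hsum q hq, Finset.sum_singleton, h7 i b hi q (hU'c hq), smul_eq_mul]
  · refine ⟨U ∩ {q | S.gen Empty.elim b q ≠ 0}, hU.inter (isOpen_ne_fun hx.continuous continuous_const),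
      ⟨hp, hb⟩, inter_subset_left, fun q => f q / S.gen Empty.elim b q,
      (hf.mono inter_subset_left).div₀ hx.contMDiffOn fun q hq => hq.2, fun q hq => ?_⟩
    rw [mul_div_cancel₀ _ hq.2]

/-- `κ` are the coefficients of the vector field `V` with respect to the labelled functions. -/
def BaseFunctions.IsCoeff (B : S.BaseFunctions N) (V : ∀ p : X, TangentSpace (𝓠 n) p)
    (κ : X → 𝓖 N) : Prop :=
  ∀ p o, vderiv (𝓠 n) (S.gen B.ext o) p (V p) = S.x₀ p * S.weight o p * κ p o

omit [IsManifold (𝓠 n) ∞ X] in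
lemma mul_weight_ne_zero {p : X} (hp : p ∈ (𝓠 n).interior X)
    (o : 𝓛 N) : S.x₀ p * S.weight o p ≠ 0 :=
  mul_ne_zero ((S.mem_interior_iff p).1 hp).1 (weight_ne_zero hp o)

lemma exists_isCoeff (B : S.BaseFunctions N) (V : S.fields) : ∃ κ : X → 𝓖 N,
      ContMDiff (𝓠 n) 𝓘(ℝ, 𝓖 N) ∞ κ ∧
      B.IsCoeff V.1 κ := by
  obtain ⟨⟨f₀, hf₀, hVf₀⟩, hVφ, hV₁⟩ := V.2
  have hf : ∀ o, ContMDiff (𝓠 n) 𝓘(ℝ, ℝ) ∞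
      fun p => vderiv (𝓠 n) (S.gen B.ext o) p (V.1 p) := fun o =>
    contMDiff_mfderiv_apply (B.contMDiff_gen o) V.1.contMDiff
  have hx₀V : ∀ p, S.x₀ p = 0 → vderiv (𝓠 n) S.x₀ p (V.1 p) = 0 := fun p hp => by
    have h := hVf₀ p
    rw [hp] at h
    exact h.trans (by ring)
  have h0 : ∀ a p, S.x₀ p = 0 → vderiv (𝓠 n) (S.gen B.ext (some a)) p (V.1 p) = 0 := fun a p hp =>
    vderiv_gen_eq_zero hp (hx₀V p hp) (fun h => hV₁ p h) (hVφ p hp) a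
  have key : ∀ o, ∃ g : X → ℝ, ContMDiff (𝓠 n) 𝓘(ℝ, ℝ) ∞ g ∧
      EqOn g (fun p => vderiv (𝓠 n) (S.gen B.ext o) p (V.1 p) /
        (S.x₀ p * S.weight o p)) ((𝓠 n).interior X) := by
    intro o
    refine exists_contMDiff_of_dense S.dense_interior fun p => ?_
    rcases o with _ | a
    · refine ⟨univ, isOpen_univ, mem_univ p, f₀, hf₀.contMDiffOn, fun q hq => ?_⟩
      have h1 := mul_weight_ne_zero (S := S) (N := N) hq.2 none
      rw [eq_div_iff h1]
      refine Eq.trans ?_ (hVf₀ q).symm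
      change f₀ q * (S.x₀ q * S.x₀ q) = _
      ring
    · obtain ⟨U, hU, hpU, -, g, hg, hfg⟩ := S.exists_eq_gen_smul none isOpen_univ (mem_univ p)
        (hf (some a)).contMDiffOn fun q _ hq => h0 a q hq
      have hfg : ∀ q ∈ U, vderiv (𝓠 n) (S.gen B.ext (some a)) q (V.1 q) = S.x₀ q * g q := hfg
      rcases a with _ | j
      · have hg0 : ∀ q ∈ U, S.x₁ q = 0 → g q = 0 := by
          have h1 : ∀ q ∈ U, S.x₁ q = 0 → S.x₀ q ≠ 0 → g q = 0 := fun q hq h1 h2 =>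
            (mul_eq_zero.1 ((hfg q hq).symm.trans (hV₁ q h1))).resolve_left h2
          intro q hq hq1
          by_cases h2 : S.x₀ q = 0
          · obtain ⟨γ, hγ, hev⟩ := S.exists_push_x₀ h2
            refine tendsto_nhds_unique_of_eventuallyEq
              ((hg.continuousOn.continuousAt (hU.mem_nhds hq)).tendsto.comp hγ) tendsto_const_nhds ?_
            filter_upwards [hev, hγ.eventually (hU.mem_nhds hq), self_mem_nhdsWithin] with t ht htU ht0
            exact h1 _ htU (ht.2 hq1) (by rw [ht.1]; exact ne_of_gt ht0)
          · exact h1 q hq hq1 h2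
        obtain ⟨U', hU', hpU', hU'U, g', hg', hgg'⟩ := S.exists_eq_gen_smul (some none) hU hpU hg hg0
        refine ⟨U', hU', hpU', g', hg', fun q hq => ?_⟩
        rw [eq_div_iff (mul_weight_ne_zero hq.2 _), hfg q (hU'U hq.1), hgg' q hq.1]
        change g' q * (S.x₀ q * S.x₁ q) = S.x₀ q * (S.x₁ q * g' q)
        ring
      · refine ⟨U, hU, hpU, g, hg, fun q hq => ?_⟩
        rw [eq_div_iff (mul_weight_ne_zero hq.2 _), hfg q hq.1]
        change g q * (S.x₀ q * 1) = _
        ring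
  choose g hg hgf using key
  refine ⟨fun p => toLp 2 fun o => g o p,
    (PiLp.contDiff_toLp (p := 2)).contMDiff.comp (contMDiff_pi_space.2 hg), fun p o => ?_⟩
  refine congrFun (Continuous.ext_on S.dense_interior (hf o).continuous
    (((S.contMDiff_x₀.mul (contMDiff_weight o)).mul (hg o)).continuous) fun q hq => ?_) p
  have h1 := mul_weight_ne_zero (S := S) (N := N) hq o
  simp only [Pi.mul_apply, hgf o hq]
  rw [mul_div_cancel₀ _ h1]

lemma BaseFunctions.IsCoeff.isFiberedCuspB {V : ∀ p : X, TangentSpace (𝓠 n) p}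
    {κ : X → 𝓖 N} (h : B.IsCoeff V κ)
    (hκ : ContMDiff (𝓠 n) 𝓘(ℝ, 𝓖 N) ∞ κ) :
    S.IsFiberedCuspB V := by
  have h1 : ∀ p, S.x₁ p = 0 → vderiv (𝓠 n) S.x₁ p (V p) = 0 := fun p hp => by
    have := h p (some none)
    rw [show S.weight (some (none : Option (Fin N))) p = 0 from hp, mul_zero, zero_mul] at this
    exact this
  have h0 : ∀ p, S.x₀ p = 0 → ∀ o, vderiv (𝓠 n) (S.gen B.ext o) p (V p) = 0 :=
    fun p hp o => by rw [h p o, hp, zero_mul, zero_mul]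
  refine ⟨⟨fun p => κ p none, (coordL none).contMDiff.comp hκ, fun p => ?_⟩,
    fun p hp => mfderivWithin_φ_eq_zero B hp (h0 p hp none) (h1 p) fun j => h0 p hp (some (some j)),
    h1⟩
  refine (h p none).trans ?_
  change S.x₀ p * S.x₀ p * κ p none = _
  ring

end FiberedBoundary

/-! ### Vertical vectors on the groupoid -/

namespace PhiBDouble.Model

open FiberedBoundary

variable (m : D.Model B) [IsManifold (𝓠 n) ∞ X] [IsManifold (𝓠 k) ∞ Y]

/-- The components of the embedding of the groupoid. -/
def quot (o : 𝓛 N) (g : D.space) : ℝ := (m.emb g).2 o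

lemma contMDiff_quot (o : 𝓛 N) : ContMDiff (𝓠 (n + n)) 𝓘(ℝ, ℝ) ∞ (m.quot o) :=
  (contMDiff_snd_apply o).comp m.contMDiff_emb

variable [T2Space X]

lemma tangent_ext {g : D.space} {v w : TangentSpace (𝓠 (n + n)) g}
    (hr : mfderiv (𝓠 (n + n)) (𝓠 n) m.gpd.rng g v = mfderiv (𝓠 (n + n)) (𝓠 n) m.gpd.rng g w)
    (hd : mfderiv (𝓠 (n + n)) (𝓠 n) m.gpd.dom g v = mfderiv (𝓠 (n + n)) (𝓠 n) m.gpd.dom g w)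
    (hq : ∀ o, vderiv (𝓠 (n + n)) (m.quot o) g v = vderiv (𝓠 (n + n)) (m.quot o) g w) : v = w := by
  have h1 := (m.gpd.contMDiff_rng g).mdifferentiableAt (by simp)
  have h2 := (m.gpd.contMDiff_dom g).mdifferentiableAt (by simp)
  have h3 : ContMDiffAt (𝓠 (n + n)) 𝓘(ℝ, 𝓖 N) ∞
    (fun g : D.space => (m.emb g).2) g := contMDiff_snd.comp m.contMDiff_emb g
  have h4 := ((h1.hasMFDerivAt.prodMk h2.hasMFDerivAt).prodMk
    (h3.mdifferentiableAt (by simp)).hasMFDerivAt).mfderiv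
  refine m.initEmb_emb.injective_mfderiv g ?_
  refine (DFunLike.congr_fun h4 v).trans (Eq.trans ?_ (DFunLike.congr_fun h4 w).symm)
  refine Prod.ext (Prod.ext hr hd) (PiLp.ext fun o => ?_)
  exact (vderiv_apply h3 o v).symm.trans ((hq o).trans (vderiv_apply h3 o w))

/-- Vertical vectors satisfy the linearized equations of the groupoid. -/
lemma vderiv_gen_dom {g : D.space} {v : TangentSpace (𝓠 (n + n)) g}
    (hr : mfderiv (𝓠 (n + n)) (𝓠 n) m.gpd.rng g v = 0)
    (o : 𝓛 N) :
    vderiv (𝓠 n) (S.gen B.ext o) (m.gpd.dom g) (mfderiv (𝓠 (n + n)) (𝓠 n) m.gpd.dom g v) =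
    S.x₀ (m.gpd.rng g) * S.weight o (m.gpd.rng g) * vderiv (𝓠 (n + n)) (m.quot o) g v := by
  have hz : ∀ {f : X → ℝ}, ContMDiff (𝓠 n) 𝓘(ℝ, ℝ) ∞ f →
      vderiv (𝓠 (n + n)) (fun g => f (m.gpd.rng g)) g v = 0 := fun hf => by
    rw [vderiv_comp (hf _) (m.gpd.contMDiff_rng g), hr, map_zero]
  have hw : ContMDiff (𝓠 n) 𝓘(ℝ, ℝ) ∞ fun p => S.x₀ p * S.weight o p :=
    S.contMDiff_x₀.mul (contMDiff_weight o)
  have hwr := (hw.comp m.gpd.contMDiff_rng) g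
  have e : (fun g => S.gen B.ext o (m.gpd.dom g)) = fun g =>
      S.gen B.ext o (m.gpd.rng g) +
        S.x₀ (m.gpd.rng g) * S.weight o (m.gpd.rng g) * m.quot o g := funext fun g => by
    refine (m.isMoved_emb g o).trans ((moveLabel_gen o _ _).trans (congrArg _ ?_))
    change S.weight o (D.β g).1 * (S.x₀ (D.β g).1 * (m.emb g).2 o) =
      S.x₀ (D.β g).1 * S.weight o (D.β g).1 * (m.emb g).2 o
    ring
  rw [← vderiv_comp (B.contMDiff_gen o _) (m.gpd.contMDiff_dom g), e]
  refine (vderiv_add (((B.contMDiff_gen o).comp m.gpd.contMDiff_rng) g)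
    (hwr.mul (m.contMDiff_quot o g)) v).trans ?_
  refine (congrArg₂ (· + ·) (hz (B.contMDiff_gen o))
    ((vderiv_mul hwr (m.contMDiff_quot o g) v).trans (congrArg₂ (· + ·) rfl
      ((congrArg _ (hz hw)).trans (mul_zero _))))).trans ?_
  rw [zero_add, add_zero]
  rfl

omit [IsManifold (𝓠 n) ∞ X] [IsManifold (𝓠 k) ∞ Y] [T2Space X] in
/-- The coordinates on the fibres of the range map. -/
def fibreCoord {p : X} (L : S.LabChart B p) (i : Fin n) (g : D.space) : ℝ :=
  (L.lab i).elim (L.c.ψ (D.β g).2 i) fun o => m.quot o g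

/-- A frame of the vertical tangent bundle. -/
lemma exists_frame (g₀ : D.space) : ∃ (L : S.LabChart B (D.β g₀).2) (O : Set D.space)
    (fr : Fin n → ∀ g : D.space, TangentSpace (𝓠 (n + n)) g), IsOpen O ∧ g₀ ∈ O ∧
    (∀ g ∈ O, m.gpd.dom g ∈ L.c.U) ∧
    (∀ i, ContMDiffOn (𝓠 (n + n)) (𝓠 (n + n)).tangent ∞
      (fun g => (⟨g, fr i g⟩ : TangentBundle (𝓠 (n + n)) D.space)) O) ∧
    (∀ i, ContMDiffOn (𝓠 (n + n)) 𝓘(ℝ, ℝ) ∞ (m.fibreCoord L i) O) ∧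
    ∀ g ∈ O, (∀ i, mfderiv (𝓠 (n + n)) (𝓠 n) m.gpd.rng g (fr i g) = 0) ∧
      (∀ i j, vderiv (𝓠 (n + n)) (m.fibreCoord L i) g (fr j g) = if i = j then 1 else 0) ∧
      ∀ v, mfderiv (𝓠 (n + n)) (𝓠 n) m.gpd.rng g v = 0 →
        v = ∑ i, vderiv (𝓠 (n + n)) (m.fibreCoord L i) g v • fr i g := by
  obtain ⟨L, Φ, hg₀, hΦ, hU⟩ := m.exists_chart g₀
  have hΦeq : Φ.toFun = fun g => (m.gpd.rng g, L.fibreCoord (m.emb g)) := funext hΦ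
  let ψ : X × 𝓔 n → D.space := Φ.invFun
  have hψΦ : ∀ g ∈ Φ.source, ψ (Φ g) = g := fun g hg => Φ.left_inv hg
  have dΦ : ∀ g ∈ Φ.source, HasMFDerivAt (𝓠 (n + n)) (𝓣 n)
      Φ.toFun g (mfderiv (𝓠 (n + n)) (𝓣 n) Φ.toFun g) :=
    fun g hg => ((Φ.contMDiffOn_toFun.contMDiffAt (Φ.open_source.mem_nhds hg)).mdifferentiableAt
      (by simp)).hasMFDerivAt
  have dψ : ∀ w ∈ Φ.target, HasMFDerivAt (𝓣 n) (𝓠 (n + n)) ψ w (mfderiv (𝓣 n) (𝓠 (n + n)) ψ w) :=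
    fun w hw => ((Φ.contMDiffOn_invFun.contMDiffAt (Φ.open_target.mem_nhds hw)).mdifferentiableAt
      (by simp)).hasMFDerivAt
  let A : ∀ g : D.space, 𝓔 (n + n) →L[ℝ] 𝓔 n × 𝓔 n := fun g =>
    mfderiv (𝓠 (n + n)) (𝓣 n) Φ.toFun g
  let C : ∀ g : D.space, 𝓔 n × 𝓔 n →L[ℝ] 𝓔 (n + n) := fun g =>
    mfderiv (𝓣 n) (𝓠 (n + n)) ψ (Φ g)
  have hCA : ∀ g ∈ Φ.source, ∀ v, C g (A g v) = v := fun g hg v => by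
    have h1 := (dψ _ (Φ.map_source hg)).comp g (dΦ g hg)
    have h2 := (hasMFDerivAt_id (I := 𝓠 (n + n)) g).congr_of_eventuallyEq
      (eventually_of_mem (Φ.open_source.mem_nhds hg) hψΦ)
    exact DFunLike.congr_fun (hasMFDerivAt_unique h1 h2) v
  have hAC : ∀ g ∈ Φ.source, ∀ w, A g (C g w) = w := fun g hg w => by
    have h1 : HasMFDerivAt (𝓠 (n + n)) (𝓣 n)
        Φ.toFun (ψ (Φ g)) (A g) := by rw [hψΦ g hg]; exact dΦ g hg
    have h2 := h1.comp (Φ g) (dψ _ (Φ.map_source hg))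
    have h3 := (hasMFDerivAt_id (I := (𝓠 n).prod (𝓡 n)) (Φ g)).congr_of_eventuallyEq
      (f₁ := Φ.toFun ∘ ψ) (eventually_of_mem (Φ.open_target.mem_nhds (Φ.map_source hg))
        fun w hw => Φ.right_inv hw)
    exact DFunLike.congr_fun (hasMFDerivAt_unique h2 h3) w
  have hfc : ContMDiffOn (𝓠 (n + n)) (𝓡 n) ∞ (fun g : D.space => L.fibreCoord (m.emb g))
      Φ.source := L.contMDiffOn_fibreCoord.comp m.contMDiff_emb.contMDiffOn hU
  have hA1 : ∀ g ∈ Φ.source, ∀ v, (A g v).1 = mfderiv (𝓠 (n + n)) (𝓠 n) m.gpd.rng g v ∧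
      ∀ i, (A g v).2 i = vderiv (𝓠 (n + n)) (m.fibreCoord L i) g v := fun g hg v => by
    have h3 := hfc.contMDiffAt (Φ.open_source.mem_nhds hg)
    have h1 := ((m.gpd.contMDiff_rng g).mdifferentiableAt (by simp)).hasMFDerivAt.prodMk
      (h3.mdifferentiableAt (by simp)).hasMFDerivAt
    have h2 : A g v = _ := DFunLike.congr_fun (hasMFDerivAt_unique (hΦeq ▸ dΦ g hg) h1) v
    exact ⟨congrArg Prod.fst h2, fun i =>
      (congrArg (fun w : 𝓔 n × 𝓔 n => w.2 i) h2).trans (vderiv_apply h3 i v).symm⟩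
  refine ⟨L, Φ.source, fun i g => C g (0, single i 1), Φ.open_source, hg₀, hU,
    fun i => ?_, fun i => (coordL i).contMDiff.comp_contMDiffOn hfc, fun g hg => ⟨fun i => ?_, fun i j => ?_, fun v hv => ?_⟩⟩
  · have i1 : IsManifold (𝓠 n) 1 X := IsManifold.of_le (n := ∞) (by simp)
    have i2 : IsManifold (𝓠 (n + n)) 1 D.space := IsManifold.of_le (n := ∞) (by simp)
    have h1 : ContMDiffOn (𝓠 (n + n)) (𝓣 n).tangent ∞
        (fun g => (⟨Φ g, ((0 : 𝓔 n), single i (1 : ℝ))⟩ :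
          TangentBundle (𝓣 n) (X × 𝓔 n))) Φ.source := by
      have h2 := (Bundle.contMDiff_zeroSection (n := ∞) (IB := 𝓠 n) (F := 𝓔 n) ℝ
        (TangentSpace (𝓠 n) : X → Type _)).comp m.gpd.contMDiff_rng
      have h3 := ((contMDiffOn_vectorSpace_iff_contDiffOn (n := ∞) (s := univ) (V := fun _ =>
        single i (1 : ℝ))).2 contDiffOn_const).comp hfc fun g _ => mem_univ _
      refine ((contMDiff_equivTangentBundleProd_symm (n := ∞)).comp_contMDiffOn
        (h2.contMDiffOn.prodMk h3)).congr fun g hg => ?_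
      rw [hΦ]; rfl
    refine ((Φ.contMDiffOn_invFun.contMDiffOn_tangentMapWithin (m := ∞) (by simp)
      Φ.open_target.uniqueMDiffOn).comp h1 fun g hg => Φ.map_source hg).congr fun g hg => ?_
    have h2 := tangentBundle_mk_eq (I := 𝓠 (n + n)) (hψΦ g hg) (C g (0, single i 1))
    refine h2.symm.trans ?_
    change _ = (⟨ψ (Φ g), mfderivWithin _ _ ψ Φ.target (Φ g) _⟩ : TangentBundle _ _)
    rw [mfderivWithin_of_isOpen Φ.open_target (Φ.map_source hg)]
    rfl
  · exact ((hA1 g hg _).1.symm.trans (congrArg Prod.fst (hAC g hg _)))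
  · refine ((hA1 g hg _).2 i).symm.trans ?_
    rw [hAC g hg]
    simp
  · have h1 : A g v = ∑ i, vderiv (𝓠 (n + n)) (m.fibreCoord L i) g v •
        ((0 : 𝓔 n), single i (1 : ℝ)) := by
      refine Prod.ext ?_ ?_
      · rw [(hA1 g hg v).1, hv]
        simp [Prod.fst_sum]
        rfl
      · ext i
        rw [(hA1 g hg v).2 i]
        simp [Prod.snd_sum, Pi.single_apply]
    refine (hCA g hg v).symm.trans ?_
    rw [h1, map_sum]
    exact Finset.sum_congr rfl fun i _ => (C g).map_smul _ _

end PhiBDouble.Model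

section Submersion

variable {J : ModelWithCorners ℝ E' H'} {G B : Type*} [TopologicalSpace G] [ChartedSpace H G] [TopologicalSpace B] [ChartedSpace H' B]

lemma mfderivWithin_eq_of_eq {f : G → B} {s : Set G} {x y : G} (h : x = y) (v : E) :
    (mfderivWithin I J f s x : E →L[ℝ] E') v = (mfderivWithin I J f s y : E →L[ℝ] E') v := by
  subst h; rfl

lemma mfderiv_eq_of_eq {f : G → B} {x y : G} (h : x = y) (v : E) :
    (mfderiv I J f x : E →L[ℝ] E') v = (mfderiv I J f y : E →L[ℝ] E') v := by
  subst h; rfl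

/-- A vector tangent to the fibre of a submersion is the velocity of a curve in the fibre. -/
lemma IsCornerSubmersionAt.exists_curve {f : G → B} {g : G} (hf : IsCornerSubmersionAt I J f g)
    {v : TangentSpace I g} (hv : mfderiv I J f g v = 0) : ∃ γ : ℝ → G, γ 0 = g ∧
      (∀ᶠ t in 𝓝 0, f (γ t) = f g) ∧ HasMFDerivAt 𝓘(ℝ, ℝ) I γ 0
        (ContinuousLinearMap.toSpanSingleton ℝ (v : E)) := by
  obtain ⟨N, h, Φ, hg, hΦ⟩ := hf
  have dΦ := ((Φ.contMDiffOn_toFun.contMDiffAt (Φ.open_source.mem_nhds hg)).mdifferentiableAt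
    (by simp)).hasMFDerivAt
  have dψ := ((Φ.contMDiffOn_invFun.contMDiffAt (Φ.open_target.mem_nhds
    (Φ.map_source hg))).mdifferentiableAt (by simp)).hasMFDerivAt
  let w : E' × 𝓔 N := mfderiv I (J.prod (𝓡 N)) Φ.toFun g v
  have hw1 : w.1 = 0 := by
    have h1 := (mdifferentiableAt_fst (I := J) (I' := 𝓡 N)).hasMFDerivAt.comp g dΦ
    have h2 := h1.congr_of_eventuallyEq (f₁ := f) (eventually_of_mem
      (Φ.open_source.mem_nhds hg) fun q hq => (congrArg Prod.fst (hΦ hq)))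
    rw [mfderiv_fst] at h2
    rw [h2.mfderiv] at hv
    exact hv
  have hgv := hΦ hg
  have hline : HasMFDerivAt 𝓘(ℝ, ℝ) (J.prod (𝓡 N)) (fun t : ℝ => (f g, h g + t • w.2)) 0
      ((0 : ℝ →L[ℝ] E').prod (ContinuousLinearMap.toSpanSingleton ℝ w.2)) := by
    refine (hasMFDerivAt_const (f g) (0 : ℝ)).prodMk (HasFDerivAt.hasMFDerivAt ?_)
    have h1 := ((hasDerivAt_id (0 : ℝ)).smul_const w.2).const_add (h g)
    rw [one_smul] at h1
    exact h1.hasFDerivAt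
  have h0 : (f g, h g + (0 : ℝ) • w.2) = Φ g := by rw [zero_smul, add_zero]; exact hgv
  have hψ : HasMFDerivAt (J.prod (𝓡 N)) I Φ.invFun (f g, h g + (0 : ℝ) • w.2)
      (mfderiv (J.prod (𝓡 N)) I Φ.invFun (Φ g) : E' × 𝓔 N →L[ℝ] E) := by
    rw [h0]; exact dψ
  have hinv : mfderiv (J.prod (𝓡 N)) I Φ.invFun (Φ g) w = v := by
    have h1 := dψ.comp g dΦ
    have h2 := (hasMFDerivAt_id (I := I) g).congr_of_eventuallyEq (f₁ := Φ.invFun ∘ Φ.toFun)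
      (eventually_of_mem (Φ.open_source.mem_nhds hg) fun q hq => Φ.left_inv hq)
    exact DFunLike.congr_fun (hasMFDerivAt_unique h1 h2) v
  refine ⟨fun t => Φ.invFun (f g, h g + t • w.2), (congrArg Φ.invFun h0).trans (Φ.left_inv hg),
    ?_, ?_⟩
  · have hc : ContinuousAt (fun t : ℝ => (f g, h g + t • w.2)) 0 := hline.continuousAt
    have ht : ∀ᶠ t : ℝ in 𝓝 0, (f g, h g + t • w.2) ∈ Φ.target :=
      hc.eventually (Φ.open_target.mem_nhds (by
        change (f g, h g + (0 : ℝ) • w.2) ∈ _; rw [h0]; exact Φ.map_source hg))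
    filter_upwards [ht] with t ht
    have h1 := (hΦ (Φ.map_target ht)).trans (Φ.right_inv ht)
    exact congrArg Prod.fst h1
  · have h1 := hψ.comp 0 hline
    refine (h1.congr_mfderiv ?_)
    refine ContinuousLinearMap.ext_ring ?_
    have hw : ((0 : E'), w.2) = w := Prod.ext hw1.symm rfl
    change (mfderiv (J.prod (𝓡 N)) I Φ.invFun (Φ g)) ((0 : E'), (1 : ℝ) • w.2) = (1 : ℝ) • (v : E)
    rw [one_smul, hw, hinv, one_smul]

/-- Left translation by `g` has the differential prescribed by functions on the fibres. -/
lemma LieGroupoid.mfderiv_translate (𝒢 : LieGroupoid I J G B)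
    {E'' H'' M : Type*} [NormedAddCommGroup E''] [NormedSpace ℝ E''] [TopologicalSpace H'']
    {I'' : ModelWithCorners ℝ E'' H''} [TopologicalSpace M] [ChartedSpace H'' M]
    {q q' : G → M} (g : G) (hq : ContMDiffAt I I'' ∞ q g)
    (hq' : ContMDiffAt I I'' ∞ q' (𝒢.one (𝒢.dom g)))
    (h : ∀ h, 𝒢.rng h = 𝒢.dom g → q (𝒢.mul g h) = q' h)
    (σ : ∀ x, 𝒢.algebroidFiber x) :
    (mfderiv I I'' q g (𝒢.leftInvariant σ g) : E'') =
      mfderiv I I'' q' (𝒢.one (𝒢.dom g)) (σ (𝒢.dom g)) := by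
  obtain ⟨γ, h0, hγ, hd⟩ := (𝒢.submersion_rng (𝒢.one (𝒢.dom g))).exists_curve
    (v := σ (𝒢.dom g)) (σ (𝒢.dom g)).2
  rw [𝒢.rng_one] at hγ
  have hm : MDifferentiableWithinAt I I (fun h => 𝒢.mul g h) {h | 𝒢.rng h = 𝒢.dom g}
      (𝒢.one (𝒢.dom g)) := by
    have h1 : ContMDiff I (I.prod I) ∞ fun h : G => (g, h) := contMDiff_const.prodMk contMDiff_id
    exact ((𝒢.contMDiffOn_mul.comp (s := {h | 𝒢.rng h = 𝒢.dom g}) h1.contMDiffOn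
      fun h hh => Eq.symm hh) _ (𝒢.rng_one _)).mdifferentiableWithinAt (by simp)
  have h1 : HasMFDerivAt 𝓘(ℝ, ℝ) I (fun t => 𝒢.mul g (γ t)) 0
      ((ContinuousLinearMap.toSpanSingleton ℝ (𝒢.leftInvariant σ g : E))) := by
    have h2 := HasMFDerivWithinAt.comp (u := {h | 𝒢.rng h = 𝒢.dom g})
      (s := {t | 𝒢.rng (γ t) = 𝒢.dom g}) (0 : ℝ) (h0.symm ▸ hm.hasMFDerivWithinAt) hd.hasMFDerivWithinAt fun t ht => ht
    refine (h2.hasMFDerivAt hγ).congr_mfderiv ?_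
    refine ContinuousLinearMap.ext_ring ?_
    change (mfderivWithin I I (fun h => 𝒢.mul g h) {h | 𝒢.rng h = 𝒢.dom g} (γ 0) : E →L[ℝ] E)
      ((1 : ℝ) • ((σ (𝒢.dom g)).1 : E)) = (1 : ℝ) • (𝒢.leftInvariant σ g : E)
    rw [one_smul, one_smul]
    exact mfderivWithin_eq_of_eq h0 _
  have e1 : 𝒢.mul g (γ 0) = g := by rw [h0, 𝒢.mul_one]
  have h3 := HasMFDerivAt.comp (0 : ℝ) (e1.symm ▸ (hq.mdifferentiableAt (by simp)).hasMFDerivAt) h1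
  have h4 := HasMFDerivAt.comp (0 : ℝ) (h0.symm ▸ (hq'.mdifferentiableAt (by simp)).hasMFDerivAt) hd
  have h5 := h3.congr_of_eventuallyEq (f₁ := q' ∘ γ) (hγ.mono fun t ht => (h _ ht).symm)
  have h6 := DFunLike.congr_fun (hasMFDerivAt_unique h5 h4) (1 : ℝ)
  change (mfderiv I I'' q (𝒢.mul g (γ 0)) : E →L[ℝ] E'') ((1 : ℝ) • (𝒢.leftInvariant σ g : E)) =
    (mfderiv I I'' q' (γ 0) : E →L[ℝ] E'') ((1 : ℝ) • ((σ (𝒢.dom g)).1 : E)) at h6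
  rw [one_smul, one_smul] at h6
  exact (mfderiv_eq_of_eq e1 _).symm.trans (h6.trans (mfderiv_eq_of_eq h0 _))

end Submersion

namespace PhiBDouble.Model

open FiberedBoundary

variable (m : D.Model B) [IsManifold (𝓠 n) ∞ X] [IsManifold (𝓠 k) ∞ Y] [T2Space X]

lemma rng_leftInvariant (σ : ∀ x, m.gpd.algebroidFiber x) (g : D.space) :
    mfderiv (𝓠 (n + n)) (𝓠 n) m.gpd.rng g (m.gpd.leftInvariant σ g) = 0 := by
  refine (m.gpd.mfderiv_translate (q' := fun _ => m.gpd.rng g) g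
    (m.gpd.contMDiff_rng g) contMDiffAt_const
    (fun h hh => m.gpd.rng_mul g h hh.symm) σ).trans ?_
  rw [mfderiv_const]
  rfl

lemma dom_leftInvariant (σ : ∀ x, m.gpd.algebroidFiber x) (g : D.space) :
    mfderiv (𝓠 (n + n)) (𝓠 n) m.gpd.dom g
      (m.gpd.leftInvariant σ g) = m.gpd.anchor _ (σ (m.gpd.dom g)) :=
  m.gpd.mfderiv_translate g (m.gpd.contMDiff_dom g) (m.gpd.contMDiff_dom _)
    (fun h hh => m.gpd.dom_mul g h hh.symm) σ

lemma quot_leftInvariant (σ : ∀ x, m.gpd.algebroidFiber x) (g : D.space) (o : 𝓛 N) :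
    vderiv (𝓠 (n + n)) (m.quot o) g (m.gpd.leftInvariant σ g) =
      S.cocycle (m.emb g) o * vderiv (𝓠 (n + n)) (m.quot o)
        (m.gpd.one (m.gpd.dom g)) (σ (m.gpd.dom g)) := by
  have h1 := m.contMDiff_quot o (m.gpd.one (m.gpd.dom g))
  refine (m.gpd.mfderiv_translate (q' := fun h => m.quot o g + S.cocycle (m.emb g) o * m.quot o h)
    g (m.contMDiff_quot o g) (contMDiffAt_const.add (contMDiffAt_const.mul h1))
    (fun h hh => ?_) σ).trans ?_
  · change (m.emb _).2 o = _
    rw [m.emb_mul hh.symm]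
    rfl
  · refine (vderiv_add contMDiffAt_const (contMDiffAt_const.mul h1) _).trans ?_
    have h2 : ∀ c : ℝ, vderiv (𝓠 (n + n)) (fun _ : D.space => c)
      (m.gpd.one (m.gpd.dom g)) = 0 := fun c => mfderiv_const
    refine (congrArg₂ (· + ·) (DFunLike.congr_fun (h2 _) _)
      (vderiv_mul contMDiffAt_const h1 _)).trans ?_
    rw [h2]
    simp

/-- The anchor of a smooth section is smooth. -/
lemma contMDiff_anchor {σ : ∀ x, m.gpd.algebroidFiber x} (hσ : m.gpd.IsSmoothSection σ) :
    ContMDiff (𝓠 n) (𝓠 n).tangent ∞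
      fun x => (⟨x, m.gpd.anchor x (σ x)⟩ : TangentBundle (𝓠 n) X) := by
  have i1 : IsManifold (𝓠 n) 1 X := IsManifold.of_le (n := ∞) (by simp)
  have i2 : IsManifold (𝓠 (n + n)) 1 D.space := IsManifold.of_le (n := ∞) (by simp)
  refine ((m.gpd.contMDiff_dom.contMDiff_tangentMap (m := ∞) (by simp)).comp hσ).congr fun x => ?_
  exact tangentBundle_mk_eq (I := 𝓠 n) (m.gpd.dom_one x).symm _

/-- The left invariant vector field that extends a smooth section is smooth. -/
lemma contMDiff_leftInvariant {σ : ∀ x, m.gpd.algebroidFiber x} (hσ : m.gpd.IsSmoothSection σ) :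
    ContMDiff (𝓠 (n + n)) (𝓠 (n + n)).tangent ∞
      fun g => (⟨g, m.gpd.leftInvariant σ g⟩ : TangentBundle (𝓠 (n + n)) D.space) := by
  intro g₀
  obtain ⟨L, O, fr, hO, hg₀, hU, hfr, -, hfr'⟩ := m.exists_frame g₀
  have hσd := hσ.comp m.gpd.contMDiff_dom
  have hc : ∀ i, ContMDiffOn (𝓠 (n + n)) 𝓘(ℝ, ℝ) ∞ (fun g =>
      vderiv (𝓠 (n + n)) (m.fibreCoord L i) g (m.gpd.leftInvariant σ g)) O := by
    intro i
    rcases hi : L.lab i with _ | o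
    · have hψ : ContMDiffOn (𝓠 n) 𝓘(ℝ, ℝ) ∞ (fun q => L.c.ψ q i) L.c.U := L.c.smooth_coord i
      refine (contMDiffOn_mfderiv_apply L.c.isOpen_U hψ
        ((m.contMDiff_anchor hσ).comp m.gpd.contMDiff_dom).contMDiffOn hU).congr fun g hg => ?_
      have e : m.fibreCoord L i = fun g => L.c.ψ (m.gpd.dom g) i := by
        unfold fibreCoord; rw [hi]; rfl
      rw [e]
      refine (vderiv_comp (hψ.contMDiffAt (L.c.isOpen_U.mem_nhds (hU g hg)))
        (m.gpd.contMDiff_dom g) _).trans ?_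
      rw [m.dom_leftInvariant]
      rfl
    · have e : m.fibreCoord L i = m.quot o := by unfold fibreCoord; rw [hi]; rfl
      rw [e]
      simp_rw [m.quot_leftInvariant]
      exact (((contMDiff_cocycle (S := S) o).comp m.contMDiff_emb).mul
        (contMDiff_mfderiv_apply (m.contMDiff_quot o) hσd)).contMDiffOn
  have h1 := ContMDiffOn.sum_section (s := Finset.univ) fun i _ => (hc i).smul_section (hfr i)
  refine (h1.congr fun g hg => ?_).contMDiffAt (hO.mem_nhds hg₀)
  exact congrArg (Bundle.TotalSpace.mk g) ((hfr' g hg).2.2 _ (m.rng_leftInvariant σ g))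

/-! ### The sections of the Lie algebroid -/

omit [IsManifold (𝓠 k) ∞ Y] [T2Space X] in
lemma _root_.FiberedBoundary.BaseFunctions.IsCoeff.unique
    {V : ∀ p : X, TangentSpace (𝓠 n) p}
    {κ κ' : X → 𝓖 N} (h : B.IsCoeff V κ)
    (h' : B.IsCoeff V κ') (hκ : Continuous κ) (hκ' : Continuous κ') : κ = κ' :=
  Continuous.ext_on S.dense_interior hκ hκ' fun p hp => PiLp.ext fun o =>
    mul_left_cancel₀ (mul_weight_ne_zero hp o) ((h p o).symm.trans (h' p o))

lemma algebroidFiber_ext {x : X} {v w : m.gpd.algebroidFiber x}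
    (hd : m.gpd.anchor x v = m.gpd.anchor x w)
    (hq : ∀ o, vderiv (𝓠 (n + n)) (m.quot o) (m.gpd.one x) v.1 =
      vderiv (𝓠 (n + n)) (m.quot o) (m.gpd.one x) w.1) : v = w :=
  Subtype.ext (m.tangent_ext ((LinearMap.mem_ker.1 v.2).trans (LinearMap.mem_ker.1 w.2).symm) hd hq)

lemma vderiv_gen_anchor {x : X} {v : TangentSpace (𝓠 (n + n)) (m.gpd.one x)}
    (hv : mfderiv (𝓠 (n + n)) (𝓠 n) m.gpd.rng (m.gpd.one x) v = 0)
    (o : 𝓛 N) :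
    (vderiv (𝓠 n) (S.gen B.ext o) x : 𝓔 n →L[ℝ] ℝ)
      (mfderiv (𝓠 (n + n)) (𝓠 n) m.gpd.dom (m.gpd.one x) v) =
    S.x₀ x * S.weight o x * vderiv (𝓠 (n + n)) (m.quot o) (m.gpd.one x) v := by
  have h := m.vderiv_gen_dom hv o
  rw [m.gpd.rng_one] at h
  exact (mfderiv_eq_of_eq (m.gpd.dom_one x).symm _).trans h

/-- The coefficients of the anchor of a smooth section. -/
lemma isCoeff_anchor {σ : ∀ x, m.gpd.algebroidFiber x} (hσ : m.gpd.IsSmoothSection σ) :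
    ∃ κ : X → 𝓖 N, ContMDiff (𝓠 n) 𝓘(ℝ, 𝓖 N) ∞ κ ∧ B.IsCoeff (fun x => m.gpd.anchor x (σ x)) κ ∧
      ∀ x o, κ x o = vderiv (𝓠 (n + n)) (m.quot o) (m.gpd.one x) (σ x).1 :=
  ⟨fun x => toLp 2 fun o => vderiv (𝓠 (n + n)) (m.quot o) (m.gpd.one x) (σ x).1,
    (PiLp.contDiff_toLp (p := 2)).contMDiff.comp (contMDiff_pi_space.2 fun o =>
      contMDiff_mfderiv_apply (m.contMDiff_quot o) hσ),
    fun _ o => m.vderiv_gen_anchor (LinearMap.mem_ker.1 (σ _).2) o, fun _ _ => rfl⟩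

lemma exists_local_lift {V : ∀ p : X, TangentSpace (𝓠 n) p} (hV : ContMDiff (𝓠 n) (𝓠 n).tangent ∞
      fun p => (⟨p, V p⟩ : TangentBundle (𝓠 n) X))
    {κ : X → 𝓖 N}
    (hκ : ContMDiff (𝓠 n) 𝓘(ℝ, 𝓖 N) ∞ κ)
    (h : B.IsCoeff V κ) (x₀ : X) : ∃ (U : Set X)
      (s : ∀ x, TangentSpace (𝓠 (n + n)) (m.gpd.one x)), IsOpen U ∧ x₀ ∈ U ∧
      ContMDiffOn (𝓠 n) (𝓠 (n + n)).tangent ∞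
        (fun x => (⟨m.gpd.one x, s x⟩ : TangentBundle (𝓠 (n + n)) D.space)) U ∧
      ∀ x ∈ U, mfderiv (𝓠 (n + n)) (𝓠 n) m.gpd.rng (m.gpd.one x) (s x) = 0 ∧
        (mfderiv (𝓠 (n + n)) (𝓠 n) m.gpd.dom (m.gpd.one x) (s x) : 𝓔 n) = V x ∧
        ∀ o, vderiv (𝓠 (n + n)) (m.quot o) (m.gpd.one x) (s x) = κ x o := by
  obtain ⟨L, O, fr, hO, hx₀, hU, hfr, hfc, hfr'⟩ := m.exists_frame (m.gpd.one x₀)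
  have hψ : ∀ i, ContMDiffOn (𝓠 n) 𝓘(ℝ, ℝ) ∞ (fun q => L.c.ψ q i) L.c.U := L.c.smooth_coord
  let ζ : Fin n → X → ℝ := fun i x =>
    (L.lab i).elim (vderiv (𝓠 n) (fun q => L.c.ψ q i) x (V x)) fun o => κ x o
  have hζ : ∀ i, ContMDiffOn (𝓠 n) 𝓘(ℝ, ℝ) ∞ (ζ i) L.c.U := fun i => by
    dsimp only [ζ]
    rcases L.lab i with _ | o
    · exact contMDiffOn_mfderiv_apply L.c.isOpen_U (hψ i) hV.contMDiffOn fun q hq => hq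
    · exact ((coordL o).contMDiff.comp hκ).contMDiffOn
  have hone := m.gpd.contMDiff_one
  have hUo : IsOpen (m.gpd.one ⁻¹' O) := hO.preimage hone.continuous
  have hUx : ∀ x ∈ m.gpd.one ⁻¹' O, x ∈ L.c.U := fun x hx => by
    have := hU _ hx
    rwa [m.gpd.dom_one] at this
  let s : ∀ x, TangentSpace (𝓠 (n + n)) (m.gpd.one x) := fun x =>
    ∑ i, ζ i x • fr i (m.gpd.one x)
  have hs : ContMDiffOn (𝓠 n) (𝓠 (n + n)).tangent ∞
      (fun x => (⟨m.gpd.one x, s x⟩ : TangentBundle (𝓠 (n + n)) D.space)) (m.gpd.one ⁻¹' O) := by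
    refine ((ContMDiffOn.sum_section (s := Finset.univ) fun i _ =>
      ((hζ i).comp m.gpd.contMDiff_dom.contMDiffOn hU).smul_section (hfr i)).comp
        hone.contMDiffOn fun x hx => hx).congr fun x hx => ?_
    have e : ∀ i, (ζ i ∘ m.gpd.dom) (m.gpd.one x) = ζ i x := fun i =>
      congrArg (ζ i) (m.gpd.dom_one x)
    exact congrArg (Bundle.TotalSpace.mk _) (Finset.sum_congr rfl fun i _ =>
      congrArg (· • fr i (m.gpd.one x)) (e i).symm)
  have hsr : ∀ x ∈ m.gpd.one ⁻¹' O, mfderiv (𝓠 (n + n)) (𝓠 n)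
      m.gpd.rng (m.gpd.one x) (s x) = 0 := fun x hx => by
    rw [map_sum]
    exact Finset.sum_eq_zero fun i _ => by rw [map_smul, (hfr' _ hx).1 i, smul_zero]
  have hsf : ∀ x ∈ m.gpd.one ⁻¹' O, ∀ j, vderiv (𝓠 (n + n)) (m.fibreCoord L j)
      (m.gpd.one x) (s x) = ζ j x := fun x hx j => by
    rw [map_sum, Finset.sum_eq_single j]
    · rw [map_smul, (hfr' _ hx).2.1, if_pos rfl]
      exact mul_one _
    · intro i _ hij
      rw [map_smul, (hfr' _ hx).2.1, if_neg hij.symm, smul_zero]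
    · exact fun hj => absurd (Finset.mem_univ j) hj
  have hsd : ∀ x ∈ m.gpd.one ⁻¹' O, (mfderiv (𝓠 (n + n)) (𝓠 n)
      m.gpd.dom (m.gpd.one x) (s x) : 𝓔 n) = V x := fun x hx => by
    have hc := L.c.contMDiffAt_ψ (hUx x hx)
    refine L.c.injective_vderiv_ψ (hUx x hx) (PiLp.ext fun j => ?_)
    refine (vderiv_apply hc j _).symm.trans (Eq.trans ?_ (vderiv_apply hc j _))
    have h1 := hsf x hx j
    rcases hj : L.lab j with _ | o
    · have e : m.fibreCoord L j = fun g => L.c.ψ (m.gpd.dom g) j := by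
        unfold fibreCoord; rw [hj]; rfl
      have e' : ζ j x = vderiv (𝓠 n) (fun q => L.c.ψ q j) x (V x) := by
        dsimp only [ζ]; rw [hj]; rfl
      rw [e, e'] at h1
      rw [← h1]
      refine Eq.trans ?_ (vderiv_comp ((hψ j).contMDiffAt (L.c.isOpen_U.mem_nhds (hU _ hx)))
        (m.gpd.contMDiff_dom _) _).symm
      exact mfderiv_eq_of_eq (m.gpd.dom_one x).symm _
    · have e : m.fibreCoord L j = m.quot o := by unfold fibreCoord; rw [hj]; rfl
      have e' : ζ j x = κ x o := by dsimp only [ζ]; rw [hj]; rfl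
      have e2 : vderiv (𝓠 n) (fun q => L.c.ψ q j) x = vderiv (𝓠 n) (S.gen B.ext o) x :=
        EventuallyEq.mfderiv_eq (eventually_of_mem (L.c.isOpen_U.mem_nhds (hUx x hx))
          (L.coord j o hj))
      rw [e, e'] at h1
      rw [e2, h x o, ← h1]
      exact m.vderiv_gen_anchor (hsr x hx) o
  refine ⟨_, s, hUo, hx₀, hs, fun x hx => ⟨hsr x hx, hsd x hx, fun o => ?_⟩⟩
  refine Set.EqOn.of_subset_closure (s := m.gpd.one ⁻¹' O ∩ (𝓠 n).interior X)
    (t := m.gpd.one ⁻¹' O) (f := fun x => vderiv (𝓠 (n + n)) (m.quot o)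
      (m.gpd.one x) (s x)) (g := fun x => κ x o) (fun p hp => ?_)
    (contMDiffOn_mfderiv_apply isOpen_univ (m.contMDiff_quot o).contMDiffOn hs
      fun _ _ => mem_univ _).continuousOn
    ((coordL o).continuous.comp hκ.continuous).continuousOn inter_subset_left
    (S.dense_interior.open_subset_closure_inter hUo) hx
  refine mul_left_cancel₀ (mul_weight_ne_zero hp.2 o) ((m.vderiv_gen_anchor (hsr p hp.1) o).symm.trans
    (Eq.trans ?_ (h p o)))
  rw [hsd p hp.1]

/-- The section of the Lie algebroid given by a field and its coefficients. -/
lemma exists_lift {V : ∀ p : X, TangentSpace (𝓠 n) p} (hV : ContMDiff (𝓠 n) (𝓠 n).tangent ∞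
      fun p => (⟨p, V p⟩ : TangentBundle (𝓠 n) X))
    {κ : X → 𝓖 N}
    (hκ : ContMDiff (𝓠 n) 𝓘(ℝ, 𝓖 N) ∞ κ)
    (h : B.IsCoeff V κ) : ∃ σ : ∀ x, m.gpd.algebroidFiber x, m.gpd.IsSmoothSection σ ∧
      (∀ x, m.gpd.anchor x (σ x) = V x) ∧
      ∀ x o, vderiv (𝓠 (n + n)) (m.quot o) (m.gpd.one x) (σ x).1 = κ x o := by
  choose U s hU hx hs hs' using m.exists_local_lift hV hκ h
  refine ⟨fun x => ⟨s x x, LinearMap.mem_ker.2 (hs' x x (hx x)).1⟩, fun x₀ => ?_,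
    fun x => (hs' x x (hx x)).2.1, fun x => (hs' x x (hx x)).2.2⟩
  refine ((hs x₀).congr fun x hxU => ?_).contMDiffAt ((hU x₀).mem_nhds (hx x₀))
  obtain ⟨h1, h2, h3⟩ := hs' x x (hx x)
  obtain ⟨h1', h2', h3'⟩ := hs' x₀ x hxU
  exact congrArg (Bundle.TotalSpace.mk _) (m.tangent_ext (h1.trans h1'.symm) (h2.trans h2'.symm)
    fun o => (h3 o).trans (h3' o).symm)

/-- The fields are the smooth sections of the Lie algebroid. -/
lemma exists_sections : ∃ s : ∀ x, S.fields →ₗ[ℝ] m.gpd.algebroidFiber x,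
    (∀ V, m.gpd.IsSmoothSection fun x => s x V) ∧
    (∀ V x, m.gpd.anchor x (s x V) = V.1 x) ∧
    ∀ σ, m.gpd.IsSmoothSection σ → ∃ V, ∀ x, s x V = σ x := by
  choose κ hκ h using exists_isCoeff B
  choose σ hσ hσV hσκ using fun V : S.fields => m.exists_lift V.1.contMDiff (hκ V) (h V)
  refine ⟨fun x => { toFun := fun V => σ V x, map_add' := fun V W => ?_, map_smul' := fun c V => ?_ },
    hσ, hσV, fun τ hτ => ?_⟩
  · have hadd : κ (V + W) = fun p => κ V p + κ W p := (h (V + W)).unique (fun p o => ?_)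
      (hκ _).continuous ((hκ V).continuous.add (hκ W).continuous)
    · refine m.algebroidFiber_ext ?_ fun o => ?_
      · refine (hσV _ x).trans (Eq.trans ?_ (map_add (mfderiv (𝓠 (n + n))
          (𝓠 n) m.gpd.dom (m.gpd.one x)) (σ V x).1 (σ W x).1).symm)
        exact (congrArg₂ (· + ·) (hσV V x) (hσV W x)).symm
      · refine (hσκ _ x o).trans (Eq.trans ?_ (map_add (vderiv (𝓠 (n + n))
          (m.quot o) (m.gpd.one x)) (σ V x).1 (σ W x).1).symm)
        rw [hσκ, hσκ, hadd]
        rfl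
    · refine (map_add (vderiv (𝓠 n) (S.gen B.ext o) p) (V.1 p) (W.1 p)).trans ?_
      rw [h V p o, h W p o]
      exact (mul_add _ _ _).symm
  · have hsmul : κ (c • V) = fun p => c • κ V p := (h (c • V)).unique (fun p o => ?_)
      (hκ _).continuous ((hκ V).continuous.const_smul c)
    · refine m.algebroidFiber_ext ?_ fun o => ?_
      · refine (hσV _ x).trans (Eq.trans ?_ (map_smul (mfderiv (𝓠 (n + n))
          (𝓠 n) m.gpd.dom (m.gpd.one x)) c (σ V x).1).symm)
        exact (congrArg (c • ·) (hσV V x)).symm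
      · refine (hσκ _ x o).trans (Eq.trans ?_ (map_smul (vderiv (𝓠 (n + n))
          (m.quot o) (m.gpd.one x)) c (σ V x).1).symm)
        rw [hσκ, hsmul]
        rfl
    · refine (map_smul (vderiv (𝓠 n) (S.gen B.ext o) p) c (V.1 p)).trans ?_
      rw [h V p o]
      exact mul_left_comm _ _ _
  · obtain ⟨κ', hκ', h', hτκ⟩ := m.isCoeff_anchor hτ
    let V₀ : Cₛ^∞⟮𝓠 n; 𝓔 n, (TangentSpace (𝓠 n) : X → Type)⟯ := ⟨fun x => m.gpd.anchor x (τ x),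
        m.contMDiff_anchor hτ⟩
    have hV₀ : V₀ ∈ S.fields := h'.isFiberedCuspB hκ'
    let V : S.fields := ⟨V₀, hV₀⟩
    have e : κ V = κ' := (h V).unique h' (hκ V).continuous hκ'.continuous
    have e' : ∀ x, σ V x = τ x := fun x => m.algebroidFiber_ext (hσV V x) fun o =>
      (hσκ V x o).trans ((congrArg (fun κ => κ x o) e).trans (hτκ x o))
    exact ⟨V, e'⟩

end PhiBDouble.Model

lemma contMDiff_of_eqOn_compl {E H M E' H' M' : Type*} [NormedAddCommGroup E] [NormedSpace ℝ E]
    [TopologicalSpace H] {I : ModelWithCorners ℝ E H} [TopologicalSpace M] [ChartedSpace H M]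
    [NormedAddCommGroup E'] [NormedSpace ℝ E'] [TopologicalSpace H'] {I' : ModelWithCorners ℝ E' H'}
    [TopologicalSpace M'] [ChartedSpace H' M'] {g g' : M → M'} {U t : Set M} (hU : IsOpen U)
    (ht : IsClosed t) (htU : t ⊆ U) (h1 : ContMDiffOn I I' ∞ g U) (h2 : ContMDiff I I' ∞ g')
    (h3 : ∀ x ∉ t, g x = g' x) : ContMDiff I I' ∞ g := fun x => by
  by_cases hx : x ∈ t
  · exact h1.contMDiffAt (hU.mem_nhds (htU hx))
  · exact (h2 x).congr_of_eventuallyEq (eventually_of_mem (ht.isOpen_compl.mem_nhds hx) h3)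

namespace FiberedBoundary

variable (S) [IsManifold (𝓠 n) ∞ X]

/-- The fibered cusp b-vector fields form a module over the smooth functions. -/
lemma exists_field_smul (V : S.fields) {f : X → ℝ} (hf : ContMDiff (𝓠 n) 𝓘(ℝ, ℝ) ∞ f) :
    ∃ W : S.fields, ∀ q, W.1 q = f q • V.1 q := by
  let W₀ : Cₛ^∞⟮𝓠 n; 𝓔 n, (TangentSpace (𝓠 n) : X → Type)⟯ := ⟨fun q => f q • V.1 q,
      hf.smul_section V.1.contMDiff⟩
  obtain ⟨⟨g, hg, hg'⟩, h₂, h₃⟩ := V.2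
  have hW₀ : W₀ ∈ S.fields := by
    refine ⟨⟨fun q => f q * g q, hf.mul hg, fun p => ?_⟩, fun p hp => ?_, fun p hp => ?_⟩
    · refine (map_smul (differential n S.x₀ p) (f p) (V.1 p)).trans ?_
      rw [hg' p]
      exact mul_left_comm _ _ _
    · refine (map_smul (mfderivWithin (𝓠 n) (𝓠 k) S.φ S.bd₀ p) (f p) (V.1 p)).trans ?_
      rw [h₂ p hp, smul_zero]
    · refine (map_smul (differential n S.x₁ p) (f p) (V.1 p)).trans ?_
      rw [h₃ p hp, smul_zero]
  exact ⟨⟨W₀, hW₀⟩, fun q => rfl⟩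

/-- The value at a point of a fibered cusp b-vector field. -/
def evalField (q : X) : S.fields →ₗ[ℝ] TangentSpace (𝓠 n) q where
  toFun V := V.1 q
  map_add' _ _ := rfl
  map_smul' _ _ := rfl

variable {S} in
lemma field_ext {V W : S.fields} (h : ∀ q, S.evalField q V = S.evalField q W) : V = W :=
  Subtype.ext (ContMDiffSection.ext h)

end FiberedBoundary

namespace PhiBDouble.Model

open FiberedBoundary

variable (m : D.Model B) [IsManifold (𝓠 n) ∞ X] [IsManifold (𝓠 k) ∞ Y] [T2Space X]

/-- Smooth sections that generate the sections of the Lie algebroid near a point. -/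
lemma exists_generators [CompactSpace X] (x₀ : X) :
    ∃ (f : X → ℝ) (W : Fin n → ∀ x, m.gpd.algebroidFiber x),
      ContMDiff (𝓠 n) 𝓘(ℝ, ℝ) ∞ f ∧ f x₀ = 1 ∧
      (∀ i, m.gpd.IsSmoothSection (W i)) ∧
      (∀ v : m.gpd.algebroidFiber x₀, ∃ c : Fin n → ℝ, v = ∑ i, c i • W i x₀) ∧
      ∀ σ, m.gpd.IsSmoothSection σ → ∃ a : Fin n → X → ℝ, (∀ i, ContMDiff (𝓠 n) 𝓘(ℝ, ℝ) ∞ (a i)) ∧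
        (∀ x, (f x * f x) • σ x = ∑ i, a i x • W i x) ∧ (σ x₀ = 0 → ∀ i, a i x₀ = 0) := by
  obtain ⟨L, O, fr, hO, hx₀, -, hfr, hfc, hfr'⟩ := m.exists_frame (m.gpd.one x₀)
  have hone := m.gpd.contMDiff_one
  have hUo : IsOpen (m.gpd.one ⁻¹' O) := hO.preimage hone.continuous
  obtain ⟨t, ht, htc, htO⟩ := exists_mem_nhds_isClosed_subset (hUo.mem_nhds hx₀)
  obtain ⟨f, hf1, hf0, -⟩ := exists_contMDiffMap_one_nhds_of_subset_interior (n := ⊤)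
    (𝓠 n) (isClosed_singleton (x := x₀)) (t := t)
    (singleton_subset_iff.2 (mem_interior_iff_mem_nhds.2 ht))
  have hf1 : f x₀ = 1 := hf1.self_of_nhdsSet x₀ rfl
  let W : Fin n → ∀ x, m.gpd.algebroidFiber x := fun i x =>
    ⟨f x • fr i (m.gpd.one x), LinearMap.mem_ker.2 (by
      refine (map_smul (mfderiv (𝓠 (n + n)) (𝓠 n) m.gpd.rng
        (m.gpd.one x)) (f x) (fr i (m.gpd.one x))).trans ?_
      by_cases hx : x ∈ t
      · rw [(hfr' _ (htO hx)).1 i, smul_zero]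
      · rw [hf0 x hx, zero_smul])⟩
  have hzero : ContMDiff (𝓠 n) (𝓠 (n + n)).tangent ∞
      (fun x => (⟨m.gpd.one x, 0⟩ : TangentBundle (𝓠 (n + n)) D.space)) := by
    have i2 : IsManifold (𝓠 (n + n)) 1 D.space := IsManifold.of_le (n := ∞) (by simp)
    exact (Bundle.contMDiff_zeroSection (n := ∞) (IB := 𝓠 (n + n)) (F := 𝓔 (n + n)) ℝ
      (TangentSpace (𝓠 (n + n)) : D.space → Type _)).comp hone
  have hW : ∀ i, m.gpd.IsSmoothSection (W i) := fun i => by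
    refine contMDiff_of_eqOn_compl hUo htc htO ((((f.contMDiff.comp m.gpd.contMDiff_dom).contMDiffOn.smul_section
      (hfr i)).comp hone.contMDiffOn fun x hx => hx).congr fun x hx => ?_) hzero fun x hx => ?_
    · exact congrArg (Bundle.TotalSpace.mk _) (congrArg (fun y => f y • fr i (m.gpd.one x))
        (m.gpd.dom_one x).symm)
    · exact congrArg (Bundle.TotalSpace.mk _) ((congrArg (· • _) (hf0 x hx)).trans (zero_smul ℝ _))
  refine ⟨f, W, f.contMDiff, hf1, hW, fun v => ?_, fun σ hσ => ?_⟩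
  · refine ⟨fun i => vderiv (𝓠 (n + n)) (m.fibreCoord L i) (m.gpd.one x₀) v.1,
      Subtype.ext (((hfr' _ hx₀).2.2 v.1 v.2).trans ?_)⟩
    rw [AddSubmonoidClass.coe_finsetSum]
    refine Finset.sum_congr rfl fun i _ => ?_
    exact congrArg (vderiv (𝓠 (n + n)) (m.fibreCoord L i) (m.gpd.one x₀) v.1 • ·)
      ((congrArg (· • fr i (m.gpd.one x₀)) hf1).trans (one_smul ℝ _)).symm
  · refine ⟨fun i x => f x * vderiv (𝓠 (n + n)) (m.fibreCoord L i) (m.gpd.one x)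
      (σ x).1, fun i => ?_, fun x => ?_, fun h0 i => ?_⟩
    · refine contMDiff_of_eqOn_compl hUo htc htO (f.contMDiff.contMDiffOn.mul (contMDiffOn_mfderiv_apply hO (hfc i)
        hσ.contMDiffOn fun x hx => hx)) (contMDiff_const (c := (0 : ℝ)) (I' := 𝓘(ℝ, ℝ))) fun x hx => ?_
      exact (congrArg (· * _) (hf0 x hx)).trans (zero_mul _)
    · refine Subtype.ext ?_
      rw [AddSubmonoidClass.coe_finsetSum]
      by_cases hx : x ∈ t
      · refine (congrArg ((f x * f x) • ·) ((hfr' _ (htO hx)).2.2 (σ x).1 (σ x).2)).trans ?_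
        refine Finset.smul_sum.trans (Finset.sum_congr rfl fun i _ => ?_)
        refine (smul_smul _ _ _).trans (Eq.trans ?_ (smul_smul _ _ _).symm)
        exact congrArg (· • _) (by ring)
      · refine ((congrArg (· • _) (show f x * f x = 0 by rw [hf0 x hx, zero_mul])).trans
          (zero_smul ℝ _)).trans (Finset.sum_eq_zero fun i _ => ?_).symm
        exact (congrArg (· • _) (show f x * _ = 0 by rw [hf0 x hx, zero_mul])).trans (zero_smul ℝ _)
    · change f x₀ * vderiv (𝓠 (n + n)) (m.fibreCoord L i) (m.gpd.one x₀) (σ x₀).1 = 0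
      rw [h0]
      exact (congrArg (f x₀ * ·) (map_zero _)).trans (mul_zero _)

/-- The bracket of two smooth sections of the Lie algebroid. -/
lemma exists_bracket [CompactSpace X] {σ τ : ∀ x, m.gpd.algebroidFiber x}
    (hσ : m.gpd.IsSmoothSection σ) (hτ : m.gpd.IsSmoothSection τ) :
    ∃ ρ : ∀ x, m.gpd.algebroidFiber x, m.gpd.IsSmoothSection ρ ∧
      (∀ x, (ρ x).1 = m.gpd.bracket σ τ x) ∧
      ∀ x, m.gpd.anchor x (ρ x) = VectorField.mlieBracket (𝓠 n)
        (fun x => m.gpd.anchor x (σ x)) (fun x => m.gpd.anchor x (τ x)) x := by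
  obtain ⟨_, e, he, -, hinj⟩ := exists_embedding_euclidean_of_compact (I := 𝓠 n) (M := X)
  have hξ := m.contMDiff_leftInvariant hσ
  have hη := m.contMDiff_leftInvariant hτ
  have i1 : IsManifold (𝓠 n) 1 X := IsManifold.of_le (n := ∞) (by simp)
  have hz : ContMDiff (𝓠 n) (𝓠 n).tangent ∞ fun x =>
      (⟨x, 0⟩ : TangentBundle (𝓠 n) X) :=
    Bundle.contMDiff_zeroSection (n := ∞) (IB := 𝓠 n) (F := 𝓔 n) ℝ (TangentSpace (𝓠 n) : X → Type _)
  have hr : ∀ x, mfderiv (𝓠 (n + n)) (𝓠 n) m.gpd.rng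
      (m.gpd.one x) (m.gpd.bracket σ τ x) = 0 := fun x => by
    refine (mfderiv_mlieBracket_of_related he hinj m.gpd.contMDiff_rng hξ hη hz hz
      (m.rng_leftInvariant σ) (m.rng_leftInvariant τ) _).trans ?_
    exact congrFun VectorField.mlieBracket_zero_left _
  refine ⟨fun x => ⟨m.gpd.bracket σ τ x, LinearMap.mem_ker.2 (hr x)⟩, ?_, fun x => rfl, fun x => ?_⟩
  · have i2 : IsManifold (𝓠 (n + n)) (∞ + 1) D.space :=
      inferInstanceAs (IsManifold (𝓠 (n + n)) ∞ D.space)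
    have i3 : IsManifold (𝓠 (n + n)) (minSmoothness ℝ 2) D.space :=
      IsManifold.of_le (n := ∞) (by simpa using two_le)
    exact ContMDiff.comp (fun g => ContMDiffAt.mlieBracket_vectorField (m := ⊤) (n := ⊤) (hξ g) (hη g)
      (by simp)) m.gpd.contMDiff_one
  · refine (mfderiv_mlieBracket_of_related he hinj m.gpd.contMDiff_dom hξ hη
      (m.contMDiff_anchor hσ) (m.contMDiff_anchor hτ) (m.dom_leftInvariant σ)
      (m.dom_leftInvariant τ) (m.gpd.one x)).trans ?_
    rw [m.gpd.dom_one]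

/-- The Lie algebroid of the groupoid. -/
lemma exists_isAlgebroidIso [CompactSpace X] :
    ∃ Θ : ∀ x : X, m.gpd.algebroidFiber x ≃ₗ[ℝ] S.bundleFiber x, D.IsAlgebroidIso m.gpd Θ := by
  obtain ⟨s, hs, hsa, hsurj⟩ := m.exists_sections
  have hker : ∀ x, S.vanishingFields x = LinearMap.ker (s x) := fun x => by
    refine le_antisymm (Submodule.span_le.2 ?_) fun V hV => ?_
    · rintro W ⟨f, V, hf, hfx, hW⟩
      obtain ⟨κ, hκ, h, hκs⟩ := m.isCoeff_anchor (hs V)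
      obtain ⟨κ', hκ', h', hκs'⟩ := m.isCoeff_anchor (hs W)
      have e : κ' = fun p => f p • κ p := h'.unique (fun p o => by
        have h1 := h p o
        simp only [hsa] at h1 ⊢
        rw [hW, map_smul, h1]
        exact mul_left_comm _ _ _) hκ'.continuous (hf.continuous.smul hκ.continuous)
      refine LinearMap.mem_ker.2 (m.algebroidFiber_ext ?_ fun o => ?_)
      · rw [hsa, hW, hfx, zero_smul]
        exact (map_zero (mfderiv (𝓠 (n + n)) (𝓠 n) m.gpd.dom (m.gpd.one x))).symm
      · rw [← hκs', e]
        refine Eq.trans ?_ (map_zero (vderiv (𝓠 (n + n)) (m.quot o) (m.gpd.one x))).symm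
        change f x * κ x o = 0
        rw [hfx, zero_mul]
    · obtain ⟨f, W, hf, hfx, hW, -, ha⟩ := m.exists_generators x
      choose W' hW' using fun i => hsurj _ (hW i)
      obtain ⟨a, hac, haV, ha0⟩ := ha _ (hs V)
      choose A hA using fun i => S.exists_field_smul (W' i) (hac i)
      obtain ⟨R, hR⟩ := S.exists_field_smul V (contMDiff_const.sub (hf.mul hf) : ContMDiff _ _ _
        fun x => (1 : ℝ) - f x * f x)
      have hVR : V = R + ∑ i, A i := field_ext fun q => by
        have h1 : (f q * f q) • s q V = s q (∑ i, a i q • W' i) := by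
          rw [haV, map_sum]
          exact Finset.sum_congr rfl fun i _ => by rw [map_smul, hW']
        rw [← map_smul] at h1
        have h2 : S.evalField q ((f q * f q) • V) = S.evalField q (∑ i, a i q • W' i) :=
          (hsa _ q).symm.trans ((congrArg (m.gpd.anchor q) h1).trans (hsa _ q))
        rw [map_sum, map_smul] at h2
        have h3 : ∀ i, S.evalField q (A i) = S.evalField q (a i q • W' i) := fun i => hA i q
        have h4 : S.evalField q R = (1 - f q * f q) • S.evalField q V := hR q
        rw [map_add, map_sum, h4, Finset.sum_congr rfl fun i _ => h3 i, ← h2, sub_smul, one_smul,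
          sub_add_cancel]
      rw [hVR]
      refine add_mem (Submodule.subset_span ⟨_, V, contMDiff_const.sub (hf.mul hf), ?_, hR⟩)
        (sum_mem fun i _ => Submodule.subset_span ⟨_, W' i, hac i,
          ha0 (LinearMap.mem_ker.1 hV) i, hA i⟩)
      change (1 : ℝ) - f x * f x = 0
      rw [hfx, mul_one, sub_self]
  have hrange : ∀ x, Function.Surjective (s x) := fun x v => by
    obtain ⟨-, W, -, -, hW, hv, -⟩ := m.exists_generators x
    choose W' hW' using fun i => hsurj _ (hW i)
    obtain ⟨c, hc⟩ := hv v
    refine ⟨∑ i, c i • W' i, ?_⟩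
    rw [map_sum, hc]
    exact Finset.sum_congr rfl fun i _ => by rw [map_smul, hW']
  let T : ∀ x, S.bundleFiber x ≃ₗ[ℝ] m.gpd.algebroidFiber x := fun x =>
    (Submodule.quotEquivOfEq _ _ (hker x)).trans ((s x).quotKerEquivOfSurjective (hrange x))
  have hT : ∀ x V, T x (S.value x V) = s x V := fun x V => rfl
  refine ⟨fun x => (T x).symm, fun σ => ⟨fun hσ => ?_, ?_⟩, fun V x => ?_, fun V W => ?_⟩
  · obtain ⟨V, hV⟩ := hsurj σ hσ
    exact ⟨V, fun x => by rw [← hV, ← hT, LinearEquiv.symm_apply_apply]⟩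
  · rintro ⟨V, hV⟩
    have e : σ = fun x => s x V := funext fun x => by
      rw [← hT, ← hV, LinearEquiv.apply_symm_apply]
    rw [e]
    exact hs V
  · exact hsa V x
  · obtain ⟨ρ, hρ, hρb, hρa⟩ := m.exists_bracket (hs V) (hs W)
    obtain ⟨U, hU⟩ := hsurj ρ hρ
    refine ⟨U, fun x => ?_, fun x => ?_⟩
    · rw [← hsa U x, hU, hρa]
      simp_rw [hsa]
    · exact (hρb x).symm.trans (congrArg Subtype.val (hU x).symm)

end PhiBDouble.Model

end Fibered

end Manifolds

theorem mainTheorem5 {n k l : ℕ} {X : Type u} {Y : Type v} {Z : Type w}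
    [TopologicalSpace X] [T2Space X] [CompactSpace X]
    [ChartedSpace (EuclideanQuadrant n) X] [IsManifold (quadrantModel n) ∞ X]
    [TopologicalSpace Y] [T2Space Y] [CompactSpace Y]
    [ChartedSpace (EuclideanQuadrant k) Y] [IsManifold (quadrantModel k) ∞ Y]
    [TopologicalSpace Z] [T2Space Z] [CompactSpace Z]
    [ChartedSpace (EuclideanSpace ℝ (Fin l)) Z] [IsManifold (𝓡 l) ∞ Z]
    (S : FiberedBoundary (n := n) (k := k) (l := l) X Y Z) :
    Nonempty (PhiBDouble S) ∧
    ∀ D : PhiBDouble S, ∃ 𝒢 : LieGroupoid (quadrantModel (n + n)) (quadrantModel n) D.space X,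
        D.ExtendsPairGroupoid 𝒢 ∧
        Subtype.val '' range 𝒢.one = D.diagonal ∧
        ∃ Θ : ∀ x : X, 𝒢.algebroidFiber x ≃ₗ[ℝ] S.bundleFiber x, D.IsAlgebroidIso 𝒢 Θ := by
  refine ⟨S.exists_phiBDouble, fun D => ?_⟩
  obtain ⟨N, ⟨B⟩⟩ := S.exists_baseFunctions
  obtain ⟨m⟩ := D.exists_model B
  exact ⟨m.gpd, m.extendsPairGroupoid, m.image_range_one, m.exists_isAlgebroidIso⟩
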